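/- **Setting.** A *bilinear structure* $(q,\mathbb G_1,\mathbb G_2,\mathbb G_3,e,\psi)$ consists of groups $(\mathbb G_1,+),(\mathbb G_2,+),(\mathbb G_3,\cdot)$ of prime order $q$ with encodings of their elements as bit strings, an isomorphism $\psi:\mathbb G_2\to\mathbb G_1$ and a non-degenerate bilinear map $e:\mathbb G_1\times\mathbb G_2\to\mathbb G_3$. A *prime-order-BDH-generator* $\mathsf{Gen}$ outputs, on input $k$, a random bilinear structure with $2^{k-1}<q<2^k$ (for $k\ge 2$). *Scheme.* Let $f_r:\mathbb N\to\mathbb N$. The public parameters of UDVS-BLS are a structure drawn by $\mathsf{Gen}(k)$, a uniform $P_2\in\mathbb G_2\setminus\{0\}$, $n_r=f_r(k)$ and a random oracle $H$ on pairs of bit strings with values in $\mathbb G_1\setminus\{0\}$. Key pairs of signers and verifiers are $(u,uP_2)$ with $u$ uniform in $\{1,\dots,q-1\}$. A signature on $m$ under $u$ is $(r,uH(m,r))$ with $r$ uniform in $\{0,1\}^{n_r}$. Designating $(r,S)$ to the verifier with public key $U_b$ gives $(r,tS,t^{-1}U_b)$ with $t$ uniform in $\{1,\dots,q-1\}$.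 The verifier with secret key $u_b$ accepts $(r,Q_1,Q_2)$ on $m$ from the signer with public key $U_a$ iff $e(u_bH(m,r),U_a)=e(Q_1,Q_2)$. *UDVS-EF-CMA.* A forger gets the public parameters, one signer's public key and one verifier's public key, has oracles for $H$, for signing and for designated verification, and outputs $(m^\star,(r^\star,Q_1^\star,Q_2^\star))$. $\mathrm{Succ}^{\mathrm{EF}}_A(k)$ is the probability that this is accepted and $m^\star$ was not submitted to the signing oracle. *Privacy of signer's identity (PSI-CMA).* A distinguisher gets the public parameters, the public keys of two signers $0,1$ and of a verifier. It has oracles for $H$, for signing under either signer and for designated verification with respect to either signer. It chooses $m^\star$, receives a designated signature on $m^\star$ by signer $b$, continues with the same oracles, and outputs $b^\star$. The experiment returns $b^\star$ if $m^\star$ was never submitted to the signing or verification oracles and $0$ otherwise. $\mathrm{Adv}^{\mathrm{PSI}}_A(k)$ is the absolute difference of the probabilities that the experiments with $b=0$ and with $b=1$ return $1$. *Problems.* Draw a structure by $\mathsf{Gen}(k)$, $P_2$ uniformly in $\mathbb G_2\setminus\{0\}$ and $x,y,z,t$ uniformly in $\{1,\dots,q-1\}$; let $P_1=\psi(P_2)$,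 $X=xP_1$, $Y=yP_2$, $Z=zP_2$. $\mathrm{Succ}^{\mathcal{PR}_2}_B(k)$ is the probability that $B$, given the structure and $P_2,X,Y,Z$, outputs $(R,Q)\in\mathbb G_1\times\mathbb G_2$ with $e(R,Q)=e(P_1,P_2)^{xyz}$. For $\mathcal{PR}_3$, $B$ is given in addition $(R,Q)=(xtP_1,yzt^{-1}P_2)$ if $d=0$ and a uniform $(R,Q)\in\mathbb G_1\times\mathbb G_2$ if $d=1$, and outputs a bit; $\mathrm{Adv}^{\mathcal{PR}_3}_B(k)$ is the absolute difference of the probabilities of output $1$ for $d=0$ and for $d=1$. *Time.* Algorithms are programs with finite control for a probabilistic random access machine with tables indexed by bit strings, on which a scalar multiplication in $\mathbb G_i$ takes time $T_{\mathbb G_i}(k)\ge1$, a pairing evaluation takes time $T_e(k)\ge1$, and every other elementary operation takes unit time. The time of an experiment is that of the adversary, the oracles and the rest of the experiment together. A $(\tau,q_S,q_V)$-adversary against UDVS-BLS with a $q_H$-random oracle is an adversary such that for every $k$, whatever answers (non-zero hash values, salts of length $f_r(k)$) are given by its oracles, the experiment ends in expected time less than $\tau(k)$ and at most $q_S(k)$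 signing, $q_V(k)$ verification and $q_H(k)$ random oracle queries are made. A $\tau'$-adversary against $\mathcal{PR}_2$ or $\mathcal{PR}_3$ is an algorithm whose experiment (for $\mathcal{PR}_3$: for both values of $d$) ends in expected time less than $\tau'(k)$ for every $k$; it may also use the numbers $f_r(k),q_S(k),q_V(k)$ as inputs. **Theorem.** There is an absolute constant $C$ such that the following holds for every prime-order-BDH-generator $\mathsf{Gen}$, all costs as above and all $f_r,q_S,q_V,q_H,\tau:\mathbb N\to\mathbb N$. 1. For every $(\tau,q_S,q_V)$-UDVS-EF-CMA-adversary $A$ against UDVS-BLS with a $q_H$-random oracle there are $\tau'\le\tau+(q_H+q_S+2q_V+2)(T_{\mathbb G_1}+C)$ and a $\tau'$-$\mathcal{PR}_2$-adversary $B$ against $\mathsf{Gen}$ such that for all $k$ $$\mathrm{Succ}^{\mathcal{PR}_2}_B(k)\ \ge\ \frac{\mathrm{Succ}^{\mathrm{EF}}_A(k)}{(1+6\,q_S(k)\,2^{f_r(k)})\,(q_V(k)+1)}.$$ 2. For every $(\tau,q_S,q_V)$-PSI-CMA-distinguisher $A$ against UDVS-BLS with a $q_H$-random oracle there are $\tau'\le\tau+(q_H+q_S+2q_V+1)(T_{\mathbb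 G_1}+C)$ and a $\tau'$-$\mathcal{PR}_3$-distinguisher $B$ against $\mathsf{Gen}$ such that for all $k$ $$\mathrm{Adv}^{\mathcal{PR}_3}_B(k)\ \ge\ \frac{\mathrm{Adv}^{\mathrm{PSI}}_A(k)}2-\frac{q_S(k)+q_V(k)}{2^{f_r(k)}}.$$ -/

import Mathlib

open scoped ENNReal

noncomputable section

/-! ## Bilinear structures and their generators -/

/-- A bilinear structure `(q, G₁, G₂, G₃, e, ψ)` of prime order `q`, with the bit strings by which
it (`desc`) and its elements (`enc₁`, `enc₂`, `enc₃`) are represented. -/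
structure BilinearStructure where
  q : ℕ
  G₁ : Type
  G₂ : Type
  G₃ : Type
  [group₁ : AddCommGroup G₁]
  [group₂ : AddCommGroup G₂]
  [group₃ : CommGroup G₃]
  [fintype₁ : Fintype G₁]
  [fintype₂ : Fintype G₂]
  [fintype₃ : Fintype G₃]
  prime_q : q.Prime
  card₁ : Fintype.card G₁ = q
  card₂ : Fintype.card G₂ = q
  card₃ : Fintype.card G₃ = q
  ψ : G₂ ≃+ G₁
  e : G₁ → G₂ → G₃
  bilinear : ∀ (Q : G₁) (R : G₂) (a b : ℤ), e (a • Q) (b • R) = e Q R ^ (a * b)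
  nondegenerate : ∃ P : G₂, e (ψ P) P ≠ 1
  desc : List Bool
  enc₁ : G₁ → List Bool
  enc₂ : G₂ → List Bool
  enc₃ : G₃ → List Bool
  enc₁_injective : Function.Injective enc₁
  enc₂_injective : Function.Injective enc₂
  enc₃_injective : Function.Injective enc₃

attribute [instance] BilinearStructure.group₁ BilinearStructure.group₂ BilinearStructure.group₃
  BilinearStructure.fintype₁ BilinearStructure.fintype₂ BilinearStructure.fintype₃

instance (S : BilinearStructure) : Fact S.q.Prime := ⟨S.prime_q⟩

instance (S : BilinearStructure) : Nontrivial S.G₁ :=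
  Fintype.one_lt_card_iff_nontrivial.mp (S.card₁.symm ▸ S.prime_q.one_lt)

instance (S : BilinearStructure) : Nontrivial S.G₂ :=
  Fintype.one_lt_card_iff_nontrivial.mp (S.card₂.symm ▸ S.prime_q.one_lt)

/-- A prime-order-BDH-parameter-generator, as the family of its output distributions. (There is no
prime strictly between `2 ^ (k - 1)` and `2 ^ k` for `k ≤ 1`.) -/
structure BDHGenerator where
  gen : ℕ → PMF BilinearStructure
  order : ∀ k, 2 ≤ k → ∀ S ∈ (gen k).support, 2 ^ (k - 1) < S.q ∧ S.q < 2 ^ k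

/-! ## Probability -/

open Classical in
/-- The uniform distribution on the non-zero elements. -/
def uniformNonzero (α : Type) [Fintype α] [Zero α] [Nontrivial α] : PMF α :=
  PMF.uniformOfFinset (Finset.univ.filter fun a : α => a ≠ 0)
    ((exists_ne (0 : α)).imp fun a h => by simpa using h)

/-- The uniform distribution on the bit strings of length `n`. -/
def uniformBits (n : ℕ) : PMF (List Bool) :=
  (PMF.uniformOfFintype (Fin n → Bool)).map List.ofFn

/-- The uniform distribution on `{0, …, n}`. -/
def uniformUpTo (n : ℕ) : PMF ℕ :=
  (PMF.uniformOfFintype (Fin (n + 1))).map fun i => (i : ℕ)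

/-- The mean of a non-negative function. -/
def mean {α : Type*} (p : PMF α) (f : α → ℝ≥0∞) : ℝ≥0∞ := ∑' a, p a * f a

/-! ## The machine model

Algorithms are programs with a finite control for a random access machine. Its registers hold
booleans, bit strings, natural numbers (used as counters), residues modulo `q` and elements of the
three groups; its tables, indexed by pairs of bit strings, are its unbounded memory. An evaluation
of the pairing and a multiplication by a scalar in one of the groups have prescribed costs; every
other elementary operation takes one unit of time. -/

/-- The kinds of data. -/
inductive Srt
  | bool | bits | nat | scalar | g₁ | g₂ | g₃

/-- The values of each kind. -/
def Val (S : BilinearStructure) : Srt → Type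
  | .bool => Bool
  | .bits => List Bool
  | .nat => ℕ
  | .scalar => ZMod S.q
  | .g₁ => S.G₁
  | .g₂ => S.G₂
  | .g₃ => S.G₃

/-- The initial contents of registers. -/
def Val.init (S : BilinearStructure) : (s : Srt) → Val S s
  | .bool => false
  | .bits => ([] : List Bool)
  | .nat => (0 : ℕ)
  | .scalar => (0 : ZMod S.q)
  | .g₁ => (0 : S.G₁)
  | .g₂ => (0 : S.G₂)
  | .g₃ => (1 : S.G₃)

/-- Tuples of values of given kinds. -/
def Args (S : BilinearStructure) : List Srt → Type
  | [] => Unit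
  | s :: l => Val S s × Args S l

/-- Tuples of register names, one for each entry of a list of kinds. Registers of different kinds
are different, also when they have the same name. -/
def Regs (R : Type) : List Srt → Type
  | [] => Unit
  | _ :: l => R × Regs R l

/-- The costs, as functions of the security parameter: the mean time of the generator, the times
of a scalar multiplication (exponentiation) in each of the groups and of a pairing evaluation. -/
structure Costs where
  gen : ℕ → ℕ
  exp₁ : ℕ → ℕ
  exp₂ : ℕ → ℕ
  exp₃ : ℕ → ℕ
  pairing : ℕ → ℕ
  exp₁_pos : ∀ k, 1 ≤ exp₁ k
  exp₂_pos : ∀ k, 1 ≤ exp₂ k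
  exp₃_pos : ∀ k, 1 ≤ exp₃ k
  pairing_pos : ∀ k, 1 ≤ pairing k

/-- The elementary operations. -/
inductive Prim
  | copy (s : Srt) | eq (s : Srt) | const (b : Bool)
  | nil | cons | uncons
  | zero | succ | pred
  | one | addS | negS | mulS | invS
  | add₁ | neg₁ | add₂ | neg₂ | mul₃ | inv₃
  | exp₁ | exp₂ | exp₃ | pairing | psi
  | encS | decS | enc₁ | dec₁ | enc₂ | dec₂ | enc₃ | dec₃
  | randUpTo | randBits | randScalar

/-- The kinds of the arguments of an operation. -/
def Prim.args : Prim → List Srt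
  | .copy s => [s]
  | .eq s => [s, s]
  | .const _ => []
  | .nil => []
  | .cons => [.bool, .bits]
  | .uncons => [.bits]
  | .zero => []
  | .succ => [.nat]
  | .pred => [.nat]
  | .one => []
  | .addS => [.scalar, .scalar]
  | .negS => [.scalar]
  | .mulS => [.scalar, .scalar]
  | .invS => [.scalar]
  | .add₁ => [.g₁, .g₁]
  | .neg₁ => [.g₁]
  | .add₂ => [.g₂, .g₂]
  | .neg₂ => [.g₂]
  | .mul₃ => [.g₃, .g₃]
  | .inv₃ => [.g₃]
  | .exp₁ => [.scalar, .g₁]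
  | .exp₂ => [.scalar, .g₂]
  | .exp₃ => [.scalar, .g₃]
  | .pairing => [.g₁, .g₂]
  | .psi => [.g₂]
  | .encS => [.scalar]
  | .decS => [.bits]
  | .enc₁ => [.g₁]
  | .dec₁ => [.bits]
  | .enc₂ => [.g₂]
  | .dec₂ => [.bits]
  | .enc₃ => [.g₃]
  | .dec₃ => [.bits]
  | .randUpTo => [.nat]
  | .randBits => [.nat]
  | .randScalar => []

/-- The kinds of the results of an operation. -/
def Prim.rets : Prim → List Srt
  | .copy s => [s]
  | .eq _ => [.bool]
  | .const _ => [.bool]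
  | .nil => [.bits]
  | .cons => [.bits]
  | .uncons => [.bool, .bool, .bits]
  | .zero => [.nat]
  | .succ => [.nat]
  | .pred => [.nat]
  | .one => [.scalar]
  | .addS => [.scalar]
  | .negS => [.scalar]
  | .mulS => [.scalar]
  | .invS => [.scalar]
  | .add₁ => [.g₁]
  | .neg₁ => [.g₁]
  | .add₂ => [.g₂]
  | .neg₂ => [.g₂]
  | .mul₃ => [.g₃]
  | .inv₃ => [.g₃]
  | .exp₁ => [.g₁]
  | .exp₂ => [.g₂]
  | .exp₃ => [.g₃]
  | .pairing => [.g₃]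
  | .psi => [.g₁]
  | .encS => [.bits]
  | .decS => [.scalar]
  | .enc₁ => [.bits]
  | .dec₁ => [.bool, .g₁]
  | .enc₂ => [.bits]
  | .dec₂ => [.bool, .g₂]
  | .enc₃ => [.bits]
  | .dec₃ => [.bool, .g₃]
  | .randUpTo => [.nat]
  | .randBits => [.bits]
  | .randScalar => [.scalar]

/-- The time taken by an operation. -/
def Prim.cost (T : Costs) (k : ℕ) : Prim → ℕ
  | .exp₁ => T.exp₁ k
  | .exp₂ => T.exp₂ k
  | .exp₃ => T.exp₃ k
  | .pairing => T.pairing k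
  | _ => 1

/-- The multiple of an element of an additive group by a residue modulo `q`. -/
def scale {q : ℕ} {G : Type} [AddCommGroup G] (a : ZMod q) (P : G) : G := a.val • P

open Classical in
/-- Decoding with respect to an injective encoding; the boolean tells whether it succeeds. -/
def decode {G : Type} (enc : G → List Bool) (dflt : G) (b : List Bool) : Bool × G :=
  if h : ∃ g, enc g = b then (true, h.choose) else (false, dflt)

open Classical in
/-- The (possibly random) results of an operation. -/
def Prim.eval (S : BilinearStructure) : (p : Prim) → Args S p.args → PMF (Args S p.rets)
  | .copy _, (x, _) => PMF.pure (x, ())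
  | .eq _, (x, y, _) => PMF.pure (decide (x = y), ())
  | .const b, _ => PMF.pure (b, ())
  | .nil, _ => PMF.pure (([] : List Bool), ())
  | .cons, ((b : Bool), (l : List Bool), _) => PMF.pure (b :: l, ())
  | .uncons, ((l : List Bool), _) => PMF.pure (!l.isEmpty, l.headD false, l.tail, ())
  | .zero, _ => PMF.pure ((0 : ℕ), ())
  | .succ, ((n : ℕ), _) => PMF.pure (n + 1, ())
  | .pred, ((n : ℕ), _) => PMF.pure (n - 1, ())
  | .one, _ => PMF.pure ((1 : ZMod S.q), ())
  | .addS, ((a : ZMod S.q), (b : ZMod S.q), _) => PMF.pure (a + b, ())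
  | .negS, ((a : ZMod S.q), _) => PMF.pure (-a, ())
  | .mulS, ((a : ZMod S.q), (b : ZMod S.q), _) => PMF.pure (a * b, ())
  | .invS, ((a : ZMod S.q), _) => PMF.pure ((a⁻¹ : ZMod S.q), ())
  | .add₁, ((P : S.G₁), (Q : S.G₁), _) => PMF.pure (P + Q, ())
  | .neg₁, ((P : S.G₁), _) => PMF.pure (-P, ())
  | .add₂, ((P : S.G₂), (Q : S.G₂), _) => PMF.pure (P + Q, ())
  | .neg₂, ((P : S.G₂), _) => PMF.pure (-P, ())
  | .mul₃, ((g : S.G₃), (h : S.G₃), _) => PMF.pure (g * h, ())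
  | .inv₃, ((g : S.G₃), _) => PMF.pure ((g⁻¹ : S.G₃), ())
  | .exp₁, ((a : ZMod S.q), (P : S.G₁), _) => PMF.pure ((scale a P : S.G₁), ())
  | .exp₂, ((a : ZMod S.q), (P : S.G₂), _) => PMF.pure ((scale a P : S.G₂), ())
  | .exp₃, ((a : ZMod S.q), (g : S.G₃), _) => PMF.pure (g ^ a.val, ())
  | .pairing, ((P : S.G₁), (Q : S.G₂), _) => PMF.pure (S.e P Q, ())
  | .psi, ((P : S.G₂), _) => PMF.pure (S.ψ P, ())
  | .encS, ((a : ZMod S.q), _) => PMF.pure (a.val.bits, ())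
  | .decS, ((l : List Bool), _) =>
      PMF.pure (((l.foldr (fun b n => Nat.bit b n) 0 : ℕ) : ZMod S.q), ())
  | .enc₁, ((P : S.G₁), _) => PMF.pure (S.enc₁ P, ())
  | .dec₁, ((l : List Bool), _) =>
      PMF.pure ((decode S.enc₁ 0 l).1, (decode S.enc₁ 0 l).2, ())
  | .enc₂, ((P : S.G₂), _) => PMF.pure (S.enc₂ P, ())
  | .dec₂, ((l : List Bool), _) =>
      PMF.pure ((decode S.enc₂ 0 l).1, (decode S.enc₂ 0 l).2, ())
  | .enc₃, ((g : S.G₃), _) => PMF.pure (S.enc₃ g, ())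
  | .dec₃, ((l : List Bool), _) =>
      PMF.pure ((decode S.enc₃ 1 l).1, (decode S.enc₃ 1 l).2, ())
  | .randUpTo, ((n : ℕ), _) => (uniformUpTo n).map fun i => (i, ())
  | .randBits, ((n : ℕ), _) => (uniformBits n).map fun l => (l, ())
  | .randScalar, _ => (uniformNonzero (ZMod S.q)).map fun a => (a, ())

/-- An oracle interface: the oracles with the kinds of their arguments and of their answers. -/
structure Sig where
  Call : Type
  args : Call → List Srt
  rets : Call → List Srt

/-- The interface without oracles. -/
def noOracle : Sig := ⟨Empty, fun c => c.elim, fun c => c.elim⟩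

/-- Instructions, with register (and table) names in `R` and labels in `L`: an elementary
operation, a conditional jump, writing a table entry, reading a table entry (with two continuations
according to whether there is an entry), an oracle call, and stopping with a result. -/
inductive Instr (O : Sig) (out : List Srt) (R L : Type)
  | prim (p : Prim) (x : Regs R p.args) (y : Regs R p.rets) (next : L)
  | branch (x : R) (ifTrue ifFalse : L)
  | store (s : Srt) (t a b x : R) (next : L)
  | load (s : Srt) (t a b x : R) (found missing : L)
  | call (c : O.Call) (x : Regs R (O.args c)) (y : Regs R (O.rets c)) (next : L)
  | halt (x : Regs R out)

/-- A program: finitely many registers and tables and finitely many labelled instructions. -/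
structure Program (O : Sig) (inp out : List Srt) where
  R : Type
  L : Type
  [finR : Finite R]
  [finL : Finite L]
  input : Regs R inp
  start : L
  code : L → Instr O out R L

/-- The contents of the registers and of the tables. -/
structure Mem (S : BilinearStructure) (R : Type) where
  reg : (s : Srt) → R → Val S s
  tab : (s : Srt) → R → List Bool → List Bool → Option (Val S s)

def Mem.init (S : BilinearStructure) (R : Type) : Mem S R :=
  ⟨fun s _ => Val.init S s, fun _ _ _ _ => none⟩

open Classical in
def Mem.set {S : BilinearStructure} {R : Type} (μ : Mem S R) (s : Srt) (x : R) (v : Val S s) :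
    Mem S R :=
  { μ with reg := Function.update μ.reg s (Function.update (μ.reg s) x v) }

open Classical in
def Mem.setTab {S : BilinearStructure} {R : Type} (μ : Mem S R) (s : Srt) (t : R)
    (a b : List Bool) (v : Val S s) : Mem S R :=
  { μ with
    tab := Function.update μ.tab s (Function.update (μ.tab s) t
      (Function.update (μ.tab s t) a (Function.update (μ.tab s t a) b (some v)))) }

def Mem.read {S : BilinearStructure} {R : Type} (μ : Mem S R) :
    (l : List Srt) → Regs R l → Args S l
  | [], _ => ()
  | s :: l, (x, xs) => (μ.reg s x, μ.read l xs)

def Mem.write {S : BilinearStructure} {R : Type} :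
    (l : List Srt) → Regs R l → Args S l → Mem S R → Mem S R
  | [], _, _, μ => μ
  | s :: l, (x, xs), (v, vs), μ => Mem.write l xs vs (μ.set s x v)

/-- A way of answering oracle calls, with an internal state in `σ`. -/
def Handler (O : Sig) (S : BilinearStructure) (σ : Type) : Type :=
  (c : O.Call) → Args S (O.args c) → σ → PMF (Args S (O.rets c) × σ)

/-- A snapshot of a run: the label and memory or the final result, the state of the oracles, the
time spent and the number of calls to each oracle so far. -/
structure Snapshot {O : Sig} {inp out : List Srt} (P : Program O inp out) (S : BilinearStructure)
    (σ : Type) where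
  conf : (P.L × Mem S P.R) ⊕ Args S out
  oracle : σ
  time : ℕ
  calls : O.Call → ℕ

section Run

variable {O : Sig} {inp out : List Srt} (P : Program O inp out) (T : Costs) (k : ℕ)
  (callCost : O.Call → ℕ) (S : BilinearStructure) {σ : Type} (h : Handler O S σ)

open Classical in
/-- One step of a run (none if the program has stopped). -/
def Program.step (st : Snapshot P S σ) : PMF (Snapshot P S σ) :=
  match st.conf with
  | .inr _ => PMF.pure st
  | .inl (l, μ) =>
    match P.code l with
    | .prim p x y next =>
        (p.eval S (μ.read p.args x)).map fun v =>
          { st with conf := .inl (next, Mem.write p.rets y v μ), time := st.time + p.cost T k }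
    | .branch x l₁ l₀ =>
        PMF.pure
          { st with
            conf := .inl (if (show Bool from μ.reg .bool x) = true then l₁ else l₀, μ)
            time := st.time + 1 }
    | .store s t a b x next =>
        PMF.pure
          { st with
            conf := .inl (next, μ.setTab s t (μ.reg .bits a) (μ.reg .bits b) (μ.reg s x))
            time := st.time + 1 }
    | .load s t a b x found missing =>
        match μ.tab s t (μ.reg .bits a) (μ.reg .bits b) with
        | some v =>
            PMF.pure { st with conf := .inl (found, μ.set s x v), time := st.time + 1 }
        | none => PMF.pure { st with conf := .inl (missing, μ), time := st.time + 1 }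
    | .call c x y next =>
        (h c (μ.read (O.args c) x) st.oracle).map fun v =>
          { conf := .inl (next, Mem.write (O.rets c) y v.1 μ)
            oracle := v.2
            time := st.time + callCost c
            calls := Function.update st.calls c (st.calls c + 1) }
    | .halt x =>
        PMF.pure { st with conf := .inr (μ.read out x), time := st.time + 1 }

/-- The snapshot after `n` steps, on input `v` and with oracles in the initial state `s`. -/
def Program.run (v : Args S inp) (s : σ) : ℕ → PMF (Snapshot P S σ)
  | 0 => PMF.pure ⟨.inl (P.start, Mem.write inp P.input v (Mem.init S P.R)), s, 0, fun _ => 0⟩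
  | n + 1 => (Program.run v s n).bind (P.step T k callCost S h)

/-- The mean total time of a run. -/
def Program.meanTime (v : Args S inp) (s : σ) : ℝ≥0∞ :=
  ⨆ n : ℕ, mean (P.run T k callCost S h v s n) fun st => (st.time : ℝ≥0∞)

/-- The probability that the run stops and its result is accepted by `judge`. -/
def Program.accept (v : Args S inp) (s : σ) (judge : Args S out → σ → PMF Bool) : ℝ≥0∞ :=
  ⨆ n : ℕ, ((P.run T k callCost S h v s n).bind fun st =>
    match st.conf with
    | .inl _ => PMF.pure false
    | .inr w => judge w st.oracle) true

end Run

/-- All answers that may be given satisfy `fmt`. -/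
def Handler.Respects {O : Sig} {S : BilinearStructure} {σ : Type} (h : Handler O S σ)
    (fmt : (c : O.Call) → Args S (O.rets c) → Prop) : Prop :=
  ∀ c a s, ∀ v ∈ (h c a s).support, fmt c v.1

/-- The mean time of a program on input `v` against the most time-consuming oracle answers among
those of the format `fmt`. -/
def Program.worstTime {O : Sig} {inp out : List Srt} (P : Program O inp out) (T : Costs) (k : ℕ)
    (callCost : O.Call → ℕ) (S : BilinearStructure)
    (fmt : (c : O.Call) → Args S (O.rets c) → Prop) (v : Args S inp) : ℝ≥0∞ :=
  ⨆ (σ : Type) (h : Handler O S σ) (_ : h.Respects fmt) (s : σ),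
    P.meanTime T k callCost S h v s

/-- Whatever the oracles answer (in the format `fmt`), the numbers of calls satisfy `bound`. -/
def Program.CallsBounded {O : Sig} {inp out : List Srt} (P : Program O inp out) (T : Costs) (k : ℕ)
    (callCost : O.Call → ℕ) (S : BilinearStructure)
    (fmt : (c : O.Call) → Args S (O.rets c) → Prop) (v : Args S inp)
    (bound : (O.Call → ℕ) → Prop) : Prop :=
  ∀ (σ : Type) (h : Handler O S σ), h.Respects fmt → ∀ (s : σ) (n : ℕ),
    ∀ st ∈ (P.run T k callCost S h v s n).support, bound st.calls

/-! ## The scheme UDVS-BLS in the random oracle model -/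

/-- The values of the random oracle that are already fixed. -/
def HashTable (S : BilinearStructure) : Type := List Bool → List Bool → Option S.G₁

open Classical in
/-- A query `(m, r)` to a random oracle with values in `G₁ ∖ {0}`. -/
def hashQuery (S : BilinearStructure) (m r : List Bool) (H : HashTable S) :
    PMF (S.G₁ × HashTable S) :=
  match H m r with
  | some g => PMF.pure (g, H)
  | none => (uniformNonzero S.G₁).map fun g =>
      (g, Function.update H m (Function.update (H m) r (some g)))

/-- `Sign`: a salt `r` of length `n` and `u • H(m, r)`. -/
def sign (S : BilinearStructure) (n : ℕ) (m : List Bool) (u : ZMod S.q) (H : HashTable S) :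
    PMF ((List Bool × S.G₁) × HashTable S) :=
  (uniformBits n).bind fun r => (hashQuery S m r H).map fun x => ((r, scale u x.1), x.2)

/-- `Designate`, for the verifying public key `U`. -/
def designate (S : BilinearStructure) (σ : List Bool × S.G₁) (U : S.G₂) :
    PMF (List Bool × S.G₁ × S.G₂) :=
  (uniformNonzero (ZMod S.q)).map fun t => (σ.1, scale t σ.2, scale t⁻¹ U)

open Classical in
/-- `DVerify`, for the signing public key `Ua` and the verifying secret key `ub`. -/
def dverify (S : BilinearStructure) (m r : List Bool) (Q₁ : S.G₁) (Q₂ : S.G₂) (Ua : S.G₂)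
    (ub : ZMod S.q) (H : HashTable S) : PMF (Bool × HashTable S) :=
  (hashQuery S m r H).map fun x => (decide (S.e (scale ub x.1) Ua = S.e Q₁ Q₂), x.2)

/-! ## Existential forgery -/

inductive EFCall
  | hash | sign | verify

/-- The oracles of a forger: `(m, r) ↦ H(m, r)`, `m ↦ (r, S)` and `(m, (r, Q₁, Q₂)) ↦` a bit. -/
def efSig : Sig where
  Call := EFCall
  args
    | .hash => [.bits, .bits]
    | .sign => [.bits]
    | .verify => [.bits, .bits, .g₁, .g₂]
  rets
    | .hash => [.g₁]
    | .sign => [.bits, .g₁]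
    | .verify => [.bool]

/-- A forger has input `(desc, P₂, n_r, pk_s, pk_v)` and output `(m, (r, Q₁, Q₂))`. -/
abbrev Forger : Type 1 :=
  Program efSig [.bits, .g₂, .nat, .g₂, .g₂] [.bits, .bits, .g₁, .g₂]

/-- Time taken by the answers to oracle calls. -/
def efCallCost (T : Costs) (k : ℕ) : EFCall → ℕ
  | .hash => 1
  | .sign => T.exp₁ k + 2
  | .verify => T.exp₁ k + 2 * T.pairing k + 2

/-- Hash values are not `0` and salts have length `n`. -/
def efFormat (S : BilinearStructure) (n : ℕ) : (c : EFCall) → Args S (efSig.rets c) → Prop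
  | .hash, ((g : S.G₁), _) => g ≠ 0
  | .sign, ((r : List Bool), _) => r.length = n
  | .verify, _ => True

/-- The oracles of the experiment; the second component of the state is the set of all messages
that were signed. -/
def efHandler (S : BilinearStructure) (n : ℕ) (P₂ : S.G₂) (ua ub : ZMod S.q) :
    Handler efSig S (HashTable S × Set (List Bool))
  | .hash, ((m : List Bool), (r : List Bool), _), (H, L) =>
      (hashQuery S m r H).map fun x => ((x.1, ()), (x.2, L))
  | .sign, ((m : List Bool), _), (H, L) =>
      (sign S n m ua H).map fun x => ((x.1.1, x.1.2, ()), (x.2, insert m L))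
  | .verify, ((m : List Bool), (r : List Bool), (Q₁ : S.G₁), (Q₂ : S.G₂), _), (H, L) =>
      (dverify S m r Q₁ Q₂ (scale ua P₂) ub H).map fun x => ((x.1, ()), (x.2, L))

open Classical in
/-- The forgery is valid and its message was not signed. -/
def efJudge (S : BilinearStructure) (P₂ : S.G₂) (ua ub : ZMod S.q) :
    Args S [.bits, .bits, .g₁, .g₂] → HashTable S × Set (List Bool) → PMF Bool
  | ((m : List Bool), (r : List Bool), (Q₁ : S.G₁), (Q₂ : S.G₂), _), (H, L) =>
      (dverify S m r Q₁ Q₂ (scale ua P₂) ub H).map fun x => x.1 && decide (m ∉ L)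

/-- The input of the forger. -/
def efInput (S : BilinearStructure) (n : ℕ) (P₂ : S.G₂) (ua ub : ZMod S.q) :
    Args S [.bits, .g₂, .nat, .g₂, .g₂] :=
  (S.desc, P₂, n, (scale ua P₂ : S.G₂), (scale ub P₂ : S.G₂), ())

/-- Time of the experiment outside the run of the forger: generator, choice of `P₂`, two key pairs,
and the final verification. -/
def efOverhead (T : Costs) (k : ℕ) : ℕ :=
  T.gen k + 1 + 2 * (T.exp₂ k + 1) + (T.exp₁ k + 2 * T.pairing k + 3)

/-- The success of a forger in the UDVS-EF-CMA experiment against UDVS-BLS. -/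
def efSucc (T : Costs) (Gen : BDHGenerator) (f : ℕ → ℕ) (A : Forger) (k : ℕ) : ℝ≥0∞ :=
  mean (Gen.gen k) fun S =>
  mean (uniformNonzero S.G₂) fun P₂ =>
  mean (uniformNonzero (ZMod S.q)) fun ua =>
  mean (uniformNonzero (ZMod S.q)) fun ub =>
    A.accept T k (efCallCost T k) S (efHandler S (f k) P₂ ua ub) (efInput S (f k) P₂ ua ub)
      (fun _ _ => none, ∅) (efJudge S P₂ ua ub)

/-- `A` is a `(τ, q_S, q_V)`-adversary for a `q_H`-random oracle: whatever its oracles answer, the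
experiment ends in mean time less than `τ(k)` and `A` respects the bounds on its calls. -/
def IsForger (T : Costs) (Gen : BDHGenerator) (f τ qS qV qH : ℕ → ℕ) (A : Forger) : Prop :=
  ∀ k : ℕ,
    (efOverhead T k : ℝ≥0∞) +
        (mean (Gen.gen k) fun S =>
          mean (uniformNonzero S.G₂) fun P₂ =>
          mean (uniformNonzero (ZMod S.q)) fun ua =>
          mean (uniformNonzero (ZMod S.q)) fun ub =>
            A.worstTime T k (efCallCost T k) S (efFormat S (f k)) (efInput S (f k) P₂ ua ub))
      < (τ k : ℝ≥0∞) ∧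
    ∀ S ∈ (Gen.gen k).support, ∀ P₂ : S.G₂, P₂ ≠ 0 → ∀ ua ub : ZMod S.q, ua ≠ 0 → ub ≠ 0 →
      A.CallsBounded T k (efCallCost T k) S (efFormat S (f k)) (efInput S (f k) P₂ ua ub)
        fun calls => calls .hash ≤ qH k ∧ calls .sign ≤ qS k ∧ calls .verify ≤ qV k

/-! ## Privacy of signer's identity -/

inductive PSICall
  | hash | sign (i : Bool) | verify (i : Bool) | challenge

/-- The oracles of a distinguisher; there are two signers. The call `challenge` separates the two
stages: its argument is the message chosen in the first stage, its answer is the designated verifier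
signature that is given to the second one, and the memory is the state information. -/
def psiSig : Sig where
  Call := PSICall
  args
    | .hash => [.bits, .bits]
    | .sign _ => [.bits]
    | .verify _ => [.bits, .bits, .g₁, .g₂]
    | .challenge => [.bits]
  rets
    | .hash => [.g₁]
    | .sign _ => [.bits, .g₁]
    | .verify _ => [.bool]
    | .challenge => [.bits, .g₁, .g₂]

/-- A distinguisher has input `(desc, P₂, n_r, pk_s₀, pk_s₁, pk_v)` and outputs a bit. -/
abbrev PSIAdversary : Type 1 :=
  Program psiSig [.bits, .g₂, .nat, .g₂, .g₂, .g₂] [.bool]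

/-- The work for the challenge is counted in `psiOverhead`. -/
def psiCallCost (T : Costs) (k : ℕ) : PSICall → ℕ
  | .hash => 1
  | .sign _ => T.exp₁ k + 2
  | .verify _ => T.exp₁ k + 2 * T.pairing k + 2
  | .challenge => 1

/-- Hash values are not `0` and salts have length `n`. -/
def psiFormat (S : BilinearStructure) (n : ℕ) : (c : PSICall) → Args S (psiSig.rets c) → Prop
  | .hash, ((g : S.G₁), _) => g ≠ 0
  | .sign _, ((r : List Bool), _) => r.length = n
  | .verify _, _ => True
  | .challenge, ((r : List Bool), _) => r.length = n

/-- The state of the experiment: the random oracle, the set of the messages that occurred in calls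
to the signing or verifying oracles, and the message of the challenge. -/
structure PSIState (S : BilinearStructure) where
  table : HashTable S
  queried : Set (List Bool)
  chosen : Option (List Bool)

/-- The oracles when the challenge is formed with the key of signer `b`; `u i` is the secret key of
signer `i`. -/
def psiHandler (S : BilinearStructure) (n : ℕ) (P₂ : S.G₂) (u : Bool → ZMod S.q) (ub : ZMod S.q)
    (b : Bool) : Handler psiSig S (PSIState S)
  | .hash, ((m : List Bool), (r : List Bool), _), st =>
      (hashQuery S m r st.table).map fun x => ((x.1, ()), { st with table := x.2 })
  | .sign i, ((m : List Bool), _), st =>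
      (sign S n m (u i) st.table).map fun x =>
        ((x.1.1, x.1.2, ()), { st with table := x.2, queried := insert m st.queried })
  | .verify i, ((m : List Bool), (r : List Bool), (Q₁ : S.G₁), (Q₂ : S.G₂), _), st =>
      (dverify S m r Q₁ Q₂ (scale (u i) P₂) ub st.table).map fun x =>
        ((x.1, ()), { st with table := x.2, queried := insert m st.queried })
  | .challenge, ((m : List Bool), _), st =>
      (sign S n m (u b) st.table).bind fun x =>
        (designate S x.1 (scale ub P₂)).map fun d =>
          ((d.1, d.2.1, d.2.2, ()), { st with table := x.2, chosen := some m })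

open Classical in
/-- The experiment returns the guess, but `0` if the message of the challenge was submitted to the
signing or verifying oracles. -/
def psiJudge (S : BilinearStructure) : Args S [.bool] → PSIState S → PMF Bool
  | ((b : Bool), _), st =>
      PMF.pure (b && decide (∃ m, st.chosen = some m ∧ m ∉ st.queried))

def psiInput (S : BilinearStructure) (n : ℕ) (P₂ : S.G₂) (u₀ u₁ ub : ZMod S.q) :
    Args S [.bits, .g₂, .nat, .g₂, .g₂, .g₂] :=
  (S.desc, P₂, n, (scale u₀ P₂ : S.G₂), (scale u₁ P₂ : S.G₂), (scale ub P₂ : S.G₂), ())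

/-- Time of the experiment outside the run of the distinguisher: generator, choice of `P₂`, three
key pairs, signing and designating the challenge. -/
def psiOverhead (T : Costs) (k : ℕ) : ℕ :=
  T.gen k + 1 + 3 * (T.exp₂ k + 1) + (T.exp₁ k + 2) + (T.exp₁ k + T.exp₂ k + 2)

/-- The probability that the experiment with challenge bit `b` returns `1`. -/
def psiProb (T : Costs) (Gen : BDHGenerator) (f : ℕ → ℕ) (A : PSIAdversary) (k : ℕ) (b : Bool) :
    ℝ≥0∞ :=
  mean (Gen.gen k) fun S =>
  mean (uniformNonzero S.G₂) fun P₂ =>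
  mean (uniformNonzero (ZMod S.q)) fun u₀ =>
  mean (uniformNonzero (ZMod S.q)) fun u₁ =>
  mean (uniformNonzero (ZMod S.q)) fun ub =>
    A.accept T k (psiCallCost T k) S
      (psiHandler S (f k) P₂ (fun i => if i = true then u₁ else u₀) ub b)
      (psiInput S (f k) P₂ u₀ u₁ ub) ⟨fun _ _ => none, ∅, none⟩ (psiJudge S)

/-- The advantage of a distinguisher against UDVS-BLS. -/
def psiAdv (T : Costs) (Gen : BDHGenerator) (f : ℕ → ℕ) (A : PSIAdversary) (k : ℕ) : ℝ :=
  |(psiProb T Gen f A k false).toReal - (psiProb T Gen f A k true).toReal|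

/-- `A` is a `(τ, q_S, q_V)`-distinguisher for a `q_H`-random oracle: whatever its oracles answer,
the experiment ends in mean time less than `τ(k)` and `A` respects the bounds on its calls. -/
def IsPSIAdversary (T : Costs) (Gen : BDHGenerator) (f τ qS qV qH : ℕ → ℕ) (A : PSIAdversary) :
    Prop :=
  ∀ k : ℕ,
    (psiOverhead T k : ℝ≥0∞) +
        (mean (Gen.gen k) fun S =>
          mean (uniformNonzero S.G₂) fun P₂ =>
          mean (uniformNonzero (ZMod S.q)) fun u₀ =>
          mean (uniformNonzero (ZMod S.q)) fun u₁ =>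
          mean (uniformNonzero (ZMod S.q)) fun ub =>
            A.worstTime T k (psiCallCost T k) S (psiFormat S (f k))
              (psiInput S (f k) P₂ u₀ u₁ ub))
      < (τ k : ℝ≥0∞) ∧
    ∀ S ∈ (Gen.gen k).support, ∀ P₂ : S.G₂, P₂ ≠ 0 → ∀ u₀ u₁ ub : ZMod S.q,
      u₀ ≠ 0 → u₁ ≠ 0 → ub ≠ 0 →
      A.CallsBounded T k (psiCallCost T k) S (psiFormat S (f k)) (psiInput S (f k) P₂ u₀ u₁ ub)
        fun calls => calls .hash ≤ qH k ∧
          calls (.sign false) + calls (.sign true) ≤ qS k ∧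
          calls (.verify false) + calls (.verify true) ≤ qV k ∧
          calls .challenge ≤ 1

/-! ## The computational problem PR₂ and the decisional problem PR₃

The algorithms for both problems are also given three natural numbers that depend on the security
parameter only. -/

/-- A solver of PR₂ has input `(desc, P₂, X, Y, Z)` and three numbers, and output `(R, Q)`. -/
abbrev PR2Solver : Type 1 :=
  Program noOracle [.bits, .g₂, .g₁, .g₂, .g₂, .nat, .nat, .nat] [.g₁, .g₂]

def pr2Input (S : BilinearStructure) (aux : ℕ × ℕ × ℕ) (P₂ : S.G₂) (x y z : ZMod S.q) :
    Args S [.bits, .g₂, .g₁, .g₂, .g₂, .nat, .nat, .nat] :=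
  (S.desc, P₂, (scale x (S.ψ P₂) : S.G₁), (scale y P₂ : S.G₂), (scale z P₂ : S.G₂),
    aux.1, aux.2.1, aux.2.2, ())

def noHandler (S : BilinearStructure) : Handler noOracle S Unit := fun c => c.elim

open Classical in
def pr2Judge (S : BilinearStructure) (P₂ : S.G₂) (x y z : ZMod S.q) :
    Args S [.g₁, .g₂] → Unit → PMF Bool
  | ((R : S.G₁), (Q : S.G₂), _), _ =>
      PMF.pure (decide (S.e R Q = S.e (S.ψ P₂) P₂ ^ (x * y * z).val))

/-- Time of the experiment outside the run of the solver: generator, choice of `P₂`, `P₁ = ψ(P₂)`,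
`x, y, z` and `X, Y, Z`, and the final test (with `e(P₁, P₂)^(xyz)` computed as
`e((xyz) P₁, P₂)`). -/
def pr2Overhead (T : Costs) (k : ℕ) : ℕ :=
  T.gen k + 2 + 3 + (T.exp₁ k + 2 * T.exp₂ k) + (T.exp₁ k + 2 * T.pairing k + 3)

/-- The success of a solver in the PR₂ experiment. -/
def pr2Succ (T : Costs) (Gen : BDHGenerator) (aux : ℕ → ℕ × ℕ × ℕ) (B : PR2Solver) (k : ℕ) :
    ℝ≥0∞ :=
  mean (Gen.gen k) fun S =>
  mean (uniformNonzero S.G₂) fun P₂ =>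
  mean (uniformNonzero (ZMod S.q)) fun x =>
  mean (uniformNonzero (ZMod S.q)) fun y =>
  mean (uniformNonzero (ZMod S.q)) fun z =>
    B.accept T k Empty.elim S (noHandler S) (pr2Input S (aux k) P₂ x y z) () (pr2Judge S P₂ x y z)

/-- `B` is a `τ`-adversary for PR₂. -/
def IsPR2Solver (T : Costs) (Gen : BDHGenerator) (aux : ℕ → ℕ × ℕ × ℕ) (τ : ℕ → ℕ)
    (B : PR2Solver) : Prop :=
  ∀ k : ℕ,
    (pr2Overhead T k : ℝ≥0∞) +
        (mean (Gen.gen k) fun S =>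
          mean (uniformNonzero S.G₂) fun P₂ =>
          mean (uniformNonzero (ZMod S.q)) fun x =>
          mean (uniformNonzero (ZMod S.q)) fun y =>
          mean (uniformNonzero (ZMod S.q)) fun z =>
            B.meanTime T k Empty.elim S (noHandler S) (pr2Input S (aux k) P₂ x y z) ())
      < (τ k : ℝ≥0∞)

/-- A distinguisher for PR₃ has input `(desc, P₂, X, Y, Z, R, Q)` and three numbers, and outputs a
bit. -/
abbrev PR3Distinguisher : Type 1 :=
  Program noOracle [.bits, .g₂, .g₁, .g₂, .g₂, .g₁, .g₂, .nat, .nat, .nat] [.bool]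

/-- The pair `(R, Q)`: `((xt) P₁, (yz/t) P₂)` if `d = 0`, uniformly random if `d = 1`. -/
def pr3Pair (S : BilinearStructure) (P₂ : S.G₂) (x y z : ZMod S.q) : Bool → PMF (S.G₁ × S.G₂)
  | false => (uniformNonzero (ZMod S.q)).map fun t =>
      (scale (x * t) (S.ψ P₂), scale (y * z * t⁻¹) P₂)
  | true => PMF.uniformOfFintype (S.G₁ × S.G₂)

def pr3Input (S : BilinearStructure) (aux : ℕ × ℕ × ℕ) (P₂ : S.G₂) (x y z : ZMod S.q)
    (RQ : S.G₁ × S.G₂) :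
    Args S [.bits, .g₂, .g₁, .g₂, .g₂, .g₁, .g₂, .nat, .nat, .nat] :=
  (S.desc, P₂, (scale x (S.ψ P₂) : S.G₁), (scale y P₂ : S.G₂), (scale z P₂ : S.G₂), RQ.1, RQ.2,
    aux.1, aux.2.1, aux.2.2, ())

/-- The mean of a function of the instance of PR₃ with bit `d`. -/
def pr3Mean (Gen : BDHGenerator) (aux : ℕ → ℕ × ℕ × ℕ) (k : ℕ) (d : Bool)
    (F : (S : BilinearStructure) →
      Args S [.bits, .g₂, .g₁, .g₂, .g₂, .g₁, .g₂, .nat, .nat, .nat] → ℝ≥0∞) : ℝ≥0∞ :=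
  mean (Gen.gen k) fun S =>
  mean (uniformNonzero S.G₂) fun P₂ =>
  mean (uniformNonzero (ZMod S.q)) fun x =>
  mean (uniformNonzero (ZMod S.q)) fun y =>
  mean (uniformNonzero (ZMod S.q)) fun z =>
  mean (pr3Pair S P₂ x y z d) fun RQ => F S (pr3Input S (aux k) P₂ x y z RQ)

/-- The probability that the distinguisher outputs `1` in the experiment with bit `d`. -/
def pr3Prob (T : Costs) (Gen : BDHGenerator) (aux : ℕ → ℕ × ℕ × ℕ) (B : PR3Distinguisher) (k : ℕ)
    (d : Bool) : ℝ≥0∞ :=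
  pr3Mean Gen aux k d fun S v =>
    B.accept T k Empty.elim S (noHandler S) v () fun w _ => PMF.pure w.1

/-- The advantage of a distinguisher for PR₃. -/
def pr3Adv (T : Costs) (Gen : BDHGenerator) (aux : ℕ → ℕ × ℕ × ℕ) (B : PR3Distinguisher) (k : ℕ) :
    ℝ :=
  |(pr3Prob T Gen aux B k false).toReal - (pr3Prob T Gen aux B k true).toReal|

/-- Time of the experiment outside the run of the distinguisher. -/
def pr3Overhead (T : Costs) (k : ℕ) : Bool → ℕ
  | false => T.gen k + 2 + 4 + (T.exp₁ k + 2 * T.exp₂ k) + (T.exp₁ k + T.exp₂ k + 4)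
  | true => T.gen k + 2 + 4 + (T.exp₁ k + 2 * T.exp₂ k) + 2

/-- `B` is a `τ`-distinguisher for PR₃. -/
def IsPR3Distinguisher (T : Costs) (Gen : BDHGenerator) (aux : ℕ → ℕ × ℕ × ℕ) (τ : ℕ → ℕ)
    (B : PR3Distinguisher) : Prop :=
  ∀ (k : ℕ) (d : Bool),
    (pr3Overhead T k d : ℝ≥0∞) +
        (pr3Mean Gen aux k d fun S v => B.meanTime T k Empty.elim S (noHandler S) v ())
      < (τ k : ℝ≥0∞)

end

/-! Both reductions program the random oracle. Each hash value is a known uniform non-zero multiple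
`h` of one of the two bases `X = xP₁` and `P₁ = ψ(P₂)`. Such a multiple is uniform among the
non-zero elements for either base, so the adversary cannot see which base was used.

Forgeries. The signer's public key is `Y` and the verifier's is `Z`. Every message has a hidden
number, uniform in `{0, …, qS}`, and the base is `X` exactly for the number `0`. For the other
numbers the signature of `hP₁` is `hψ(Y)`, and verification compares `e(hψ(Y), Z)` with `e(Q₁, Q₂)`.
For the number `0` neither is possible, but an accepted `(Q₁, Q₂)` satisfies `e(h⁻¹Q₁, Q₂) = e(P₁,
P₂)^(xyz)` (`e_forgery`). The verifications of this kind are handled by a guess: a uniform `j ≤ qV`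
of them are rejected and the next one is output as the solution. Some value of `j` is right, which
costs the factor `qV + 1` (`forgeIdeal_le_sum`). The number of an unsigned message is independent of
the forger's view. Hence no signed message has the number `0` while the forged one has it with
probability at least `(qS/(qS+1))^qS / (qS+1)` (`mul_bounded_le_forgeIdeal`), and this is at least
`1/(1+6qS)` because `(1+1/n)^n ≤ 3` (`inv_le_guess`). The salts play no role in this part; the
factor `2^f_r` only weakens the bound.

Privacy. A coin `bit` decides which signer gets the key `Y`; the other secret key `u` is chosen by
the reduction. Every message has a hidden salt, and the base is `X` exactly for this salt. The
challenge uses the hidden salt and answers `(hR, Q)`. If the instance is valid, this is `(tH,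
(yz/t)P₂)`, and with `t = t'y` it is a designated signature of the signer `bit`. The simulation
fails only if a signing or verification query meets the hidden salt of its message, with probability
at most `2^-n` for each query (`psiValue_le_hideValue`). If the pair is random, exchanging the
signers together with `y` and `u` changes nothing in the view but turns right guesses into wrong
ones, so both outputs are equally likely (`hideMean_random`). `half_sub_le_abs` turns the two facts
into the bound for the advantage.

Machines. Expected payoffs of runs are computed by recursion on the code (`mean_run_payoff`).
`Wrapper.program` runs an adversary and answers its calls by loop-free code. That the code does what
it should (`Wrapper.Implements`) is proved for an arbitrary relation preserved by means; the
instances `≤` and `≥` give the bound for the time and the bound for the success. The answers of the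
reductions have the format of oracle answers, so the worst-case time of the adversary bounds its
time inside the reduction; to this the costs of the code are added call by call. -/

noncomputable section

/-! ## Means -/

section Mean

variable {α β : Type*}

theorem mean_pure (a : α) (f : α → ℝ≥0∞) : mean (PMF.pure a) f = f a := by
  classical
  simp [mean, PMF.pure_apply, ite_mul]

theorem mean_bind (p : PMF α) (g : α → PMF β) (f : β → ℝ≥0∞) :
    mean (p.bind g) f = mean p fun a => mean (g a) f := by
  simp only [mean, PMF.bind_apply, ← ENNReal.tsum_mul_right, ← ENNReal.tsum_mul_left]
  rw [ENNReal.tsum_comm]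
  simp only [mul_assoc]

theorem mean_map (p : PMF α) (g : α → β) (f : β → ℝ≥0∞) :
    mean (p.map g) f = mean p fun a => f (g a) := by
  rw [PMF.map, mean_bind]
  simp [mean_pure]

theorem mean_comm (p : PMF α) (q : PMF β) (f : α → β → ℝ≥0∞) :
    (mean p fun a => mean q (f a)) = mean q fun b => mean p fun a => f a b := by
  simp only [mean, ← ENNReal.tsum_mul_left]
  rw [ENNReal.tsum_comm]
  simp only [mul_left_comm]

theorem mean_mono {p : PMF α} {f g : α → ℝ≥0∞} (h : ∀ a, f a ≤ g a) : mean p f ≤ mean p g :=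
  ENNReal.tsum_le_tsum fun a => by gcongr; exact h a

theorem mean_mono_support {p : PMF α} {f g : α → ℝ≥0∞} (h : ∀ a ∈ p.support, f a ≤ g a) :
    mean p f ≤ mean p g :=
  ENNReal.tsum_le_tsum fun a => by
    by_cases ha : a ∈ p.support
    · gcongr; exact h a ha
    · rw [PMF.mem_support_iff, not_not] at ha
      simp [ha]

theorem mean_congr_support {p : PMF α} {f g : α → ℝ≥0∞} (h : ∀ a ∈ p.support, f a = g a) :
    mean p f = mean p g :=
  le_antisymm (mean_mono_support fun a ha => (h a ha).le) (mean_mono_support fun a ha => (h a ha).ge)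

theorem mean_const (p : PMF α) (c : ℝ≥0∞) : (mean p fun _ => c) = c := by
  simp [mean, ENNReal.tsum_mul_right, p.tsum_coe]

theorem mean_add (p : PMF α) (f g : α → ℝ≥0∞) :
    (mean p fun a => f a + g a) = mean p f + mean p g := by
  simp [mean, mul_add, ENNReal.tsum_add]

theorem mean_mul_left (p : PMF α) (c : ℝ≥0∞) (f : α → ℝ≥0∞) :
    (mean p fun a => c * f a) = c * mean p f := by
  simp only [mean, ← ENNReal.tsum_mul_left, mul_left_comm]

theorem mean_sum {ι : Type*} (p : PMF α) (s : Finset ι) (f : ι → α → ℝ≥0∞) :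
    (mean p fun a => ∑ i ∈ s, f i a) = ∑ i ∈ s, mean p (f i) := by
  simp only [mean, Finset.mul_sum]
  exact Summable.tsum_finsetSum fun _ _ => ENNReal.summable

theorem mean_le_const {p : PMF α} {f : α → ℝ≥0∞} {c : ℝ≥0∞} (h : ∀ a, f a ≤ c) : mean p f ≤ c :=
  (mean_mono h).trans (mean_const p c).le

/-- Monotone convergence, for the counting measure. -/
theorem mean_iSup (p : PMF α) (f : ℕ → α → ℝ≥0∞) (h : ∀ a, Monotone fun n => f n a) :
    (mean p fun a => ⨆ n, f n a) = ⨆ n, mean p (f n) := by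
  have hm : Monotone f := fun m n hmn a => h a hmn
  simp only [mean, ENNReal.mul_iSup]
  let _ : MeasurableSpace α := ⊤
  simp only [← MeasureTheory.lintegral_count]
  rw [MeasureTheory.lintegral_iSup (fun n => measurable_from_top)]
  intro m n hmn a
  exact mul_le_mul_right (h a hmn) _

/-- A point of positive mass with an infinite value would make the mean infinite. Finiteness of the
mean time of an experiment is thus inherited by all keys and instances that can occur. -/
theorem lt_top_of_mean_lt_top {p : PMF α} {f : α → ℝ≥0∞} (h : mean p f < ⊤) {a : α}
    (ha : a ∈ p.support) : f a < ⊤ := by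
  by_contra hf
  rw [not_lt, top_le_iff] at hf
  have h1 : p a * f a ≤ mean p f := ENNReal.le_tsum a
  rw [hf, ENNReal.mul_top ((PMF.mem_support_iff _ _).1 ha), top_le_iff] at h1
  exact h.ne h1

theorem mean_indicator [DecidableEq α] (p : PMF α) (a : α) :
    (mean p fun b => if b = a then 1 else 0) = p a := by
  simp [mean, mul_ite]

theorem bind_apply_eq_mean (p : PMF α) (f : α → PMF β) (b : β) :
    (p.bind f) b = mean p fun a => f a b := PMF.bind_apply _ _ _

theorem map_apply_eq_mean [DecidableEq β] (p : PMF α) (f : α → β) (b : β) :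
    (p.map f) b = mean p fun a => if b = f a then 1 else 0 := by
  simp only [PMF.map_apply, mean, mul_ite, mul_one, mul_zero]
  refine tsum_congr fun a => ?_
  split_ifs <;> rfl

/-- The relation `r` holds between means if it holds between the functions. -/
structure MeanClosed (r : ℝ≥0∞ → ℝ≥0∞ → Prop) : Prop where
  mean : ∀ {α : Type} (p : PMF α) (f g : α → ℝ≥0∞), (∀ a ∈ p.support, r (f a) (g a)) →
    r (mean p f) (mean p g)

theorem MeanClosed.rel_bind {r : ℝ≥0∞ → ℝ≥0∞ → Prop} (hr : MeanClosed r) {α β : Type} {p : PMF α}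
    {f : α → ℝ≥0∞} {g : α → PMF β} {F : β → ℝ≥0∞} (h : ∀ a ∈ p.support, r (f a) (_root_.mean (g a) F)) :
    r (_root_.mean p f) (_root_.mean (p.bind g) F) := by
  rw [mean_bind]
  exact hr.mean _ _ _ h

theorem MeanClosed.rel_map {r : ℝ≥0∞ → ℝ≥0∞ → Prop} (hr : MeanClosed r) {α β : Type} {p : PMF α}
    {f : α → ℝ≥0∞} {g : α → β} {F : β → ℝ≥0∞} (h : ∀ a ∈ p.support, r (f a) (F (g a))) :
    r (_root_.mean p f) (_root_.mean (p.map g) F) := by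
  rw [mean_map]
  exact hr.mean _ _ _ h

/-- The analysis of code is carried out for an arbitrary such relation; this instance serves for
upper bounds, and `meanClosed_ge` for lower bounds. -/
theorem meanClosed_le : MeanClosed (· ≤ ·) := ⟨fun _ _ _ h => mean_mono_support h⟩

theorem meanClosed_ge : MeanClosed (· ≥ ·) := ⟨fun _ _ _ h => mean_mono_support h⟩

/-- Functionals that commute with means. -/
def CommutesWithMean {σ : Type*} (K : (σ → ℝ≥0∞) → ℝ≥0∞) : Prop :=
  ∀ {γ : Type} (p : PMF γ) (F : γ → σ → ℝ≥0∞),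
    (K fun s => mean p fun c => F c s) = mean p fun c => K (F c)

end Mean

/-! ## Values of runs -/

/-- The transformation of payoffs (functions of answer and new state) by oracle calls. -/
def CallTransformer (O : Sig) (S : BilinearStructure) (σ : Type) : Type :=
  (c : O.Call) → Args S (O.args c) → σ → (Args S (O.rets c) × σ → ℝ≥0∞) → ℝ≥0∞

section Value

variable {O : Sig} {inp out : List Srt} (P : Program O inp out) (S : BilinearStructure) {σ : Type}

/-- The mean payoff of a run of at most `n` steps: `pc` is paid for an elementary operation, `oc`
for a jump or an access to a table, and `J` when the run stops. -/
def Program.value (pc : Prim → ℝ≥0∞) (oc : ℝ≥0∞) (H : CallTransformer O S σ)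
    (J : Args S out → σ → ℝ≥0∞) : ℕ → P.L → Mem S P.R → σ → ℝ≥0∞
  | 0, _, _, _ => 0
  | n + 1, l, μ, s =>
    match P.code l with
    | .prim p x y next =>
        pc p + mean (p.eval S (μ.read p.args x)) fun v =>
          Program.value pc oc H J n next (Mem.write p.rets y v μ) s
    | .branch x l₁ l₀ =>
        oc + Program.value pc oc H J n (if (show Bool from μ.reg .bool x) = true then l₁ else l₀) μ s
    | .store i t a b x next =>
        oc + Program.value pc oc H J n next
          (μ.setTab i t (μ.reg .bits a) (μ.reg .bits b) (μ.reg i x)) s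
    | .load i t a b x found missing =>
        oc + match μ.tab i t (μ.reg .bits a) (μ.reg .bits b) with
          | some v => Program.value pc oc H J n found (μ.set i x v) s
          | none => Program.value pc oc H J n missing μ s
    | .call c x y next =>
        H c (μ.read (O.args c) x) s fun v =>
          Program.value pc oc H J n next (Mem.write (O.rets c) y v.1 μ) v.2
    | .halt x => J (μ.read out x) s

section

variable {P S} {pc : Prim → ℝ≥0∞} {oc : ℝ≥0∞} {H : CallTransformer O S σ}
  {J : Args S out → σ → ℝ≥0∞} {n : ℕ} {l : P.L} {μ : Mem S P.R} {s : σ}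

theorem Program.value_of_prim {p : Prim} {x : Regs P.R p.args} {y : Regs P.R p.rets} {next : P.L}
    (h : P.code l = .prim p x y next) :
    P.value S pc oc H J (n + 1) l μ s = pc p + mean (p.eval S (μ.read p.args x)) fun v =>
      P.value S pc oc H J n next (Mem.write p.rets y v μ) s := by
  rw [Program.value, h]

theorem Program.value_of_branch {x : P.R} {l₁ l₀ : P.L} (h : P.code l = .branch x l₁ l₀) :
    P.value S pc oc H J (n + 1) l μ s = oc + P.value S pc oc H J n
      (if (show Bool from μ.reg .bool x) = true then l₁ else l₀) μ s := by
  rw [Program.value, h]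

theorem Program.value_of_store {i : Srt} {t a b x : P.R} {next : P.L}
    (h : P.code l = .store i t a b x next) :
    P.value S pc oc H J (n + 1) l μ s = oc + P.value S pc oc H J n next
      (μ.setTab i t (μ.reg .bits a) (μ.reg .bits b) (μ.reg i x)) s := by
  rw [Program.value, h]

theorem Program.value_of_load {i : Srt} {t a b x : P.R} {l₁ l₀ : P.L}
    (h : P.code l = .load i t a b x l₁ l₀) :
    P.value S pc oc H J (n + 1) l μ s =
      oc + match μ.tab i t (μ.reg .bits a) (μ.reg .bits b) with
        | some v => P.value S pc oc H J n l₁ (μ.set i x v) s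
        | none => P.value S pc oc H J n l₀ μ s := by
  rw [Program.value, h]

theorem Program.value_of_halt {x : Regs P.R out} (h : P.code l = .halt x) :
    P.value S pc oc H J (n + 1) l μ s = J (μ.read out x) s := by
  rw [Program.value, h]

end

/-- The expected payoff at a snapshot. -/
def Snapshot.payoff {P : Program O inp out} {S : BilinearStructure} (g : ℕ → (O.Call → ℕ) → ℝ≥0∞)
    (J : Args S out → σ → ℝ≥0∞) (V : P.L → Mem S P.R → σ → ℝ≥0∞) (st : Snapshot P S σ) : ℝ≥0∞ :=
  g st.time st.calls +
    match st.conf with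
    | .inl c => V c.1 c.2 st.oracle
    | .inr w => J w st.oracle

theorem Snapshot.payoff_inl {P : Program O inp out} {S : BilinearStructure}
    (g : ℕ → (O.Call → ℕ) → ℝ≥0∞) (J : Args S out → σ → ℝ≥0∞) (V : P.L → Mem S P.R → σ → ℝ≥0∞)
    (l : P.L) (μ : Mem S P.R) (s : σ) (t : ℕ) (c : O.Call → ℕ) :
    Snapshot.payoff g J V ⟨.inl (l, μ), s, t, c⟩ = g t c + V l μ s := rfl

theorem Snapshot.payoff_inr {P : Program O inp out} {S : BilinearStructure}
    (g : ℕ → (O.Call → ℕ) → ℝ≥0∞) (J : Args S out → σ → ℝ≥0∞) (V : P.L → Mem S P.R → σ → ℝ≥0∞)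
    (w : Args S out) (s : σ) (t : ℕ) (c : O.Call → ℕ) :
    Snapshot.payoff g J V ⟨.inr w, s, t, c⟩ = g t c + J w s := rfl

variable (T : Costs) (k : ℕ) (callCost : O.Call → ℕ) (h : Handler O S σ)

/-- The transformer of a handler, with a payment for every call. -/
def Handler.transformer {S : BilinearStructure} (h : Handler O S σ) (cc : O.Call → ℝ≥0∞) :
    CallTransformer O S σ :=
  fun c a s Φ => cc c + mean (h c a s) Φ

-- The expected payoff is a martingale: a step transfers what is due for the current instruction
-- from the value function to the payment `g` made so far. Stopping is itself a step with the price
-- `oc`, so the value function has the final payoff `oc + J` where a stopped snapshot has `J`.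
open Classical in
theorem mean_step_payoff {pc : Prim → ℝ≥0∞} {oc : ℝ≥0∞} {cc : O.Call → ℝ≥0∞}
    {g : ℕ → (O.Call → ℕ) → ℝ≥0∞} (hp : ∀ p t c, g (t + Prim.cost T k p) c = g t c + pc p)
    (ho : ∀ t c, g (t + 1) c = g t c + oc)
    (hc : ∀ t c i, g (t + callCost i) (Function.update c i (c i + 1)) = g t c + cc i)
    (J : Args S out → σ → ℝ≥0∞) (n : ℕ) (st : Snapshot P S σ) :
    mean (P.step T k callCost S h st)
        (Snapshot.payoff g J (P.value S pc oc (h.transformer cc) (fun w s => oc + J w s) n)) =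
      Snapshot.payoff g J (P.value S pc oc (h.transformer cc) (fun w s => oc + J w s) (n + 1)) st := by
  obtain ⟨conf, s, t, calls⟩ := st
  rcases conf with ⟨l, μ⟩ | w
  · simp only [Program.step, Snapshot.payoff_inl, Program.value]
    cases hl : P.code l with
    | prim p x y next => simp only [mean_map, hp, mean_add, mean_const, Snapshot.payoff_inl, add_assoc]
    | branch x l₁ l₀ => simp only [mean_pure, ho, Snapshot.payoff_inl, add_assoc]
    | store i t a b x next => simp only [mean_pure, ho, Snapshot.payoff_inl, add_assoc]
    | load i t a b x found missing =>
      cases hv : μ.tab i t (μ.reg .bits a) (μ.reg .bits b) <;> simp only [hv, mean_pure, ho,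
          Snapshot.payoff_inl, add_assoc]
    | call c x y next =>
      simp only [mean_map, hc, mean_add, mean_const, Snapshot.payoff_inl, add_assoc, Handler.transformer]
    | halt x => simp only [mean_pure, ho, Snapshot.payoff_inr, add_assoc]
  · simp [Program.step, Snapshot.payoff, mean_pure]

/-- Iteration of the martingale property. For `m = 0` the left side is the mean of the payments made
so far and of `J` on the stopped runs, so that statements about distributions of snapshots become
statements about a recursive function. -/
theorem mean_run_payoff {pc : Prim → ℝ≥0∞} {oc : ℝ≥0∞} {cc : O.Call → ℝ≥0∞}
    {g : ℕ → (O.Call → ℕ) → ℝ≥0∞} (hp : ∀ p t c, g (t + Prim.cost T k p) c = g t c + pc p)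
    (ho : ∀ t c, g (t + 1) c = g t c + oc)
    (hc : ∀ t c i, g (t + callCost i) (@Function.update _ _ (Classical.decEq _) c i (c i + 1))
      = g t c + cc i)
    (h0 : g 0 (fun _ => 0) = 0)
    (J : Args S out → σ → ℝ≥0∞) (v : Args S inp) (s : σ) (n m : ℕ) :
    mean (P.run T k callCost S h v s n)
        (Snapshot.payoff g J (P.value S pc oc (h.transformer cc) (fun w s => oc + J w s) m)) =
      P.value S pc oc (h.transformer cc) (fun w s => oc + J w s) (n + m) P.start
        (Mem.write inp P.input v (Mem.init S P.R)) s := by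
  induction n generalizing m with
  | zero => simp [Program.run, mean_pure, Snapshot.payoff, h0]
  | succ n ih =>
    rw [Program.run, mean_bind]
    simp only [mean_step_payoff P S T k callCost h hp ho
      (fun t c i => hc t c i)]
    rw [ih, show n + (m + 1) = n + 1 + m by omega]

/-- The start of a run. -/
abbrev Program.startMem {P : Program O inp out} (v : Args S inp) : Mem S P.R :=
  Mem.write inp P.input v (Mem.init S P.R)

/-- The mean payoff of a run that is only paid for its result. -/
abbrev Program.resultValue (H : CallTransformer O S σ) (J : Args S out → σ → ℝ≥0∞) :
    ℕ → P.L → Mem S P.R → σ → ℝ≥0∞ :=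
  P.value S (fun _ => 0) 0 H J

theorem Program.accept_eq_iSup (v : Args S inp) (s : σ) (judge : Args S out → σ → PMF Bool) :
    P.accept T k callCost S h v s judge =
      ⨆ n, P.resultValue S (h.transformer fun _ => 0) (fun w s => judge w s true) n P.start
        (Program.startMem S v) s := by
  refine iSup_congr fun n => ?_
  have := mean_run_payoff P S T k callCost h (pc := fun _ => 0) (oc := 0) (cc := fun _ => 0)
    (g := fun _ _ => 0) (by simp) (by simp) (by simp) rfl (fun w s => judge w s true) v s n 0
  simp only [zero_add, add_zero] at this
  rw [Program.resultValue, ← this, bind_apply_eq_mean]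
  congr 1
  funext st
  simp only [Snapshot.payoff, zero_add]
  cases st.conf with
  | inl c => simp [Program.value, PMF.pure_apply]
  | inr w => rfl

/-- An additive charge `e` on the counters is the same as a surcharge `w` on each call. In this way
the extra work of a reduction is expressed by numbers of queries. -/
theorem Program.mean_time_add_calls {w : O.Call → ℝ≥0∞} {e : (O.Call → ℕ) → ℝ≥0∞}
    (he : ∀ c i, e (@Function.update _ _ (Classical.decEq _) c i (c i + 1)) = e c + w i)
    (h0 : e (fun _ => 0) = 0) (v : Args S inp) (s : σ) (n : ℕ) :
    mean (P.run T k callCost S h v s n) (fun st => (st.time : ℝ≥0∞) + e st.calls) =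
      P.value S (fun p => Prim.cost T k p) 1 (h.transformer fun c => callCost c + w c)
        (fun _ _ => 1) n P.start (Program.startMem S v) s := by
  have := mean_run_payoff P S T k callCost h (pc := fun p => Prim.cost T k p) (oc := 1)
    (cc := fun c => callCost c + w c) (g := fun t c => (t : ℝ≥0∞) + e c)
    (fun p t c => by push_cast; ring) (fun t c => by push_cast; ring)
    (fun t c i => by rw [he]; push_cast; ring) (by simp [h0]) (fun _ _ => 0) v s n 0
  simp only [add_zero] at this
  rw [← this]
  congr 1
  funext st
  simp only [Snapshot.payoff]
  cases st.conf <;> simp [Program.value]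

theorem Program.meanTime_eq_iSup (v : Args S inp) (s : σ) :
    P.meanTime T k callCost S h v s =
      ⨆ n, P.value S (fun p => Prim.cost T k p) 1 (h.transformer fun c => callCost c)
        (fun _ _ => 1) n P.start (Program.startMem S v) s := by
  refine iSup_congr fun n => ?_
  have := P.mean_time_add_calls S T k callCost h (w := fun _ => 0) (e := fun _ => 0) (by simp) rfl
    v s n
  simpa only [add_zero] using this

/-- If the numbers of calls are bounded, then charging extra time for the calls adds a bounded
amount to the mean time. -/
theorem Program.value_time_le {w : O.Call → ℝ≥0∞} {e : (O.Call → ℕ) → ℝ≥0∞} {b : ℝ≥0∞}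
    (he : ∀ c i, e (@Function.update _ _ (Classical.decEq _) c i (c i + 1)) = e c + w i)
    (h0 : e (fun _ => 0) = 0) (v : Args S inp) (s : σ)
    (hb : ∀ n, ∀ st ∈ (P.run T k callCost S h v s n).support, e st.calls ≤ b) (n : ℕ) :
    P.value S (fun p => Prim.cost T k p) 1 (h.transformer fun c => callCost c + w c)
        (fun _ _ => 1) n P.start (Program.startMem S v) s ≤
      P.meanTime T k callCost S h v s + b := by
  rw [← P.mean_time_add_calls S T k callCost h he h0, mean_add]
  refine add_le_add (le_iSup (fun n => mean (P.run T k callCost S h v s n)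
    fun st => (st.time : ℝ≥0∞)) n) ?_
  exact (mean_mono_support (hb n)).trans (mean_const _ b).le

end Value

/-! ### Bounded numbers of calls, termination, and comparison of runs. -/

section Bounded

variable {O : Sig} {inp out : List Srt} (P : Program O inp out) (S : BilinearStructure) {σ : Type}

/-- The number of calls after one more call. -/
def countCall (n : O.Call → ℕ) (c : O.Call) : O.Call → ℕ :=
  @Function.update _ _ (Classical.decEq _) n c (n c + 1)

theorem countCall_same (n : O.Call → ℕ) (c : O.Call) : countCall n c c = n c + 1 := by
  classical
  exact Function.update_self _ _ _

theorem countCall_of_ne (n : O.Call → ℕ) {c d : O.Call} (h : d ≠ c) : countCall n c d = n d := by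
  classical
  exact Function.update_of_ne h _ _

open Classical in
/-- The transformer of a handler that keeps count of the calls and stops without a payoff when
`bound` is violated. -/
def Handler.boundedTransformer {S : BilinearStructure} (h : Handler O S σ)
    (bound : (O.Call → ℕ) → Prop) : CallTransformer O S (σ × (O.Call → ℕ)) :=
  fun c a s Φ =>
    if bound (countCall s.2 c) then
      mean (h c a s.1) fun v => Φ (v.1, v.2, countCall s.2 c)
    else 0

variable (T : Costs) (k : ℕ) (callCost : O.Call → ℕ) (h : Handler O S σ)

theorem Program.mem_support_run_succ {v : Args S inp} {s : σ} {n : ℕ} {st st' : Snapshot P S σ}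
    (h₁ : st ∈ (P.run T k callCost S h v s n).support)
    (h₂ : st' ∈ (P.step T k callCost S h st).support) :
    st' ∈ (P.run T k callCost S h v s (n + 1)).support := by
  rw [Program.run, PMF.mem_support_bind_iff]
  exact ⟨st, h₁, h₂⟩

/-- The bound holds at every snapshot that can be reached, so the cut-off never takes effect.
Reachability is carried through the induction as membership in the support of `run`; `t` and `m`
occur only for this purpose. -/
theorem Program.resultValue_le_bounded {bound : (O.Call → ℕ) → Prop} {v : Args S inp} {s₀ : σ}
    (hb : ∀ n, ∀ st ∈ (P.run T k callCost S h v s₀ n).support, bound st.calls)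
    (J : Args S out → σ → ℝ≥0∞) (n : ℕ) (l : P.L) (μ : Mem S P.R) (s : σ) (t : ℕ)
    (calls : O.Call → ℕ) (m : ℕ)
    (hm : (⟨.inl (l, μ), s, t, calls⟩ : Snapshot P S σ) ∈ (P.run T k callCost S h v s₀ m).support) :
    P.resultValue S (h.transformer fun _ => 0) J n l μ s ≤
      P.resultValue S (h.boundedTransformer bound) (fun w s => J w s.1) n l μ (s, calls) := by
  induction n generalizing l μ s t calls m with
  | zero => exact le_rfl
  | succ n ih =>
    have hs := fun st' => P.mem_support_run_succ S T k callCost h hm (st' := st')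
    simp only [Program.resultValue, Program.value] at ih ⊢
    simp only [Program.step] at hs
    cases hl : P.code l with
    | prim p x y next =>
      simp only [hl] at hs
      refine add_le_add le_rfl (mean_mono_support fun w hw => ih _ _ _ _ _ _
        (hs _ ((PMF.mem_support_map_iff _ _ _).2 ⟨w, hw, rfl⟩)))
    | branch x l₁ l₀ =>
      simp only [hl] at hs
      exact add_le_add le_rfl (ih _ _ _ _ _ _ (hs _ (by rw [PMF.mem_support_pure_iff])))
    | store i t a b x next =>
      simp only [hl] at hs
      exact add_le_add le_rfl (ih _ _ _ _ _ _ (hs _ (by rw [PMF.mem_support_pure_iff])))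
    | load i t a b x found missing =>
      simp only [hl] at hs
      cases hv : μ.tab i t (μ.reg .bits a) (μ.reg .bits b) <;> simp only [hv] at hs ⊢ <;>
      exact add_le_add le_rfl (ih _ _ _ _ _ _ (hs _ (by rw [PMF.mem_support_pure_iff])))
    | call c x y next =>
      simp only [hl] at hs
      have hs' : ∀ w ∈ (h c (μ.read (O.args c) x) s).support,
          (⟨.inl (next, Mem.write (O.rets c) y w.1 μ), w.2, t + callCost c, countCall calls c⟩ :
            Snapshot P S σ) ∈ (P.run T k callCost S h v s₀ (m + 1)).support := fun w hw =>
        hs _ (by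
          rw [PMF.mem_support_map_iff]
          exact ⟨w, hw, rfl⟩)
      -- One possible answer is enough: the counters after the call do not depend on it.
      obtain ⟨w, hw⟩ := (h c (μ.read (O.args c) x) s).support_nonempty
      simp only [Handler.transformer, Handler.boundedTransformer, zero_add]
      rw [if_pos (hb _ _ (hs' w hw))]
      exact mean_mono_support fun w hw => ih _ _ _ _ _ _ (hs' w hw)
    | halt x => exact le_rfl

theorem Program.resultValue_start_le_bounded {fmt : (c : O.Call) → Args S (O.rets c) → Prop}
    {bound : (O.Call → ℕ) → Prop} {v : Args S inp} (hf : h.Respects fmt)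
    (hb : P.CallsBounded T k callCost S fmt v bound) (s : σ)
    (J : Args S out → σ → ℝ≥0∞) (n : ℕ) :
    P.resultValue S (h.transformer fun _ => 0) J n P.start (Program.startMem S v) s ≤
      P.resultValue S (h.boundedTransformer bound) (fun w s => J w s.1) n P.start
        (Program.startMem S v) (s, fun _ => 0) :=
  P.resultValue_le_bounded S T k callCost h (hb σ h hf s) J n _ _ _ 0 _ 0
    (by rw [Program.run, PMF.mem_support_pure_iff])

theorem Prim.one_le_cost (p : Prim) : 1 ≤ Prim.cost T k p := by
  cases p <;> first | exact le_rfl | exact T.exp₁_pos k | exact T.exp₂_pos k | exact T.exp₃_pos k |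
    exact T.pairing_pos k

/-- Each step takes at least one unit of time; this is where the positivity of the costs enters. -/
theorem Program.le_time_of_mem_support (hc : ∀ c, 1 ≤ callCost c) (v : Args S inp) (s : σ)
    (n : ℕ) : ∀ st ∈ (P.run T k callCost S h v s n).support, st.conf.isLeft → n ≤ st.time := by
  induction n with
  | zero => simp
  | succ n ih =>
    intro st hst hl
    rw [Program.run, PMF.mem_support_bind_iff] at hst
    obtain ⟨⟨conf, s', t, calls⟩, h₁, h₂⟩ := hst
    have h₁ := ih _ h₁
    rcases conf with ⟨l, μ⟩ | w
    · simp only [Sum.isLeft_inl, forall_const] at h₁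
      suffices t + 1 ≤ st.time by omega
      simp only [Program.step] at h₂
      cases hl : P.code l with
      | prim p x y next =>
        simp only [hl, PMF.mem_support_map_iff] at h₂
        obtain ⟨w, -, rfl⟩ := h₂
        exact Nat.add_le_add_left (Prim.one_le_cost T k p) t
      | call c x y next =>
        simp only [hl, PMF.mem_support_map_iff] at h₂
        obtain ⟨w, -, rfl⟩ := h₂
        exact Nat.add_le_add_left (hc c) t
      | load i t a b x found missing =>
        simp only [hl] at h₂
        cases hv : μ.tab i t (μ.reg .bits a) (μ.reg .bits b) <;>
          simp only [hv, PMF.mem_support_pure_iff] at h₂ <;> rw [h₂]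
      | _ => simp only [hl, PMF.mem_support_pure_iff] at h₂; rw [h₂]
    · simp only [Program.step, PMF.mem_support_pure_iff] at h₂
      rw [h₂] at hl
      simp at hl

/-- Markov's inequality: a run that is still going after `n` steps has taken time at least `n`, so
`n` times the probability of this event is at most the mean time. -/
theorem Program.iSup_resultValue_one (hc : ∀ c, 1 ≤ callCost c) (v : Args S inp) (s : σ)
    (ht : P.meanTime T k callCost S h v s < ⊤) :
    ⨆ n, P.resultValue S (h.transformer fun _ => 0) (fun _ _ => 1) n P.start
      (Program.startMem S v) s = 1 := by
  set E := P.meanTime T k callCost S h v s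
  have hval : ∀ n, P.resultValue S (h.transformer fun _ => 0) (fun _ _ => 1) n P.start
      (Program.startMem S v) s =
      mean (P.run T k callCost S h v s n) fun st => if st.conf.isLeft then 0 else 1 := by
    intro n
    have := mean_run_payoff P S T k callCost h (pc := fun _ => 0) (oc := 0) (cc := fun _ => 0)
      (g := fun _ _ => 0) (by simp) (by simp) (by simp) rfl (fun w s => 1) v s n 0
    simp only [zero_add, add_zero] at this
    rw [Program.resultValue, ← this]
    congr 1
    funext st
    simp only [Snapshot.payoff]
    cases st.conf <;> simp [Program.value]
  have hrun : ∀ n : ℕ, (n : ℝ≥0∞) * mean (P.run T k callCost S h v s n)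
      (fun st => if st.conf.isLeft then 1 else 0) ≤ E := by
    intro n
    rw [← mean_mul_left]
    refine (mean_mono_support fun st hst => ?_).trans
      (le_iSup (fun n => mean (P.run T k callCost S h v s n) fun st => (st.time : ℝ≥0∞)) n)
    split_ifs with hl
    · simpa using P.le_time_of_mem_support S T k callCost h hc v s n st hst hl
    · simp
  refine le_antisymm (iSup_le fun n => ?_) ?_
  · rw [hval]
    exact mean_le_const fun st => by split_ifs <;> simp
  · refine ENNReal.le_of_forall_pos_le_add fun ε hε _ => ?_
    obtain ⟨n, hn⟩ := ENNReal.exists_nat_mul_gt (a := (ε : ℝ≥0∞)) (b := E)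
      (by simpa using hε.ne') ht.ne
    have hn0 : (n : ℝ≥0∞) ≠ 0 := by
      rintro h0
      simp [h0] at hn
    have hle : mean (P.run T k callCost S h v s n) (fun st => if st.conf.isLeft then 1 else 0)
        ≤ ε := by
      by_contra hcon
      rw [not_le] at hcon
      have := (hrun n).trans_lt hn
      exact absurd ((ENNReal.mul_lt_mul_iff_right hn0 (ENNReal.natCast_ne_top n)).1 this)
        hcon.not_gt
    calc (1 : ℝ≥0∞) = mean (P.run T k callCost S h v s n) fun _ => 1 := (mean_const _ _).symm
      _ = mean (P.run T k callCost S h v s n) (fun st => if st.conf.isLeft then 0 else 1) +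
          mean (P.run T k callCost S h v s n) (fun st => if st.conf.isLeft then 1 else 0) := by
        rw [← mean_add]
        congr 1
        funext st
        split_ifs <;> simp
      _ ≤ _ := by
        rw [← hval]
        exact add_le_add (le_iSup (fun n => P.resultValue S (h.transformer fun _ => 0)
          (fun _ _ => 1) n P.start (Program.startMem S v) s) n) hle

/-- Comparison of two ways of answering calls with related states. -/
theorem Program.value_le_value {τ : Type} {pc : Prim → ℝ≥0∞} {oc : ℝ≥0∞} {H : CallTransformer O S σ}
    {H' : CallTransformer O S τ} {J : Args S out → σ → ℝ≥0∞} {J' : Args S out → τ → ℝ≥0∞}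
    (Rel : σ → τ → Prop)
    (hH : ∀ s t, Rel s t → ∀ c a Φ Φ', (∀ v s' t', Rel s' t' → Φ (v, s') ≤ Φ' (v, t')) →
      H c a s Φ ≤ H' c a t Φ')
    (hJ : ∀ s t, Rel s t → ∀ w, J w s ≤ J' w t) {s : σ} {t : τ} (hst : Rel s t) (n : ℕ) (l : P.L)
    (μ : Mem S P.R) :
    P.value S pc oc H J n l μ s ≤ P.value S pc oc H' J' n l μ t := by
  induction n generalizing l μ s t with
  | zero => exact le_rfl
  | succ n ih =>
    simp only [Program.value]
    cases hl : P.code l with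
    | prim p x y next => exact add_le_add le_rfl (mean_mono fun _ => ih hst _ _)
    | branch x l₁ l₀ => exact add_le_add le_rfl (ih hst _ _)
    | store i t a b x next => exact add_le_add le_rfl (ih hst _ _)
    | load i t a b x found missing =>
      cases hv : μ.tab i t (μ.reg .bits a) (μ.reg .bits b) <;> simp only [hv] <;>
        exact add_le_add le_rfl (ih hst _ _)
    | call c x y next => exact hH _ _ hst _ _ _ _ fun v s' t' h => ih h _ _
    | halt x => exact hJ _ _ hst _

/-- The amount `b` is paid at most once, when the run stops; `hH` says that calls do not enlarge an
additive error. -/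
theorem Program.value_add_le {pc : Prim → ℝ≥0∞} {oc : ℝ≥0∞} {H : CallTransformer O S σ} {b : ℝ≥0∞}
    (hH : ∀ c a s Φ Φ', (∀ v, Φ v ≤ Φ' v + b) → H c a s Φ ≤ H c a s Φ' + b)
    {J : Args S out → σ → ℝ≥0∞} (n : ℕ) (l : P.L) (μ : Mem S P.R) (s : σ) :
    P.value S pc oc H (fun w s => J w s + b) n l μ s ≤ P.value S pc oc H J n l μ s + b := by
  induction n generalizing l μ s with
  | zero => exact zero_le
  | succ n ih =>
    simp only [Program.value]
    cases hl : P.code l with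
    | prim p x y next =>
      dsimp only
      rw [add_assoc, ← mean_const (Prim.eval S p (μ.read p.args x)) b, ← mean_add, mean_const]
      exact add_le_add le_rfl (mean_mono fun _ => ih _ _ _)
    | branch x l₁ l₀ => exact (add_le_add le_rfl (ih _ _ _)).trans_eq (add_assoc _ _ _).symm
    | store i t a b x next => exact (add_le_add le_rfl (ih _ _ _)).trans_eq (add_assoc _ _ _).symm
    | load i t a b x found missing =>
      cases hv : μ.tab i t (μ.reg .bits a) (μ.reg .bits b) <;> simp only [hv] <;>
        exact (add_le_add le_rfl (ih _ _ _)).trans_eq (add_assoc _ _ _).symm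
    | call c x y next => exact hH _ _ _ _ _ fun v => ih _ _ _
    | halt x => exact le_rfl

theorem Program.value_mono {pc : Prim → ℝ≥0∞} {oc : ℝ≥0∞} {H : CallTransformer O S σ}
    (hH : ∀ c a s Φ Φ', (∀ v, Φ v ≤ Φ' v) → H c a s Φ ≤ H c a s Φ')
    {J : Args S out → σ → ℝ≥0∞} (l : P.L) (μ : Mem S P.R) (s : σ) :
    Monotone fun n => P.value S pc oc H J n l μ s := by
  refine monotone_nat_of_le_succ fun n => ?_
  induction n generalizing l μ s with
  | zero => exact zero_le
  | succ n ih =>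
    rw [Program.value, Program.value]
    cases hl : P.code l with
    | prim p x y next => exact add_le_add le_rfl (mean_mono fun _ => ih _ _ _)
    | branch x l₁ l₀ => exact add_le_add le_rfl (ih _ _ _)
    | store i t a b x next => exact add_le_add le_rfl (ih _ _ _)
    | load i t a b x found missing =>
      cases hv : μ.tab i t (μ.reg .bits a) (μ.reg .bits b) <;> simp only [hv] <;>
        exact add_le_add le_rfl (ih _ _ _)
    | call c x y next => exact hH _ _ _ _ _ fun v => ih _ _ _
    | halt x => exact le_rfl

theorem Program.resultValue_le_const {H : CallTransformer O S σ} {J : Args S out → σ → ℝ≥0∞}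
    {b : ℝ≥0∞} (hH : ∀ c a s Φ, (∀ v, Φ v ≤ b) → H c a s Φ ≤ b) (hJ : ∀ w s, J w s ≤ b)
    (n : ℕ) (l : P.L) (μ : Mem S P.R) (s : σ) : P.resultValue S H J n l μ s ≤ b := by
  induction n generalizing l μ s with
  | zero => exact zero_le
  | succ n ih =>
    simp only [Program.resultValue, Program.value, zero_add] at ih ⊢
    cases hl : P.code l with
    | prim p x y next => exact mean_le_const fun _ => ih _ _ _
    | branch x l₁ l₀ => exact ih _ _ _
    | store i t a b x next => exact ih _ _ _
    | load i t a b x found missing =>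
      cases hv : μ.tab i t (μ.reg .bits a) (μ.reg .bits b) <;> simp only [hv] <;> exact ih _ _ _
    | call c x y next => exact hH _ _ _ _ fun v => ih _ _ _
    | halt x => exact hJ _ _

/-- Comparison of two ways of answering calls: a state of the first one is related to an average of
states of the second one. -/
theorem Program.resultValue_le_average {τ : Type} {H : CallTransformer O S σ}
    {J : Args S out → σ → ℝ≥0∞} {H' : CallTransformer O S τ} {J' : Args S out → τ → ℝ≥0∞}
    (Rel : ℝ≥0∞ → σ → ((τ → ℝ≥0∞) → ℝ≥0∞) → ℝ≥0∞ → Prop)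
    (hK : ∀ α s K ε, Rel α s K ε → CommutesWithMean K)
    (hJ : ∀ α s K ε, Rel α s K ε → ∀ w, α * J w s ≤ K (J' w) + ε)
    (hH : ∀ α s K ε, Rel α s K ε → ∀ c a n l (μ : Args S (O.rets c) → Mem S P.R),
      (∀ α' s' K' ε', Rel α' s' K' ε' → ∀ v,
        α' * P.resultValue S H J n l (μ v) s' ≤ K' (P.resultValue S H' J' n l (μ v)) + ε') →
      α * H c a s (fun v => P.resultValue S H J n l (μ v.1) v.2) ≤
        K (fun t => H' c a t fun v => P.resultValue S H' J' n l (μ v.1) v.2) + ε)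
    {α : ℝ≥0∞} {s : σ} {K : (τ → ℝ≥0∞) → ℝ≥0∞} {ε : ℝ≥0∞} (hR : Rel α s K ε)
    (n : ℕ) (l : P.L) (μ : Mem S P.R) :
    α * P.resultValue S H J n l μ s ≤ K (P.resultValue S H' J' n l μ) + ε := by
  -- All four data of the relation vary: a call may use up a part of the factor `α` or of the error
  -- `ε`, and it may change the average `K`.
  induction n generalizing l μ α s K ε with
  | zero => simp [Program.value]
  | succ n ih =>
    unfold Program.resultValue at ih hH ⊢
    change _ ≤ K (fun t => P.value S (fun _ => 0) 0 H' J' (n + 1) l μ t) + ε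
    simp only [Program.value, zero_add]
    cases hl : P.code l with
    | prim p x y next =>
      dsimp only
      -- The coins of the program are independent of what `K` averages over, so the two means are
      -- exchanged.
      rw [hK _ _ _ _ hR, ← mean_mul_left, ← mean_const (Prim.eval S p (μ.read p.args x)) ε,
        ← mean_add]
      exact mean_mono fun v => ih hR _ _
    | branch x l₁ l₀ => exact ih hR _ _
    | store i t a b x next => exact ih hR _ _
    | load i t a b x found missing =>
      cases hv : μ.tab i t (μ.reg .bits a) (μ.reg .bits b) <;> simp only [hv] <;> exact ih hR _ _
    | call c x y next =>
      exact hH _ _ _ _ hR c _ n next (fun v => Mem.write (O.rets c) y v μ)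
        fun α' s' K' ε' h' v => ih h' _ _
    | halt x => exact hJ _ _ _ _ hR _

end Bounded

/-! ## Loop-free code -/

/-- Loop-free code in the form of a tree; at a leaf it stops or goes to a label in `L`. -/
inductive CodeTree (out : List Srt) (R L : Type) : Type
  | prim (p : Prim) (x : Regs R p.args) (y : Regs R p.rets) (t : CodeTree out R L)
  | branch (x : R) (t₁ t₀ : CodeTree out R L)
  | store (s : Srt) (t a b x : R) (next : CodeTree out R L)
  | load (s : Srt) (t a b x : R) (found missing : CodeTree out R L)
  | halt (x : Regs R out)
  | goto (l : L)

/-- Renaming of a tuple of registers. -/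
def Regs.map {R R' : Type} (f : R → R') : (l : List Srt) → Regs R l → Regs R' l
  | [], _ => ()
  | _ :: l, (x, xs) => (f x, Regs.map f l xs)

namespace CodeTree

variable {out : List Srt} {R R' L L' : Type}

def mapReg (f : R → R') : CodeTree out R L → CodeTree out R' L
  | prim p x y t => prim p (x.map f) (y.map f) (mapReg f t)
  | branch x t₁ t₀ => branch (f x) (mapReg f t₁) (mapReg f t₀)
  | store s t a b x next => store s (f t) (f a) (f b) (f x) (mapReg f next)
  | load s t a b x t₁ t₀ => load s (f t) (f a) (f b) (f x) (mapReg f t₁) (mapReg f t₀)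
  | halt x => halt (x.map f)
  | goto l => goto l

/-- A `halt` inside the code ends the whole computation, so the code for a call may stop the run
early. -/
def bind (g : L → CodeTree out R L') : CodeTree out R L → CodeTree out R L'
  | prim p x y t => prim p x y (bind g t)
  | branch x t₁ t₀ => branch x (bind g t₁) (bind g t₀)
  | store s t a b x next => store s t a b x (bind g next)
  | load s t a b x t₁ t₀ => load s t a b x (bind g t₁) (bind g t₀)
  | halt x => halt x
  | goto l => g l

/-- The mean of `φ` (at a `goto`) or `J` (at a `halt`) after the execution of a tree. -/
def wp (S : BilinearStructure) (φ : L → Mem S R → ℝ≥0∞) (J : Args S out → ℝ≥0∞) :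
    CodeTree out R L → Mem S R → ℝ≥0∞
  | prim p x y t, μ =>
      mean (p.eval S (μ.read p.args x)) fun v => wp S φ J t (Mem.write p.rets y v μ)
  | branch x t₁ t₀, μ => if (show Bool from μ.reg .bool x) = true then wp S φ J t₁ μ else wp S φ J t₀ μ
  | store s t a b x next, μ =>
      wp S φ J next (μ.setTab s t (μ.reg .bits a) (μ.reg .bits b) (μ.reg s x))
  | load s t a b x t₁ t₀, μ =>
      match μ.tab s t (μ.reg .bits a) (μ.reg .bits b) with
      | some v => wp S φ J t₁ (μ.set s x v)
      | none => wp S φ J t₀ μ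
  | halt x, μ => J (μ.read out x)
  | goto l, μ => φ l μ

/-- The maximal cost of the execution of a tree. -/
def cost (pc : Prim → ℝ≥0∞) (oc : ℝ≥0∞) : CodeTree out R L → ℝ≥0∞
  | prim p _ _ t => pc p + cost pc oc t
  | branch _ t₁ t₀ => oc + max (cost pc oc t₁) (cost pc oc t₀)
  | store _ _ _ _ _ next => oc + cost pc oc next
  | load _ _ _ _ _ t₁ t₀ => oc + max (cost pc oc t₁) (cost pc oc t₀)
  | halt _ => oc
  | goto _ => 0

def depth : CodeTree out R L → ℕ
  | prim _ _ _ t => depth t + 1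
  | branch _ t₁ t₀ => max (depth t₁) (depth t₀) + 1
  | store _ _ _ _ _ next => depth next + 1
  | load _ _ _ _ _ t₁ t₀ => max (depth t₁) (depth t₀) + 1
  | halt _ => 1
  | goto _ => 0

/-- The subtrees of a tree. -/
def subs : CodeTree out R L → Set (CodeTree out R L)
  | prim p x y t => insert (prim p x y t) (subs t)
  | branch x t₁ t₀ => insert (branch x t₁ t₀) (subs t₁ ∪ subs t₀)
  | store s t a b x next => insert (store s t a b x next) (subs next)
  | load s t a b x t₁ t₀ => insert (load s t a b x t₁ t₀) (subs t₁ ∪ subs t₀)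
  | halt x => {halt x}
  | goto l => {goto l}

theorem self_mem_subs (t : CodeTree out R L) : t ∈ t.subs := by
  cases t <;> simp [subs]

theorem finite_subs (t : CodeTree out R L) : t.subs.Finite := by
  induction t <;> simp_all [subs]

theorem wp_bind (S : BilinearStructure) (φ : L' → Mem S R → ℝ≥0∞) (J : Args S out → ℝ≥0∞)
    (g : L → CodeTree out R L') (t : CodeTree out R L) (μ : Mem S R) :
    wp S φ J (t.bind g) μ = wp S (fun l => wp S φ J (g l)) J t μ := by
  induction t generalizing μ with
  | load s t a b x t₁ t₀ h₁ h₀ =>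
    simp only [bind, wp]
    split <;> simp [h₁, h₀]
  | _ => simp_all [bind, wp]

theorem cost_bind_le {pc : Prim → ℝ≥0∞} {oc : ℝ≥0∞} {g : L → CodeTree out R L'} {b : ℝ≥0∞}
    (hg : ∀ l, (g l).cost pc oc ≤ b) (t : CodeTree out R L) :
    (t.bind g).cost pc oc ≤ t.cost pc oc + b := by
  induction t with
  | prim p x y t h => simpa only [bind, cost, add_assoc] using add_le_add le_rfl h
  | branch x t₁ t₀ h₁ h₀ =>
    simp only [bind, cost, add_assoc]
    refine add_le_add le_rfl (max_le (h₁.trans ?_) (h₀.trans ?_)) <;> gcongr <;> simp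
  | store s t a b x t h => simpa only [bind, cost, add_assoc] using add_le_add le_rfl h
  | load s t a b x t₁ t₀ h₁ h₀ =>
    simp only [bind, cost, add_assoc]
    refine add_le_add le_rfl (max_le (h₁.trans ?_) (h₀.trans ?_)) <;> gcongr <;> simp
  | halt x => simp [bind, cost]
  | goto l => simpa [bind, cost] using hg l

theorem cost_mapReg (pc : Prim → ℝ≥0∞) (oc : ℝ≥0∞) (f : R → R') (t : CodeTree out R L) :
    (t.mapReg f).cost pc oc = t.cost pc oc := by
  induction t <;> simp_all [mapReg, cost]

end CodeTree

/-! ## Memories with two sets of registers -/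

namespace Mem

variable {S : BilinearStructure} {R₁ R₂ : Type}

/-- The memory of a reduction: that of the adversary beside that of the code answering its calls.
The lemmas on `join` express that neither side touches the other. -/
def join (μ : Mem S R₁) (ν : Mem S R₂) : Mem S (R₁ ⊕ R₂) :=
  ⟨fun s => Sum.elim (μ.reg s) (ν.reg s), fun s => Sum.elim (μ.tab s) (ν.tab s)⟩

@[ext] theorem ext {μ ν : Mem S R₁} (h₁ : ∀ s x, μ.reg s x = ν.reg s x)
    (h₂ : ∀ s x, μ.tab s x = ν.tab s x) : μ = ν := by
  obtain ⟨r, t⟩ := μ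
  obtain ⟨r', t'⟩ := ν
  obtain rfl : r = r' := by funext s x; exact h₁ s x
  obtain rfl : t = t' := by funext s x; exact h₂ s x
  rfl

theorem set_reg_self (μ : Mem S R₁) (s : Srt) (x : R₁) (v : Val S s) : (μ.set s x v).reg s x = v := by
  simp [Mem.set]

theorem set_reg_of_srt_ne (μ : Mem S R₁) {s s' : Srt} (h : s' ≠ s) (x y : R₁) (v : Val S s) :
    (μ.set s x v).reg s' y = μ.reg s' y := by
  simp [Mem.set, h]

theorem set_reg_of_ne (μ : Mem S R₁) (s : Srt) {x y : R₁} (h : y ≠ x) (v : Val S s) (s' : Srt) :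
    (μ.set s x v).reg s' y = μ.reg s' y := by
  by_cases hs : s' = s
  · subst hs
    simp [Mem.set, h]
  · exact set_reg_of_srt_ne μ hs x y v

theorem set_tab (μ : Mem S R₁) (s : Srt) (x : R₁) (v : Val S s) : (μ.set s x v).tab = μ.tab := rfl

theorem setTab_reg (μ : Mem S R₁) (s : Srt) (t : R₁) (a b : List Bool) (v : Val S s) :
    (μ.setTab s t a b v).reg = μ.reg := rfl

open Classical in
theorem setTab_tab_self (μ : Mem S R₁) (s : Srt) (t : R₁) (a b : List Bool) (v : Val S s) :
    (μ.setTab s t a b v).tab s t =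
      Function.update (μ.tab s t) a (Function.update (μ.tab s t a) b (some v)) := by
  simp [Mem.setTab]

theorem setTab_tab_of_srt_ne (μ : Mem S R₁) {s s' : Srt} (h : s' ≠ s) (t t' : R₁) (a b : List Bool)
    (v : Val S s) : (μ.setTab s t a b v).tab s' t' = μ.tab s' t' := by
  simp [Mem.setTab, h]

theorem setTab_tab_of_ne (μ : Mem S R₁) {s : Srt} {t t' : R₁} (h : t' ≠ t) (a b : List Bool)
    (v : Val S s) (s' : Srt) : (μ.setTab s t a b v).tab s' t' = μ.tab s' t' := by
  by_cases hs : s' = s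
  · subst hs
    simp [Mem.setTab, h]
  · exact setTab_tab_of_srt_ne μ hs t t' a b v

theorem join_set_inl (μ : Mem S R₁) (ν : Mem S R₂) (s : Srt) (x : R₁) (v : Val S s) :
    (join μ ν).set s (.inl x) v = join (μ.set s x v) ν := by
  ext s' y
  · rcases y with y | y
    · by_cases hy : y = x
      · subst hy
        by_cases hs : s' = s
        · subst hs
          simp [set_reg_self, join]
        · simp [set_reg_of_srt_ne _ hs, join]
      · rw [set_reg_of_ne _ _ (by simpa using hy)]
        simp [join, set_reg_of_ne _ _ hy]
    · rw [set_reg_of_ne _ _ (by simp)]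
      rfl
  · rfl

theorem join_set_inr (μ : Mem S R₁) (ν : Mem S R₂) (s : Srt) (x : R₂) (v : Val S s) :
    (join μ ν).set s (.inr x) v = join μ (ν.set s x v) := by
  ext s' y
  · rcases y with y | y
    · rw [set_reg_of_ne _ _ (by simp)]
      rfl
    · by_cases hy : y = x
      · subst hy
        by_cases hs : s' = s
        · subst hs
          simp [set_reg_self, join]
        · simp [set_reg_of_srt_ne _ hs, join]
      · rw [set_reg_of_ne _ _ (by simpa using hy)]
        simp [join, set_reg_of_ne _ _ hy]
  · rfl

theorem join_setTab_inl (μ : Mem S R₁) (ν : Mem S R₂) (s : Srt) (t : R₁) (a b : List Bool)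
    (v : Val S s) : (join μ ν).setTab s (.inl t) a b v = join (μ.setTab s t a b v) ν := by
  ext1 s' y
  · rfl
  · rcases y with y | y
    · by_cases hy : y = t
      · subst hy
        by_cases hs : s' = s
        · subst hs
          simp [setTab_tab_self, join]
        · simp [setTab_tab_of_srt_ne _ hs, join]
      · rw [setTab_tab_of_ne _ (by simpa using hy)]
        simp [join, setTab_tab_of_ne _ hy]
    · rw [setTab_tab_of_ne _ (by simp)]
      rfl

theorem join_setTab_inr (μ : Mem S R₁) (ν : Mem S R₂) (s : Srt) (t : R₂) (a b : List Bool)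
    (v : Val S s) : (join μ ν).setTab s (.inr t) a b v = join μ (ν.setTab s t a b v) := by
  ext1 s' y
  · rfl
  · rcases y with y | y
    · rw [setTab_tab_of_ne _ (by simp)]
      rfl
    · by_cases hy : y = t
      · subst hy
        by_cases hs : s' = s
        · subst hs
          simp [setTab_tab_self, join]
        · simp [setTab_tab_of_srt_ne _ hs, join]
      · rw [setTab_tab_of_ne _ (by simpa using hy)]
        simp [join, setTab_tab_of_ne _ hy]

theorem join_read_inl (μ : Mem S R₁) (ν : Mem S R₂) (l : List Srt) (x : Regs R₁ l) :
    (join μ ν).read l (x.map .inl) = μ.read l x := by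
  induction l with
  | nil => rfl
  | cons s l ih => exact Prod.ext rfl (ih _)

theorem join_read_inr (μ : Mem S R₁) (ν : Mem S R₂) (l : List Srt) (x : Regs R₂ l) :
    (join μ ν).read l (x.map .inr) = ν.read l x := by
  induction l with
  | nil => rfl
  | cons s l ih => exact Prod.ext rfl (ih _)

theorem join_write_inl (μ : Mem S R₁) (ν : Mem S R₂) (l : List Srt) (x : Regs R₁ l)
    (v : Args S l) :
    Mem.write l (x.map .inl) v (join μ ν) = join (Mem.write l x v μ) ν := by
  induction l generalizing μ with
  | nil => rfl
  | cons s l ih =>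
    obtain ⟨x, xs⟩ := x
    obtain ⟨v, vs⟩ := v
    exact (congrArg (Mem.write l (xs.map .inl) vs) (join_set_inl μ ν s x v)).trans (ih _ _ _)

theorem join_write_inr (μ : Mem S R₁) (ν : Mem S R₂) (l : List Srt) (x : Regs R₂ l)
    (v : Args S l) :
    Mem.write l (x.map .inr) v (join μ ν) = join μ (Mem.write l x v ν) := by
  induction l generalizing ν with
  | nil => rfl
  | cons s l ih =>
    obtain ⟨x, xs⟩ := x
    obtain ⟨v, vs⟩ := v
    exact (congrArg (Mem.write l (xs.map .inr) vs) (join_set_inr μ ν s x v)).trans (ih _ _ _)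

theorem join_init : join (Mem.init S R₁) (Mem.init S R₂) = Mem.init S (R₁ ⊕ R₂) := by
  ext1 s x <;> cases x <;> rfl

end Mem

namespace CodeTree

variable {out : List Srt} {R R' L L' : Type}

/-- Code that has its own registers sees the memory of the other program only as a parameter. -/
theorem wp_mapReg_inr {S : BilinearStructure} (φ : L → Mem S (R ⊕ R') → ℝ≥0∞)
    (J : Args S out → ℝ≥0∞) (t : CodeTree out R' L) (μ : Mem S R) (ν : Mem S R') :
    wp S φ J (t.mapReg .inr) (μ.join ν) = wp S (fun l ν => φ l (μ.join ν)) J t ν := by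
  induction t generalizing ν with
  | prim p x y t h => simp only [mapReg, wp, Mem.join_read_inr, Mem.join_write_inr, h]
  | branch x t₁ t₀ h₁ h₀ => simp only [mapReg, wp, h₁, h₀]; rfl
  | store s t a b x u h =>
    exact (congrArg (wp S φ J (u.mapReg .inr)) (Mem.join_setTab_inr μ ν s t _ _ _)).trans (h _)
  | load s t a b x t₁ t₀ h₁ h₀ =>
    simp only [mapReg, wp, Mem.join_set_inr, h₁, h₀]
    rfl
  | halt x => simp only [mapReg, wp, Mem.join_read_inr]
  | goto l => rfl

/-- Copying registers one after the other. -/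
def copies : (l : List Srt) → Regs R l → Regs R l → CodeTree out R L → CodeTree out R L
  | [], _, _, t => t
  | s :: l, (x, xs), (y, ys), t => prim (.copy s) (x, ()) (y, ()) (copies l xs ys t)

theorem wp_copies_inl {S : BilinearStructure} (φ : L → Mem S (R ⊕ R') → ℝ≥0∞)
    (J : Args S out → ℝ≥0∞) (l : List Srt) (x : Regs R l) (y : Regs R' l)
    (t : CodeTree out (R ⊕ R') L) (μ : Mem S R) (ν : Mem S R') :
    wp S φ J (copies l (x.map .inl) (y.map .inr) t) (μ.join ν) =
      wp S φ J t (μ.join (Mem.write l y (μ.read l x) ν)) := by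
  induction l generalizing ν with
  | nil => rfl
  | cons s l ih =>
    obtain ⟨x, xs⟩ := x
    obtain ⟨y, ys⟩ := y
    exact (mean_pure (α := Args S [s]) _ _).trans
      ((congrArg (wp S φ J _) (Mem.join_set_inr μ ν s y _)).trans (ih _ _ _))

theorem wp_copies_inr {S : BilinearStructure} (φ : L → Mem S (R ⊕ R') → ℝ≥0∞)
    (J : Args S out → ℝ≥0∞) (l : List Srt) (x : Regs R' l) (y : Regs R l)
    (t : CodeTree out (R ⊕ R') L) (μ : Mem S R) (ν : Mem S R') :
    wp S φ J (copies l (x.map .inr) (y.map .inl) t) (μ.join ν) =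
      wp S φ J t ((Mem.write l y (ν.read l x) μ).join ν) := by
  induction l generalizing μ with
  | nil => rfl
  | cons s l ih =>
    obtain ⟨x, xs⟩ := x
    obtain ⟨y, ys⟩ := y
    exact (mean_pure (α := Args S [s]) _ _).trans
      ((congrArg (wp S φ J _) (Mem.join_set_inl μ ν s y _)).trans (ih _ _ _))

theorem cost_copies (pc : Prim → ℝ≥0∞) (oc : ℝ≥0∞) {b : ℝ≥0∞} (hb : ∀ s, pc (.copy s) = b)
    (l : List Srt) (x y : Regs R l) (t : CodeTree out R L) :
    (copies l x y t).cost pc oc = l.length * b + t.cost pc oc := by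
  induction l with
  | nil => simp [copies]
  | cons s l ih =>
    obtain ⟨x, xs⟩ := x
    obtain ⟨y, ys⟩ := y
    simp only [copies, cost, ih, hb, List.length_cons, Nat.cast_add, Nat.cast_one]
    ring

end CodeTree

/-! ## Programs that answer the oracle calls of another program -/

namespace CodeTree

variable {out : List Srt} {R L : Type}

def children : CodeTree out R L → Set (CodeTree out R L)
  | prim _ _ _ t => {t}
  | branch _ t₁ t₀ => {t₁, t₀}
  | store _ _ _ _ _ t => {t}
  | load _ _ _ _ _ t₁ t₀ => {t₁, t₀}
  | halt _ => ∅
  | goto _ => ∅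

/-- Labels of compiled programs are subtrees, and this closure property keeps the execution inside a
finite set of labels. -/
theorem mem_subs_of_mem_children {u t c : CodeTree out R L} (ht : t ∈ u.subs)
    (hc : c ∈ t.children) : c ∈ u.subs := by
  induction u with
  | prim p x y u h =>
    rcases ht with rfl | ht
    · rw [children, Set.mem_singleton_iff] at hc
      exact Or.inr (hc ▸ self_mem_subs _)
    · exact Or.inr (h ht)
  | store s a b d x u h =>
    rcases ht with rfl | ht
    · rw [children, Set.mem_singleton_iff] at hc
      exact Or.inr (hc ▸ self_mem_subs _)
    · exact Or.inr (h ht)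
  | branch x u₁ u₀ h₁ h₀ =>
    rcases ht with rfl | ht | ht
    · rcases hc with rfl | rfl
      · exact Or.inr (Or.inl (self_mem_subs _))
      · exact Or.inr (Or.inr (self_mem_subs _))
    · exact Or.inr (Or.inl (h₁ ht))
    · exact Or.inr (Or.inr (h₀ ht))
  | load s a b d x u₁ u₀ h₁ h₀ =>
    rcases ht with rfl | ht | ht
    · rcases hc with rfl | rfl
      · exact Or.inr (Or.inl (self_mem_subs _))
      · exact Or.inr (Or.inr (self_mem_subs _))
    · exact Or.inr (Or.inl (h₁ ht))
    · exact Or.inr (Or.inr (h₀ ht))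
  | halt x =>
    rw [subs, Set.mem_singleton_iff] at ht
    simp [ht, children] at hc
  | goto l =>
    rw [subs, Set.mem_singleton_iff] at ht
    simp [ht, children] at hc

/-- The tree at the label `l` if `t` is `goto l`. -/
def resolve (code : L → CodeTree out R L) : CodeTree out R L → CodeTree out R L
  | goto l => code l
  | t => t

/-- The mean payoff of at most `n` steps of the machine with the loop-free code `code l` at the
label `l`. -/
def value (S : BilinearStructure) (code : L → CodeTree out R L) (pc : Prim → ℝ≥0∞) (oc : ℝ≥0∞)
    (J : Args S out → ℝ≥0∞) : ℕ → CodeTree out R L → Mem S R → ℝ≥0∞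
  | 0, _, _ => 0
  | n + 1, prim p x y t, μ =>
      pc p + mean (p.eval S (μ.read p.args x)) fun v =>
        value S code pc oc J n (t.resolve code) (Mem.write p.rets y v μ)
  | n + 1, branch x t₁ t₀, μ =>
      oc + value S code pc oc J n
        (if (show Bool from μ.reg .bool x) = true then t₁.resolve code else t₀.resolve code) μ
  | n + 1, store s t a b x next, μ =>
      oc + value S code pc oc J n (next.resolve code)
        (μ.setTab s t (μ.reg .bits a) (μ.reg .bits b) (μ.reg s x))
  | n + 1, load s t a b x t₁ t₀, μ =>
      oc + match μ.tab s t (μ.reg .bits a) (μ.reg .bits b) with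
        | some v => value S code pc oc J n (t₁.resolve code) (μ.set s x v)
        | none => value S code pc oc J n (t₀.resolve code) μ
  | _ + 1, halt x, μ => oc + J (μ.read out x)
  | n + 1, goto l, μ => value S code pc oc J n (code l) μ

variable {S : BilinearStructure} {code : L → CodeTree out R L} {pc : Prim → ℝ≥0∞} {oc : ℝ≥0∞}
  {J : Args S out → ℝ≥0∞}

theorem value_le_succ (n : ℕ) (t : CodeTree out R L) (μ : Mem S R) :
    value S code pc oc J n t μ ≤ value S code pc oc J (n + 1) t μ := by
  induction n generalizing t μ with
  | zero => exact zero_le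
  | succ n ih =>
    cases t with
    | prim p x y t => exact add_le_add le_rfl (mean_mono fun v => ih _ _)
    | branch x t₁ t₀ => exact add_le_add le_rfl (ih _ _)
    | store s t a b x next => exact add_le_add le_rfl (ih _ _)
    | load s t a b x t₁ t₀ =>
      rw [value, value]
      cases hv : μ.tab s t (μ.reg .bits a) (μ.reg .bits b) <;> simp only [hv] <;>
        exact add_le_add le_rfl (ih _ _)
    | halt x => exact le_rfl
    | goto l => exact ih _ _

theorem value_mono (t : CodeTree out R L) (μ : Mem S R) :
    Monotone fun n => value S code pc oc J n t μ :=
  monotone_nat_of_le_succ fun n => value_le_succ n t μ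

/-- The first instruction uses up one unit of the budget, so whatever is reached through a `goto`
runs with budget at most `n`. This allows one step of the adversary to be matched with a whole tree.
-/
theorem value_succ_le_wp_of {n : ℕ} {t : CodeTree out R L}
    (hc : ∀ c ∈ t.children, ∀ μ, value S code pc oc J n (c.resolve code) μ ≤
      c.cost pc oc + wp S (fun l => value S code pc oc J n (code l)) J c μ)
    (ht : ∀ l, t ≠ goto l) (μ : Mem S R) :
    value S code pc oc J (n + 1) t μ ≤
      t.cost pc oc + wp S (fun l => value S code pc oc J n (code l)) J t μ := by
  cases t with
  | prim p x y t =>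
    rw [value, cost, wp, add_assoc, ← mean_const (p.eval S (μ.read p.args x)) (t.cost pc oc),
      ← mean_add]
    exact add_le_add le_rfl (mean_mono fun v => hc t rfl _)
  | branch x t₁ t₀ =>
    rw [value, cost, wp, add_assoc]
    refine add_le_add le_rfl ?_
    split_ifs
    · exact (hc t₁ (Or.inl rfl) _).trans (add_le_add (le_max_left _ _) le_rfl)
    · exact (hc t₀ (Or.inr rfl) _).trans (add_le_add (le_max_right _ _) le_rfl)
  | store s t a b x next =>
    rw [value, cost, wp, add_assoc]
    exact add_le_add le_rfl (hc next rfl _)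
  | load s t a b x t₁ t₀ =>
    rw [value, cost, wp, add_assoc]
    refine add_le_add le_rfl ?_
    cases hv : μ.tab s t (μ.reg .bits a) (μ.reg .bits b) <;> simp only [hv]
    · exact (hc t₀ (Or.inr rfl) _).trans (add_le_add (le_max_right _ _) le_rfl)
    · exact (hc t₁ (Or.inl rfl) _).trans (add_le_add (le_max_left _ _) le_rfl)
  | halt x => exact le_rfl
  | goto l => exact absurd rfl (ht l)

theorem value_resolve_le_wp (n : ℕ) (t : CodeTree out R L) (μ : Mem S R) :
    value S code pc oc J n (t.resolve code) μ ≤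
      t.cost pc oc + wp S (fun l => value S code pc oc J n (code l)) J t μ := by
  have key : ∀ t : CodeTree out R L, (∀ c ∈ t.children, ∀ μ,
      value S code pc oc J n (c.resolve code) μ ≤
        c.cost pc oc + wp S (fun l => value S code pc oc J n (code l)) J c μ) →
      ∀ μ, value S code pc oc J n (t.resolve code) μ ≤
        t.cost pc oc + wp S (fun l => value S code pc oc J n (code l)) J t μ := by
    intro t hc μ
    by_cases ht : ∀ l, t ≠ goto l
    · have hr : t.resolve code = t := by
        cases t with
        | goto l => exact absurd rfl (ht l)
        | _ => rfl
      rw [hr]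
      exact (value_le_succ n t μ).trans (value_succ_le_wp_of hc ht μ)
    · push Not at ht
      obtain ⟨l, rfl⟩ := ht
      simp [resolve, cost, wp]
  induction t generalizing μ with
  | prim p x y t h => exact key _ (by rintro c rfl; exact fun μ => h μ) μ
  | store s a b d x t h => exact key _ (by rintro c rfl; exact fun μ => h μ) μ
  | branch x t₁ t₀ h₁ h₀ =>
    exact key _ (by rintro c (rfl | rfl) <;> [exact fun μ => h₁ μ; exact fun μ => h₀ μ]) μ
  | load s a b d x t₁ t₀ h₁ h₀ =>
    exact key _ (by rintro c (rfl | rfl) <;> [exact fun μ => h₁ μ; exact fun μ => h₀ μ]) μ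
  | halt x => exact key _ (by simp [children]) μ
  | goto l => exact key _ (by simp [children]) μ

theorem value_succ_le_wp (n : ℕ) (t : CodeTree out R L) (ht : ∀ l, t ≠ goto l) (μ : Mem S R) :
    value S code pc oc J (n + 1) t μ ≤
      t.cost pc oc + wp S (fun l => value S code pc oc J n (code l)) J t μ :=
  value_succ_le_wp_of (fun c _ => value_resolve_le_wp n c) ht μ

/-- A tree has no loops: if the budget exceeds `n` by its depth, then at least `n` is left at every
`goto`. -/
theorem wp_le_value (n : ℕ) (t : CodeTree out R L) (μ : Mem S R) :
    wp S (fun l => value S code pc oc J n (code l)) J t μ ≤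
      value S code pc oc J (n + t.depth) (t.resolve code) μ := by
  induction t generalizing μ with
  | prim p x y t h => exact le_add_left (mean_mono fun v => h _)
  | branch x t₁ t₀ h₁ h₀ =>
    rw [wp, depth, ← add_assoc, resolve, value]
    · refine le_add_left ?_
      split_ifs
      · exact (h₁ _).trans (value_mono _ _ (by simp))
      · exact (h₀ _).trans (value_mono _ _ (by simp))
    · simp
  | store s t a b x next h => exact le_add_left (h _)
  | load s t a b x t₁ t₀ h₁ h₀ =>
    rw [wp, depth, ← add_assoc, resolve, value]
    · refine le_add_left ?_
      cases hv : μ.tab s t (μ.reg .bits a) (μ.reg .bits b) <;> simp only [hv]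
      · exact (h₀ _).trans (value_mono _ _ (by simp))
      · exact (h₁ _).trans (value_mono _ _ (by simp))
    · simp
  | halt x => exact le_add_left le_rfl
  | goto l => exact le_rfl

end CodeTree

/-- Code for running a program with the interface `O` and answering its calls. The code has its own
registers. -/
structure Wrapper (O : Sig) (inp out inp' out' : List Srt) where
  R : Type
  [finite : Finite R]
  dummy : R
  input : Regs R inp'
  init : CodeTree out' R Unit
  initOut : Regs R inp
  arg : (c : O.Call) → Regs R (O.args c)
  ret : (c : O.Call) → Regs R (O.rets c)
  body : O.Call → CodeTree out' R Unit
  finIn : Regs R out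
  fin : CodeTree out' R Empty

namespace Wrapper

open CodeTree

variable {O : Sig} {inp out inp' out' : List Srt} (W : Wrapper O inp out inp' out')
  (A : Program O inp out)

/-- The code for a call. -/
def callTree (c : O.Call) (x : Regs A.R (O.args c)) (y : Regs A.R (O.rets c)) (next : A.L) :
    CodeTree out' (A.R ⊕ W.R) A.L :=
  copies (O.args c) (x.map .inl) ((W.arg c).map .inr)
    (((W.body c).mapReg .inr).bind fun _ =>
      copies (O.rets c) ((W.ret c).map .inr) (y.map .inl) (goto next))

/-- The code for the result. -/
def finTree (x : Regs A.R out) : CodeTree out' (A.R ⊕ W.R) A.L :=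
  copies out (x.map .inl) (W.finIn.map .inr) ((W.fin.mapReg .inr).bind fun e => e.elim)

/-- The code for an instruction. -/
def compile (l : A.L) : CodeTree out' (A.R ⊕ W.R) A.L :=
  match A.code l with
  | .prim p x y next => prim p (x.map .inl) (y.map .inl) (goto next)
  | .branch x l₁ l₀ => branch (.inl x) (goto l₁) (goto l₀)
  | .store s t a b x next => store s (.inl t) (.inl a) (.inl b) (.inl x) (goto next)
  | .load s t a b x l₁ l₀ => load s (.inl t) (.inl a) (.inl b) (.inl x) (goto l₁) (goto l₀)
  -- The test of a dummy register, with the same code on both sides, guarantees that the tree is not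
  -- a bare `goto`, whatever the body is. So every instruction of the adversary takes at least one
  -- step of the compiled program.
  | .call c x y next => branch (.inr W.dummy) (W.callTree A c x y next) (W.callTree A c x y next)
  | .halt x => branch (.inr W.dummy) (W.finTree A x) (W.finTree A x)

def initTree : CodeTree out' (A.R ⊕ W.R) A.L :=
  (W.init.mapReg .inr).bind fun _ => copies inp (W.initOut.map .inr) (A.input.map .inl) (goto A.start)

/-- The code that is executed first. -/
def startTree : CodeTree out' (A.R ⊕ W.R) A.L :=
  branch (.inr W.dummy) (W.initTree A) (W.initTree A)

/-- A finite set, because there are finitely many labels of the adversary and each tree has finitely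
many subtrees. The compiled program therefore has a finite control. -/
def labels : Set (CodeTree out' (A.R ⊕ W.R) A.L) :=
  (⋃ l, (W.compile A l).subs) ∪ (W.startTree A).subs

theorem finite_labels : (W.labels A).Finite := by
  have := A.finL
  exact (Set.finite_iUnion fun l => finite_subs _).union (finite_subs _)

theorem compile_ne_goto (l l' : A.L) : W.compile A l ≠ goto l' := by
  unfold compile
  cases A.code l <;> simp

/-- The labels of the program are trees. -/
def label (t : CodeTree out' (A.R ⊕ W.R) A.L) : W.labels A :=
  open Classical in
  if h : t ∈ W.labels A then ⟨t, h⟩ else ⟨W.startTree A, Or.inr (self_mem_subs _)⟩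

/-- The first instruction of a tree. -/
def instr : CodeTree out' (A.R ⊕ W.R) A.L → Instr noOracle out' (A.R ⊕ W.R) (W.labels A)
  | prim p x y t => .prim p x y (W.label A (t.resolve (W.compile A)))
  | branch x t₁ t₀ =>
      .branch x (W.label A (t₁.resolve (W.compile A))) (W.label A (t₀.resolve (W.compile A)))
  | store s t a b x next => .store s t a b x (W.label A (next.resolve (W.compile A)))
  | load s t a b x t₁ t₀ =>
      .load s t a b x (W.label A (t₁.resolve (W.compile A))) (W.label A (t₀.resolve (W.compile A)))
  | halt x => .halt x
  -- A filler that is never executed: a `goto` is resolved before the tree is used as a label.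
  | goto _ => .branch (.inr W.dummy) (W.label A (W.startTree A)) (W.label A (W.startTree A))

/-- The program that runs `A` and answers its calls by the code in `W`. -/
def program : Program noOracle inp' out' where
  R := A.R ⊕ W.R
  L := W.labels A
  finR := by
    have := A.finR
    have := W.finite
    infer_instance
  finL := (W.finite_labels A).to_subtype
  input := W.input.map .inr
  start := W.label A (W.startTree A)
  code t := W.instr A t

theorem label_val {t : CodeTree out' (A.R ⊕ W.R) A.L} (h : t ∈ W.labels A) :
    (W.label A t : CodeTree out' (A.R ⊕ W.R) A.L) = t := by
  simp [label, h]

theorem resolve_mem_labels {t c : CodeTree out' (A.R ⊕ W.R) A.L} (ht : t ∈ W.labels A)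
    (hc : c ∈ t.children) : c.resolve (W.compile A) ∈ W.labels A := by
  have hcl : ∀ l, W.compile A l ∈ W.labels A := fun l =>
    Or.inl (Set.mem_iUnion.2 ⟨l, self_mem_subs _⟩)
  have hmem : c ∈ W.labels A := by
    rcases ht with ht | ht
    · obtain ⟨l, hl⟩ := Set.mem_iUnion.1 ht
      exact Or.inl (Set.mem_iUnion.2 ⟨l, mem_subs_of_mem_children hl hc⟩)
    · exact Or.inr (mem_subs_of_mem_children ht hc)
  cases c with
  | goto l => exact hcl l
  | _ => exact hmem

variable (S : BilinearStructure)

/-- The compiled program makes the same steps as the machine on trees, since `resolve` is applied to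
every successor in both. -/
theorem program_value {pc : Prim → ℝ≥0∞} {oc : ℝ≥0∞} {H : CallTransformer noOracle S Unit}
    {J : Args S out' → ℝ≥0∞} (n : ℕ) (t : CodeTree out' (A.R ⊕ W.R) A.L) (ht : t ∈ W.labels A)
    (hg : ∀ l, t ≠ goto l) (μ : Mem S (A.R ⊕ W.R)) :
    (W.program A).value S pc oc H (fun w _ => oc + J w) n (W.label A t) μ () =
      t.value S (W.compile A) pc oc J n μ := by
  have hne : ∀ c : CodeTree out' (A.R ⊕ W.R) A.L, ∀ l, c.resolve (W.compile A) ≠ goto l := by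
    intro c l
    cases c with
    | goto l' => exact W.compile_ne_goto A l' l
    | _ => simp [resolve]
  induction n generalizing t μ with
  | zero => rfl
  | succ n ih =>
    have hcode : (W.program A).code (W.label A t) = W.instr A t := by
      simp only [program, W.label_val A ht]
    have hch := fun c hc => ih (c.resolve (W.compile A)) (W.resolve_mem_labels A (c := c) ht hc)
      (hne c)
    cases t with
    | prim p x y t =>
      refine (Program.value_of_prim hcode).trans (congrArg (pc p + ·) ?_)
      exact congrArg (mean _) (funext fun v => hch t rfl _)
    | branch x t₁ t₀ =>
      refine (Program.value_of_branch hcode).trans ?_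
      rw [CodeTree.value]
      refine congrArg (oc + ·) ?_
      by_cases h : (show Bool from μ.reg .bool x) = true
      · exact ((congrArg (fun l => (W.program A).value S pc oc H (fun w _ => oc + J w) n l μ ())
          (if_pos h)).trans (hch t₁ (Or.inl rfl) μ)).trans
          (congrArg (fun t => CodeTree.value S (W.compile A) pc oc J n t μ) (if_pos h).symm)
      · exact ((congrArg (fun l => (W.program A).value S pc oc H (fun w _ => oc + J w) n l μ ())
          (if_neg h)).trans (hch t₀ (Or.inr rfl) μ)).trans
          (congrArg (fun t => CodeTree.value S (W.compile A) pc oc J n t μ) (if_neg h).symm)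
    | store s t a b x next =>
      exact (Program.value_of_store hcode).trans (congrArg (oc + ·) (hch next rfl _))
    | load s t a b x t₁ t₀ =>
      refine (Program.value_of_load hcode).trans ?_
      rw [CodeTree.value]
      refine congrArg (oc + ·) ?_
      cases hv : μ.tab s t (μ.reg .bits a) (μ.reg .bits b) <;> simp only
      · exact hch t₀ (Or.inr rfl) _
      · exact hch t₁ (Or.inl rfl) _
    | halt x => exact Program.value_of_halt hcode
    | goto l => exact absurd rfl (hg l)

/-- What it means that the code of a wrapper implements answers `hx` to the calls (or stopping with
a result of kind `b : Bool`), a distribution `ix` of inputs and initial states, and an evaluation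
`fx` of the result: the states are represented by memories according to `Rel`, and results of the
kind `b` by results of the code according to `Res`. -/
structure Implements {S : BilinearStructure} {σ : Type} (v : Args S inp') (Rel : Mem S W.R → σ → Prop)
    (Res : Args S out' → Bool → Prop) (ix : PMF (Args S inp × σ))
    (hx : (c : O.Call) → Args S (O.args c) → σ → PMF ((Args S (O.rets c) × σ) ⊕ Bool))
    (fx : Args S out → σ → PMF Bool) : Prop where
  -- The relation is left open so that one proof gives both inequalities: the code acts on payoffs
  -- only by means and by evaluation of `Ψ` and `J`.
  init : ∀ {r}, MeanClosed r → ∀ {Ψ : Mem S W.R → ℝ≥0∞} {Φ : Args S inp × σ → ℝ≥0∞}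
    (J : Args S out' → ℝ≥0∞),
    (∀ ν s, Rel ν s → r (Ψ ν) (Φ (ν.read inp W.initOut, s))) →
    r (wp S (fun _ => Ψ) J W.init (Mem.write inp' W.input v (Mem.init S W.R))) (mean ix Φ)
  call : ∀ {r}, MeanClosed r → ∀ {c : O.Call} {Ψ : Mem S W.R → ℝ≥0∞}
    {Φ : Args S (O.rets c) × σ → ℝ≥0∞} {J : Args S out' → ℝ≥0∞} {pay : Bool → ℝ≥0∞},
    (∀ ν s, Rel ν s → r (Ψ ν) (Φ (ν.read (O.rets c) (W.ret c), s))) →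
    (∀ w b, Res w b → r (J w) (pay b)) → ∀ (a : Args S (O.args c)) (ν : Mem S W.R) (s : σ),
    Rel ν s → r (wp S (fun _ => Ψ) J (W.body c) (Mem.write (O.args c) (W.arg c) a ν))
      (mean (hx c a s) (Sum.elim Φ pay))
  fin : ∀ {r}, MeanClosed r → ∀ {J : Args S out' → ℝ≥0∞} {pay : Bool → ℝ≥0∞},
    (∀ w b, Res w b → r (J w) (pay b)) → ∀ (w : Args S out) (ν : Mem S W.R) (s : σ), Rel ν s →
    r (wp S (fun e => e.elim) J W.fin (Mem.write out W.finIn w ν)) (mean (fx w s) pay)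

variable {S} {σ : Type} {v : Args S inp'} {Rel : Mem S W.R → σ → Prop}
  {Res : Args S out' → Bool → Prop} {ix : PMF (Args S inp × σ)}
  {hx : (c : O.Call) → Args S (O.args c) → σ → PMF ((Args S (O.rets c) × σ) ⊕ Bool)}
  {fx : Args S out → σ → PMF Bool}

/-- The transformer of answers that may stop the run. -/
def exitTransformer (hx : (c : O.Call) → Args S (O.args c) → σ → PMF ((Args S (O.rets c) × σ) ⊕ Bool))
    (pay : Bool → ℝ≥0∞) (cc : O.Call → ℝ≥0∞) : CallTransformer O S σ :=
  fun c a s Φ => cc c + mean (hx c a s) (Sum.elim Φ pay)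

theorem wp_callTree (φ : A.L → Mem S (A.R ⊕ W.R) → ℝ≥0∞) (J : Args S out' → ℝ≥0∞) (c : O.Call)
    (x : Regs A.R (O.args c)) (y : Regs A.R (O.rets c)) (next : A.L) (μ : Mem S A.R)
    (ν : Mem S W.R) :
    wp S φ J (W.callTree A c x y next) (μ.join ν) =
      wp S (fun _ ν => φ next ((Mem.write (O.rets c) y (ν.read (O.rets c) (W.ret c)) μ).join ν)) J
        (W.body c) (Mem.write (O.args c) (W.arg c) (μ.read (O.args c) x) ν) := by
  rw [callTree, wp_copies_inl, wp_bind, wp_mapReg_inr]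
  simp only [wp_copies_inr]
  rfl

theorem wp_finTree (φ : A.L → Mem S (A.R ⊕ W.R) → ℝ≥0∞) (J : Args S out' → ℝ≥0∞)
    (x : Regs A.R out) (μ : Mem S A.R) (ν : Mem S W.R) :
    wp S φ J (W.finTree A x) (μ.join ν) =
      wp S (fun e => e.elim) J W.fin (Mem.write out W.finIn (μ.read out x) ν) := by
  rw [finTree, wp_copies_inl, wp_bind, wp_mapReg_inr]
  congr 1
  funext e
  exact e.elim

theorem wp_initTree (φ : A.L → Mem S (A.R ⊕ W.R) → ℝ≥0∞) (J : Args S out' → ℝ≥0∞) (μ : Mem S A.R)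
    (ν : Mem S W.R) :
    wp S φ J (W.initTree A) (μ.join ν) =
      wp S (fun _ ν => φ A.start ((Mem.write inp A.input (ν.read inp W.initOut) μ).join ν)) J
        W.init ν := by
  rw [initTree, wp_bind, wp_mapReg_inr]
  simp only [wp_copies_inr]
  rfl

theorem cost_callTree_le {pc : Prim → ℝ≥0∞} {oc : ℝ≥0∞} {b : ℝ≥0∞} (hb : ∀ s, pc (.copy s) = b)
    (c : O.Call) (x : Regs A.R (O.args c)) (y : Regs A.R (O.rets c)) (next : A.L) :
    (W.callTree A c x y next).cost pc oc ≤
      (O.args c).length * b + ((W.body c).cost pc oc + (O.rets c).length * b) := by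
  rw [callTree, cost_copies pc oc hb]
  refine add_le_add le_rfl ((cost_bind_le (fun _ => ?_) _).trans_eq (by rw [cost_mapReg]))
  rw [cost_copies pc oc hb, CodeTree.cost, add_zero]

theorem cost_finTree_le {pc : Prim → ℝ≥0∞} {oc : ℝ≥0∞} {b : ℝ≥0∞} (hb : ∀ s, pc (.copy s) = b)
    (x : Regs A.R out) :
    (W.finTree A x).cost pc oc ≤ out.length * b + W.fin.cost pc oc := by
  rw [finTree, cost_copies pc oc hb]
  refine add_le_add le_rfl ((cost_bind_le (b := 0) (fun e => e.elim) _).trans_eq ?_)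
  rw [cost_mapReg, add_zero]

theorem cost_initTree_le {pc : Prim → ℝ≥0∞} {oc : ℝ≥0∞} {b : ℝ≥0∞} (hb : ∀ s, pc (.copy s) = b) :
    (W.initTree A).cost pc oc ≤ W.init.cost pc oc + inp.length * b := by
  refine (cost_bind_le (fun _ => ?_) _).trans_eq (by rw [cost_mapReg])
  rw [cost_copies pc oc hb, CodeTree.cost, add_zero]

/-- Every instruction of the adversary becomes at least one step, so the adversary needs no larger
budget than the compiled program. The code for a call or for the result is charged with its maximal
cost, which is bounded by `cc` or `fc`. -/
theorem value_compile_le (hW : W.Implements v Rel Res ix hx fx) {pc : Prim → ℝ≥0∞} {oc : ℝ≥0∞}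
    {cc : O.Call → ℝ≥0∞} {fc : ℝ≥0∞} {b : ℝ≥0∞} (hb : ∀ s, pc (.copy s) = b)
    (hcc : ∀ c, oc + ((O.args c).length * b + ((W.body c).cost pc oc + (O.rets c).length * b)) ≤ cc c)
    (hfc : oc + (out.length * b + W.fin.cost pc oc) ≤ fc)
    {J : Args S out' → ℝ≥0∞} {pay : Bool → ℝ≥0∞} (hJ : ∀ w b, Res w b → J w ≤ pay b)
    (n : ℕ) (l : A.L) (μ : Mem S A.R) (ν : Mem S W.R) (s : σ) (hs : Rel ν s) :
    (W.compile A l).value S (W.compile A) pc oc J n (μ.join ν) ≤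
      A.value S pc oc (exitTransformer hx pay cc) (fun w s => fc + mean (fx w s) pay) n l μ s := by
  induction n generalizing l μ ν s with
  | zero => exact zero_le
  | succ n ih =>
    have hdummy : ∀ (t : CodeTree out' (A.R ⊕ W.R) A.L) (ρ : Mem S (A.R ⊕ W.R)),
        (branch (.inr W.dummy) t t).value S (W.compile A) pc oc J (n + 1) ρ ≤
          oc + t.cost pc oc + wp S (fun l => (W.compile A l).value S (W.compile A) pc oc J n) J t ρ := by
      intro t ρ
      refine (value_succ_le_wp n _ (by simp) ρ).trans_eq ?_
      simp [CodeTree.cost, wp]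
    rw [Program.value, compile]
    cases hl : A.code l with
    | prim p x y next =>
      simp only [CodeTree.value, resolve, Mem.join_read_inl, Mem.join_write_inl]
      exact add_le_add le_rfl (mean_mono fun w => ih _ _ _ _ hs)
    | branch x l₁ l₀ =>
      simp only [CodeTree.value, resolve]
      refine add_le_add le_rfl ?_
      by_cases hx : (show Bool from μ.reg .bool x) = true
      · have hx' : (show Bool from (μ.join ν).reg .bool (.inl x)) = true := hx
        rw [if_pos hx, if_pos hx']
        exact ih _ _ _ _ hs
      · have hx' : ¬ (show Bool from (μ.join ν).reg .bool (.inl x)) = true := hx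
        rw [if_neg hx, if_neg hx']
        exact ih _ _ _ _ hs
    | store i t a b x next =>
      refine add_le_add le_rfl ((le_of_eq ?_).trans (ih _ _ _ _ hs))
      exact congrArg (CodeTree.value S _ _ _ _ _ _) (Mem.join_setTab_inl _ _ _ _ _ _ _)
    | load i t a b x l₁ l₀ =>
      simp only [CodeTree.value, resolve, Mem.join_set_inl]
      refine add_le_add le_rfl ?_
      have : (μ.join ν).tab i (.inl t) ((μ.join ν).reg .bits (.inl a)) ((μ.join ν).reg .bits (.inl b))
        = μ.tab i t (μ.reg .bits a) (μ.reg .bits b) := rfl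
      rw [this]
      cases hv : μ.tab i t (μ.reg .bits a) (μ.reg .bits b) <;> simp only <;> exact ih _ _ _ _ hs
    | call c x y next =>
      refine (hdummy _ _).trans (add_le_add ((add_le_add le_rfl ?_).trans (hcc c)) ?_)
      · exact W.cost_callTree_le A hb c x y next
      · rw [wp_callTree]
        exact hW.call meanClosed_le (fun ν s hs => ih _ _ _ _ hs) hJ _ _ _ hs
    | halt x =>
      refine (hdummy _ _).trans (add_le_add ((add_le_add le_rfl ?_).trans hfc) ?_)
      · exact W.cost_finTree_le A hb x
      · rw [wp_finTree]
        exact hW.fin meanClosed_le hJ _ _ _ hs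

/-- The finitely many trees have a common bound `D` for their depths, and `D` further steps suffice
for each instruction of the adversary. The budget `N` must not depend on the label or the state,
because the induction uses it below a mean. -/
theorem exists_le_value_compile (hW : W.Implements v Rel Res ix hx fx)
    {J : Args S out' → ℝ≥0∞} {pay : Bool → ℝ≥0∞} (hJ : ∀ w b, Res w b → pay b ≤ J w)
    (n : ℕ) : ∃ N, ∀ (l : A.L) (μ : Mem S A.R) (ν : Mem S W.R) (s : σ), Rel ν s →
    A.resultValue S (exitTransformer hx pay fun _ => 0) (fun w s => mean (fx w s) pay) n l μ s ≤
      (W.compile A l).value S (W.compile A) (fun _ => 0) 0 J N (μ.join ν) := by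
  have := A.finL
  obtain ⟨D, hD⟩ := (Set.finite_range fun l => (W.compile A l).depth).bddAbove
  induction n with
  | zero => exact ⟨0, fun l μ ν s _ => zero_le⟩
  | succ n ih =>
    obtain ⟨N, hN⟩ := ih
    refine ⟨N + D, fun l μ ν s hs => ?_⟩
    have hres : (W.compile A l).resolve (W.compile A) = W.compile A l := by
      cases h : W.compile A l with
      | goto l' => exact absurd h (W.compile_ne_goto A l l')
      | _ => rfl
    refine le_trans ?_ ((wp_le_value (J := J) (pc := fun _ => 0) (oc := 0) N (W.compile A l)
      (μ.join ν)).trans (by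
        rw [hres]
        exact value_mono _ _ (Nat.add_le_add_left (hD ⟨l, rfl⟩) N)))
    unfold Program.resultValue at hN ⊢
    rw [Program.value]
    conv_rhs => rw [compile]
    cases hl : A.code l with
    | prim p x y next =>
      simp only [wp, Mem.join_read_inl, Mem.join_write_inl, zero_add]
      exact mean_mono fun w => hN _ _ _ _ hs
    | branch x l₁ l₀ =>
      simp only [wp, zero_add]
      by_cases hx : (show Bool from μ.reg .bool x) = true
      · have hx' : (show Bool from (μ.join ν).reg .bool (.inl x)) = true := hx
        rw [if_pos hx, if_pos hx']
        exact hN _ _ _ _ hs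
      · have hx' : ¬ (show Bool from (μ.join ν).reg .bool (.inl x)) = true := hx
        rw [if_neg hx, if_neg hx']
        exact hN _ _ _ _ hs
    | store i t a b x next =>
      simp only [wp, zero_add]
      refine (hN _ _ _ _ hs).trans (le_of_eq ?_)
      exact congrArg (CodeTree.value S _ _ _ _ _ _) (Mem.join_setTab_inl _ _ _ _ _ _ _).symm
    | load i t a b x l₁ l₀ =>
      simp only [wp, Mem.join_set_inl, zero_add]
      have : (μ.join ν).tab i (.inl t) ((μ.join ν).reg .bits (.inl a)) ((μ.join ν).reg .bits (.inl b))
        = μ.tab i t (μ.reg .bits a) (μ.reg .bits b) := rfl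
      rw [this]
      cases hv : μ.tab i t (μ.reg .bits a) (μ.reg .bits b) <;> simp only <;> exact hN _ _ _ _ hs
    | call c x y next =>
      simp only [wp, ite_self, exitTransformer, zero_add]
      rw [wp_callTree]
      exact hW.call meanClosed_ge (fun ν s hs => hN _ _ _ _ hs) hJ _ _ _ hs
    | halt x =>
      simp only [wp, ite_self]
      rw [wp_finTree]
      exact hW.fin meanClosed_ge hJ _ _ _ hs

theorem startMem_program (v : Args S inp') :
    Program.startMem (P := W.program A) S v =
      (Mem.init S A.R).join (Mem.write inp' W.input v (Mem.init S W.R)) := by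
  refine Eq.trans ?_ (Mem.join_write_inr _ _ _ _ _)
  rw [Mem.join_init]
  rfl

theorem startTree_mem_labels : W.startTree A ∈ W.labels A := Or.inr (self_mem_subs _)

theorem resultValue_program (T : Costs) (k : ℕ) (callCost : noOracle.Call → ℕ)
    (judge : Args S out' → Unit → PMF Bool) :
    (W.program A).accept T k callCost S (noHandler S) v () judge =
      ⨆ n, (W.startTree A).value S (W.compile A) (fun _ => 0) 0 (fun w => judge w () true) n
        ((Mem.init S A.R).join (Mem.write inp' W.input v (Mem.init S W.R))) := by
  refine ((W.program A).accept_eq_iSup S T k callCost (noHandler S) v () judge).trans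
    (iSup_congr fun n => ?_)
  have hv := W.program_value A S (pc := fun _ => 0) (oc := 0)
    (H := (noHandler S).transformer fun _ => 0) (J := fun w => judge w () true) n (W.startTree A)
    (W.startTree_mem_labels A) (by simp [startTree])
    (Program.startMem (P := W.program A) S v)
  simp only [zero_add] at hv
  exact hv.trans (congrArg (CodeTree.value S _ _ _ _ n _) (W.startMem_program A v))

theorem meanTime_program (T : Costs) (k : ℕ) (callCost : noOracle.Call → ℕ) :
    (W.program A).meanTime T k callCost S (noHandler S) v () =
      ⨆ n, (W.startTree A).value S (W.compile A) (fun p => Prim.cost T k p) 1 (fun _ => 0) n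
        ((Mem.init S A.R).join (Mem.write inp' W.input v (Mem.init S W.R))) := by
  refine ((W.program A).meanTime_eq_iSup S T k callCost (noHandler S) v ()).trans
    (iSup_congr fun n => ?_)
  have hv := W.program_value A S (pc := fun p => Prim.cost T k p) (oc := 1)
    (H := (noHandler S).transformer fun c => callCost c) (J := fun _ => 0) n (W.startTree A)
    (W.startTree_mem_labels A) (by simp [startTree])
    (Program.startMem (P := W.program A) S v)
  simp only [add_zero] at hv
  exact hv.trans (congrArg (CodeTree.value S _ _ _ _ n _) (W.startMem_program A v))

theorem value_startTree_le (hW : W.Implements v Rel Res ix hx fx) {pc : Prim → ℝ≥0∞} {oc : ℝ≥0∞}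
    {cc : O.Call → ℝ≥0∞} {fc : ℝ≥0∞} {b : ℝ≥0∞} (hb : ∀ s, pc (.copy s) = b)
    (hcc : ∀ c, oc + ((O.args c).length * b + ((W.body c).cost pc oc + (O.rets c).length * b)) ≤ cc c)
    (hfc : oc + (out.length * b + W.fin.cost pc oc) ≤ fc)
    {J : Args S out' → ℝ≥0∞} {pay : Bool → ℝ≥0∞} (hJ : ∀ w b, Res w b → J w ≤ pay b) (n : ℕ) :
    (W.startTree A).value S (W.compile A) pc oc J n
        ((Mem.init S A.R).join (Mem.write inp' W.input v (Mem.init S W.R))) ≤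
      oc + (W.init.cost pc oc + inp.length * b) + mean ix fun x =>
        A.value S pc oc (exitTransformer hx pay cc) (fun w s => fc + mean (fx w s) pay) n A.start
          (Program.startMem S x.1) x.2 := by
  refine (value_le_succ _ _ _).trans ((value_succ_le_wp n _ (by simp [startTree]) _).trans
    (add_le_add ?_ ?_))
  · rw [startTree, CodeTree.cost, max_self]
    exact add_le_add le_rfl (W.cost_initTree_le A hb)
  · rw [startTree, wp, ite_self, wp_initTree]
    exact hW.init meanClosed_le J fun ν s hs => W.value_compile_le A hW hb hcc hfc hJ n _ _ _ _ hs

/-- The bound for running times with all prices equal to zero. -/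
theorem accept_program_le (hW : W.Implements v Rel Res ix hx fx) (T : Costs) (k : ℕ)
    (callCost : noOracle.Call → ℕ) {judge : Args S out' → Unit → PMF Bool} {pay : Bool → ℝ≥0∞}
    (hJ : ∀ w b, Res w b → judge w () true ≤ pay b) :
    (W.program A).accept T k callCost S (noHandler S) v () judge ≤
      ⨆ n, mean ix fun x => A.resultValue S (exitTransformer hx pay fun _ => 0)
        (fun w s => mean (fx w s) pay) n A.start (Program.startMem S x.1) x.2 := by
  have hc : ∀ {out : List Srt} {R L : Type} (t : CodeTree out R L), t.cost (fun _ => 0) 0 = 0 := by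
    intro out R L t
    induction t <;> simp_all [CodeTree.cost]
  rw [resultValue_program]
  refine iSup_mono fun n => ?_
  refine (W.value_startTree_le A hW (b := 0) (cc := fun _ => 0) (fc := 0) (fun _ => rfl)
    (by simp [hc]) (by simp [hc]) hJ n).trans_eq ?_
  simp [hc]

theorem le_accept_program (hW : W.Implements v Rel Res ix hx fx) (T : Costs) (k : ℕ)
    (callCost : noOracle.Call → ℕ) {judge : Args S out' → Unit → PMF Bool} {pay : Bool → ℝ≥0∞}
    (hJ : ∀ w b, Res w b → pay b ≤ judge w () true) (n : ℕ) :
    (mean ix fun x => A.resultValue S (exitTransformer hx pay fun _ => 0)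
        (fun w s => mean (fx w s) pay) n A.start (Program.startMem S x.1) x.2) ≤
      (W.program A).accept T k callCost S (noHandler S) v () judge := by
  rw [resultValue_program]
  obtain ⟨N, hN⟩ := W.exists_le_value_compile A hW hJ n
  refine le_trans ?_ (le_iSup _ (N + (W.startTree A).depth))
  refine le_trans ?_ (wp_le_value N (W.startTree A) _)
  rw [startTree, wp, ite_self, wp_initTree]
  exact hW.init meanClosed_ge _ fun ν s hs => hN _ _ _ _ hs

theorem meanTime_program_le (hW : W.Implements v Rel Res ix hx fx) (T : Costs) (k : ℕ)
    (callCost : noOracle.Call → ℕ) {cc : O.Call → ℝ≥0∞} {fc : ℝ≥0∞}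
    (hcc : ∀ c, 1 + ((O.args c).length +
      ((W.body c).cost (fun p => Prim.cost T k p) 1 + (O.rets c).length)) ≤ cc c)
    (hfc : 1 + (out.length + W.fin.cost (fun p => Prim.cost T k p) 1) ≤ fc) :
    (W.program A).meanTime T k callCost S (noHandler S) v () ≤
      1 + (W.init.cost (fun p => Prim.cost T k p) 1 + inp.length) + ⨆ n, mean ix fun x =>
        A.value S (fun p => Prim.cost T k p) 1 (exitTransformer hx (fun _ => 0) cc)
          (fun _ _ => fc) n A.start (Program.startMem S x.1) x.2 := by
  rw [meanTime_program]
  refine iSup_le fun n => (W.value_startTree_le A hW (b := 1) (cc := cc) (fc := fc)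
    (pay := fun _ => 0) (fun _ => by simp [Prim.cost]) (by simpa using hcc) (by simpa using hfc)
    (fun _ _ _ => le_rfl) n).trans ?_
  simp only [mean_const, add_zero, mul_one]
  exact add_le_add le_rfl (le_iSup (fun n => mean ix fun x =>
    A.value S (fun p => Prim.cost T k p) 1 (exitTransformer hx (fun _ => 0) cc)
      (fun _ _ => fc) n A.start (Program.startMem S x.1) x.2) n)

end Wrapper

/-! ## Groups of prime order -/

section Scale

variable {q : ℕ} [Fact q.Prime] {G : Type} [AddCommGroup G] [Fintype G]

/-- The order of the group annihilates it, so the representative of a residue does not matter. The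
other rules for `scale` rest on this one. -/
theorem scale_natCast (hG : Fintype.card G = q) (n : ℕ) (P : G) : scale (n : ZMod q) P = n • P := by
  have hP : q • P = 0 := by rw [← hG]; exact card_nsmul_eq_zero
  rw [scale, ZMod.val_natCast]
  conv_rhs => rw [← Nat.mod_add_div n q, add_nsmul, mul_nsmul, hP, nsmul_zero, add_zero]

theorem scale_mul (hG : Fintype.card G = q) (a b : ZMod q) (P : G) :
    scale (a * b) P = scale a (scale b P) := by
  have : a * b = ((a.val * b.val : ℕ) : ZMod q) := by simp
  rw [this, scale_natCast hG, scale, scale, mul_comm, mul_nsmul]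

theorem scale_zero (P : G) : scale (0 : ZMod q) P = 0 := by simp [scale]

theorem scale_one (P : G) : scale (1 : ZMod q) P = P := by
  simp [scale, ZMod.val_one'' (Fact.out : q.Prime).ne_one]

theorem scale_comm (hG : Fintype.card G = q) (a b : ZMod q) (P : G) :
    scale a (scale b P) = scale b (scale a P) := by
  rw [← scale_mul hG, mul_comm, scale_mul hG]

theorem scale_eq_zero_iff (hG : Fintype.card G = q) {a : ZMod q} {P : G} :
    scale a P = 0 ↔ a = 0 ∨ P = 0 := by
  constructor
  · intro h
    by_contra! hne
    have := scale_mul hG a⁻¹ a P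
    rw [inv_mul_cancel₀ hne.1, scale_one, h, scale, nsmul_zero] at this
    exact hne.2 this
  · rintro (rfl | rfl)
    · exact scale_zero P
    · simp [scale]

theorem scale_ne_zero (hG : Fintype.card G = q) {a : ZMod q} {P : G} (ha : a ≠ 0) (hP : P ≠ 0) :
    scale a P ≠ 0 := by
  rw [Ne, scale_eq_zero_iff hG]
  tauto

/-- A group of prime order is generated by each of its non-zero elements. -/
theorem scale_bijective (hG : Fintype.card G = q) {P : G} (hP : P ≠ 0) :
    Function.Bijective fun a : ZMod q => scale a P := by
  rw [Fintype.bijective_iff_injective_and_card]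
  refine ⟨fun a b hab => ?_, by rw [ZMod.card, hG]⟩
  have hadd : scale (a - b) P + scale b P = scale a P := by
    have h : a = (((a - b).val + b.val : ℕ) : ZMod q) := by simp
    conv_rhs => rw [h]
    rw [scale_natCast hG, add_nsmul]
    rfl
  have h0 : scale (a - b) P = 0 := by
    rw [← add_right_cancel_iff (a := scale b P), hadd, zero_add]
    exact hab
  rcases (scale_eq_zero_iff hG).1 h0 with h | h
  · exact sub_eq_zero.1 h
  · exact absurd h hP

end Scale

/-! ### Uniform distributions. -/

section Uniform

theorem mean_uniformNonzero {α : Type} [Fintype α] [Zero α] [Nontrivial α] (f : α → ℝ≥0∞) :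
    mean (uniformNonzero α) f =
      (Nat.card {a : α // a ≠ 0} : ℝ≥0∞)⁻¹ * ∑' a : {a : α // a ≠ 0}, f a := by
  classical
  rw [mean, ← ENNReal.tsum_mul_left]
  refine Eq.trans ?_ (tsum_subtype {a : α | a ≠ 0}
    fun a => (Nat.card {a : α // a ≠ 0} : ℝ≥0∞)⁻¹ * f a).symm
  refine tsum_congr fun a => ?_
  by_cases ha : a = 0
  · simp [uniformNonzero, ha, Set.indicator]
  · simp [uniformNonzero, ha, Set.indicator, PMF.uniformOfFinset_apply, Fintype.card_subtype]

/-- Substitution in a mean. It is used for hash values with a random logarithm and for the change of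
the random scalar of a designated signature. -/
theorem mean_uniformNonzero_bijective {α β : Type} [Fintype α] [Zero α] [Nontrivial α] [Fintype β]
    [Zero β] [Nontrivial β] {g : α → β} (hg : Function.Bijective g) (h0 : g 0 = 0)
    (f : β → ℝ≥0∞) :
    (mean (uniformNonzero α) fun a => f (g a)) = mean (uniformNonzero β) f := by
  have hz : ∀ a, a ≠ 0 ↔ g a ≠ 0 := fun a => by
    rw [Ne, Ne, ← h0, hg.injective.eq_iff]
  let E : {a : α // a ≠ 0} ≃ {b : β // b ≠ 0} := (Equiv.ofBijective g hg).subtypeEquiv hz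
  rw [mean_uniformNonzero, mean_uniformNonzero, Nat.card_congr E, ← E.tsum_eq]
  rfl

theorem mem_support_uniformNonzero {α : Type} [Fintype α] [Zero α] [Nontrivial α] {a : α} :
    a ∈ (uniformNonzero α).support ↔ a ≠ 0 := by
  classical
  simp [uniformNonzero]

theorem uniformBits_apply_le (n : ℕ) (l : List Bool) : uniformBits n l ≤ ((2 : ℝ≥0∞) ^ n)⁻¹ := by
  classical
  rw [uniformBits, PMF.map_apply, tsum_fintype]
  simp only [PMF.uniformOfFintype_apply, Fintype.card_pi, Fintype.card_bool, Finset.prod_const,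
    Finset.card_univ, Fintype.card_fin, Nat.cast_pow, Nat.cast_ofNat]
  by_cases h : ∃ v : Fin n → Bool, l = List.ofFn v
  · obtain ⟨v, rfl⟩ := h
    rw [Finset.sum_eq_single v]
    · simp
    · intro b _ hb
      rw [if_neg fun h => hb (List.ofFn_injective h.symm)]
    · simp
  · push Not at h
    simp [h]

theorem length_of_mem_support_uniformBits {n : ℕ} {l : List Bool}
    (h : l ∈ (uniformBits n).support) : l.length = n := by
  rw [uniformBits, PMF.mem_support_map_iff] at h
  obtain ⟨v, -, rfl⟩ := h
  simp

theorem mean_uniformUpTo (n : ℕ) (f : ℕ → ℝ≥0∞) :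
    mean (uniformUpTo n) f = ((n : ℝ≥0∞) + 1)⁻¹ * ∑ i ∈ Finset.range (n + 1), f i := by
  refine (mean_map _ _ _).trans ((mean_bind (PMF.uniformOfFintype (Fin (n + 1)))
    (fun a => PMF.pure (a : ℕ)) fun i => f i).trans ?_)
  simp only [mean_pure]
  rw [mean, tsum_fintype, Finset.sum_range, Finset.mul_sum]
  simp

end Uniform

/-! ### The pairing and multiplication by scalars. -/

namespace BilinearStructure

variable (S : BilinearStructure)

theorem e_pow_q (P : S.G₁) (Q : S.G₂) : S.e P Q ^ S.q = 1 := by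
  rw [← S.card₃]
  exact pow_card_eq_one

theorem pow_val_natCast {g : S.G₃} (hg : g ^ S.q = 1) (n : ℕ) :
    g ^ ((n : ZMod S.q)).val = g ^ n := by
  rw [ZMod.val_natCast]
  conv_rhs => rw [← Nat.mod_add_div n S.q, pow_add, pow_mul, hg, one_pow, mul_one]

theorem pow_val_mul {g : S.G₃} (hg : g ^ S.q = 1) (a b : ZMod S.q) :
    g ^ (a * b).val = (g ^ a.val) ^ b.val := by
  have : a * b = ((a.val * b.val : ℕ) : ZMod S.q) := by simp
  rw [this, S.pow_val_natCast hg, pow_mul]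

theorem e_scale (a b : ZMod S.q) (P : S.G₁) (Q : S.G₂) :
    S.e (scale a P) (scale b Q) = S.e P Q ^ (a * b).val := by
  have h := S.bilinear P Q a.val b.val
  simp only [natCast_zsmul] at h
  rw [scale, scale, h, S.pow_val_mul (S.e_pow_q P Q), ← pow_mul]
  exact_mod_cast zpow_natCast (S.e P Q) (a.val * b.val)

theorem e_scale_left (a : ZMod S.q) (P : S.G₁) (Q : S.G₂) :
    S.e (scale a P) Q = S.e P Q ^ a.val := by
  have := S.e_scale a 1 P Q
  rwa [scale_one, mul_one] at this

theorem psi_scale (a : ZMod S.q) (P : S.G₂) : S.ψ (scale a P) = scale a (S.ψ P) := by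
  simp [scale]

theorem psi_ne_zero {P : S.G₂} (hP : P ≠ 0) : S.ψ P ≠ 0 := by simpa using hP

/-- The equation of the verification for hash values with a known logarithm. -/
theorem e_verify (ua ub h : ZMod S.q) (P₂ : S.G₂) :
    S.e (scale h (S.ψ (scale ua P₂))) (scale ub P₂) =
      S.e (scale ub (scale h (S.ψ P₂))) (scale ua P₂) := by
  rw [psi_scale, ← scale_mul S.card₁, ← scale_mul S.card₁, e_scale, e_scale]
  ring_nf

/-- A forgery for a hash value that is a known multiple of `X` solves PR₂. -/
theorem e_forgery {x y z h : ZMod S.q} (hh : h ≠ 0) {P₂ : S.G₂} {Q₁ : S.G₁} {Q₂ : S.G₂}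
    (he : S.e (scale z (scale h (scale x (S.ψ P₂)))) (scale y P₂) = S.e Q₁ Q₂) :
    S.e (scale h⁻¹ Q₁) Q₂ = S.e (S.ψ P₂) P₂ ^ (x * y * z).val := by
  rw [e_scale_left, ← he, ← scale_mul S.card₁, ← scale_mul S.card₁, e_scale,
    ← S.pow_val_mul (S.e_pow_q _ _)]
  congr 2
  field_simp

theorem mean_scale₁ {P : S.G₁} (hP : P ≠ 0) (f : S.G₁ → ℝ≥0∞) :
    (mean (uniformNonzero (ZMod S.q)) fun a => f (scale a P)) = mean (uniformNonzero S.G₁) f :=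
  mean_uniformNonzero_bijective (scale_bijective S.card₁ hP) (scale_zero P) f

end BilinearStructure

/-! ## Hidden random functions -/

section Hidden

variable {K : Type} (p : PMF K)

/-- The distribution of a partial function that agrees with `κ` outside of `D` and whose values on
`D` are independent. -/
def hiddenFun (κ : List Bool → Option K) : List (List Bool) → PMF (List Bool → Option K)
  | [] => PMF.pure κ
  | m :: D => p.bind fun c => (hiddenFun κ D).map fun κ' => Function.update κ' m (some c)

/-- A value that is drawn if there is none yet. -/
def drawn (o : Option K) : PMF K := o.elim p PMF.pure

/-- The value at `m`, which is drawn now if there is none yet. -/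
def reveal (m : List Bool) (κ : List Bool → Option K) : PMF (K × (List Bool → Option K)) :=
  (drawn p (κ m)).map fun c => (c, Function.update κ m (some c))

variable {p} {κ : List Bool → Option K} {D : List (List Bool)} {m : List Bool}

theorem mean_hidden_nil (F : (List Bool → Option K) → ℝ≥0∞) : mean (hiddenFun p κ []) F = F κ :=
  mean_pure _ _

theorem mean_hidden_cons (F : (List Bool → Option K) → ℝ≥0∞) :
    mean (hiddenFun p κ (m :: D)) F =
      mean p fun c => mean (hiddenFun p κ D) fun κ' => F (Function.update κ' m (some c)) := by
  rw [hiddenFun, mean_bind]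
  simp only [mean_map]

/-- The outermost draw at `m` overwrites the one inside, and a draw that is not used does not change
a mean. So repetitions in `D` are harmless. -/
theorem mean_hidden_cons_of_mem (hm : m ∈ D) (F : (List Bool → Option K) → ℝ≥0∞) :
    mean (hiddenFun p κ (m :: D)) F = mean (hiddenFun p κ D) F := by
  induction D generalizing F with
  | nil => simp at hm
  | cons a D ih =>
    rw [mean_hidden_cons]
    by_cases ha : m = a
    · subst ha
      simp only [mean_hidden_cons, Function.update_idem, mean_const]
    · have hm : m ∈ D := by simpa [ha] using hm
      simp only [mean_hidden_cons]
      rw [mean_comm]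
      congr 1
      funext c
      rw [← ih hm, mean_hidden_cons]
      simp only [Function.update_comm ha]

theorem hidden_apply_of_notMem (hm : m ∉ D) {κ' : List Bool → Option K}
    (h : κ' ∈ (hiddenFun p κ D).support) : κ' m = κ m := by
  induction D generalizing κ' with
  | nil =>
    rw [hiddenFun, PMF.mem_support_pure_iff] at h
    rw [h]
  | cons a D ih =>
    rw [hiddenFun, PMF.mem_support_bind_iff] at h
    obtain ⟨c, -, h⟩ := h
    rw [PMF.mem_support_map_iff] at h
    obtain ⟨κ'', h, rfl⟩ := h
    simp only [List.mem_cons, not_or] at hm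
    rw [Function.update_of_ne hm.1, ih hm.2 h]

theorem mean_reveal_of_none (h : κ m = none) (F : K × (List Bool → Option K) → ℝ≥0∞) :
    mean (reveal p m κ) F = mean p fun c => F (c, Function.update κ m (some c)) := by
  rw [reveal, h, mean_map]
  rfl

theorem mean_reveal (F : K × (List Bool → Option K) → ℝ≥0∞) :
    mean (reveal p m κ) F = mean (drawn p (κ m)) fun c => F (c, Function.update κ m (some c)) :=
  mean_map _ _ _

theorem mean_reveal_of_some {c : K} (h : κ m = some c) (F : K × (List Bool → Option K) → ℝ≥0∞) :
    mean (reveal p m κ) F = F (c, κ) := by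
  rw [mean_reveal, h]
  exact (mean_pure _ _).trans (by rw [← h, Function.update_eq_self])

/-- Deferred sampling: a value that was drawn earlier but has remained hidden may as well be drawn
when it is revealed. -/
theorem mean_hidden_reveal (hm : m ∈ D ∨ κ m = none) (F : K × (List Bool → Option K) → ℝ≥0∞) :
    (mean (hiddenFun p κ D) fun κ' => mean (reveal p m κ') F) =
      mean p fun c => mean (hiddenFun p κ D) fun κ' => F (c, Function.update κ' m (some c)) := by
  by_cases hD : m ∈ D
  · rw [← mean_hidden_cons_of_mem hD, mean_hidden_cons]
    congr 1
    funext c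
    congr 1
    funext κ'
    exact mean_reveal_of_some (Function.update_self _ _ _) _
  · rw [mean_comm]
    refine mean_congr_support fun κ' hκ => mean_reveal_of_none ?_ _
    rw [hidden_apply_of_notMem hD hκ]
    exact hm.resolve_left hD

theorem mean_hidden_reveal_of_some (hm : m ∉ D) {c : K} (hc : κ m = some c)
    (F : K × (List Bool → Option K) → ℝ≥0∞) :
    (mean (hiddenFun p κ D) fun κ' => mean (reveal p m κ') F) =
      mean (hiddenFun p κ D) fun κ' => F (c, κ') :=
  mean_congr_support fun κ' hκ =>
    mean_reveal_of_some ((hidden_apply_of_notMem hm hκ).trans hc) F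

/-- A revealed value becomes a part of the known function `κ`, and its argument is no longer among
the hidden ones. -/
theorem mean_hidden_update (c : K) (F : (List Bool → Option K) → ℝ≥0∞) :
    (mean (hiddenFun p κ D) fun κ' => F (Function.update κ' m (some c))) =
      mean (hiddenFun p (Function.update κ m (some c)) (D.filter (· ≠ m))) F := by
  induction D generalizing F with
  | nil => simp only [List.filter_nil, mean_hidden_nil]
  | cons a D ih =>
    by_cases ha : a = m
    · subst ha
      simp only [mean_hidden_cons, Function.update_idem, mean_const, ih]
      simp
    · rw [List.filter_cons_of_pos (by simpa using ha)]
      simp only [mean_hidden_cons]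
      congr 1
      funext c'
      rw [← ih]
      simp only [Function.update_comm ha]

end Hidden

/-! ## Hash values with known logarithms -/

section Hash

variable {S : BilinearStructure}

theorem hashQuery_of_some {H : HashTable S} {m r : List Bool} {g : S.G₁} (h : H m r = some g) :
    hashQuery S m r H = PMF.pure (g, H) := by
  rw [hashQuery, h]

open Classical in
/-- Fixing a value of the random oracle. -/
def HashTable.set (H : HashTable S) (m r : List Bool) (g : S.G₁) : HashTable S :=
  Function.update H m (Function.update (H m) r (some g))

theorem hashQuery_of_none {H : HashTable S} {m r : List Bool} (h : H m r = none) :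
    hashQuery S m r H = (uniformNonzero S.G₁).map fun g => (g, H.set m r g) := by
  rw [hashQuery, h]
  rfl

theorem HashTable.set_self (H : HashTable S) (m r : List Bool) (g : S.G₁) :
    H.set m r g m r = some g := by
  classical
  have : H.set m r g m = Function.update (H m) r (some g) := Function.update_self m _ H
  rw [this]
  exact Function.update_self r _ _

theorem HashTable.set_of_ne (H : HashTable S) {m r m' r' : List Bool} (g : S.G₁)
    (h : ¬ (m' = m ∧ r' = r)) : H.set m r g m' r' = H m' r' := by
  classical
  by_cases hm : m' = m
  · subst hm
    have : H.set m' r g m' = Function.update (H m') r (some g) := Function.update_self m' _ H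
    rw [this]
    exact Function.update_of_ne (fun hr => h ⟨rfl, hr⟩) _ _
  · exact congrFun (Function.update_of_ne hm _ H) r'

/-- The values in the table are not `0`. -/
def HashTable.NeZero (H : HashTable S) : Prop := ∀ m r g, H m r = some g → g ≠ 0

theorem HashTable.NeZero.of_mem_support {H : HashTable S} (hH : H.NeZero) {m r : List Bool}
    {x : S.G₁ × HashTable S} (hx : x ∈ (hashQuery S m r H).support) : x.1 ≠ 0 ∧ x.2.NeZero := by
  cases h : H m r with
  | some g =>
    rw [hashQuery_of_some h, PMF.mem_support_pure_iff] at hx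
    subst hx
    exact ⟨hH _ _ _ h, hH⟩
  | none =>
    rw [hashQuery_of_none h, PMF.mem_support_map_iff] at hx
    obtain ⟨g, hg, rfl⟩ := hx
    rw [mem_support_uniformNonzero] at hg
    refine ⟨hg, fun m' r' g' h' => ?_⟩
    change H.set m r g m' r' = some g' at h'
    by_cases hms : m' = m ∧ r' = r
    · obtain ⟨rfl, rfl⟩ := hms
      rw [HashTable.set_self, Option.some_inj] at h'
      exact h' ▸ hg
    · rw [HashTable.set_of_ne _ _ hms] at h'
      exact hH _ _ _ h'

/-- The hash values are the multiples by the scalars in `tab` of the elements given by `base`, for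
the values of a hidden function. -/
def HashTable.IsMultiple {K : Type} (H : HashTable S) (κ : List Bool → Option K)
    (base : K → List Bool → S.G₁) (tab : List Bool → List Bool → Option (ZMod S.q)) : Prop :=
  ∀ m r, (tab m r = none ∧ H m r = none) ∨
    ∃ h c, h ≠ 0 ∧ tab m r = some h ∧ κ m = some c ∧ H m r = some (scale h (base c r))

variable {K : Type} {H : HashTable S} {κ : List Bool → Option K} {base : K → List Bool → S.G₁}
  {tab : List Bool → List Bool → Option (ZMod S.q)}

/-- Entries of the table exist only at messages whose hidden value is known. At a message without
such a value nothing can be contradicted by drawing one. -/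
theorem HashTable.IsMultiple.update (hH : H.IsMultiple κ base tab) {m : List Bool}
    (hm : κ m = none) (c : K) : H.IsMultiple (Function.update κ m (some c)) base tab := by
  intro m' r
  rcases hH m' r with h | ⟨h, c', h0, ht, hc, he⟩
  · exact Or.inl h
  · refine Or.inr ⟨h, c', h0, ht, ?_, he⟩
    rw [Function.update_of_ne, hc]
    rintro rfl
    rw [hm] at hc
    cases hc

theorem HashTable.IsMultiple.reveal (hH : H.IsMultiple κ base tab) {p : PMF K} {m : List Bool}
    {x : K × (List Bool → Option K)} (hx : x ∈ (reveal p m κ).support) :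
    H.IsMultiple x.2 base tab ∧ x.2 m = some x.1 ∧ x.2 = Function.update κ m (some x.1) := by
  rw [_root_.reveal, PMF.mem_support_map_iff] at hx
  obtain ⟨c, hc, rfl⟩ := hx
  refine ⟨?_, by simp, rfl⟩
  cases hm : κ m with
  | none => exact hH.update hm c
  | some c' =>
    rw [hm, drawn, Option.elim_some, PMF.mem_support_pure_iff] at hc
    subst hc
    rwa [← hm, Function.update_eq_self]

/-- The analysis of the code that looks up or draws the logarithm of a hash value. -/
theorem HashTable.IsMultiple.rel_hashQuery {r : ℝ≥0∞ → ℝ≥0∞ → Prop} (hr : MeanClosed r)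
    (hH : H.IsMultiple κ base tab) {m s : List Bool} {c : K} (hc : κ m = some c)
    (hb : base c s ≠ 0)
    {f : ZMod S.q → ℝ≥0∞}
    {Φ : S.G₁ × HashTable S → ℝ≥0∞}
    (hf : ∀ h H', h ≠ 0 →
      H'.IsMultiple κ base (Function.update tab m (Function.update (tab m) s (some h))) →
      r (f h) (Φ (scale h (base c s), H'))) :
    r (mean (drawn (uniformNonzero (ZMod S.q)) (tab m s)) f) (mean (hashQuery S m s H) Φ) := by
  rcases hH m s with ⟨ht, he⟩ | ⟨h, c', h0, ht, hc', he⟩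
  -- A uniform non-zero multiple of a non-zero base is a uniform non-zero element. This is why the
  -- base cannot be seen from the hash value.
  · rw [ht, hashQuery_of_none he, mean_map, ← S.mean_scale₁ hb]
    refine hr.mean _ _ _ fun h hh => hf _ _ (mem_support_uniformNonzero.1 hh) fun m' s' => ?_
    by_cases hms : m' = m ∧ s' = s
    · obtain ⟨rfl, rfl⟩ := hms
      exact Or.inr ⟨h, c, mem_support_uniformNonzero.1 hh, by simp, hc, HashTable.set_self _ _ _ _⟩
    · have hu : ∀ {γ : Type} (T : List Bool → List Bool → Option γ) (g : γ),
          Function.update T m (Function.update (T m) s (some g)) m' s' = T m' s' := by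
        intro γ T g
        by_cases hm : m' = m
        · subst hm
          have : s' ≠ s := fun h => hms ⟨rfl, h⟩
          simp [this]
        · simp [hm]
      rw [hu, HashTable.set_of_ne _ _ hms]
      exact hH m' s'
  · rw [hc] at hc'
    cases hc'
    rw [ht, hashQuery_of_some he, mean_pure]
    rw [drawn, Option.elim_some, mean_pure]
    refine hf h H h0 ?_
    rwa [← ht, Function.update_eq_self, Function.update_eq_self]

end Hash

/-! ## The execution of some pieces of code -/

attribute [simp] Mem.set_reg_self Mem.set_reg_of_srt_ne Mem.set_reg_of_ne Mem.set_tab Mem.setTab_reg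

namespace Val

variable {S : BilinearStructure}

def ofBool (b : Bool) : Val S .bool := b
def ofBits (l : List Bool) : Val S .bits := l
def ofNat (n : ℕ) : Val S .nat := n
def ofScalar (a : ZMod S.q) : Val S .scalar := a
def of₁ (g : S.G₁) : Val S .g₁ := g
def of₂ (g : S.G₂) : Val S .g₂ := g
def of₃ (g : S.G₃) : Val S .g₃ := g

end Val

/-- With this, both outcomes of a `lookup` end in a memory of the same form. -/
theorem Mem.setTab_eq_self {S : BilinearStructure} {R : Type} {μ : Mem S R} {s : Srt} {t : R}
    {a b : List Bool} {v : Val S s} (h : μ.tab s t a b = some v) : μ.setTab s t a b v = μ := by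
  refine Mem.ext (fun _ _ => rfl) fun s' t' => ?_
  by_cases ht : t' = t
  · subst ht
    by_cases hs : s' = s
    · subst hs
      rw [Mem.setTab_tab_self, ← h, Function.update_eq_self, Function.update_eq_self]
    · exact Mem.setTab_tab_of_srt_ne μ hs t' t' a b v
  · exact Mem.setTab_tab_of_ne μ ht a b v s'

namespace CodeTree

variable {S : BilinearStructure} {out : List Srt} {R L : Type} {φ : L → Mem S R → ℝ≥0∞}
  {J : Args S out → ℝ≥0∞} {μ : Mem S R} {t t' : CodeTree out R L}

theorem wp_exp₁ {a P y : R} {u : ZMod S.q} {g : S.G₁} (ha : μ.reg .scalar a = .ofScalar u)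
    (hP : μ.reg .g₁ P = .of₁ g) :
    wp S φ J (prim .exp₁ (a, P, ()) (y, ()) t) μ = wp S φ J t (μ.set .g₁ y (.of₁ (scale u g))) := by
  subst ha hP
  exact mean_pure (α := Args S [.g₁]) _ _

theorem wp_exp₂ {a P y : R} {u : ZMod S.q} {g : S.G₂} (ha : μ.reg .scalar a = .ofScalar u)
    (hP : μ.reg .g₂ P = .of₂ g) :
    wp S φ J (prim .exp₂ (a, P, ()) (y, ()) t) μ = wp S φ J t (μ.set .g₂ y (.of₂ (scale u g))) := by
  subst ha hP
  exact mean_pure (α := Args S [.g₂]) _ _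

theorem wp_pairing {P Q y : R} {g : S.G₁} {g' : S.G₂} (hP : μ.reg .g₁ P = .of₁ g)
    (hQ : μ.reg .g₂ Q = .of₂ g') :
    wp S φ J (prim .pairing (P, Q, ()) (y, ()) t) μ = wp S φ J t (μ.set .g₃ y (.of₃ (S.e g g'))) := by
  subst hP hQ
  exact mean_pure (α := Args S [.g₃]) _ _

theorem wp_psi {P y : R} {g : S.G₂} (hP : μ.reg .g₂ P = .of₂ g) :
    wp S φ J (prim .psi (P, ()) (y, ()) t) μ = wp S φ J t (μ.set .g₁ y (.of₁ (S.ψ g))) := by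
  subst hP
  exact mean_pure (α := Args S [.g₁]) _ _

theorem wp_invS {a y : R} {u : ZMod S.q} (ha : μ.reg .scalar a = .ofScalar u) :
    wp S φ J (prim .invS (a, ()) (y, ()) t) μ = wp S φ J t (μ.set .scalar y (.ofScalar u⁻¹)) := by
  subst ha
  exact mean_pure (α := Args S [.scalar]) _ _

theorem wp_const {b : Bool} {y : R} :
    wp S φ J (prim (.const b) () (y, ()) t) μ = wp S φ J t (μ.set .bool y (.ofBool b)) :=
  mean_pure (α := Args S [.bool]) _ _

theorem wp_pred {a y : R} {n : ℕ} (ha : μ.reg .nat a = .ofNat n) :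
    wp S φ J (prim .pred (a, ()) (y, ()) t) μ = wp S φ J t (μ.set .nat y (.ofNat (n - 1))) := by
  subst ha
  exact mean_pure (α := Args S [.nat]) _ _

theorem wp_succ {a y : R} {n : ℕ} (ha : μ.reg .nat a = .ofNat n) :
    wp S φ J (prim .succ (a, ()) (y, ()) t) μ = wp S φ J t (μ.set .nat y (.ofNat (n + 1))) := by
  subst ha
  exact mean_pure (α := Args S [.nat]) _ _

theorem wp_copy {s : Srt} {a y : R} {v : Val S s} (ha : μ.reg s a = v) :
    wp S φ J (prim (.copy s) (a, ()) (y, ()) t) μ = wp S φ J t (μ.set s y v) := by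
  subst ha
  exact mean_pure (α := Args S [s]) _ _

open Classical in
theorem wp_eq {s : Srt} {a b y : R} {v w : Val S s} (ha : μ.reg s a = v) (hb : μ.reg s b = w) :
    wp S φ J (prim (.eq s) (a, b, ()) (y, ()) t) μ =
      wp S φ J t (μ.set .bool y (.ofBool (decide (v = w)))) := by
  subst ha hb
  exact mean_pure (α := Args S [.bool]) _ _

theorem wp_randUpTo {a y : R} {n : ℕ} (ha : μ.reg .nat a = .ofNat n) :
    wp S φ J (prim .randUpTo (a, ()) (y, ()) t) μ =
      mean (uniformUpTo n) fun i => wp S φ J t (μ.set .nat y (.ofNat i)) := by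
  subst ha
  exact mean_map (β := Args S [.nat]) _ _ _

theorem wp_randBits {a y : R} {n : ℕ} (ha : μ.reg .nat a = .ofNat n) :
    wp S φ J (prim .randBits (a, ()) (y, ()) t) μ =
      mean (uniformBits n) fun i => wp S φ J t (μ.set .bits y (.ofBits i)) := by
  subst ha
  exact mean_map (β := Args S [.bits]) _ _ _

theorem wp_randScalar {y : R} :
    wp S φ J (prim .randScalar () (y, ()) t) μ =
      mean (uniformNonzero (ZMod S.q)) fun u => wp S φ J t (μ.set .scalar y (.ofScalar u)) :=
  mean_map (β := Args S [.scalar]) _ _ _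

theorem wp_branch {x : R} {b : Bool} (hx : μ.reg .bool x = .ofBool b) :
    wp S φ J (branch x t t') μ = if b = true then wp S φ J t μ else wp S φ J t' μ := by
  subst hx
  rfl

/-- Reading an entry of a table, which is first drawn by `draw` if it is missing. -/
def lookup (s : Srt) (tab a b c : R) (draw : CodeTree out R L → CodeTree out R L)
    (t : CodeTree out R L) : CodeTree out R L :=
  load s tab a b c t (draw (store s tab a b c t))

/-- Whether found or drawn, the value ends up in the register and in the table. The conditions `hac`
and `hbc` prevent a drawn bit string from overwriting the indices under which it is stored. -/
theorem wp_lookup {s : Srt} {tab a b c : R} {draw : CodeTree out R L → CodeTree out R L}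
    {m r : List Bool} {p : PMF (Val S s)} (ha : μ.reg .bits a = .ofBits m) (hb : μ.reg .bits b = .ofBits r)
    (hac : s = .bits → a ≠ c) (hbc : s = .bits → b ≠ c)
    (hdraw : ∀ u, wp S φ J (draw u) μ = mean p fun v => wp S φ J u (μ.set s c v)) :
    wp S φ J (lookup s tab a b c draw t) μ = mean (drawn p (μ.tab s tab m r)) fun v =>
      wp S φ J t ((μ.set s c v).setTab s tab m r v) := by
  subst ha hb
  have h : ∀ d, (s = .bits → d ≠ c) → ∀ v, (μ.set s c v).reg .bits d = μ.reg .bits d := by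
    intro d hd v
    by_cases hs : s = .bits
    · exact Mem.set_reg_of_ne _ _ (hd hs) _ _
    · exact Mem.set_reg_of_srt_ne _ (Ne.symm hs) _ _ _
  rw [lookup, wp]
  split
  · next v hv =>
    have hv' : μ.tab s tab (μ.reg .bits a) (μ.reg .bits b) = some v := hv
    rw [hv', drawn, Option.elim_some, mean_pure]
    exact congrArg (wp S φ J t) (Mem.setTab_eq_self (μ := μ.set s c v) hv').symm
  · next hv =>
    have hv' : μ.tab s tab (μ.reg .bits a) (μ.reg .bits b) = none := hv
    rw [hv', drawn, Option.elim_none, hdraw]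
    simp only [wp, h a hac, h b hbc, Mem.set_reg_self]

/-- The code that looks up or draws a value of a hidden function. -/
theorem wp_reveal {s : Srt} {tab a b c : R} {draw : CodeTree out R L → CodeTree out R L}
    {m : List Bool} {p : PMF (Val S s)} {κ : List Bool → Option (Val S s)}
    (ha : μ.reg .bits a = .ofBits m) (hb : μ.reg .bits b = .ofBits [])
    (hac : s = .bits → a ≠ c) (hbc : s = .bits → b ≠ c)
    (hdraw : ∀ u, wp S φ J (draw u) μ = mean p fun v => wp S φ J u (μ.set s c v))
    (hκ : ∀ m, μ.tab s tab m [] = κ m) :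
    wp S φ J (lookup s tab a b c draw t) μ = mean (reveal p m κ) fun x =>
      wp S φ J t ((μ.set s c x.1).setTab s tab m [] x.1) := by
  rw [wp_lookup ha hb hac hbc hdraw, mean_reveal, hκ]

theorem wp_reveal_nat {tab a b c N : R} {m : List Bool} {n : ℕ} {κ : List Bool → Option ℕ}
    (ha : μ.reg .bits a = .ofBits m) (hb : μ.reg .bits b = .ofBits []) (hN : μ.reg .nat N = .ofNat n)
    (hκ : ∀ m, μ.tab .nat tab m [] = κ m) :
    wp S φ J (lookup .nat tab a b c (prim .randUpTo (N, ()) (c, ())) t) μ =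
      mean (reveal (uniformUpTo n) m κ) fun x =>
        wp S φ J t ((μ.set .nat c (.ofNat x.1)).setTab .nat tab m [] (.ofNat x.1)) :=
  wp_reveal (s := .nat) ha hb (by simp) (by simp) (fun _ => wp_randUpTo hN) hκ

theorem wp_reveal_bits {tab a b c N : R} {m : List Bool} {n : ℕ} {κ : List Bool → Option (List Bool)}
    (ha : μ.reg .bits a = .ofBits m) (hb : μ.reg .bits b = .ofBits []) (hN : μ.reg .nat N = .ofNat n)
    (hac : a ≠ c) (hbc : b ≠ c) (hκ : ∀ m, μ.tab .bits tab m [] = κ m) :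
    wp S φ J (lookup .bits tab a b c (prim .randBits (N, ()) (c, ())) t) μ =
      mean (reveal (uniformBits n) m κ) fun x =>
        wp S φ J t ((μ.set .bits c (.ofBits x.1)).setTab .bits tab m [] (.ofBits x.1)) :=
  wp_reveal (s := .bits) ha hb (fun _ => hac) (fun _ => hbc) (fun _ => wp_randBits hN) hκ

theorem wp_eq_nat {a b y : R} {v w : ℕ} (ha : μ.reg .nat a = .ofNat v) (hb : μ.reg .nat b = .ofNat w) :
    wp S φ J (prim (.eq .nat) (a, b, ()) (y, ()) t) μ =
      wp S φ J t (μ.set .bool y (.ofBool (decide (v = w)))) := by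
  rw [wp_eq ha hb]
  congr!

open Classical in
theorem wp_eq₃ {a b y : R} {v w : S.G₃} (ha : μ.reg .g₃ a = .of₃ v) (hb : μ.reg .g₃ b = .of₃ w) :
    wp S φ J (prim (.eq .g₃) (a, b, ()) (y, ()) t) μ =
      wp S φ J t (μ.set .bool y (.ofBool (decide (v = w)))) :=
  wp_eq ha hb

theorem setTab_tab_nil {s : Srt} {tab : R} {m : List Bool} {κ κ' : List Bool → Option (Val S s)}
    {v : Val S s} (hκ : ∀ m, μ.tab s tab m [] = κ m) (h : κ' = Function.update κ m (some v))
    (m' : List Bool) : (μ.setTab s tab m [] v).tab s tab m' [] = κ' m' := by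
  classical
  rw [Mem.setTab_tab_self, h]
  by_cases hm : m' = m
  · subst hm
    simp
  · simp [hm, hκ]

/-- The code that looks up or draws the logarithm of a hash value. -/
theorem rel_wp_log {r : ℝ≥0∞ → ℝ≥0∞ → Prop} (hr : MeanClosed r) {tab a b c : R}
    {m salt : List Bool} (ha : μ.reg .bits a = .ofBits m) (hb : μ.reg .bits b = .ofBits salt) {K : Type}
    {H : HashTable S} {κ : List Bool → Option K} {base : K → List Bool → S.G₁} {i : K}
    (hH : H.IsMultiple κ base (μ.tab .scalar tab)) (hi : κ m = some i) (h0 : base i salt ≠ 0)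
    {Φ : S.G₁ × HashTable S → ℝ≥0∞}
    (hf : ∀ (h : ZMod S.q) (H' : HashTable S), h ≠ 0 →
      H'.IsMultiple κ base
        (((μ.set .scalar c (.ofScalar h)).setTab .scalar tab m salt (.ofScalar h)).tab .scalar tab) →
      r (wp S φ J t ((μ.set .scalar c (.ofScalar h)).setTab .scalar tab m salt (.ofScalar h)))
        (Φ (scale h (base i salt), H'))) :
    r (wp S φ J (lookup .scalar tab a b c (fun u => prim .randScalar () (c, ()) u) t) μ)
      (mean (hashQuery S m salt H) Φ) := by
  rw [wp_lookup (s := .scalar) (p := uniformNonzero (ZMod S.q)) ha hb (by simp) (by simp)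
    fun u => wp_randScalar]
  refine hH.rel_hashQuery hr hi h0
    (f := fun h => wp S φ J t ((μ.set .scalar c (.ofScalar h)).setTab .scalar tab m salt (.ofScalar h)))
    fun h H' hh hH' => hf h H' hh ?_
  rw [Mem.setTab_tab_self]
  exact hH'

/-- The maximal cost as a natural number. -/
def natCost (pc : Prim → ℕ) : CodeTree out R L → ℕ
  | prim p _ _ t => pc p + natCost pc t
  | branch _ t₁ t₀ => 1 + max (natCost pc t₁) (natCost pc t₀)
  | store _ _ _ _ _ next => 1 + natCost pc next
  | load _ _ _ _ _ t₁ t₀ => 1 + max (natCost pc t₁) (natCost pc t₀)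
  | halt _ => 1
  | goto _ => 0

theorem cost_eq_natCost (pc : Prim → ℕ) (t : CodeTree out R L) :
    t.cost (fun p => pc p) 1 = t.natCost pc := by
  induction t <;> simp_all [cost, natCost, Nat.mono_cast.map_max]

end CodeTree

/-! ## Handlers with an invariant -/

section Guard

variable {O : Sig} {inp out : List Srt} {S : BilinearStructure} {σ : Type}

open Classical in
/-- A handler that gives default answers in the states without the property `Inv`. -/
def Handler.guard (h : Handler O S σ) (Inv : σ → Prop) (dflt : ∀ c, Args S (O.rets c)) :
    Handler O S σ :=
  fun c a s => if Inv s then h c a s else PMF.pure (dflt c, s)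

variable {h : Handler O S σ} {Inv : σ → Prop} {dflt : ∀ c, Args S (O.rets c)}
  {fmt : (c : O.Call) → Args S (O.rets c) → Prop}

theorem Handler.guard_apply {c : O.Call} {a : Args S (O.args c)} {s : σ} (hs : Inv s) :
    h.guard Inv dflt c a s = h c a s := if_pos hs

theorem Handler.guard_respects (hd : ∀ c, fmt c (dflt c))
    (hf : ∀ c a s, Inv s → ∀ v ∈ (h c a s).support, fmt c v.1) :
    (h.guard Inv dflt).Respects fmt := by
  intro c a s v hv
  by_cases hs : Inv s
  · rw [guard_apply hs] at hv
    exact hf c a s hs v hv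
  · rw [Handler.guard, if_neg hs, PMF.mem_support_pure_iff] at hv
    rw [hv]
    exact hd c

variable (P : Program O inp out) (T : Costs) (k : ℕ) {callCost : O.Call → ℕ}
  {v : Args S inp} {bound : (O.Call → ℕ) → Prop}

/-- `CallsBounded` concerns handlers whose answers have the format in all states, whereas the
oracles of the experiments are only known to give such answers in states with the invariant. The
guarded handler is of the first kind and agrees with the given one in all states that are reached.
-/
theorem Program.resultValue_le_bounded_of_invariant (hfmt : ∀ c, ∃ w, fmt c w)
    (hI : ∀ c a s, Inv s → ∀ w ∈ (h c a s).support, fmt c w.1 ∧ Inv w.2)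
    (hb : P.CallsBounded T k callCost S fmt v bound) {s : σ} (hs : Inv s)
    (J : Args S out → σ → ℝ≥0∞) (n : ℕ) :
    P.resultValue S (h.transformer fun _ => 0) J n P.start (Program.startMem S v) s ≤
      P.resultValue S (h.boundedTransformer bound) (fun w s => J w s.1) n P.start
        (Program.startMem S v) (s, fun _ => 0) := by
  choose dflt hd using hfmt
  refine le_trans ?_ ((P.resultValue_start_le_bounded S T k callCost (h.guard Inv dflt)
    (Handler.guard_respects hd fun c a s hs w hw => (hI c a s hs w hw).1) hb s J n).trans ?_)
  · refine P.value_le_value S (fun s t => s = t ∧ Inv s) ?_ ?_ ⟨rfl, hs⟩ n _ _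
    · rintro s _ ⟨rfl, hs⟩ c a Φ Φ' hΦ
      rw [Handler.transformer, Handler.transformer, Handler.guard_apply hs]
      exact add_le_add le_rfl (mean_mono_support fun w hw => hΦ _ _ _ ⟨rfl, (hI c a s hs w hw).2⟩)
    · rintro s _ ⟨rfl, hs⟩ w
      exact le_rfl
  · refine P.value_le_value S (fun s t => s = t ∧ Inv s.1) ?_ ?_ ⟨rfl, hs⟩ n _ _
    · rintro ⟨s, i⟩ _ ⟨rfl, hs⟩ c a Φ Φ' hΦ
      rw [Handler.boundedTransformer, Handler.boundedTransformer]
      dsimp only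
      rw [Handler.guard_apply hs]
      split_ifs
      · exact mean_mono_support fun w hw => hΦ _ _ _ ⟨rfl, (hI c a s hs w hw).2⟩
      · exact le_rfl
    · rintro s _ ⟨rfl, hs⟩ w
      exact le_rfl

/-- The guarded handler is one of those over which the supremum `worstTime` is taken. So its mean
time is finite, and its runs stop almost surely. -/
theorem Program.one_le_iSup_resultValue (hfmt : ∀ c, ∃ w, fmt c w) (hc : ∀ c, 1 ≤ callCost c)
    (hI : ∀ c a s, Inv s → ∀ w ∈ (h c a s).support, fmt c w.1 ∧ Inv w.2)
    (ht : P.worstTime T k callCost S fmt v < ⊤) {s : σ} (hs : Inv s) :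
    1 ≤ ⨆ n, P.resultValue S (h.transformer fun _ => 0) (fun _ _ => 1) n P.start
      (Program.startMem S v) s := by
  choose dflt hd using hfmt
  have hr : (h.guard Inv dflt).Respects fmt :=
    Handler.guard_respects hd fun c a s hs w hw => (hI c a s hs w hw).1
  have hle : P.meanTime T k callCost S (h.guard Inv dflt) v s ≤ P.worstTime T k callCost S fmt v :=
    le_iSup_of_le σ (le_iSup_of_le _ (le_iSup_of_le hr (le_iSup_of_le s le_rfl)))
  refine (P.iSup_resultValue_one S T k callCost (h.guard Inv dflt) hc v s
    (hle.trans_lt ht)).ge.trans (iSup_mono fun n => P.value_le_value S (fun s t => s = t ∧ Inv s)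
        ?_ ?_ ⟨rfl, hs⟩ n _ _)
  · rintro s _ ⟨rfl, hs⟩ c a Φ Φ' hΦ
    rw [Handler.transformer, Handler.transformer, Handler.guard_apply hs]
    exact add_le_add le_rfl (mean_mono_support fun w hw => hΦ _ _ _ ⟨rfl, (hI c a s hs w hw).2⟩)
  · rintro s _ ⟨rfl, hs⟩ w
    exact le_rfl

/-- The mean time of a run in which extra time is charged for the calls, and which may be stopped by
the answers. -/
theorem Program.value_exitTransformer_le
    {hx : (c : O.Call) → Args S (O.args c) → σ → PMF ((Args S (O.rets c) × σ) ⊕ Bool)}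
    (hfmt : ∀ c, ∃ w, fmt c w)
    (hI : ∀ c a s, Inv s → ∀ w, Sum.inl w ∈ (hx c a s).support → fmt c w.1 ∧ Inv w.2)
    {w : O.Call → ℝ≥0∞} {e : (O.Call → ℕ) → ℝ≥0∞} {b : ℝ≥0∞}
    (he : ∀ c i, e (@Function.update _ _ (Classical.decEq _) c i (c i + 1)) = e c + w i)
    (h0 : e (fun _ => 0) = 0)
    (hb : P.CallsBounded T k callCost S fmt v fun calls => e calls ≤ b)
    {cc : O.Call → ℝ≥0∞} (hcc : ∀ c, cc c ≤ callCost c + w c) (fc : ℝ≥0∞) {s : σ} (hs : Inv s)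
    (n : ℕ) :
    P.value S (fun p => Prim.cost T k p) 1 (Wrapper.exitTransformer hx (fun _ => 0) cc)
        (fun _ _ => fc) n P.start (Program.startMem S v) s ≤
      P.worstTime T k callCost S fmt v + b + fc := by
  choose dflt hd using hfmt
  -- Instead of being stopped, the run continues with a default answer. This can only take more
  -- time, and it makes `worstTime` applicable.
  set h' : Handler O S σ := fun c a s => (hx c a s).map (Sum.elim id fun _ => (dflt c, s)) with hh'
  have hr : (h'.guard Inv dflt).Respects fmt := by
    refine Handler.guard_respects hd fun c a s hs w hw => ?_
    rw [hh', PMF.mem_support_map_iff] at hw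
    obtain ⟨x, hx', rfl⟩ := hw
    cases x with
    | inl x => exact (hI c a s hs x hx').1
    | inr x => exact hd c
  have hle : P.meanTime T k callCost S (h'.guard Inv dflt) v s ≤ P.worstTime T k callCost S fmt v :=
    le_iSup_of_le σ (le_iSup_of_le _ (le_iSup_of_le hr (le_iSup_of_le s le_rfl)))
  have htr : ∀ c a s Φ Φ', (∀ v, Φ v ≤ Φ' v + fc) →
      (h'.guard Inv dflt).transformer (fun c => (callCost c : ℝ≥0∞) + w c) c a s Φ ≤
        (h'.guard Inv dflt).transformer (fun c => (callCost c : ℝ≥0∞) + w c) c a s Φ' + fc := by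
    intro c a s Φ Φ' hΦ
    rw [Handler.transformer, Handler.transformer, add_assoc (_ + _)]
    refine add_le_add le_rfl ?_
    exact (mean_mono hΦ).trans_eq ((mean_add _ _ _).trans (congrArg _ (mean_const _ _)))
  calc _ ≤ P.value S (fun p => Prim.cost T k p) 1
        ((h'.guard Inv dflt).transformer fun c => (callCost c : ℝ≥0∞) + w c) (fun _ _ => 1 + fc) n
        P.start (Program.startMem S v) s := ?_
    _ ≤ P.value S (fun p => Prim.cost T k p) 1
        ((h'.guard Inv dflt).transformer fun c => (callCost c : ℝ≥0∞) + w c) (fun _ _ => 1) n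
        P.start (Program.startMem S v) s + fc := P.value_add_le S htr (J := fun _ _ => 1) n _ _ _
    _ ≤ _ := add_le_add ((P.value_time_le S T k callCost (h'.guard Inv dflt) he h0 v s
        (hb σ _ hr s) n).trans (add_le_add hle le_rfl)) le_rfl
  refine P.value_le_value S (fun s t => s = t ∧ Inv s) ?_ ?_ ⟨rfl, hs⟩ n _ _
  · rintro s _ ⟨rfl, hs⟩ c a Φ Φ' hΦ
    rw [Wrapper.exitTransformer, Handler.transformer, Handler.guard_apply hs, hh', mean_map]
    refine add_le_add (hcc c) (mean_mono_support fun x hx' => ?_)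
    cases x with
    | inl x => exact hΦ _ _ _ ⟨rfl, (hI c a s hs x hx').2⟩
    | inr x => exact zero_le
  · rintro s _ ⟨rfl, hs⟩ w
    exact le_add_self

end Guard

/-! ## From forgers to solvers of PR₂ -/

/-- The registers of the reduction. -/
inductive ForgeReg
  | desc | P₂ | X | Y | Z | n | qS | qV | P₁ | W | left | zero | empty
  | coin | isX | log | m | r | h | Q₁ | Q₂ | V | e₁ | e₂ | last | ans

namespace ForgeReg

theorem finite : Finite ForgeReg := by
  refine Set.finite_univ_iff.1 ((List.finite_toSet [desc, P₂, X, Y, Z, n, qS, qV, P₁, W, left, zero,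
    empty, coin, isX, log, m, r, h, Q₁, Q₂, V, e₁, e₂, last, ans]).subset fun x _ => ?_)
  cases x <;> simp

/-- The registers for temporary values. -/
def Temp : ForgeReg → Prop
  | coin | isX | log | m | r | h | Q₁ | Q₂ | V | e₁ | e₂ | last | ans => True
  | _ => False

end ForgeReg

open CodeTree ForgeReg in
/-- The code of the reduction: every message has a hidden number up to `qS`. The hash values for
messages with the number `0` are multiples of `X`, the other ones are multiples of `P₁`. -/
def forgeWrapper : Wrapper efSig [.bits, .g₂, .nat, .g₂, .g₂] [.bits, .bits, .g₁, .g₂]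
    [.bits, .g₂, .g₁, .g₂, .g₂, .nat, .nat, .nat] [.g₁, .g₂] where
  R := ForgeReg
  finite := ForgeReg.finite
  dummy := isX
  input := (desc, P₂, X, Y, Z, n, qS, qV, ())
  init := prim .psi (P₂, ()) (P₁, ()) <| prim .psi (Y, ()) (W, ()) <|
    prim .randUpTo (qV, ()) (left, ()) <| goto ()
  initOut := (desc, P₂, n, Y, Z, ())
  arg
    | .hash => (m, r, ())
    | .sign => (m, ())
    | .verify => (m, r, Q₁, Q₂, ())
  ret
    | .hash => (h, ())
    | .sign => (r, h, ())
    | .verify => (ans, ())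
  body
    | .hash => lookup .nat coin m empty coin (prim .randUpTo (qS, ()) (coin, ())) <|
        lookup .scalar log m r log (prim .randScalar () (log, ())) <|
        prim (.eq .nat) (coin, zero, ()) (isX, ()) <|
        branch isX
          (prim .exp₁ (log, X, ()) (h, ()) <| goto ())
          (prim .exp₁ (log, P₁, ()) (h, ()) <| goto ())
    | .sign => lookup .nat coin m empty coin (prim .randUpTo (qS, ()) (coin, ())) <|
        prim (.eq .nat) (coin, zero, ()) (isX, ()) <|
        branch isX
          -- The signature would be a multiple of `xyP₁`, which is unknown. The run is given up,
          -- with an arbitrary output.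
          (halt (X, Z, ()))
          (prim .randBits (n, ()) (r, ()) <|
            lookup .scalar log m r log (prim .randScalar () (log, ())) <|
            prim .exp₁ (log, W, ()) (h, ()) <| goto ())
    | .verify => lookup .nat coin m empty coin (prim .randUpTo (qS, ()) (coin, ())) <|
        lookup .scalar log m r log (prim .randScalar () (log, ())) <|
        prim (.eq .nat) (coin, zero, ()) (isX, ()) <|
        branch isX
          -- A signature for a multiple of `X` cannot be checked. Such signatures are rejected until
          -- the counter `left` is zero; the next one is taken for valid and turned into the output.
          (prim (.eq .nat) (left, zero, ()) (last, ()) <|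
            branch last
              (prim .invS (log, ()) (log, ()) <| prim .exp₁ (log, Q₁, ()) (Q₁, ()) <|
                halt (Q₁, Q₂, ()))
              (prim .pred (left, ()) (left, ()) <| prim (.const false) () (ans, ()) <| goto ()))
          (prim .exp₁ (log, W, ()) (V, ()) <| prim .pairing (V, Z, ()) (e₁, ()) <|
            prim .pairing (Q₁, Q₂, ()) (e₂, ()) <| prim (.eq .g₃) (e₁, e₂, ()) (ans, ()) <| goto ())
  finIn := (m, r, Q₁, Q₂, ())
  -- The forgery is converted without regard to the number of its message. For a number other than
  -- `0` nothing is claimed about the output.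
  fin := lookup .nat coin m empty coin (prim .randUpTo (qS, ()) (coin, ())) <|
    lookup .scalar log m r log (prim .randScalar () (log, ())) <|
    prim .invS (log, ()) (log, ()) <| prim .exp₁ (log, Q₁, ()) (Q₁, ()) <| halt (Q₁, Q₂, ())

section Forge

variable (S : BilinearStructure)

/-- The state of the reduction: the random oracle, the hidden numbers of the messages and the number
of verifications for messages with the number `0` that are still answered. -/
abbrev ForgeState : Type := HashTable S × (List Bool → Option ℕ) × ℕ

variable (n qS : ℕ) (P₂ : S.G₂) (x y z : ZMod S.q)

/-- The signer has the secret key `y` and the verifier `z`. The uniform `j` is the guess of how many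
verifications for the number `0` precede the first valid one. -/
def forgeInit (qV : ℕ) : PMF (Args S [.bits, .g₂, .nat, .g₂, .g₂] × ForgeState S) :=
  (uniformUpTo qV).map fun j => (efInput S n P₂ y z, fun _ _ => none, fun _ => none, j)

/-- The answers are expressed by the secret keys and the true random oracle, although the code knows
neither `y` nor `z`. An exit `.inr true` means that the output is certain to be a solution; `.inr
false` claims nothing. -/
def forgeAnswer : (c : EFCall) → Args S (efSig.args c) → ForgeState S →
    PMF ((Args S (efSig.rets c) × ForgeState S) ⊕ Bool)
  | .hash, ((m : List Bool), (r : List Bool), _), (H, κ, j) =>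
      (reveal (uniformUpTo qS) m κ).bind fun c => (hashQuery S m r H).map fun g =>
        .inl ((g.1, ()), g.2, c.2, j)
  | .sign, ((m : List Bool), _), (H, κ, j) =>
      (reveal (uniformUpTo qS) m κ).bind fun c =>
        if c.1 = 0 then PMF.pure (.inr false)
        else (sign S n m y H).map fun g => .inl ((g.1.1, g.1.2, ()), g.2, c.2, j)
  | .verify, ((m : List Bool), (r : List Bool), (Q₁ : S.G₁), (Q₂ : S.G₂), _), (H, κ, j) =>
      (reveal (uniformUpTo qS) m κ).bind fun c =>
        (dverify S m r Q₁ Q₂ (scale y P₂) z H).map fun g =>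
          if c.1 = 0 then
            if j = 0 then .inr g.1 else .inl ((false, ()), g.2, c.2, j - 1)
          else .inl ((g.1, ()), g.2, c.2, j)

def forgeFinal : Args S [.bits, .bits, .g₁, .g₂] → ForgeState S → PMF Bool
  | ((m : List Bool), (r : List Bool), (Q₁ : S.G₁), (Q₂ : S.G₂), _), (H, κ, _) =>
      (reveal (uniformUpTo qS) m κ).bind fun c =>
        (dverify S m r Q₁ Q₂ (scale y P₂) z H).map fun g => decide (c.1 = 0) && g.1

/-- The contents of the registers for permanent values. -/
structure ForgeRegs (j : ℕ) (ν : Mem S ForgeReg) : Prop where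
  X : ν.reg .g₁ .X = .of₁ (scale x (S.ψ P₂))
  P₁ : ν.reg .g₁ .P₁ = .of₁ (S.ψ P₂)
  W : ν.reg .g₁ .W = .of₁ (S.ψ (scale y P₂))
  Z : ν.reg .g₂ .Z = .of₂ (scale z P₂)
  n : ν.reg .nat .n = .ofNat n
  qS : ν.reg .nat .qS = .ofNat qS
  left : ν.reg .nat .left = .ofNat j
  zero : ν.reg .nat .zero = .ofNat 0
  empty : ν.reg .bits .empty = .ofBits []

variable {S n qS P₂ x y z} {j : ℕ} {ν : Mem S ForgeReg}

theorem ForgeRegs.set (h : ForgeRegs S n qS P₂ x y z j ν) {t : ForgeReg} (ht : t.Temp) (s : Srt)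
    (v : Val S s) : ForgeRegs S n qS P₂ x y z j (ν.set s t v) := by
  have key : ∀ s' u, ¬ u.Temp → (ν.set s t v).reg s' u = ν.reg s' u := fun s' u hu =>
    Mem.set_reg_of_ne _ _ (fun e : u = t => hu (by rwa [e])) _ _
  exact ⟨(key _ _ id).trans h.X, (key _ _ id).trans h.P₁, (key _ _ id).trans h.W,
    (key _ _ id).trans h.Z, (key _ _ id).trans h.n, (key _ _ id).trans h.qS,
    (key _ _ id).trans h.left, (key _ _ id).trans h.zero, (key _ _ id).trans h.empty⟩

theorem ForgeRegs.set_left (h : ForgeRegs S n qS P₂ x y z j ν) (i : ℕ) :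
    ForgeRegs S n qS P₂ x y z i (ν.set .nat .left (.ofNat i)) := by
  refine ⟨?_, ?_, ?_, ?_, ?_, ?_, ?_, ?_, ?_⟩ <;> simp [h.X, h.P₁, h.W, h.Z, h.n, h.qS, h.zero, h.empty]

theorem ForgeRegs.setTab (h : ForgeRegs S n qS P₂ x y z j ν) (t : ForgeReg) (s : Srt)
    (a b : List Bool) (v : Val S s) : ForgeRegs S n qS P₂ x y z j (ν.setTab s t a b v) :=
  ⟨h.X, h.P₁, h.W, h.Z, h.n, h.qS, h.left, h.zero, h.empty⟩

variable (S n qS P₂ x y z) in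
/-- The elements of which the hash values are multiples. -/
def forgeBase (c : ℕ) (_ : List Bool) : S.G₁ := if c = 0 then scale x (S.ψ P₂) else S.ψ P₂

theorem forgeBase_ne_zero (hP : P₂ ≠ 0) (hx : x ≠ 0) (c : ℕ) (r : List Bool) :
    forgeBase S P₂ x c r ≠ 0 := by
  rw [forgeBase]
  split_ifs
  · exact scale_ne_zero S.card₁ hx (S.psi_ne_zero hP)
  · exact S.psi_ne_zero hP

variable (S n qS P₂ x y z) in
/-- The memory represents the state. -/
structure ForgeRel (ν : Mem S ForgeReg) (s : ForgeState S) : Prop where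
  regs : ForgeRegs S n qS P₂ x y z s.2.2 ν
  coin : ∀ m, ν.tab .nat .coin m [] = s.2.1 m
  log : s.1.IsMultiple s.2.1 (forgeBase S P₂ x) (ν.tab .scalar .log)

open CodeTree

/-- The first part of the code for a call. -/
theorem rel_wp_coin {r : ℝ≥0∞ → ℝ≥0∞ → Prop} (hr : MeanClosed r) {out : List Srt} {L : Type}
    {φ : L → Mem S ForgeReg → ℝ≥0∞} {J : Args S out → ℝ≥0∞} {t : CodeTree out ForgeReg L}
    {s : ForgeState S} (h : ForgeRel S n qS P₂ x y z ν s) {m : List Bool}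
    (hm : ν.reg .bits .m = .ofBits m) {β : Type} {F : β → ℝ≥0∞}
    {g : ℕ × (List Bool → Option ℕ) → PMF β}
    (hf : ∀ c κ', κ' m = some c →
      ForgeRel S n qS P₂ x y z
        ((ν.set .nat .coin (.ofNat c)).setTab .nat .coin m [] (.ofNat c)) (s.1, κ', s.2.2) →
      r (wp S φ J t ((ν.set .nat .coin (.ofNat c)).setTab .nat .coin m [] (.ofNat c)))
        (mean (g (c, κ')) F)) :
    r (wp S φ J (lookup .nat .coin .m .empty .coin (prim .randUpTo (.qS, ()) (.coin, ())) t) ν)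
      (mean ((reveal (uniformUpTo qS) m s.2.1).bind g) F) := by
  refine (congrArg (r · _) (wp_reveal_nat hm h.regs.empty h.regs.qS h.coin)).mpr ?_
  refine hr.rel_bind fun c hc => ?_
  obtain ⟨hH, hc', hu⟩ := h.log.reveal hc
  refine hf c.1 c.2 hc' ⟨(h.regs.set (t := .coin) trivial _ _).setTab _ _ _ _ _, ?_, ?_⟩
  · exact setTab_tab_nil (s := .nat) (κ := s.2.1) h.coin hu
  · rw [Mem.setTab_tab_of_srt_ne _ (by simp)]
    exact hH

/-- The second part of the code for a call. -/
theorem rel_wp_forgeLog {r : ℝ≥0∞ → ℝ≥0∞ → Prop} (hr : MeanClosed r) (hP : P₂ ≠ 0) (hx : x ≠ 0)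
    {out : List Srt} {L : Type}
    {φ : L → Mem S ForgeReg → ℝ≥0∞} {J : Args S out → ℝ≥0∞} {t : CodeTree out ForgeReg L}
    {s : ForgeState S} (hs : ForgeRel S n qS P₂ x y z ν s) {m salt : List Bool}
    (hm : ν.reg .bits .m = .ofBits m) (hsalt : ν.reg .bits .r = .ofBits salt) {c : ℕ}
    (hc : s.2.1 m = some c) {β : Type} {F : β → ℝ≥0∞} {g : S.G₁ × HashTable S → β}
    (hf : ∀ (h : ZMod S.q) H', h ≠ 0 →
      ForgeRel S n qS P₂ x y z
        ((ν.set .scalar .log (.ofScalar h)).setTab .scalar .log m salt (.ofScalar h)) (H', s.2) →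
      r (wp S φ J t ((ν.set .scalar .log (.ofScalar h)).setTab .scalar .log m salt (.ofScalar h)))
        (F (g (scale h (forgeBase S P₂ x c salt), H')))) :
    r (wp S φ J (lookup .scalar .log .m .r .log (prim .randScalar () (.log, ())) t) ν)
      (mean ((hashQuery S m salt s.1).map g) F) := by
  rw [mean_map]
  refine rel_wp_log hr hm hsalt hs.log hc (forgeBase_ne_zero hP hx c salt) fun h H' hh hH' => ?_
  refine hf h H' hh ⟨(hs.regs.set (t := .log) trivial _ _).setTab _ _ _ _ _, fun m' => ?_, hH'⟩
  rw [Mem.setTab_tab_of_srt_ne _ (by simp)]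
  exact hs.coin m'

theorem ForgeRel.set {s : ForgeState S} (hs : ForgeRel S n qS P₂ x y z ν s) {t : ForgeReg}
    (ht : t.Temp) (i : Srt) (v : Val S i) : ForgeRel S n qS P₂ x y z (ν.set i t v) s :=
  ⟨hs.regs.set ht i v, hs.coin, hs.log⟩

/-- The meaning of the result. -/
def ForgeRes (S : BilinearStructure) (P₂ : S.G₂) (x y z : ZMod S.q) :
    Args S [.g₁, .g₂] → Bool → Prop
  | ((R : S.G₁), (Q : S.G₂), _), b => b = true → S.e R Q = S.e (S.ψ P₂) P₂ ^ (x * y * z).val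

theorem forgeRes_read {Q₁ : S.G₁} {Q₂ : S.G₂} {b : Bool} (h₁ : ν.reg .g₁ .Q₁ = .of₁ Q₁)
    (h₂ : ν.reg .g₂ .Q₂ = .of₂ Q₂)
    (h : b = true → S.e Q₁ Q₂ = S.e (S.ψ P₂) P₂ ^ (x * y * z).val) :
    ForgeRes S P₂ x y z (ν.read [.g₁, .g₂] (.Q₁, .Q₂, ())) b := fun hb =>
  (congrArg₂ (fun (R : S.G₁) (Q : S.G₂) => S.e R Q) h₁ h₂).trans (h hb)

/-- A fresh logarithm stands for a fresh hash value with either base. For the base `P₁`, the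
multiple of `ψ(Y)` by the logarithm is the signature, because scalars commute with each other and
with `ψ`, and `e_verify` justifies the test. For the base `X` the output is justified by
`e_forgery`. -/
theorem forgeWrapper_implements (hP : P₂ ≠ 0) (hx : x ≠ 0) (qV : ℕ) :
    forgeWrapper.Implements (pr2Input S (n, qS, qV) P₂ x y z) (ForgeRel S n qS P₂ x y z)
      (ForgeRes S P₂ x y z) (forgeInit S n P₂ y z qV) (forgeAnswer S n qS P₂ y z)
      (forgeFinal S qS P₂ y z) where
  init := by
    intro r hr (Ψ : Mem S ForgeReg → ℝ≥0∞) Φ J hΨ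
    let ν₀ : Mem S ForgeReg := ((((((((Mem.init S ForgeReg).set .bits .desc (.ofBits S.desc)).set
      .g₂ .P₂ (.of₂ P₂)).set .g₁ .X (.of₁ (scale x (S.ψ P₂)))).set .g₂ .Y (.of₂ (scale y P₂))).set
      .g₂ .Z (.of₂ (scale z P₂))).set .nat .n (.ofNat n)).set .nat .qS (.ofNat qS)).set
      .nat .qV (.ofNat qV)
    change r (wp (R := ForgeReg) S (fun _ => Ψ) J (prim .psi (.P₂, ()) (.P₁, ()) <|
      prim .psi (.Y, ()) (.W, ()) <| prim .randUpTo (.qV, ()) (.left, ()) <| goto ()) ν₀) _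
    rw [wp_psi (g := P₂) (by simp [ν₀]), wp_psi (g := scale y P₂) (by simp [ν₀]),
      wp_randUpTo (n := qV) (by simp [ν₀])]
    refine hr.rel_map fun j _ => ?_
    let ν₁ : Mem S ForgeReg := ((ν₀.set .g₁ .P₁ (.of₁ (S.ψ P₂))).set .g₁ .W
      (.of₁ (S.ψ (scale y P₂)))).set .nat .left (.ofNat j)
    have h₁ : ν₁.reg .bits .desc = .ofBits S.desc := by simp [ν₁, ν₀]
    have h₂ : ν₁.reg .g₂ .P₂ = .of₂ P₂ := by simp [ν₁, ν₀]
    have h₃ : ν₁.reg .nat .n = .ofNat n := by simp [ν₁, ν₀]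
    have h₄ : ν₁.reg .g₂ .Y = .of₂ (scale y P₂) := by simp [ν₁, ν₀]
    have h₅ : ν₁.reg .g₂ .Z = .of₂ (scale z P₂) := by simp [ν₁, ν₀]
    have hread : ν₁.read [.bits, .g₂, .nat, .g₂, .g₂] (.desc, .P₂, .n, .Y, .Z, ()) =
        efInput S n P₂ y z :=
      congrArg₂ Prod.mk h₁ (congrArg₂ Prod.mk h₂ (congrArg₂ Prod.mk h₃ (congrArg₂ Prod.mk h₄
        (congrArg (fun a => (a, ())) h₅))))
    refine (congrArg (fun w => r (Ψ ν₁) (Φ (w, fun _ _ => none, fun _ => none, j))) hread).mp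
      (hΨ ν₁ _ ⟨⟨?_, ?_, ?_, h₅, h₃, ?_, ?_, ?_, ?_⟩, fun _ => rfl, fun _ _ => Or.inl ⟨rfl, rfl⟩⟩)
    all_goals simp [ν₁, ν₀]
    all_goals rfl
  call := by
    intro r hr c (Ψ : Mem S ForgeReg → ℝ≥0∞) Φ J pay hΨ hJ a (ν : Mem S ForgeReg) s hs
    obtain ⟨H, κ, j⟩ := s
    cases c with
    | hash =>
      have hΨ : ∀ (ν : Mem S ForgeReg) s, ForgeRel S n qS P₂ x y z ν s → ∀ g,
          ν.reg .g₁ .h = .of₁ g → r (Ψ ν) (Φ ((g, ()), s)) := fun ν s hs g hg =>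
        (congrArg (fun g => r (Ψ ν) (Φ ((g, ()), s))) hg).mp (hΨ ν s hs)
      obtain ⟨(m : List Bool), (salt : List Bool), ⟨⟩⟩ := a
      refine rel_wp_coin hr ((hs.set (t := .m) trivial .bits (.ofBits m)).set (t := .r) trivial .bits
        (.ofBits salt)) (by simp) fun c κ' hκ hs => ?_
      refine rel_wp_forgeLog hr hP hx hs (by simp) (by simp) hκ fun h H' hh hs => ?_
      rw [wp_eq_nat (v := c) (w := 0) (by simp) hs.regs.zero, wp_branch (b := decide (c = 0)) (by simp)]
      have hs := hs.set (t := .isX) trivial .bool (.ofBool (decide (c = 0)))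
      rw [forgeBase]
      by_cases hc : c = 0
      · rw [if_pos (by simpa), wp_exp₁ (u := h) (by simp) hs.regs.X, if_pos hc]
        exact hΨ _ _ (hs.set (t := .h) trivial _ _) _ (by simp)
      · rw [if_neg (by simpa), wp_exp₁ (u := h) (by simp) hs.regs.P₁, if_neg hc]
        exact hΨ _ _ (hs.set (t := .h) trivial _ _) _ (by simp)
    | sign =>
      have hΨ : ∀ (ν : Mem S ForgeReg) s, ForgeRel S n qS P₂ x y z ν s → ∀ r' g,
          ν.reg .bits .r = .ofBits r' → ν.reg .g₁ .h = .of₁ g → r (Ψ ν) (Φ ((r', g, ()), s)) :=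
        fun ν s hs r' g hr' hg => (congrArg₂ (fun r' g => r (Ψ ν) (Φ ((r', g, ()), s))) hr' hg).mp
          (hΨ ν s hs)
      obtain ⟨(m : List Bool), ⟨⟩⟩ := a
      refine rel_wp_coin hr (hs.set (t := .m) trivial .bits (.ofBits m)) (by simp) fun c κ' hκ hs => ?_
      rw [wp_eq_nat (v := c) (w := 0) (by simp) hs.regs.zero, wp_branch (b := decide (c = 0)) (by simp)]
      have hs := hs.set (t := .isX) trivial .bool (.ofBool (decide (c = 0)))
      by_cases hc : c = 0
      · rw [if_pos (by simpa), if_pos hc, mean_pure]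
        exact hJ _ _ nofun
      · rw [if_neg (by simpa), if_neg hc, wp_randBits hs.regs.n, sign, PMF.map_bind]
        refine hr.rel_bind fun salt _ => ?_
        rw [PMF.map_comp]
        refine rel_wp_forgeLog hr hP hx (hs.set (t := .r) trivial .bits (.ofBits salt)) (by simp)
          (by simp) hκ fun h H' hh hs => ?_
        rw [wp_exp₁ (u := h) (by simp) hs.regs.W]
        refine hΨ _ _ (hs.set (t := .h) trivial _ _) _ _ (by simp) ?_
        rw [forgeBase, if_neg hc, Mem.set_reg_self, S.psi_scale, scale_comm S.card₁]
    | verify =>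
      have hΨ : ∀ (ν : Mem S ForgeReg) s, ForgeRel S n qS P₂ x y z ν s → ∀ b,
          ν.reg .bool .ans = .ofBool b → r (Ψ ν) (Φ ((b, ()), s)) := fun ν s hs b hb =>
        (congrArg (fun b => r (Ψ ν) (Φ ((b, ()), s))) hb).mp (hΨ ν s hs)
      obtain ⟨(m : List Bool), (salt : List Bool), (Q₁ : S.G₁), (Q₂ : S.G₂), ⟨⟩⟩ := a
      refine rel_wp_coin hr ((((hs.set (t := .m) trivial .bits (.ofBits m)).set (t := .r) trivial .bits
        (.ofBits salt)).set (t := .Q₁) trivial .g₁ (.of₁ Q₁)).set (t := .Q₂) trivial .g₂ (.of₂ Q₂))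
        (by simp) fun c κ' hκ hs => ?_
      rw [dverify, PMF.map_comp]
      refine rel_wp_forgeLog hr hP hx hs (by simp) (by simp) hκ fun h H' hh hs => ?_
      rw [wp_eq_nat (v := c) (w := 0) (by simp) hs.regs.zero, wp_branch (b := decide (c = 0)) (by simp)]
      have hs := hs.set (t := .isX) trivial .bool (.ofBool (decide (c = 0)))
      rw [forgeBase, Function.comp_apply]
      dsimp only
      by_cases hc : c = 0
      · rw [if_pos (by simpa), if_pos hc, if_pos hc, wp_eq_nat hs.regs.left hs.regs.zero,
          wp_branch (b := decide (j = 0)) (by simp)]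
        have hs := hs.set (t := .last) trivial .bool (.ofBool (decide (j = 0)))
        by_cases hj : j = 0
        · rw [if_pos (by simpa), if_pos hj, wp_invS (u := h) (by simp),
            wp_exp₁ (u := h⁻¹) (g := Q₁) (by simp) (by simp)]
          exact hJ _ _ (forgeRes_read (by simp) (by simp) fun he =>
            S.e_forgery hh (@of_decide_eq_true _ (_) he))
        · rw [if_neg (by simpa), if_neg hj, wp_pred hs.regs.left, wp_const]
          exact hΨ _ _ (ForgeRel.set (s := (H', κ', j - 1)) ⟨hs.regs.set_left _, hs.coin, hs.log⟩
            (t := .ans) trivial .bool (.ofBool false)) _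
            (by simp)
      · rw [if_neg (by simpa), if_neg hc, if_neg hc, wp_exp₁ (u := h) (by simp) hs.regs.W]
        have hs := hs.set (t := .V) trivial .g₁ (.of₁ (scale h (S.ψ (scale y P₂))))
        rw [wp_pairing (g := scale h (S.ψ (scale y P₂))) (by simp) hs.regs.Z,
          wp_pairing (g := Q₁) (g' := Q₂) (by simp) (by simp), wp_eq₃ (v := S.e (scale h (S.ψ
              (scale y P₂))) (scale z P₂))
            (w := S.e Q₁ Q₂) (by simp) (by simp),
          S.e_verify]
        exact hΨ _ _ (((hs.set (t := .e₁) trivial _ _).set (t := .e₂) trivial _ _).set (t := .ans)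
          trivial _ _) _ (by simp)
  fin := by
    intro r hr J pay hJ a (ν : Mem S ForgeReg) s hs
    obtain ⟨H, κ, j⟩ := s
    obtain ⟨(m : List Bool), (salt : List Bool), (Q₁ : S.G₁), (Q₂ : S.G₂), ⟨⟩⟩ := a
    refine rel_wp_coin (m := m) (φ := fun e : Empty => (e.elim : Mem S ForgeReg → ℝ≥0∞)) hr
        ((((hs.set (t := .m) trivial .bits (.ofBits m)).set (t := .r) trivial .bits
      (.ofBits salt)).set (t := .Q₁) trivial .g₁ (.of₁ Q₁)).set (t := .Q₂) trivial .g₂ (.of₂ Q₂))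
      (by simp) fun c κ' hκ hs => ?_
    rw [dverify, PMF.map_comp]
    refine rel_wp_forgeLog hr hP hx hs (m := m) (by simp) (by simp) hκ fun h H' hh hs => ?_
    rw [wp_invS (u := h) (by simp), wp_exp₁ (u := h⁻¹) (g := Q₁) (by simp) (by simp)]
    refine hJ _ _ (forgeRes_read (Q₁ := scale h⁻¹ Q₁) (Q₂ := Q₂) (by simp) (by simp) fun he => ?_)
    rw [Function.comp_apply, Bool.and_eq_true, decide_eq_true_iff] at he
    rw [forgeBase, if_pos he.1] at he
    exact S.e_forgery hh (@of_decide_eq_true _ (_) he.2)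

end Forge

/-! ### The guess of the first valid verification. -/

section Forge

variable {S : BilinearStructure} {n qS : ℕ} {P₂ : S.G₂} {x y z : ZMod S.q}

/-- The payoff for a success. -/
def truePayoff (b : Bool) : ℝ≥0∞ := if b = true then 1 else 0

theorem truePayoff_le_one (b : Bool) : truePayoff b ≤ 1 := by
  cases b <;> simp [truePayoff]

variable (S n qS P₂ y z) in
/-- Answers as in the experiment of the forger, except that the run ends when a message with the
number `0` is signed, or when the number of verifications is exhausted. -/
def forgeIdeal : CallTransformer efSig S (ForgeState S)
  | .hash, ((m : List Bool), (r : List Bool), _), (H, κ, j), Φ =>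
      mean (reveal (uniformUpTo qS) m κ) fun c => mean (hashQuery S m r H) fun g =>
        Φ ((g.1, ()), g.2, c.2, j)
  | .sign, ((m : List Bool), _), (H, κ, j), Φ =>
      mean (reveal (uniformUpTo qS) m κ) fun c =>
        if c.1 = 0 then 0
        else mean (sign S n m y H) fun g => Φ ((g.1.1, g.1.2, ()), g.2, c.2, j)
  | .verify, ((m : List Bool), (r : List Bool), (Q₁ : S.G₁), (Q₂ : S.G₂), _), (H, κ, j), Φ =>
      if j = 0 then 0
      else mean (reveal (uniformUpTo qS) m κ) fun c =>
        mean (dverify S m r Q₁ Q₂ (scale y P₂) z H) fun g => Φ ((g.1, ()), g.2, c.2, j - 1)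

theorem forgeIdeal_le {c : EFCall} {a : Args S (efSig.args c)} {s : ForgeState S}
    {Φ : Args S (efSig.rets c) × ForgeState S → ℝ≥0∞} {b : ℝ≥0∞} (h : ∀ v, Φ v ≤ b) :
    forgeIdeal S n qS P₂ y z c a s Φ ≤ b := by
  obtain ⟨H, κ, j⟩ := s
  cases c with
  | hash => exact mean_le_const fun _ => mean_le_const fun _ => h _
  | sign =>
    refine mean_le_const fun _ => ?_
    split_ifs
    · exact zero_le
    · exact mean_le_const fun _ => h _
  | verify =>
    by_cases hj : j = 0
    · exact (if_pos hj).trans_le zero_le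
    · exact (if_neg hj).trans_le (mean_le_const fun _ => mean_le_const fun _ => h _)

variable (A : Forger)

/-- The reduction guesses which verification is the first one of a forgery. -/
theorem forgeIdeal_le_sum (H : HashTable S) (κ : List Bool → Option ℕ) (j i : ℕ) (l : A.L)
    (μ : Mem S A.R) :
    A.resultValue S (forgeIdeal S n qS P₂ y z) (fun w s => mean (forgeFinal S qS P₂ y z w s) truePayoff)
        i l μ (H, κ, j) ≤
      ∑ j' ∈ Finset.range (j + 1), A.resultValue S
        (Wrapper.exitTransformer (forgeAnswer S n qS P₂ y z) truePayoff fun _ => 0)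
        (fun w s => mean (forgeFinal S qS P₂ y z w s) truePayoff) i l μ (H, κ, j') := by
  have h1 : ∀ i l μ s, A.resultValue S (forgeIdeal S n qS P₂ y z)
      (fun w s => mean (forgeFinal S qS P₂ y z w s) truePayoff) i l μ s ≤ 1 := fun i l μ s =>
    A.resultValue_le_const S (fun _ _ _ _ h => forgeIdeal_le h)
      (fun w s => mean_le_const truePayoff_le_one) i l μ s
  have := A.resultValue_le_average S
    (H := forgeIdeal S n qS P₂ y z) (J := fun w s => mean (forgeFinal S qS P₂ y z w s) truePayoff)
    (H' := Wrapper.exitTransformer (forgeAnswer S n qS P₂ y z) truePayoff fun _ => 0)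
    (J' := fun w s => mean (forgeFinal S qS P₂ y z w s) truePayoff)
    -- There is neither a loss nor an error: `K` is the sum over all guesses up to the present
    -- counter of the ideal run.
    (fun α s K ε => α = 1 ∧ ε = 0 ∧
      K = fun F => ∑ j' ∈ Finset.range (s.2.2 + 1), F (s.1, s.2.1, j')) ?_ ?_ ?_
    (s := (H, κ, j)) ⟨rfl, rfl, rfl⟩ i l μ
  · simpa using this
  · rintro _ s _ _ ⟨rfl, rfl, rfl⟩ γ p F
    exact (mean_sum _ _ _).symm
  · rintro _ ⟨H, κ, j⟩ _ _ ⟨rfl, rfl, rfl⟩ w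
    change 1 * _ ≤ (∑ j' ∈ Finset.range (j + 1), mean (forgeFinal S qS P₂ y z w (H, κ, j'))
      truePayoff) + 0
    rw [one_mul, add_zero, Finset.sum_range_succ]
    exact le_add_left le_rfl
  · rintro _ ⟨H, κ, j⟩ _ _ ⟨rfl, rfl, rfl⟩ c a i l μ ih
    have ih : ∀ (s : ForgeState S) v, A.resultValue S (forgeIdeal S n qS P₂ y z)
        (fun w s => mean (forgeFinal S qS P₂ y z w s) truePayoff) i l (μ v) s ≤
          ∑ j' ∈ Finset.range (s.2.2 + 1), A.resultValue S
            (Wrapper.exitTransformer (forgeAnswer S n qS P₂ y z) truePayoff fun _ => 0)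
            (fun w s => mean (forgeFinal S qS P₂ y z w s) truePayoff) i l (μ v) (s.1, s.2.1, j') := by
      intro s v
      simpa using ih 1 s _ 0 ⟨rfl, rfl, rfl⟩ v
    rw [one_mul, add_zero]
    simp only [Wrapper.exitTransformer, zero_add]
    cases c with
    | hash =>
      obtain ⟨(m : List Bool), (salt : List Bool), ⟨⟩⟩ := a
      simp only [forgeAnswer, forgeIdeal, mean_bind, mean_map, Sum.elim_inl]
      rw [← mean_sum]
      refine mean_mono fun c => ?_
      rw [← mean_sum]
      exact mean_mono fun g => ih _ _
    | sign =>
      obtain ⟨(m : List Bool), ⟨⟩⟩ := a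
      simp only [forgeAnswer, forgeIdeal, mean_bind]
      rw [← mean_sum]
      refine mean_mono fun c => ?_
      split_ifs
      · exact zero_le
      · simp only [mean_map, Sum.elim_inl]
        rw [← mean_sum]
        exact mean_mono fun g => ih _ _
    | verify =>
      obtain ⟨(m : List Bool), (salt : List Bool), (Q₁ : S.G₁), (Q₂ : S.G₂), ⟨⟩⟩ := a
      simp only [forgeAnswer, forgeIdeal, mean_bind, mean_map]
      split_ifs with hj
      · exact zero_le
      · obtain ⟨j, rfl⟩ := Nat.exists_eq_succ_of_ne_zero hj
        rw [← mean_sum]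
        refine mean_mono fun c => ?_
        rw [← mean_sum]
        refine mean_mono fun g => ?_
        -- For the number `0`, the guess `0` wins at once if the signature is valid. If it is
        -- invalid, the guesses `j' + 1` have given the correct answer and continue as the sum for
        -- the smaller counter. For other numbers all guesses are kept, and the largest one is
        -- superfluous.
        by_cases hc : c.1 = 0
        · simp only [if_pos hc]
          rw [Finset.sum_range_succ']
          simp only [if_true, Nat.add_eq_zero_iff, one_ne_zero, and_false, if_false, Sum.elim_inl,
            Sum.elim_inr]
          cases hg : g.1 with
          | true => exact (h1 _ _ _ _).trans (le_add_left (by simp [truePayoff]))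
          | false => exact (ih _ _).trans (le_add_right le_rfl)
        · simp only [if_neg hc, Sum.elim_inl]
          exact (ih _ _).trans (Finset.sum_le_sum_of_subset (Finset.range_mono (by simp)))

end Forge

/-! ### The guess of the message of the forgery. -/

section Forge

variable {S : BilinearStructure} {n qS : ℕ} {P₂ : S.G₂} {x y z : ZMod S.q}

theorem le_mean_uniformUpTo {f : ℕ → ℝ≥0∞} {b : ℝ≥0∞} (h : ∀ i, i ≠ 0 → b ≤ f i) :
    ((qS : ℝ≥0∞) + 1)⁻¹ * qS * b ≤ mean (uniformUpTo qS) f := by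
  rw [mean_uniformUpTo, mul_assoc, Finset.sum_range_succ']
  gcongr
  refine le_add_right ?_
  calc (qS : ℝ≥0∞) * b = ∑ _i ∈ Finset.range qS, b := by simp
    _ ≤ _ := Finset.sum_le_sum fun i _ => h _ (Nat.succ_ne_zero i)

theorem mean_uniformUpTo_zero_le (f : ℕ → ℝ≥0∞) :
    ((qS : ℝ≥0∞) + 1)⁻¹ * f 0 ≤ mean (uniformUpTo qS) f := by
  rw [mean_uniformUpTo, Finset.sum_range_succ']
  gcongr
  exact le_add_self

/-- Which hidden numbers are known when the messages in `L` are signed: the numbers of these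
messages, and they are not `0`. -/
structure ForgeHidden (L : Set (List Bool)) (κ : List Bool → Option ℕ) (D : List (List Bool)) :
    Prop where
  signed : ∀ m ∈ L, ∃ c, c ≠ 0 ∧ κ m = some c
  unsigned : ∀ m, m ∉ L → κ m = none
  drawn : ∀ m ∈ D, m ∉ L

variable {L : Set (List Bool)} {κ : List Bool → Option ℕ} {D : List (List Bool)}

/-- A number that only the simulation uses remains hidden: its draw is absorbed into the hidden
part, as the continuation does not depend on its value. -/
theorem ForgeHidden.exists_mean_reveal (h : ForgeHidden L κ D) (m : List Bool) :
    ∃ D', ForgeHidden L κ D' ∧ ∀ F : (List Bool → Option ℕ) → ℝ≥0∞,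
      (mean (hiddenFun (uniformUpTo qS) κ D) fun κ' => mean (reveal (uniformUpTo qS) m κ')
        fun c => F c.2) = mean (hiddenFun (uniformUpTo qS) κ D') F := by
  by_cases hm : m ∈ L
  · obtain ⟨c, -, hc⟩ := h.signed m hm
    exact ⟨D, h, fun F => mean_hidden_reveal_of_some (fun hD => h.drawn m hD hm) hc fun c => F c.2⟩
  · refine ⟨m :: D, ⟨h.signed, h.unsigned, ?_⟩, fun F => ?_⟩
    · simpa [hm] using h.drawn
    · rw [mean_hidden_reveal (Or.inr (h.unsigned m hm)) fun c => F c.2, mean_hidden_cons]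

/-- The first signature for `m` reveals its number, and `qS` of the `qS + 1` possible numbers are
harmless. For a message signed before, the number is known not to be `0`, and the factor is given
away. -/
theorem ForgeHidden.le_mean_sign (h : ForgeHidden L κ D) (m : List Bool) {b : ℝ≥0∞}
    {F : (List Bool → Option ℕ) → ℝ≥0∞}
    (hF : ∀ κ' D', ForgeHidden (insert m L) κ' D' →
      b ≤ mean (hiddenFun (uniformUpTo qS) κ' D') F) :
    ((qS : ℝ≥0∞) + 1)⁻¹ * qS * b ≤
      mean (hiddenFun (uniformUpTo qS) κ D) fun κ' => mean (reveal (uniformUpTo qS) m κ')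
        fun c => if c.1 = 0 then 0 else F c.2 := by
  by_cases hm : m ∈ L
  · obtain ⟨c, hc0, hc⟩ := h.signed m hm
    rw [mean_hidden_reveal_of_some (fun hD => h.drawn m hD hm) hc]
    simp only [if_neg hc0]
    refine le_trans ?_ (hF κ D (by rwa [Set.insert_eq_of_mem hm]))
    refine mul_le_of_le_one_left' ?_
    rw [mul_comm, ← div_eq_mul_inv]
    exact ENNReal.div_le_of_le_mul (by simp)
  · rw [mean_hidden_reveal (Or.inr (h.unsigned m hm))]
    refine le_mean_uniformUpTo fun c hc => ?_
    simp only [if_neg hc]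
    rw [mean_hidden_update]
    refine hF _ _ ⟨fun m' hm' => ?_, fun m' hm' => ?_, fun m' hm' => ?_⟩
    · by_cases e : m' = m
      · exact ⟨c, hc, by simp [e]⟩
      · obtain ⟨c', hc', h'⟩ := h.signed m' (hm'.resolve_left e)
        exact ⟨c', hc', by simpa [e] using h'⟩
    · simp only [Set.mem_insert_iff, not_or] at hm'
      simpa [hm'.1] using h.unsigned m' hm'.2
    · rw [List.mem_filter] at hm'
      simp only [Set.mem_insert_iff, not_or]
      exact ⟨by simpa using hm'.2, h.drawn m' hm'.1⟩

variable (A : Forger)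

open Classical in
theorem efJudge_true {m salt : List Bool} {Q₁ : S.G₁} {Q₂ : S.G₂} {H : HashTable S} :
    efJudge S P₂ y z (m, salt, Q₁, Q₂, ()) (H, L) true =
      if m ∈ L then 0 else mean (dverify S m salt Q₁ Q₂ (scale y P₂) z H) fun g => truePayoff g.1 := by
  refine (map_apply_eq_mean (dverify S m salt Q₁ Q₂ (scale y P₂) z H)
    (fun g => g.1 && decide (m ∉ L)) true).trans ?_
  by_cases hm : m ∈ L
  · simp [hm, mean_const]
  · simp [hm, truePayoff]

/-- Each signing query costs at most the factor `qS/(qS+1)`, and the forgery costs `1/(qS+1)` for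
having the number `0`. The factor `α` consists of what may still have to be paid. -/
theorem mul_bounded_le_forgeIdeal {qV : ℕ} (bound : (EFCall → ℕ) → Prop)
    (hS : ∀ c, bound c → c .sign ≤ qS) (hV : ∀ c, bound c → c .verify ≤ qV) (i : ℕ) (l : A.L)
    (μ : Mem S A.R) :
    ((qS : ℝ≥0∞) + 1)⁻¹ * (((qS : ℝ≥0∞) + 1)⁻¹ * qS) ^ qS *
        A.resultValue S ((efHandler S n P₂ y z).boundedTransformer bound)
          (fun w s => efJudge S P₂ y z w s.1 true) i l μ ((fun _ _ => none, ∅), fun _ => 0) ≤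
      A.resultValue S (forgeIdeal S n qS P₂ y z)
        (fun w s => mean (forgeFinal S qS P₂ y z w s) truePayoff) i l μ
        (fun _ _ => none, fun _ => none, qV) := by
  have := A.resultValue_le_average S (H := (efHandler S n P₂ y z).boundedTransformer bound)
    (J := fun w s => efJudge S P₂ y z w s.1 true)
    (H' := forgeIdeal S n qS P₂ y z) (J' := fun w s => mean (forgeFinal S qS P₂ y z w s) truePayoff)
    -- The counter of the ideal run is `qV` minus the number of verifications made, so the bound on
    -- the calls keeps it from being exhausted.
    (fun α s K ε => α = ((qS : ℝ≥0∞) + 1)⁻¹ * (((qS : ℝ≥0∞) + 1)⁻¹ * qS) ^ (qS - s.2 .sign) ∧ ε = 0 ∧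
      ∃ κ D, ForgeHidden s.1.2 κ D ∧ K = fun F => mean (hiddenFun (uniformUpTo qS) κ D) fun κ' =>
        F (s.1.1, κ', qV - s.2 .verify)) ?_ ?_ ?_
    (s := ((fun _ _ => none, ∅), fun _ => 0)) ⟨rfl, rfl, fun _ => none, [], ⟨by simp, by simp, by
        simp⟩, rfl⟩ i l μ
  · rw [mean_hidden_nil] at this
    simpa using this
  · rintro _ s _ _ ⟨rfl, rfl, κ, D, hκ, rfl⟩ γ p F
    exact mean_comm _ _ _
  · rintro _ ⟨⟨H, L⟩, cnt⟩ _ _ ⟨rfl, rfl, κ, D, hκ, rfl⟩ ⟨(m : List Bool), (salt : List Bool),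
        (Q₁ : S.G₁), (Q₂ : S.G₂), ⟨⟩⟩
    rw [add_zero]
    rw [efJudge_true]
    change _ ≤ mean (hiddenFun (uniformUpTo qS) κ D) fun κ' =>
      mean ((reveal (uniformUpTo qS) m κ').bind fun c =>
        (dverify S m salt Q₁ Q₂ (scale y P₂) z H).map fun g => decide (c.1 = 0) && g.1) truePayoff
    simp only [mean_bind, mean_map]
    split_ifs with hm
    · simp
    -- The message of the forgery is unsigned, so its number is still uniform given the view. The
    -- factors for signing queries that were not made are dropped, since they are at most `1`.
    · rw [mean_hidden_reveal (Or.inr (hκ.unsigned m hm)) fun c =>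
        mean (dverify S m salt Q₁ Q₂ (scale y P₂) z H) fun g => truePayoff (decide (c.1 = 0) && g.1)]
      refine le_trans (mul_le_mul' (mul_le_of_le_one_right' (pow_le_one' ?_ _)) le_rfl)
        ((le_of_eq ?_).trans (mean_uniformUpTo_zero_le _))
      · rw [mul_comm, ← div_eq_mul_inv]
        exact ENNReal.div_le_of_le_mul (by simp)
      · simp [mean_const]
  · rintro _ ⟨⟨H, L⟩, cnt⟩ _ _ ⟨rfl, rfl, κ, D, hκ, rfl⟩ c a i l μ ih
    have ih : ∀ (s : (HashTable S × Set (List Bool)) × (EFCall → ℕ)) κ D, ForgeHidden s.1.2 κ D → ∀ v,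
        ((qS : ℝ≥0∞) + 1)⁻¹ * (((qS : ℝ≥0∞) + 1)⁻¹ * qS) ^ (qS - s.2 .sign) *
          A.resultValue S ((efHandler S n P₂ y z).boundedTransformer bound)
            (fun w s => efJudge S P₂ y z w s.1 true) i l (μ v) s ≤
        mean (hiddenFun (uniformUpTo qS) κ D) fun κ' => A.resultValue S (forgeIdeal S n qS P₂ y z)
          (fun w s => mean (forgeFinal S qS P₂ y z w s) truePayoff) i l (μ v)
          (s.1.1, κ', qV - s.2 .verify) := by
      intro s κ D h v
      simpa using ih _ s _ 0 ⟨rfl, rfl, κ, D, h, rfl⟩ v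
    by_cases hb : bound (countCall cnt c)
    swap
    · refine le_trans (le_of_eq ?_) zero_le
      exact (congrArg _ (if_neg hb)).trans (mul_zero _)
    refine (congrArg _ (if_pos hb)).trans_le ?_
    rw [add_zero]
    cases c with
    | hash =>
      obtain ⟨(m : List Bool), (salt : List Bool), ⟨⟩⟩ := a
      simp only [efHandler, forgeIdeal, mean_map]
      obtain ⟨D', hD', he⟩ := hκ.exists_mean_reveal (qS := qS) m
      refine le_of_le_of_eq ?_ (he fun κ' => mean (hashQuery S m salt H) fun g =>
        A.resultValue S (forgeIdeal S n qS P₂ y z)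
        (fun w s => mean (forgeFinal S qS P₂ y z w s) truePayoff) i l (μ (g.1, ()))
        (g.2, κ', qV - cnt .verify)).symm
      rw [mean_comm, ← mean_mul_left]
      refine mean_mono fun g => ?_
      have := ih ((g.2, L), countCall cnt .hash) κ D' hD' (g.1, ())
      simp only [countCall_of_ne (O := efSig) cnt (c := .hash) (d := .sign) nofun,
        countCall_of_ne (O := efSig) cnt (c := .hash) (d := .verify) nofun] at this
      exact this
    | sign =>
      obtain ⟨(m : List Bool), ⟨⟩⟩ := a
      simp only [efHandler, forgeIdeal, mean_map]
      have hb' : cnt .sign + 1 ≤ qS := (countCall_same (O := efSig) cnt .sign) ▸ hS _ hb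
      obtain ⟨k, hk⟩ := Nat.exists_eq_add_of_le hb'
      have e₁ : qS - cnt .sign = k + 1 := by omega
      rw [e₁, pow_succ]
      refine le_trans (le_of_eq ?_) (hκ.le_mean_sign m (b := ((qS : ℝ≥0∞) + 1)⁻¹ *
        (((qS : ℝ≥0∞) + 1)⁻¹ * qS) ^ k * mean (sign S n m y H) fun g => A.resultValue S
          ((efHandler S n P₂ y z).boundedTransformer bound)
            (fun w s => efJudge S P₂ y z w s.1 true) i l (μ (g.1.1, g.1.2, ()))
            ((g.2, insert m L), countCall cnt .sign))
        (F := fun κ' => mean (sign S n m y H) fun g => A.resultValue S (forgeIdeal S n qS P₂ y z)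
          (fun w s => mean (forgeFinal S qS P₂ y z w s) truePayoff) i l (μ (g.1.1, g.1.2, ()))
          (g.2, κ', qV - cnt .verify)) fun κ' D' h' => ?_)
      · ring
      · rw [mean_comm, ← mean_mul_left]
        refine mean_mono fun g => ?_
        have := ih ((g.2, insert m L), countCall cnt .sign) κ' D' h' (g.1.1, g.1.2, ())
        simp only [countCall_same (O := efSig) cnt .sign,
          countCall_of_ne (O := efSig) cnt (c := .sign) (d := .verify) nofun] at this
        rwa [show qS - (cnt .sign + 1) = k by omega] at this
    | verify =>
      obtain ⟨(m : List Bool), (salt : List Bool), (Q₁ : S.G₁), (Q₂ : S.G₂), ⟨⟩⟩ := a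
      simp only [efHandler, forgeIdeal, mean_map]
      have hb' : cnt .verify + 1 ≤ qV := (countCall_same (O := efSig) cnt .verify) ▸ hV _ hb
      simp only [if_neg (show ¬ qV - cnt .verify = 0 by omega)]
      obtain ⟨D', hD', he⟩ := hκ.exists_mean_reveal (qS := qS) m
      refine le_of_le_of_eq ?_ (he fun κ' =>
        mean (dverify S m salt Q₁ Q₂ (scale y P₂) z H) fun g => A.resultValue S (forgeIdeal S n qS P₂ y z)
        (fun w s => mean (forgeFinal S qS P₂ y z w s) truePayoff) i l (μ (g.1, ()))
        (g.2, κ', qV - cnt .verify - 1)).symm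
      rw [mean_comm, ← mean_mul_left]
      refine mean_mono fun g => ?_
      have := ih ((g.2, L), countCall cnt .verify) κ D' hD' (g.1, ())
      simp only [countCall_of_ne (O := efSig) cnt (c := .verify) (d := .sign) nofun,
        countCall_same (O := efSig) cnt .verify] at this
      rwa [← Nat.sub_sub] at this

end Forge

/-! ### Answers have the prescribed format. -/

section Supports

variable {S : BilinearStructure} {n : ℕ} {H : HashTable S}

theorem HashTable.NeZero.sign (hH : H.NeZero) {m : List Bool} {u : ZMod S.q}
    {w : (List Bool × S.G₁) × HashTable S} (hw : w ∈ (sign S n m u H).support) :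
    w.1.1.length = n ∧ w.2.NeZero := by
  rw [_root_.sign, PMF.mem_support_bind_iff] at hw
  obtain ⟨r, hr, hw⟩ := hw
  rw [PMF.mem_support_map_iff] at hw
  obtain ⟨g, hg, rfl⟩ := hw
  exact ⟨length_of_mem_support_uniformBits hr, (hH.of_mem_support hg).2⟩

theorem HashTable.NeZero.dverify (hH : H.NeZero) {m r : List Bool} {Q₁ : S.G₁} {Q₂ U : S.G₂}
    {u : ZMod S.q} {w : Bool × HashTable S} (hw : w ∈ (dverify S m r Q₁ Q₂ U u H).support) :
    w.2.NeZero := by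
  rw [_root_.dverify, PMF.mem_support_map_iff] at hw
  obtain ⟨g, hg, rfl⟩ := hw
  exact (hH.of_mem_support hg).2

theorem HashTable.neZero_empty : HashTable.NeZero (S := S) fun _ _ => none := fun _ _ _ h => nomatch h

end Supports

theorem mean_le_mean_add_const {α : Type*} {p : PMF α} {f g : α → ℝ≥0∞} {c : ℝ≥0∞}
    (h : ∀ a ∈ p.support, f a ≤ g a + c) : mean p f ≤ mean p g + c := by
  refine (mean_mono_support h).trans_eq ?_
  rw [mean_add, mean_const]

theorem mul_mean_le_mean {α : Type*} {p : PMF α} {f g : α → ℝ≥0∞} {c : ℝ≥0∞}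
    (h : ∀ a ∈ p.support, c * f a ≤ g a) : c * mean p f ≤ mean p g := by
  rw [← mean_mul_left]
  exact mean_mono_support h

/-! ### Success and time of the solver of PR₂. -/

section Forge

variable {S : BilinearStructure} {n qS : ℕ} {P₂ : S.G₂} {x y z : ZMod S.q}

theorem exists_efFormat (S : BilinearStructure) (n : ℕ) (c : EFCall) : ∃ w, efFormat S n c w := by
  cases c with
  | hash =>
    obtain ⟨g, hg⟩ := exists_ne (0 : S.G₁)
    exact ⟨(g, ()), hg⟩
  | sign => exact ⟨((List.replicate n false : List Bool), (0 : S.G₁), ()), List.length_replicate⟩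
  | verify => exact ⟨(false, ()), trivial⟩

theorem efHandler_invariant (c : EFCall) (a : Args S (efSig.args c))
    (s : HashTable S × Set (List Bool)) (hs : s.1.NeZero) :
    ∀ w ∈ (efHandler S n P₂ y z c a s).support, efFormat S n c w.1 ∧ w.2.1.NeZero := by
  intro w hw
  cases c with
  | hash =>
    obtain ⟨g, hg, rfl⟩ := (PMF.mem_support_map_iff _ _ _).1 hw
    exact hs.of_mem_support hg
  | sign =>
    obtain ⟨g, hg, rfl⟩ := (PMF.mem_support_map_iff _ _ _).1 hw
    exact hs.sign hg
  | verify =>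
    obtain ⟨g, hg, rfl⟩ := (PMF.mem_support_map_iff _ _ _).1 hw
    exact ⟨trivial, hs.dverify hg⟩

theorem forgeAnswer_invariant (c : EFCall) (a : Args S (efSig.args c)) (s : ForgeState S)
    (hs : s.1.NeZero) : ∀ w, Sum.inl w ∈ (forgeAnswer S n qS P₂ y z c a s).support →
      efFormat S n c w.1 ∧ w.2.1.NeZero := by
  intro w hw
  obtain ⟨H, κ, j⟩ := s
  cases c with
  | hash =>
    obtain ⟨c, -, hw⟩ := (PMF.mem_support_bind_iff _ _ _).1 hw
    obtain ⟨g, hg, hw⟩ := (PMF.mem_support_map_iff _ _ _).1 hw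
    cases hw
    exact hs.of_mem_support hg
  | sign =>
    obtain ⟨c, -, hw⟩ := (PMF.mem_support_bind_iff _ _ _).1 hw
    split_ifs at hw with hc
    · exact nomatch (PMF.mem_support_pure_iff _ _).1 hw
    · obtain ⟨g, hg, hw⟩ := (PMF.mem_support_map_iff _ _ _).1 hw
      cases hw
      exact hs.sign hg
  | verify =>
    obtain ⟨c, -, hw⟩ := (PMF.mem_support_bind_iff _ _ _).1 hw
    obtain ⟨g, hg, hw⟩ := (PMF.mem_support_map_iff _ _ _).1 hw
    refine ⟨trivial, ?_⟩
    split_ifs at hw <;> cases hw <;> exact hs.dverify hg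

/-- The two guesses are combined: the mean over the uniform `j` is `1/(qV + 1)` times the sum in
`forgeIdeal_le_sum`, and the sum dominates the ideal run that starts with the counter `qV`. -/
theorem accept_le_forgeProgram (A : Forger) (T : Costs) (k : ℕ) (hP : P₂ ≠ 0) (hx : x ≠ 0)
    {qV : ℕ} {bound : (EFCall → ℕ) → Prop}
    (hb : A.CallsBounded T k (efCallCost T k) S (efFormat S n) (efInput S n P₂ y z) bound)
    (hS : ∀ c, bound c → c .sign ≤ qS) (hV : ∀ c, bound c → c .verify ≤ qV) :
    ((qV : ℝ≥0∞) + 1)⁻¹ * (((qS : ℝ≥0∞) + 1)⁻¹ * (((qS : ℝ≥0∞) + 1)⁻¹ * qS) ^ qS) *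
        A.accept T k (efCallCost T k) S (efHandler S n P₂ y z) (efInput S n P₂ y z)
          (fun _ _ => none, ∅) (efJudge S P₂ y z) ≤
      (forgeWrapper.program A).accept T k Empty.elim S (noHandler S)
        (pr2Input S (n, qS, qV) P₂ x y z) () (pr2Judge S P₂ x y z) := by
  refine (congrArg _ (A.accept_eq_iSup S T k (efCallCost T k) (efHandler S n P₂ y z)
    (efInput S n P₂ y z) (fun _ _ => none, ∅) (efJudge S P₂ y z))).trans_le ?_
  rw [ENNReal.mul_iSup]
  refine iSup_le fun i => ?_
  refine le_trans ?_ (forgeWrapper.le_accept_program A (forgeWrapper_implements (n := n) (qS :=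
      qS) (y := y) (z := z) hP hx qV) T k Empty.elim
    (pay := truePayoff) (fun w b hw => ?_) i)
  · rw [forgeInit, mean_map, mean_uniformUpTo, mul_assoc]
    gcongr
    refine le_trans ?_ (forgeIdeal_le_sum A _ _ _ i A.start (Program.startMem S (efInput S n P₂ y z)))
    refine le_trans ?_ (mul_bounded_le_forgeIdeal A bound hS hV i _ _)
    gcongr
    exact A.resultValue_le_bounded_of_invariant T k (h := efHandler S n P₂ y z)
      (Inv := fun s => s.1.NeZero) (exists_efFormat S n)
      efHandler_invariant hb HashTable.neZero_empty (fun w s => efJudge S P₂ y z w s true) i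
  · cases b with
    | false => simp [truePayoff]
    | true =>
      obtain ⟨(R : S.G₁), (Q : S.G₂), ⟨⟩⟩ := w
      have : pr2Judge S P₂ x y z (R, Q, ()) () = PMF.pure true := by
        classical
        exact congrArg PMF.pure (decide_eq_true (hw rfl))
      refine (truePayoff_le_one _).trans (le_of_eq ?_)
      exact ((congrArg (fun p : PMF Bool => p true) this).trans (by simp)).symm

/-- Bounds for the time that the code of the reduction takes in addition. -/
def forgeExtra (T : Costs) (k : ℕ) : EFCall → ℕ
  | .hash => T.exp₁ k + 40
  | .sign => 40
  | .verify => 40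

/-- For signatures and verifications, the scalar multiplications and pairings in the code are
already paid for by the experiment. Only a hash query needs a multiplication of its own. -/
theorem forgeWrapper_cost (T : Costs) (k : ℕ) (c : EFCall) :
    1 + (((efSig.args c).length : ℝ≥0∞) + ((forgeWrapper.body c).cost (fun p => Prim.cost T k p) 1 +
      (efSig.rets c).length)) ≤ (efCallCost T k c : ℝ≥0∞) + forgeExtra T k c := by
  rw [CodeTree.cost_eq_natCost]
  norm_cast
  cases c <;>
  simp only [forgeWrapper, CodeTree.natCost, CodeTree.lookup, Prim.cost, efSig, efCallCost,
    forgeExtra, List.length_cons, List.length_nil] <;>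
  omega

theorem forgeProgram_meanTime_le (A : Forger) (T : Costs) (k : ℕ) (hP : P₂ ≠ 0) (hx : x ≠ 0)
    {qV qH : ℕ}
    (hb : A.CallsBounded T k (efCallCost T k) S (efFormat S n) (efInput S n P₂ y z)
      fun calls => calls .hash ≤ qH ∧ calls .sign ≤ qS ∧ calls .verify ≤ qV) :
    (forgeWrapper.program A).meanTime T k Empty.elim S (noHandler S)
        (pr2Input S (n, qS, qV) P₂ x y z) () ≤
      A.worstTime T k (efCallCost T k) S (efFormat S n) (efInput S n P₂ y z) +
        ((qH * (T.exp₁ k + 40) + qS * 40 + qV * 40 + (T.exp₁ k + 60) : ℕ) : ℝ≥0∞) := by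
  refine (forgeWrapper.meanTime_program_le A (forgeWrapper_implements (n := n) (qS := qS) (y := y)
    (z := z) hP hx qV) T k Empty.elim (forgeWrapper_cost T k)
    (fc := (T.exp₁ k + 40 : ℕ)) ?_).trans ?_
  · rw [CodeTree.cost_eq_natCost]
    norm_cast
    simp only [forgeWrapper, CodeTree.natCost, CodeTree.lookup, Prim.cost, List.length_cons,
      List.length_nil]
    omega
  · have hinit : 1 + (forgeWrapper.init.cost (fun p => (Prim.cost T k p : ℝ≥0∞)) 1 +
        ([.bits, .g₂, .nat, .g₂, .g₂] : List Srt).length) ≤ ((20 : ℕ) : ℝ≥0∞) := by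
      rw [CodeTree.cost_eq_natCost]
      norm_cast
      simp only [forgeWrapper, CodeTree.natCost, Prim.cost, List.length_cons, List.length_nil]
      omega
    -- Here `20` is for the initialisation, `T.exp₁ k + 40` for the conversion of the forgery, and
    -- the remaining constant for the surcharges on the calls.
    calc _ ≤ ((20 : ℕ) : ℝ≥0∞) + (A.worstTime T k (efCallCost T k) S (efFormat S n)
          (efInput S n P₂ y z) + ((qH * (T.exp₁ k + 40) + qS * 40 + qV * 40 : ℕ) : ℝ≥0∞) +
            ((T.exp₁ k + 40 : ℕ) : ℝ≥0∞)) := ?_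
      _ = _ := by push_cast; ring
    refine add_le_add hinit (iSup_le fun i => ?_)
    rw [forgeInit, mean_map]
    refine mean_le_const fun j => ?_
    refine A.value_exitTransformer_le T k (Inv := fun s : ForgeState S => s.1.NeZero)
      (exists_efFormat S n) forgeAnswer_invariant (w := fun c => (forgeExtra T k c : ℝ≥0∞))
      (e := fun calls => ((calls .hash * (T.exp₁ k + 40) + calls .sign * 40 + calls .verify * 40 : ℕ)
        : ℝ≥0∞)) ?_ (by simp) ?_ (fun _ => le_rfl) _ HashTable.neZero_empty i
    · intro c i
      refine (congrArg Nat.cast (?_ : countCall (O := efSig) c i EFCall.hash * (T.exp₁ k + 40) +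
        countCall (O := efSig) c i EFCall.sign * 40 + countCall (O := efSig) c i EFCall.verify * 40 =
        _ + forgeExtra T k i)).trans (Nat.cast_add _ _)
      have hsame : countCall (O := efSig) c i i = c i + 1 := countCall_same c i
      have hne : ∀ d, d ≠ i → countCall (O := efSig) c i d = c d := fun d => countCall_of_ne c
      cases i
      · rw [hsame, hne .sign nofun, hne .verify nofun, forgeExtra]; ring
      · rw [hsame, hne .hash nofun, hne .verify nofun, forgeExtra]; ring
      · rw [hsame, hne .sign nofun, hne .hash nofun, forgeExtra]; ring
    · intro σ h hr s i st hst
      obtain ⟨h₁, h₂, h₃⟩ := hb σ h hr s i st hst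
      norm_cast
      gcongr

end Forge

/-- For `n ≥ 1` one has `(1 + 1/n)^n ≤ e < 3` and `n + 1 ≤ 2n`, which gives the factor `6n`. The
summand `1` takes care of `n = 0`. -/
theorem succ_pow_succ_le (n : ℕ) : (n + 1) ^ (n + 1) ≤ (1 + 6 * n) * n ^ n := by
  rcases Nat.eq_zero_or_pos n with rfl | hn
  · simp
  have h : ((n : ℝ) + 1) ^ n ≤ 3 * (n : ℝ) ^ n := by
    have hn' : (0 : ℝ) < n := by exact_mod_cast hn
    have h₁ : (1 + 1 / (n : ℝ)) ^ n ≤ 3 := by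
      have h₂ : 1 + 1 / (n : ℝ) ≤ Real.exp (1 / n) := by
        rw [add_comm]
        exact Real.add_one_le_exp _
      calc _ ≤ Real.exp (1 / n) ^ n := by gcongr
        _ = Real.exp 1 := by
          rw [← Real.exp_nat_mul]
          congr 1
          field_simp
        _ ≤ 3 := Real.exp_one_lt_three.le
    calc ((n : ℝ) + 1) ^ n = (1 + 1 / (n : ℝ)) ^ n * (n : ℝ) ^ n := by
          rw [← mul_pow]
          congr 1
          field_simp
      _ ≤ _ := by gcongr
  have h' : (n + 1) ^ n ≤ 3 * n ^ n := by exact_mod_cast h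
  calc (n + 1) ^ (n + 1) = (n + 1) ^ n * (n + 1) := pow_succ _ _
    _ ≤ 3 * n ^ n * (n + n) := by gcongr; exact hn
    _ ≤ (1 + 6 * n) * n ^ n := by nlinarith [Nat.zero_le (n ^ n)]

/-- The right side is `n^n / (n+1)^(n+1)`. Messages are guessed and not salts, so the power of two
is merely estimated from below by `1`. -/
theorem inv_le_guess (n N : ℕ) : (1 + 6 * (n : ℝ≥0∞) * 2 ^ N)⁻¹ ≤
    ((n : ℝ≥0∞) + 1)⁻¹ * (((n : ℝ≥0∞) + 1)⁻¹ * n) ^ n := by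
  have h : ((n : ℝ≥0∞) + 1) ^ (n + 1) ≤ (1 + 6 * n) * n ^ n := by
    exact_mod_cast succ_pow_succ_le n
  have h₀ : ((n : ℝ≥0∞) + 1) ^ (n + 1) ≠ 0 := by positivity
  have h₁ : ((n : ℝ≥0∞) + 1) ^ (n + 1) ≠ ⊤ := ENNReal.pow_ne_top (by simp)
  calc _ ≤ (1 + 6 * (n : ℝ≥0∞))⁻¹ := by
        rw [ENNReal.inv_le_inv]
        exact add_le_add le_rfl (le_mul_of_one_le_right' (one_le_pow₀ (by norm_num)))
    _ ≤ (((n : ℝ≥0∞) + 1) ^ (n + 1))⁻¹ * n ^ n := by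
        rw [mul_comm (_)⁻¹, ← div_eq_mul_inv, ENNReal.le_div_iff_mul_le (Or.inl h₀) (Or.inl h₁),
          ENNReal.inv_mul_le_iff (by simp) (by finiteness)]
        exact h
    _ = _ := by rw [mul_pow, ← mul_assoc, ← pow_succ', ENNReal.inv_pow]

theorem natCast_add_lt {v v' t d c e : ℕ} {M M' : ℝ≥0∞} (hv : v' = v + d) (hM : M' ≤ M + (c : ℕ))
    (ht : v + M < (t : ℝ≥0∞)) (he : d + c ≤ e) : (v' : ℝ≥0∞) + M' < ((t + e : ℕ) : ℝ≥0∞) := by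
  calc (v' : ℝ≥0∞) + M' ≤ (v : ℝ≥0∞) + M + ((d + c : ℕ) : ℝ≥0∞) := by
        rw [hv]
        push_cast
        refine (add_le_add le_rfl hM).trans_eq ?_
        ring
    _ < _ := by
        rw [Nat.cast_add t]
        exact ENNReal.add_lt_add_of_lt_of_le (ENNReal.natCast_ne_top _) ht (Nat.cast_le.2 he)

theorem exists_pr2Solver {T : Costs} {Gen : BDHGenerator} {f τ qS qV qH : ℕ → ℕ} {C : ℕ}
    (hC : 40 ≤ C) {A : Forger} (hA : IsForger T Gen f τ qS qV qH A) :
    ∃ τ' : ℕ → ℕ,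
      (∀ k, τ' k ≤ τ k + (qH k + qS k + 2 * qV k + 2) * (T.exp₁ k + C)) ∧
      ∃ B : PR2Solver,
        IsPR2Solver T Gen (fun k => (f k, qS k, qV k)) τ' B ∧
        ∀ k, pr2Succ T Gen (fun k => (f k, qS k, qV k)) B k ≥
          efSucc T Gen f A k /
            ((1 + 6 * (qS k : ℝ≥0∞) * 2 ^ f k) * ((qV k : ℝ≥0∞) + 1)) := by
  refine ⟨_, fun k => le_rfl, forgeWrapper.program A, fun k => ?_, fun k => ?_⟩
  · obtain ⟨ht, hb⟩ := hA k
    set c : ℕ := qH k * (T.exp₁ k + 40) + qS k * 40 + qV k * 40 + (T.exp₁ k + 60) with hc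
    -- The two multiplications beyond the hash queries are that by which the overheads differ
    -- (`hov`) and that for the final forgery. The constants need `2 + 60 ≤ 2 * C`.
    have hle : T.exp₁ k + 2 + c ≤ (qH k + qS k + 2 * qV k + 2) * (T.exp₁ k + C) := by
      have h₁ : qH k * (T.exp₁ k + 40) ≤ qH k * (T.exp₁ k + C) := by gcongr
      have h₂ : qS k * 40 ≤ qS k * (T.exp₁ k + C) := by gcongr; omega
      have h₃ : qV k * 40 ≤ 2 * qV k * (T.exp₁ k + C) := by gcongr <;> omega
      simp only [add_mul] at *
      omega
    have hov : pr2Overhead T k = efOverhead T k + (T.exp₁ k + 2) := by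
      rw [pr2Overhead, efOverhead]
      ring
    refine natCast_add_lt hov ?_ ht hle
    refine mean_le_mean_add_const fun S hS => mean_le_mean_add_const fun P₂ hP => ?_
    -- The experiment of the forger has no `x`; a mean over it is inserted.
    rw [← mean_const (uniformNonzero (ZMod S.q)) (_ + (c : ℝ≥0∞))]
    refine mean_mono_support fun x hx => mean_le_mean_add_const fun y hy =>
      mean_le_mean_add_const fun z hz => ?_
    rw [mem_support_uniformNonzero] at hP hx hy hz
    exact forgeProgram_meanTime_le A T k hP hx (hb S hS P₂ hP y z hy hz)
  · obtain ⟨ht, hb⟩ := hA k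
    rw [ge_iff_le, div_eq_mul_inv, mul_comm]
    rw [ENNReal.mul_inv (by simp) (by simp), mul_comm _ ((_ : ℝ≥0∞) + 1)⁻¹]
    refine (mul_le_mul_left (mul_le_mul_right (inv_le_guess _ _) _) _).trans ?_
    refine mul_mean_le_mean fun S hS => mul_mean_le_mean fun P₂ hP => ?_
    rw [← mean_const (uniformNonzero (ZMod S.q)) (_ * _)]
    refine mean_mono_support fun x hx => mul_mean_le_mean fun y hy => mul_mean_le_mean fun z hz => ?_
    rw [mem_support_uniformNonzero] at hP hx hy hz
    exact accept_le_forgeProgram A T k hP hx (hb S hS P₂ hP y z hy hz) (fun c h => h.2.1)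
      fun c h => h.2.2

/-! ## From distinguishers of signers to distinguishers for PR₃ -/

/-- The registers of the reduction. -/
inductive HideReg
  | desc | P₂ | X | Y | Z | R | Q | n | qS | qV | P₁ | u | U | V (i : Bool) | W (i : Bool) | zero | one
  | bit | lose | started | empty
  | salts | queried | challenged
  | coin | cond | log | m | r | c | h | Q₁ | Q₂ | e₁ | e₂ | ans

namespace HideReg

theorem finite : Finite HideReg := by
  refine Set.finite_univ_iff.1 ((List.finite_toSet [desc, P₂, X, Y, Z, R, Q, n, qS, qV, P₁, u, U,
    V false, V true, W false, W true, zero, one, bit, lose, started, empty, salts, queried, challenged,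
    coin, cond, log, m, r, c, h, Q₁, Q₂, e₁, e₂, ans]).subset fun x _ => ?_)
  rcases x with _ | _ | _ | _ | _ | _ | _ | _ | _ | _ | _ | _ | _ | i | i | _ <;>
    first | (cases i <;> simp) | simp

/-- The registers for temporary values. -/
def Temp : HideReg → Prop
  | coin | cond | log | m | r | c | h | Q₁ | Q₂ | e₁ | e₂ | ans => True
  | _ => False

end HideReg

open CodeTree HideReg in
/-- The code of the reduction: every message has a hidden salt, and the hash values for this salt
are multiples of `X`, the other ones are multiples of `P₁`. -/
def hideWrapper : Wrapper psiSig [.bits, .g₂, .nat, .g₂, .g₂, .g₂] [.bool]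
    [.bits, .g₂, .g₁, .g₂, .g₂, .g₁, .g₂, .nat, .nat, .nat] [.bool] where
  R := HideReg
  finite := HideReg.finite
  dummy := cond
  input := (desc, P₂, X, Y, Z, R, Q, n, qS, qV, ())
  init := prim .psi (P₂, ()) (P₁, ()) <| prim .randScalar () (u, ()) <|
    prim .exp₂ (u, P₂, ()) (U, ()) <| prim .succ (zero, ()) (one, ()) <|
    -- The register `lose` gets the truth value of `bit = false`: this is the output of the
    -- reduction when the experiment returns `0`.
    prim .randUpTo (one, ()) (coin, ()) <| prim (.eq .nat) (coin, zero, ()) (lose, ()) <|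
    branch lose
      (prim (.const false) () (bit, ()) <| prim (.copy .g₂) (Y, ()) (V false, ()) <|
        prim (.copy .g₂) (U, ()) (V true, ()) <| prim .psi (Y, ()) (W false, ()) <|
        prim .psi (U, ()) (W true, ()) <| goto ())
      (prim (.const true) () (bit, ()) <| prim (.copy .g₂) (U, ()) (V false, ()) <|
        prim (.copy .g₂) (Y, ()) (V true, ()) <| prim .psi (U, ()) (W false, ()) <|
        prim .psi (Y, ()) (W true, ()) <| goto ())
  initOut := (desc, P₂, n, V false, V true, Z, ())
  arg
    | .hash => (m, r, ())
    | .sign _ => (m, ())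
    | .verify _ => (m, r, Q₁, Q₂, ())
    | .challenge => (m, ())
  ret
    | .hash => (h, ())
    | .sign _ => (r, h, ())
    | .verify _ => (ans, ())
    | .challenge => (c, h, Q, ())
  body
    | .hash => lookup .bits salts m empty c (prim .randBits (n, ()) (c, ())) <|
        lookup .scalar log m r log (prim .randScalar () (log, ())) <|
        prim (.eq .bits) (r, c, ()) (cond, ()) <|
        branch cond
          (prim .exp₁ (log, X, ()) (h, ()) <| goto ())
          (prim .exp₁ (log, P₁, ()) (h, ()) <| goto ())
    -- A signature for the message of the challenge makes the experiment return `0` whatever happens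
    -- later, so the run can stop.
    | .sign i => load .bool challenged m empty cond (halt (lose, ())) <|
        -- Only the presence of the entry matters, not its value.
        store .bool queried m empty lose <|
        lookup .bits salts m empty c (prim .randBits (n, ()) (c, ())) <|
        prim .randBits (n, ()) (r, ()) <|
        prim (.eq .bits) (r, c, ()) (cond, ()) <|
        branch cond
          -- At the hidden salt the hash value is a multiple of `X` and cannot be signed. This exit
          -- is what the error term pays for.
          (halt (lose, ()))
          (lookup .scalar log m r log (prim .randScalar () (log, ())) <|
            prim .exp₁ (log, W i, ()) (h, ()) <| goto ())
    | .verify i => load .bool challenged m empty cond (halt (lose, ())) <|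
        store .bool queried m empty lose <|
        lookup .bits salts m empty c (prim .randBits (n, ()) (c, ())) <|
        prim (.eq .bits) (r, c, ()) (cond, ()) <|
        branch cond
          (halt (lose, ()))
          (lookup .scalar log m r log (prim .randScalar () (log, ())) <|
            prim .exp₁ (log, W i, ()) (h, ()) <| prim .pairing (h, Z, ()) (e₁, ()) <|
            prim .pairing (Q₁, Q₂, ()) (e₂, ()) <| prim (.eq .g₃) (e₁, e₂, ()) (ans, ()) <| goto ())
    | .challenge => load .bool queried m empty cond (halt (lose, ())) <|
        store .bool challenged m empty lose <|
        prim (.const true) () (started, ()) <|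
        lookup .bits salts m empty c (prim .randBits (n, ()) (c, ())) <|
        lookup .scalar log m c log (prim .randScalar () (log, ())) <|
        -- The hash value is `hX`, so with `R = tX` the element `hR` is its multiple by `t`. The
        -- second component of the answer is the element `Q` of the instance.
        prim .exp₁ (log, R, ()) (h, ()) <| goto ()
  finIn := (ans, ())
  -- Without a challenge the experiment returns `0`, and the guess is not considered.
  fin := branch started (prim (.eq .bool) (ans, bit, ()) (cond, ()) <| halt (cond, ()))
    (halt (lose, ()))

section Hide

variable (S : BilinearStructure)

/-- The choices of the reduction (the number of the signer whose public key is `Y` and the secret key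
of the other one), the pair of the instance of PR₃ as a multiple of `X` and an element of `G₂`, and
whether the challenge was given. -/
structure HideCore where
  bit : Bool
  u : ZMod S.q
  t : ZMod S.q
  Q : S.G₂
  started : Bool

variable {S} in
/-- The secret keys. -/
def HideCore.key (s : HideCore S) (y : ZMod S.q) (i : Bool) : ZMod S.q := if i = s.bit then y else s.u

/-- The state of the reduction: its choices, the random oracle, the hidden salts, the messages that
were submitted to the signing or verifying oracles and the messages of challenges. -/
abbrev HideState : Type :=
  HideCore S × HashTable S × (List Bool → Option (List Bool)) × Set (List Bool) × Set (List Bool)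

variable (n : ℕ) (P₂ : S.G₂) (x y z : ZMod S.q)

def hideInput (s : HideCore S) : Args S [.bits, .g₂, .nat, .g₂, .g₂, .g₂] :=
  psiInput S n P₂ (s.key y false) (s.key y true) z

def hideStart (t : ZMod S.q) (Q : S.G₂) (u : ZMod S.q) (i : ℕ) : HideCore S :=
  ⟨!decide (i = 0), u, t, Q, false⟩

def hideInit (t : ZMod S.q) (Q : S.G₂) :
    PMF (Args S [.bits, .g₂, .nat, .g₂, .g₂, .g₂] × HideState S) :=
  (uniformNonzero (ZMod S.q)).bind fun u => (uniformUpTo 1).map fun i =>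
    (hideInput S n P₂ y z (hideStart S t Q u i), hideStart S t Q u i, fun _ _ => none,
      fun _ => none, ∅, ∅)

-- Every exit has the result `!s.bit`, which is the comparison of the value `0` of the experiment
-- with `bit`. The element `R` of the instance enters only through `t`, where `R = tX`, and `Q` need
-- not be related to `t`.
open Classical in
def hideAnswer : (c : PSICall) → Args S (psiSig.args c) → HideState S →
    PMF ((Args S (psiSig.rets c) × HideState S) ⊕ Bool)
  | .hash, ((m : List Bool), (r : List Bool), _), (s, H, κ, L, C) =>
      (reveal (uniformBits n) m κ).bind fun c => (hashQuery S m r H).map fun g =>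
        .inl ((g.1, ()), s, g.2, c.2, L, C)
  | .sign i, ((m : List Bool), _), (s, H, κ, L, C) =>
      if m ∈ C then PMF.pure (.inr !s.bit)
      else (reveal (uniformBits n) m κ).bind fun c => (uniformBits n).bind fun r =>
        if r = c.1 then PMF.pure (.inr !s.bit)
        else (hashQuery S m r H).map fun g =>
          .inl ((r, (scale (s.key y i) g.1 : S.G₁), ()), s, g.2, c.2, insert m L, C)
  | .verify i, ((m : List Bool), (r : List Bool), (Q₁ : S.G₁), (Q₂ : S.G₂), _), (s, H, κ, L, C) =>
      if m ∈ C then PMF.pure (.inr !s.bit)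
      else (reveal (uniformBits n) m κ).bind fun c =>
        if r = c.1 then PMF.pure (.inr !s.bit)
        else (dverify S m r Q₁ Q₂ (scale (s.key y i) P₂) z H).map fun g =>
          .inl ((g.1, ()), s, g.2, c.2, insert m L, C)
  | .challenge, ((m : List Bool), _), (s, H, κ, L, C) =>
      if m ∈ L then PMF.pure (.inr !s.bit)
      else (reveal (uniformBits n) m κ).bind fun c => (hashQuery S m c.1 H).map fun g =>
        .inl ((c.1, (scale s.t g.1 : S.G₁), s.Q, ()), { s with started := true }, g.2, c.2, L, insert m C)

def hideFinal : Args S [.bool] → HideState S → PMF Bool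
  | ((w : Bool), _), (s, _) => PMF.pure (decide ((w && s.started) = s.bit))

/-- The contents of the registers for permanent values. -/
structure HideRegs (s : HideCore S) (ν : Mem S HideReg) : Prop where
  X : ν.reg .g₁ .X = .of₁ (scale x (S.ψ P₂))
  P₁ : ν.reg .g₁ .P₁ = .of₁ (S.ψ P₂)
  W : ∀ i, ν.reg .g₁ (.W i) = .of₁ (S.ψ (scale (s.key y i) P₂))
  Z : ν.reg .g₂ .Z = .of₂ (scale z P₂)
  R : ν.reg .g₁ .R = .of₁ (scale s.t (scale x (S.ψ P₂)))
  Q : ν.reg .g₂ .Q = .of₂ s.Q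
  n : ν.reg .nat .n = .ofNat n
  bit : ν.reg .bool .bit = .ofBool s.bit
  lose : ν.reg .bool .lose = .ofBool !s.bit
  started : ν.reg .bool .started = .ofBool s.started
  empty : ν.reg .bits .empty = .ofBits []

variable {S n P₂ x y z} {s : HideCore S} {ν : Mem S HideReg}

theorem HideRegs.set (h : HideRegs S n P₂ x y z s ν) {t : HideReg} (ht : t.Temp) (i : Srt)
    (v : Val S i) : HideRegs S n P₂ x y z s (ν.set i t v) := by
  have key : ∀ s' u, ¬ u.Temp → (ν.set i t v).reg s' u = ν.reg s' u := fun s' u hu =>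
    Mem.set_reg_of_ne _ _ (fun e : u = t => hu (by rwa [e])) _ _
  exact ⟨(key _ _ id).trans h.X, (key _ _ id).trans h.P₁, fun i => (key _ _ id).trans (h.W i),
    (key _ _ id).trans h.Z, (key _ _ id).trans h.R, (key _ _ id).trans h.Q, (key _ _ id).trans h.n,
    (key _ _ id).trans h.bit, (key _ _ id).trans h.lose, (key _ _ id).trans h.started,
    (key _ _ id).trans h.empty⟩

theorem HideRegs.setTab (h : HideRegs S n P₂ x y z s ν) (t : HideReg) (i : Srt)
    (a b : List Bool) (v : Val S i) : HideRegs S n P₂ x y z s (ν.setTab i t a b v) :=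
  ⟨h.X, h.P₁, h.W, h.Z, h.R, h.Q, h.n, h.bit, h.lose, h.started, h.empty⟩

theorem HideRegs.set_started (h : HideRegs S n P₂ x y z s ν) (b : Bool) :
    HideRegs S n P₂ x y z { s with started := b } (ν.set .bool .started (.ofBool b)) := by
  refine ⟨?_, ?_, fun i => ?_, ?_, ?_, ?_, ?_, ?_, ?_, ?_, ?_⟩ <;>
    simp [h.X, h.P₁, h.W, h.Z, h.R, h.Q, h.n, h.bit, h.lose, h.empty, HideCore.key]

variable (S P₂ x) in
open Classical in
/-- The elements of which the hash values are multiples. -/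
def hideBase (c r : List Bool) : S.G₁ := if r = c then scale x (S.ψ P₂) else S.ψ P₂

theorem hideBase_ne_zero (hP : P₂ ≠ 0) (hx : x ≠ 0) (c r : List Bool) : hideBase S P₂ x c r ≠ 0 := by
  rw [hideBase]
  split_ifs
  · exact scale_ne_zero S.card₁ hx (S.psi_ne_zero hP)
  · exact S.psi_ne_zero hP

variable (S n P₂ x y z) in
/-- The memory represents the state. -/
structure HideRel (ν : Mem S HideReg) (s : HideState S) : Prop where
  regs : HideRegs S n P₂ x y z s.1 ν
  salts : ∀ m, ν.tab .bits .salts m [] = s.2.2.1 m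
  log : s.2.1.IsMultiple s.2.2.1 (hideBase S P₂ x) (ν.tab .scalar .log)
  queried : ∀ m, (ν.tab .bool .queried m []).isSome ↔ m ∈ s.2.2.2.1
  challenged : ∀ m, (ν.tab .bool .challenged m []).isSome ↔ m ∈ s.2.2.2.2

theorem HideRel.set {s : HideState S} (hs : HideRel S n P₂ x y z ν s) {t : HideReg}
    (ht : t.Temp) (i : Srt) (v : Val S i) : HideRel S n P₂ x y z (ν.set i t v) s :=
  ⟨hs.regs.set ht i v, hs.salts, hs.log, hs.queried, hs.challenged⟩

namespace CodeTree

variable {out : List Srt} {R L : Type} {φ : L → Mem S R → ℝ≥0∞} {J : Args S out → ℝ≥0∞}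
  {μ : Mem S R} {t t' : CodeTree out R L} {m r : List Bool} {a b c tab : R} {D : Set (List Bool)}

theorem wp_store {i : Srt} {v : Val S i} (ha : μ.reg .bits a = .ofBits m) (hb : μ.reg .bits b = .ofBits r)
    (hc : μ.reg i c = v) : wp S φ J (store i tab a b c t) μ = wp S φ J t (μ.setTab i tab m r v) := by
  subst ha hb hc
  rfl

theorem exists_wp_load_of_mem {i : Srt} (ha : μ.reg .bits a = .ofBits m)
    (hb : μ.reg .bits b = .ofBits []) (hD : ∀ m, (μ.tab i tab m []).isSome ↔ m ∈ D) (hm : m ∈ D) :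
    ∃ v, wp S φ J (load i tab a b c t t') μ = wp S φ J t (μ.set i c v) := by
  obtain ⟨v, hv⟩ := Option.isSome_iff_exists.1 ((hD m).2 hm)
  refine ⟨v, ?_⟩
  subst ha
  have hv : μ.tab i tab (μ.reg .bits a) (μ.reg .bits b) = some v := (congrArg _ hb).trans hv
  rw [wp]
  split
  · next w hw => rw [hv] at hw; cases hw; rfl
  · next hw => rw [hv] at hw; cases hw

theorem wp_load_of_notMem {i : Srt} (ha : μ.reg .bits a = .ofBits m)
    (hb : μ.reg .bits b = .ofBits []) (hD : ∀ m, (μ.tab i tab m []).isSome ↔ m ∈ D) (hm : m ∉ D) :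
    wp S φ J (load i tab a b c t t') μ = wp S φ J t' μ := by
  have hv := Option.not_isSome_iff_eq_none.1 (mt (hD m).1 hm)
  subst ha
  have hv : μ.tab i tab (μ.reg .bits a) (μ.reg .bits b) = none := (congrArg _ hb).trans hv
  rw [wp]
  split
  · next w hw => rw [hv] at hw; cases hw
  · rfl

theorem isSome_setTab {i : Srt} {v : Val S i} (hD : ∀ m, (μ.tab i tab m []).isSome ↔ m ∈ D)
    (m' : List Bool) : ((μ.setTab i tab m [] v).tab i tab m' []).isSome ↔ m' ∈ insert m D := by
  rw [Mem.setTab_tab_self]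
  by_cases hm : m' = m
  · subst hm
    simp
  · simp [hm, hD]

end CodeTree

open CodeTree

theorem HideRel.store_queried {H : HashTable S} {κ : List Bool → Option (List Bool)}
    {L C : Set (List Bool)} (hs : HideRel S n P₂ x y z ν (s, H, κ, L, C)) (m : List Bool)
    (v : Val S .bool) :
    HideRel S n P₂ x y z (ν.setTab .bool .queried m [] v) (s, H, κ, insert m L, C) := by
  refine ⟨hs.regs.setTab _ _ _ _ _, fun m' => ?_, ?_, isSome_setTab hs.queried, fun m' => ?_⟩
  · rw [Mem.setTab_tab_of_srt_ne _ (by simp)]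
    exact hs.salts m'
  · rw [Mem.setTab_tab_of_srt_ne _ (by simp)]
    exact hs.log
  · rw [Mem.setTab_tab_of_ne _ (by simp)]
    exact hs.challenged m'

theorem HideRel.store_challenged {H : HashTable S} {κ : List Bool → Option (List Bool)}
    {L C : Set (List Bool)} (hs : HideRel S n P₂ x y z ν (s, H, κ, L, C)) (m : List Bool)
    (v : Val S .bool) :
    HideRel S n P₂ x y z (ν.setTab .bool .challenged m [] v) (s, H, κ, L, insert m C) := by
  refine ⟨hs.regs.setTab _ _ _ _ _, fun m' => ?_, ?_, fun m' => ?_, isSome_setTab hs.challenged⟩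
  · rw [Mem.setTab_tab_of_srt_ne _ (by simp)]
    exact hs.salts m'
  · rw [Mem.setTab_tab_of_srt_ne _ (by simp)]
    exact hs.log
  · rw [Mem.setTab_tab_of_ne _ (by simp)]
    exact hs.queried m'

theorem HideRel.set_started {H : HashTable S} {κ : List Bool → Option (List Bool)}
    {L C : Set (List Bool)} (hs : HideRel S n P₂ x y z ν (s, H, κ, L, C)) (b : Bool) :
    HideRel S n P₂ x y z (ν.set .bool .started (.ofBool b)) ({ s with started := b }, H, κ, L, C) :=
  ⟨hs.regs.set_started b, hs.salts, hs.log, hs.queried, hs.challenged⟩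

theorem rel_wp_salt {r : ℝ≥0∞ → ℝ≥0∞ → Prop} (hr : MeanClosed r) {out : List Srt} {L : Type}
    {φ : L → Mem S HideReg → ℝ≥0∞} {J : Args S out → ℝ≥0∞} {t : CodeTree out HideReg L}
    {H : HashTable S} {κ : List Bool → Option (List Bool)} {D C : Set (List Bool)}
    (h : HideRel S n P₂ x y z ν (s, H, κ, D, C)) {m : List Bool}
    (hm : ν.reg .bits .m = .ofBits m) {β : Type} {F : β → ℝ≥0∞}
    {g : List Bool × (List Bool → Option (List Bool)) → PMF β}
    (hf : ∀ c κ', κ' m = some c →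
      HideRel S n P₂ x y z
        ((ν.set .bits .c (.ofBits c)).setTab .bits .salts m [] (.ofBits c)) (s, H, κ', D, C) →
      r (wp S φ J t ((ν.set .bits .c (.ofBits c)).setTab .bits .salts m [] (.ofBits c)))
        (mean (g (c, κ')) F)) :
    r (wp S φ J (lookup .bits .salts .m .empty .c (prim .randBits (.n, ()) (.c, ())) t) ν)
      (mean ((reveal (uniformBits n) m κ).bind g) F) := by
  refine (congrArg (r · _) (wp_reveal_bits hm h.regs.empty h.regs.n (by simp) (by simp)
    h.salts)).mpr ?_
  refine hr.rel_bind fun c hc => ?_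
  obtain ⟨hH, hc', hu⟩ := h.log.reveal hc
  refine hf c.1 c.2 hc' ⟨(h.regs.set (t := .c) trivial _ _).setTab _ _ _ _ _, ?_, ?_, fun m' => ?_,
    fun m' => ?_⟩
  · exact setTab_tab_nil (s := .bits) (κ := κ) h.salts hu
  · rw [Mem.setTab_tab_of_srt_ne _ (by simp)]
    exact hH
  · rw [Mem.setTab_tab_of_srt_ne _ (by simp)]
    exact h.queried m'
  · rw [Mem.setTab_tab_of_srt_ne _ (by simp)]
    exact h.challenged m'

theorem rel_wp_hideLog {r : ℝ≥0∞ → ℝ≥0∞ → Prop} (hr : MeanClosed r) (hP : P₂ ≠ 0) (hx : x ≠ 0)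
    {out : List Srt} {L : Type}
    {φ : L → Mem S HideReg → ℝ≥0∞} {J : Args S out → ℝ≥0∞} {t : CodeTree out HideReg L}
    {H : HashTable S} {κ : List Bool → Option (List Bool)} {D C : Set (List Bool)}
    (hs : HideRel S n P₂ x y z ν (s, H, κ, D, C)) {m salt : List Bool} {b : HideReg}
    (hm : ν.reg .bits .m = .ofBits m) (hsalt : ν.reg .bits b = .ofBits salt) {c : List Bool}
    (hc : κ m = some c) {β : Type} {F : β → ℝ≥0∞} {g : S.G₁ × HashTable S → β}
    (hf : ∀ (h : ZMod S.q) H', h ≠ 0 →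
      HideRel S n P₂ x y z
        ((ν.set .scalar .log (.ofScalar h)).setTab .scalar .log m salt (.ofScalar h))
        (s, H', κ, D, C) →
      r (wp S φ J t ((ν.set .scalar .log (.ofScalar h)).setTab .scalar .log m salt (.ofScalar h)))
        (F (g (scale h (hideBase S P₂ x c salt), H')))) :
    r (wp S φ J (lookup .scalar .log .m b .log (prim .randScalar () (.log, ())) t) ν)
      (mean ((hashQuery S m salt H).map g) F) := by
  rw [mean_map]
  refine rel_wp_log hr hm hsalt hs.log hc (hideBase_ne_zero hP hx c salt) fun h H' hh hH' => ?_
  refine hf h H' hh ⟨(hs.regs.set (t := .log) trivial _ _).setTab _ _ _ _ _, fun m' => ?_, hH',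
    fun m' => ?_, fun m' => ?_⟩
  · rw [Mem.setTab_tab_of_srt_ne _ (by simp)]
    exact hs.salts m'
  · rw [Mem.setTab_tab_of_srt_ne _ (by simp)]
    exact hs.queried m'
  · rw [Mem.setTab_tab_of_srt_ne _ (by simp)]
    exact hs.challenged m'

end Hide

section Hide

variable {S : BilinearStructure} {n : ℕ} {P₂ : S.G₂} {x y z : ZMod S.q} {ν : Mem S HideReg}

namespace CodeTree

variable {out : List Srt} {R L : Type} {φ : L → Mem S R → ℝ≥0∞} {J : Args S out → ℝ≥0∞}
  {μ : Mem S R} {t : CodeTree out R L} {a b c : R}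

theorem wp_eq_bits {v w : List Bool} (ha : μ.reg .bits a = .ofBits v) (hb : μ.reg .bits b = .ofBits w) :
    wp S φ J (prim (.eq .bits) (a, b, ()) (c, ()) t) μ =
      wp S φ J t (μ.set .bool c (.ofBool (decide (v = w)))) := by
  rw [wp_eq ha hb]
  congr!

theorem wp_eq_bool {v w : Bool} (ha : μ.reg .bool a = .ofBool v) (hb : μ.reg .bool b = .ofBool w) :
    wp S φ J (prim (.eq .bool) (a, b, ()) (c, ()) t) μ =
      wp S φ J t (μ.set .bool c (.ofBool (decide (v = w)))) := by
  rw [wp_eq ha hb]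
  congr!

end CodeTree

open CodeTree

/-- The meaning of the result. -/
def HideRes (S : BilinearStructure) : Args S [.bool] → Bool → Prop
  | ((w : Bool), _), b => w = b

theorem hideRes_read {a : HideReg} {b : Bool} (h : ν.reg .bool a = .ofBool b) :
    HideRes S (ν.read [.bool] (a, ())) b := h

/-- No relation between `t` and `Q` is assumed, so valid and random pairs are treated together. Away
from the hidden salt the argument is the same as for forgeries; at the hidden salt only the
challenge is answered, by `h(tX) = t(hX)`. -/
theorem hideWrapper_implements (hP : P₂ ≠ 0) (hx : x ≠ 0) (aux : ℕ × ℕ) (t : ZMod S.q) (Q : S.G₂) :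
    hideWrapper.Implements (pr3Input S (n, aux) P₂ x y z (scale t (scale x (S.ψ P₂)), Q))
      (HideRel S n P₂ x y z) (HideRes S) (hideInit S n P₂ y z t Q) (hideAnswer S n P₂ y z)
      (hideFinal S) where
  init := by
    intro r hr (Ψ : Mem S HideReg → ℝ≥0∞) Φ J hΨ
    obtain ⟨aS, aV⟩ := aux
    let ν₀ : Mem S HideReg := ((((((((((Mem.init S HideReg).set .bits .desc (.ofBits S.desc)).set
      .g₂ .P₂ (.of₂ P₂)).set .g₁ .X (.of₁ (scale x (S.ψ P₂)))).set .g₂ .Y (.of₂ (scale y P₂))).set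
      .g₂ .Z (.of₂ (scale z P₂))).set .g₁ .R (.of₁ (scale t (scale x (S.ψ P₂))))).set .g₂ .Q
      (.of₂ Q)).set .nat .n (.ofNat n)).set .nat .qS (.ofNat aS)).set .nat .qV (.ofNat aV)
    have hzero : ν₀.reg .nat .zero = .ofNat 0 := by
      simp [ν₀]
      rfl
    have hempty : ν₀.reg .bits .empty = .ofBits [] := by
      simp [ν₀]
      rfl
    have hstarted : ν₀.reg .bool .started = .ofBool false := by
      simp [ν₀]
      rfl
    change r (wp (R := HideReg) S (fun _ => Ψ) J hideWrapper.init ν₀) _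
    simp only [hideWrapper]
    rw [wp_psi (g := P₂) (by simp [ν₀]), wp_randScalar]
    refine hr.rel_bind fun u _ => ?_
    rw [wp_exp₂ (u := u) (g := P₂) (by simp) (by simp [ν₀]), wp_succ (n := 0) (by simp [hzero]),
      wp_randUpTo (n := 1) (by simp)]
    refine hr.rel_map fun i _ => ?_
    rw [wp_eq_nat (v := i) (w := 0) (by simp) (by simp [hzero]), wp_branch (b := decide (i = 0)) (by simp)]
    set ν₁ : Mem S HideReg := (((((ν₀.set .g₁ .P₁ (.of₁ (S.ψ P₂))).set .scalar .u (.ofScalar u)).set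
      .g₂ .U (.of₂ (scale u P₂))).set .nat .one (.ofNat (0 + 1))).set .nat .coin (.ofNat i)).set
      .bool .lose (.ofBool (decide (i = 0))) with hν₁
    have hY : ν₁.reg .g₂ .Y = .of₂ (scale y P₂) := by simp [ν₁, ν₀]
    have hU : ν₁.reg .g₂ .U = .of₂ (scale u P₂) := by simp [ν₁]
    have key : ∀ ν : Mem S HideReg, (∀ v, ν.reg .g₂ (.V v) = .of₂ (scale ((hideStart S t Q u
        i).key y v) P₂)) →
        (∀ v, ν.reg .g₁ (.W v) = .of₁ (S.ψ (scale ((hideStart S t Q u i).key y v) P₂))) →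
        ν.reg .bool .bit = .ofBool (hideStart S t Q u i).bit →
        (∀ s a, (∀ v, a ≠ .V v) → (∀ v, a ≠ .W v) → a ≠ .bit → ν.reg s a = ν₁.reg s a) →
        ν.tab = (Mem.init S HideReg).tab →
        r (Ψ ν) (Φ (hideInput S n P₂ y z (hideStart S t Q u i), hideStart S t Q u i, fun _ _ => none,
          fun _ => none, ∅, ∅)) := by
      intro ν hV hW hb hsame htab
      have h₁ : ν.reg .bits .desc = .ofBits S.desc := by refine (hsame _ _ (by simp) (by simp) (by simp)).trans ?_; simp [ν₁, ν₀]
      have h₂ : ν.reg .g₂ .P₂ = .of₂ P₂ := by refine (hsame _ _ (by simp) (by simp) (by simp)).trans ?_; simp [ν₁, ν₀]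
      have h₃ : ν.reg .nat .n = .ofNat n := by refine (hsame _ _ (by simp) (by simp) (by simp)).trans ?_; simp [ν₁, ν₀]
      have h₄ : ν.reg .g₂ .Z = .of₂ (scale z P₂) := by refine (hsame _ _ (by simp) (by simp) (by simp)).trans ?_; simp [ν₁, ν₀]
      have hread : ν.read [.bits, .g₂, .nat, .g₂, .g₂, .g₂] (.desc, .P₂, .n, .V false, .V true, .Z, ()) =
          hideInput S n P₂ y z (hideStart S t Q u i) :=
        congrArg₂ Prod.mk h₁ (congrArg₂ Prod.mk h₂ (congrArg₂ Prod.mk h₃ (congrArg₂ Prod.mk (hV false)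
          (congrArg₂ Prod.mk (hV true) (congrArg (fun a => (a, ())) h₄)))))
      refine (congrArg (fun w => r (Ψ ν) (Φ (w, hideStart S t Q u i, fun _ _ => none,
          fun _ => none, ∅, ∅))) hread).mp
        (hΨ ν _ ⟨⟨?_, ?_, hW, h₄, ?_, ?_, h₃, hb, ?_, ?_, ?_⟩, fun _ => ?_, fun _ _ => Or.inl ⟨?_, rfl⟩,
          fun _ => ?_, fun _ => ?_⟩)
      · refine (hsame _ _ (by simp) (by simp) (by simp)).trans ?_; simp [ν₁, ν₀]
      · refine (hsame _ _ (by simp) (by simp) (by simp)).trans ?_; simp [ν₁, ν₀]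
      · refine (hsame _ _ (by simp) (by simp) (by simp)).trans ?_; simp [ν₁, ν₀, hideStart]
      · refine (hsame _ _ (by simp) (by simp) (by simp)).trans ?_; simp [ν₁, ν₀, hideStart]
      · refine (hsame _ _ (by simp) (by simp) (by simp)).trans ?_; simp [ν₁, hideStart]
      · refine (hsame _ _ (by simp) (by simp) (by simp)).trans ?_; simp [ν₁, hideStart, hstarted]
      · refine (hsame _ _ (by simp) (by simp) (by simp)).trans ?_; simp [ν₁, hempty]
      all_goals rw [htab]
      · rfl
      · rfl
      · exact ⟨nofun, nofun⟩
      · exact ⟨nofun, nofun⟩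
    by_cases hi : i = 0
    · rw [if_pos (by simpa), wp_const, wp_copy (v := .of₂ (scale y P₂)) (by simp [hY]), wp_copy
          (v := .of₂ (scale u P₂)) (by simp [hU]),
        wp_psi (g := scale y P₂) (by simp [hY]), wp_psi (g := scale u P₂) (by simp [hU])]
      refine key _ (fun v => ?_) (fun v => ?_) ?_ (fun s a h₁ h₂ h₃ => ?_) rfl
      · cases v <;> simp [hideStart, HideCore.key, hi]
      · cases v <;> simp [hideStart, HideCore.key, hi]
      · simp [hideStart, hi]
      · simp [h₁, h₂, h₃]
    · rw [if_neg (by simpa), wp_const, wp_copy (v := .of₂ (scale u P₂)) (by simp [hU]), wp_copy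
          (v := .of₂ (scale y P₂)) (by simp [hY]),
        wp_psi (g := scale u P₂) (by simp [hU]), wp_psi (g := scale y P₂) (by simp [hY])]
      refine key _ (fun v => ?_) (fun v => ?_) ?_ (fun s a h₁ h₂ h₃ => ?_) rfl
      · cases v <;> simp [hideStart, HideCore.key, hi]
      · cases v <;> simp [hideStart, HideCore.key, hi]
      · simp [hideStart, hi]
      · simp [h₁, h₂, h₃]
  call := by
    intro r hr c (Ψ : Mem S HideReg → ℝ≥0∞) Φ J pay hΨ hJ a (ν : Mem S HideReg) s hs
    obtain ⟨s, H, κ, D, C⟩ := s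
    have hlose : ∀ (ν : Mem S HideReg) H κ D C, HideRel S n P₂ x y z ν (s, H, κ, D, C) →
        r (J (ν.read [.bool] (.lose, ()))) (pay !s.bit) := fun ν H κ D C hs =>
      hJ _ _ (hideRes_read hs.regs.lose)
    cases c with
    | hash =>
      have hΨ : ∀ (ν : Mem S HideReg) s, HideRel S n P₂ x y z ν s → ∀ g,
          ν.reg .g₁ .h = .of₁ g → r (Ψ ν) (Φ ((g, ()), s)) := fun ν s hs g hg =>
        (congrArg (fun g => r (Ψ ν) (Φ ((g, ()), s))) hg).mp (hΨ ν s hs)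
      obtain ⟨(m : List Bool), (salt : List Bool), ⟨⟩⟩ := a
      refine rel_wp_salt hr ((hs.set (t := .m) trivial .bits (.ofBits m)).set (t := .r) trivial .bits
        (.ofBits salt)) (by simp) fun c κ' hκ hs => ?_
      refine rel_wp_hideLog (m := m) (salt := salt) (b := .r) hr hP hx hs (by simp) (by simp) hκ
          fun h H' hh hs => ?_
      classical
      rw [wp_eq_bits (v := salt) (w := c) (by simp) (by simp), wp_branch (b := decide (salt = c)) (by simp)]
      have hs := hs.set (t := .cond) trivial .bool (.ofBool (decide (salt = c)))
      rw [hideBase]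
      by_cases hc : salt = c
      · rw [if_pos (by simpa), wp_exp₁ (u := h) (by simp) hs.regs.X, if_pos hc]
        exact hΨ _ _ (hs.set (t := .h) trivial _ _) _ (by simp)
      · rw [if_neg (by simpa), wp_exp₁ (u := h) (by simp) hs.regs.P₁, if_neg hc]
        exact hΨ _ _ (hs.set (t := .h) trivial _ _) _ (by simp)
    | sign i =>
      have hΨ : ∀ (ν : Mem S HideReg) s, HideRel S n P₂ x y z ν s → ∀ r' g,
          ν.reg .bits .r = .ofBits r' → ν.reg .g₁ .h = .of₁ g → r (Ψ ν) (Φ ((r', g, ()), s)) :=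
        fun ν s hs r' g hr' hg => (congrArg₂ (fun r' g => r (Ψ ν) (Φ ((r', g, ()), s))) hr' hg).mp
          (hΨ ν s hs)
      obtain ⟨(m : List Bool), ⟨⟩⟩ := a
      have hs := hs.set (t := .m) trivial .bits (.ofBits m)
      change r (wp (R := HideReg) S (fun _ => Ψ) J (hideWrapper.body (.sign i)) (ν.set .bits .m
          (.ofBits m))) _
      simp only [hideWrapper, hideAnswer]
      by_cases hm : m ∈ C
      · obtain ⟨v, hv⟩ := exists_wp_load_of_mem (φ := fun _ => Ψ) (J := J) (t := halt (.lose, ()))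
          (t' := _) (a := .m) (b := .empty) (c := .cond) (m := m) (by simp) hs.regs.empty hs.challenged hm
        rw [hv, if_pos hm, mean_pure]
        exact hlose _ _ _ _ _ (hs.set (t := .cond) trivial _ v)
      rw [wp_load_of_notMem (m := m) (by simp) hs.regs.empty hs.challenged hm, if_neg hm,
        wp_store (m := m) (by simp) hs.regs.empty hs.regs.lose]
      have hs := hs.store_queried m (.ofBool !s.bit)
      refine rel_wp_salt hr hs (m := m) (by simp) fun c κ' hκ hs => ?_
      rw [wp_randBits hs.regs.n]
      refine hr.rel_bind fun salt _ => ?_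
      classical
      have hs := hs.set (t := .r) trivial .bits (.ofBits salt)
      rw [wp_eq_bits (v := salt) (w := c) (by simp) (by simp), wp_branch (b := decide (salt = c)) (by simp)]
      have hs := hs.set (t := .cond) trivial .bool (.ofBool (decide (salt = c)))
      by_cases hc : salt = c
      · rw [if_pos (by simpa), if_pos hc, mean_pure]
        exact hlose _ _ _ _ _ hs
      · rw [if_neg (by simpa), if_neg hc]
        refine rel_wp_hideLog (m := m) (salt := salt) (b := .r) hr hP hx hs (by simp) (by simp)
            hκ fun h H' hh hs => ?_
        rw [wp_exp₁ (u := h) (by simp) (hs.regs.W i)]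
        refine hΨ _ _ (hs.set (t := .h) trivial _ _) _ _ (by simp) ?_
        rw [hideBase, if_neg hc, Mem.set_reg_self, S.psi_scale, scale_comm S.card₁]
    | verify i =>
      have hΨ : ∀ (ν : Mem S HideReg) s, HideRel S n P₂ x y z ν s → ∀ b,
          ν.reg .bool .ans = .ofBool b → r (Ψ ν) (Φ ((b, ()), s)) := fun ν s hs b hb =>
        (congrArg (fun b => r (Ψ ν) (Φ ((b, ()), s))) hb).mp (hΨ ν s hs)
      obtain ⟨(m : List Bool), (salt : List Bool), (Q₁ : S.G₁), (Q₂ : S.G₂), ⟨⟩⟩ := a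
      have hs := (((hs.set (t := .m) trivial .bits (.ofBits m)).set (t := .r) trivial .bits
        (.ofBits salt)).set (t := .Q₁) trivial .g₁ (.of₁ Q₁)).set (t := .Q₂) trivial .g₂ (.of₂ Q₂)
      change r (wp (R := HideReg) S (fun _ => Ψ) J (hideWrapper.body (.verify i)) ((((ν.set .bits .m
        (.ofBits m)).set .bits .r (.ofBits salt)).set .g₁ .Q₁ (.of₁ Q₁)).set .g₂ .Q₂ (.of₂ Q₂))) _
      simp only [hideWrapper, hideAnswer]
      by_cases hm : m ∈ C
      · obtain ⟨v, hv⟩ := exists_wp_load_of_mem (φ := fun _ => Ψ) (J := J) (t := halt (.lose, ()))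
          (t' := _) (a := .m) (b := .empty) (c := .cond) (m := m) (by simp) hs.regs.empty hs.challenged hm
        rw [hv, if_pos hm, mean_pure]
        exact hlose _ _ _ _ _ (hs.set (t := .cond) trivial _ v)
      rw [wp_load_of_notMem (m := m) (by simp) hs.regs.empty hs.challenged hm, if_neg hm,
        wp_store (m := m) (by simp) hs.regs.empty hs.regs.lose]
      have hs := hs.store_queried m (.ofBool !s.bit)
      refine rel_wp_salt hr hs (m := m) (by simp) fun c κ' hκ hs => ?_
      rw [wp_eq_bits (v := salt) (w := c) (by simp) (by simp), wp_branch (b := decide (salt = c)) (by simp)]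
      have hs := hs.set (t := .cond) trivial .bool (.ofBool (decide (salt = c)))
      by_cases hc : salt = c
      · rw [if_pos (by simpa), if_pos hc, mean_pure]
        exact hlose _ _ _ _ _ hs
      · rw [if_neg (by simpa), if_neg hc, dverify, PMF.map_comp]
        refine rel_wp_hideLog (m := m) (salt := salt) (b := .r) hr hP hx hs (by simp) (by simp) hκ
          fun h H' hh hs => ?_
        rw [wp_exp₁ (u := h) (by simp) (hs.regs.W i)]
        have hs := hs.set (t := .h) trivial .g₁ (.of₁ (scale h (S.ψ (scale (s.key y i) P₂))))
        rw [wp_pairing (g := scale h (S.ψ (scale (s.key y i) P₂))) (by simp) hs.regs.Z,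
          wp_pairing (g := Q₁) (g' := Q₂) (by simp) (by simp),
          wp_eq₃ (v := S.e (scale h (S.ψ (scale (s.key y i) P₂))) (scale z P₂)) (w := S.e Q₁ Q₂)
            (by simp) (by simp), S.e_verify, hideBase, if_neg hc]
        exact hΨ _ _ (((hs.set (t := .e₁) trivial _ _).set (t := .e₂) trivial _ _).set (t := .ans)
          trivial _ _) _ (by simp)
    | challenge =>
      have hΨ : ∀ (ν : Mem S HideReg) s, HideRel S n P₂ x y z ν s → ∀ c g Q,
          ν.reg .bits .c = .ofBits c → ν.reg .g₁ .h = .of₁ g → ν.reg .g₂ .Q = .of₂ Q →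
          r (Ψ ν) (Φ ((c, g, Q, ()), s)) := by
        intro ν s hs c g Q hc hg hQ
        exact (congrArg (fun w => r (Ψ ν) (Φ (w, s))) (congrArg₂ Prod.mk hc (congrArg₂ Prod.mk hg
          (congrArg (fun a => (a, ())) hQ)))).mp (hΨ ν s hs)
      obtain ⟨(m : List Bool), ⟨⟩⟩ := a
      have hs := hs.set (t := .m) trivial .bits (.ofBits m)
      change r (wp (R := HideReg) S (fun _ => Ψ) J (hideWrapper.body .challenge)
        (ν.set .bits .m (.ofBits m))) _
      simp only [hideWrapper, hideAnswer]
      by_cases hm : m ∈ D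
      · obtain ⟨v, hv⟩ := exists_wp_load_of_mem (φ := fun _ => Ψ) (J := J) (t := halt (.lose, ()))
          (t' := _) (a := .m) (b := .empty) (c := .cond) (m := m) (by simp) hs.regs.empty hs.queried hm
        rw [hv, if_pos hm, mean_pure]
        exact hlose _ _ _ _ _ (hs.set (t := .cond) trivial _ v)
      rw [wp_load_of_notMem (m := m) (by simp) hs.regs.empty hs.queried hm, if_neg hm,
        wp_store (m := m) (by simp) hs.regs.empty hs.regs.lose, wp_const]
      have hs := (hs.store_challenged m (.ofBool !s.bit)).set_started true
      refine rel_wp_salt hr hs (m := m) (by simp) fun c κ' hκ hs => ?_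
      refine rel_wp_hideLog (m := m) (salt := c) (b := .c) hr hP hx hs (by simp) (by simp) hκ
        fun h H' hh hs => ?_
      rw [wp_exp₁ (u := h) (by simp) hs.regs.R]
      have hs := hs.set (t := .h) trivial .g₁ (.of₁ (scale h (scale s.t (scale x (S.ψ P₂)))))
      refine hΨ _ _ hs _ _ _ (by simp) ?_ hs.regs.Q
      rw [hideBase, if_pos rfl, Mem.set_reg_self, scale_comm S.card₁]
  fin := by
    intro r hr J pay hJ a (ν : Mem S HideReg) s hs
    obtain ⟨s, H, κ, D, C⟩ := s
    obtain ⟨(w : Bool), ⟨⟩⟩ := a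
    have hs := hs.set (t := .ans) trivial .bool (.ofBool w)
    change r (wp (R := HideReg) S (fun e => e.elim) J hideWrapper.fin (ν.set .bool .ans (.ofBool w))) _
    simp only [hideWrapper, hideFinal, mean_pure]
    rw [wp_branch hs.regs.started]
    cases hst : s.started with
    | false =>
      rw [if_neg (by simp)]
      refine hJ _ _ (hideRes_read (hs.regs.lose.trans ?_))
      cases s.bit <;> simp
    | true =>
      rw [if_pos rfl, wp_eq_bool (v := w) (w := s.bit) (by simp) hs.regs.bit]
      exact hJ _ _ (hideRes_read (by simp))

end Hide

/-- Two distributions that differ where the value is `r`. -/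
theorem mean_le_mean_ite_add {α : Type*} [DecidableEq α] {p : PMF α} {f g : α → ℝ≥0∞} {r : α}
    (hf : ∀ c, f c ≤ 1) : mean p f ≤ (mean p fun c => if r = c then g c else f c) + p r := by
  rw [← mean_indicator p r, ← mean_add]
  refine mean_mono fun c => ?_
  by_cases h : r = c
  · rw [if_pos h, if_pos h.symm]
    exact le_add_left (hf c)
  · rw [if_neg h]
    exact le_add_right le_rfl

/-! ### Hidden salts and numbers of queries. -/

section Hide

variable {S : BilinearStructure} {n : ℕ} {P₂ : S.G₂} {y z u : ZMod S.q} {b : Bool}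

/-- The number of signing and verification queries. -/
def psiQueries (c : PSICall → ℕ) : ℕ :=
  c (.sign false) + c (.sign true) + (c (.verify false) + c (.verify true))

theorem psiQueries_hash (c : PSICall → ℕ) : psiQueries (countCall (O := psiSig) c .hash) =
    psiQueries c := by
  simp only [psiQueries]
  rw [countCall_of_ne (O := psiSig) c (c := .hash) (d := .sign false) nofun,
    countCall_of_ne (O := psiSig) c (c := .hash) (d := .sign true) nofun,
    countCall_of_ne (O := psiSig) c (c := .hash) (d := .verify false) nofun,
    countCall_of_ne (O := psiSig) c (c := .hash) (d := .verify true) nofun]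

theorem psiQueries_challenge (c : PSICall → ℕ) :
    psiQueries (countCall (O := psiSig) c .challenge) = psiQueries c := by
  simp only [psiQueries]
  rw [countCall_of_ne (O := psiSig) c (c := .challenge) (d := .sign false) nofun,
    countCall_of_ne (O := psiSig) c (c := .challenge) (d := .sign true) nofun,
    countCall_of_ne (O := psiSig) c (c := .challenge) (d := .verify false) nofun,
    countCall_of_ne (O := psiSig) c (c := .challenge) (d := .verify true) nofun]

theorem psiQueries_sign (c : PSICall → ℕ) (i : Bool) :
    psiQueries (countCall (O := psiSig) c (.sign i)) = psiQueries c + 1 := by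
  have h : countCall (O := psiSig) c (.sign i) (.sign i) = c (.sign i) + 1 := countCall_same _ _
  have h' : ∀ d : PSICall, d ≠ .sign i → countCall (O := psiSig) c (.sign i) d = c d :=
    fun d => countCall_of_ne (O := psiSig) c
  simp only [psiQueries]
  cases i
  · rw [h, h' (.sign true) nofun, h' (.verify false) nofun, h' (.verify true) nofun]
    ring
  · rw [h, h' (.sign false) nofun, h' (.verify false) nofun, h' (.verify true) nofun]
    ring

theorem psiQueries_verify (c : PSICall → ℕ) (i : Bool) :
    psiQueries (countCall (O := psiSig) c (.verify i)) = psiQueries c + 1 := by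
  have h : countCall (O := psiSig) c (.verify i) (.verify i) = c (.verify i) + 1 := countCall_same _ _
  have h' : ∀ d : PSICall, d ≠ .verify i → countCall (O := psiSig) c (.verify i) d = c d :=
    fun d => countCall_of_ne (O := psiSig) c
  simp only [psiQueries]
  cases i
  · rw [h, h' (.verify true) nofun, h' (.sign false) nofun, h' (.sign true) nofun]
    ring
  · rw [h, h' (.verify false) nofun, h' (.sign false) nofun, h' (.sign true) nofun]
    ring

/-- Which hidden salts are known: the salt of the message of the challenge. -/
structure HideHidden (o : Option (List Bool)) (κ : List Bool → Option (List Bool))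
    (D : List (List Bool)) : Prop where
  chosen : ∀ m, o = some m → ∃ c, κ m = some c
  other : ∀ m, o ≠ some m → κ m = none
  drawn : ∀ m ∈ D, o ≠ some m

variable {o : Option (List Bool)} {κ : List Bool → Option (List Bool)} {D : List (List Bool)}

theorem HideHidden.cons (h : HideHidden o κ D) {m : List Bool} (hm : o ≠ some m) :
    HideHidden o κ (m :: D) :=
  ⟨h.chosen, h.other, fun m' hm' => (List.mem_cons.1 hm').elim (fun e => e ▸ hm) (h.drawn m')⟩

/-- A salt that only the simulation uses remains hidden. Only the salt of the message of the
challenge is known, and it is not drawn again. -/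
theorem HideHidden.exists_mean_reveal (h : HideHidden o κ D) (m : List Bool) :
    ∃ D', HideHidden o κ D' ∧ ∀ F : (List Bool → Option (List Bool)) → ℝ≥0∞,
      (mean (hiddenFun (uniformBits n) κ D) fun κ' => mean (reveal (uniformBits n) m κ')
        fun c => F c.2) = mean (hiddenFun (uniformBits n) κ D') F := by
  by_cases hm : o = some m
  · obtain ⟨c, hc⟩ := h.chosen m hm
    exact ⟨D, h, fun F => mean_hidden_reveal_of_some (fun hD => h.drawn m hD hm) hc fun c => F c.2⟩
  · refine ⟨m :: D, h.cons hm, fun F => ?_⟩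
    rw [mean_hidden_reveal (Or.inr (h.other m hm)) fun c => F c.2, mean_hidden_cons]

/-- A salt is different from a hidden one except with a small probability. -/
theorem HideHidden.mean_cons_le (h : HideHidden o κ D) {m r : List Bool} (hm : o ≠ some m)
    {F : (List Bool → Option (List Bool)) → ℝ≥0∞} {e : ℝ≥0∞} (hF : ∀ κ', F κ' ≤ 1) :
    mean (hiddenFun (uniformBits n) κ (m :: D)) F ≤
      (mean (hiddenFun (uniformBits n) κ D) fun κ' => mean (reveal (uniformBits n) m κ')
        fun c => if r = c.1 then e else F c.2) + ((2 : ℝ≥0∞) ^ n)⁻¹ := by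
  rw [mean_hidden_reveal (Or.inr (h.other m hm)) fun c => if r = c.1 then e else F c.2,
    mean_hidden_cons]
  refine (mean_le_mean_ite_add (r := r) (g := fun _ => e) fun c => mean_le_const fun κ' => hF _).trans
    (add_le_add (le_of_eq ?_) (uniformBits_apply_le n r))
  congr 1
  funext c
  split_ifs
  · rw [mean_const]
  · rfl

/-- The challenge makes the salt of `m` public, whether or not it was drawn before. All other salts
stay hidden. -/
theorem HideHidden.challenge (h : HideHidden none κ D) (m c : List Bool) :
    HideHidden (some m) (Function.update κ m (some c)) (D.filter (· ≠ m)) := by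
  refine ⟨fun m' hm' => ?_, fun m' hm' => ?_, fun m' hm' => ?_⟩
  · cases hm'
    exact ⟨c, by simp⟩
  · rw [Function.update_of_ne fun e => hm' (by rw [e])]
    exact h.other _ nofun
  · rw [List.mem_filter] at hm'
    have := hm'.2
    simp only [ne_eq, decide_not, Bool.not_eq_eq_eq_not, Bool.not_true, decide_eq_false_iff_not] at this
    exact fun e => this (Option.some.inj e).symm

theorem mean_challenge (h : HideHidden none κ D) (m : List Bool)
    (F : List Bool × (List Bool → Option (List Bool)) → ℝ≥0∞) :
    (mean (hiddenFun (uniformBits n) κ D) fun κ' => mean (reveal (uniformBits n) m κ') F) =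
      mean (uniformBits n) fun c => mean (hiddenFun (uniformBits n) (Function.update κ m (some c))
        (D.filter (· ≠ m))) fun κ' => F (c, κ') := by
  rw [mean_hidden_reveal (Or.inr (h.other m nofun))]
  congr 1
  funext c
  exact mean_hidden_update c fun κ' => F (c, κ')

variable (A : PSIAdversary) (S n P₂ y z u b) in
/-- The value of the experiment for a distinguisher if the payoff depends on whether it is right. -/
def psiValue (bound : (PSICall → ℕ) → Prop) (pay : Bool → ℝ≥0∞) (i : ℕ) (l : A.L) (μ : Mem S A.R)
    (s : PSIState S × (PSICall → ℕ)) : ℝ≥0∞ :=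
  A.resultValue S ((psiHandler S n P₂ (fun i => if i = b then y else u) z b).boundedTransformer bound)
    (fun w s => mean (psiJudge S w s.1) fun g => pay (decide (g = b))) i l μ s

variable (A : PSIAdversary) {bound : (PSICall → ℕ) → Prop} {pay : Bool → ℝ≥0∞}

/-- The message of the challenge must not occur in other calls. -/
theorem psiValue_le_of_mem (hC : ∀ c, bound c → c .challenge ≤ 1) (i : ℕ) (l : A.L) (μ : Mem S A.R)
    {st : PSIState S} {cnt : PSICall → ℕ} {m : List Bool} (hm : st.chosen = some m)
    (hq : m ∈ st.queried) (hc : 1 ≤ cnt .challenge) :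
    psiValue S n P₂ y z u b A bound pay i l μ (st, cnt) ≤ pay !b := by
  rw [psiValue]
  have := A.resultValue_le_average S
    (H := (psiHandler S n P₂ (fun i => if i = b then y else u) z b).boundedTransformer bound)
    (J := fun w s => mean (psiJudge S w s.1) fun g => pay (decide (g = b)))
    -- The comparison is with a system that has one state and a constant value: from now on the
    -- experiment can only return `0`, which is the right guess if and only if `b` is `false`. The
    -- situation persists because messages are never removed from `queried` and a second challenge
    -- is excluded by the bound.
    (H' := fun _ _ (_ : Unit) _ => pay !b) (J' := fun _ _ => pay !b)
    (fun α s K ε => α = 1 ∧ ε = 0 ∧ (K = fun F => F ()) ∧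
      (∃ m, s.1.chosen = some m ∧ m ∈ s.1.queried) ∧ 1 ≤ s.2 .challenge) ?_ ?_ ?_
    (s := (st, cnt)) ⟨rfl, rfl, rfl, ⟨m, hm, hq⟩, hc⟩ i l μ
  · rw [one_mul, add_zero] at this
    exact this.trans (A.resultValue_le_const S (fun _ _ _ _ _ => le_rfl) (fun _ _ => le_rfl) _ _ _ _)
  · rintro _ s _ _ ⟨rfl, rfl, rfl, -⟩ γ p F
    rfl
  · rintro _ ⟨st, cnt⟩ _ _ ⟨rfl, rfl, rfl, ⟨m, hm, hq⟩, hc⟩ ⟨(w : Bool), ⟨⟩⟩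
    simp only at hm hq
    rw [one_mul, add_zero]
    simp only [psiJudge, mean_pure]
    have : ¬ ∃ m, st.chosen = some m ∧ m ∉ st.queried := by
      rintro ⟨m', hm', hq'⟩
      rw [hm] at hm'
      cases hm'
      exact hq' hq
    classical
    rw [decide_eq_false this, Bool.and_false]
    cases b <;> exact le_rfl
  · rintro _ ⟨st, cnt⟩ _ _ ⟨rfl, rfl, rfl, ⟨m, hm, hq⟩, hc⟩ c a i l μ ih
    simp only at hm hq hc
    have hle : ∀ (s : PSIState S × (PSICall → ℕ)) v, (∃ m, s.1.chosen = some m ∧ m ∈ s.1.queried) →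
        1 ≤ s.2 .challenge → A.resultValue S
          ((psiHandler S n P₂ (fun i => if i = b then y else u) z b).boundedTransformer bound)
          (fun w s => mean (psiJudge S w s.1) fun g => pay (decide (g = b))) i l (μ v) s ≤ pay !b := by
      intro s v h₁ h₂
      refine (le_of_eq (one_mul _).symm).trans ((ih 1 s _ 0 ⟨rfl, rfl, rfl, h₁, h₂⟩ v).trans ?_)
      rw [add_zero]
      exact A.resultValue_le_const S (fun _ _ _ _ _ => le_rfl) (fun _ _ => le_rfl) _ _ _ _
    by_cases hb : bound (countCall cnt c)
    swap
    · refine le_trans (le_of_eq ?_) zero_le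
      exact (congrArg _ (if_neg hb)).trans (mul_zero _)
    refine (congrArg _ (if_pos hb)).trans_le ?_
    rw [one_mul, add_zero]
    have hcnt : ∀ d : PSICall, d ≠ .challenge → countCall (O := psiSig) cnt d .challenge = cnt .challenge :=
      fun d hd => countCall_of_ne (O := psiSig) cnt hd.symm
    cases c with
    | hash =>
      obtain ⟨(m' : List Bool), (salt : List Bool), ⟨⟩⟩ := a
      refine (congrArg (· ≤ _) (mean_map _ _ _)).mpr ?_
      exact mean_le_const fun g => hle _ _ ⟨m, hm, hq⟩ (hc.trans_eq (hcnt .hash (by simp)).symm)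
    | sign j =>
      obtain ⟨(m' : List Bool), ⟨⟩⟩ := a
      refine (congrArg (· ≤ _) (mean_map _ _ _)).mpr ?_
      exact mean_le_const fun g => hle _ _ ⟨m, hm, Or.inr hq⟩ (hc.trans_eq (hcnt (.sign j) (by simp)).symm)
    | verify j =>
      obtain ⟨(m' : List Bool), (salt : List Bool), (Q₁ : S.G₁), (Q₂ : S.G₂), ⟨⟩⟩ := a
      refine (congrArg (· ≤ _) (mean_map _ _ _)).mpr ?_
      exact mean_le_const fun g => hle _ _ ⟨m, hm, Or.inr hq⟩ (hc.trans_eq (hcnt (.verify j) (by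
          simp)).symm)
    | challenge =>
      have h₁ := hC _ hb
      have h₂ : countCall (O := psiSig) cnt .challenge .challenge = cnt .challenge + 1 :=
        countCall_same (O := psiSig) cnt .challenge
      exact absurd (h₂ ▸ h₁ : cnt .challenge + 1 ≤ 1) (by omega)

end Hide

/-! ### From the experiment to the reduction with a valid instance. -/

section Hide

variable {S : BilinearStructure} {n : ℕ} {P₂ : S.G₂} {y z u : ZMod S.q} {b : Bool}

variable (A : PSIAdversary) (S n P₂ y z) in
/-- The value of the reduction. -/
def hideValue (pay : Bool → ℝ≥0∞) (i : ℕ) (l : A.L) (μ : Mem S A.R) (s : HideState S) : ℝ≥0∞ :=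
  A.resultValue S (Wrapper.exitTransformer (hideAnswer S n P₂ y z) pay fun _ => 0)
    (fun w s => mean (hideFinal S w s) pay) i l μ s

variable (A : PSIAdversary) {bound : (PSICall → ℕ) → Prop} {pay : Bool → ℝ≥0∞} {q : ℕ}

theorem hideValue_le_one (hpay : ∀ g, pay g ≤ 1) (i : ℕ) (l : A.L) (μ : Mem S A.R)
    (s : HideState S) : hideValue S n P₂ y z A pay i l μ s ≤ 1 := by
  refine A.resultValue_le_const S (fun c a s Φ hΦ => ?_) (fun w s => mean_le_const hpay) _ _ _ _
  simp only [Wrapper.exitTransformer, zero_add]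
  exact mean_le_const fun v => by
    cases v
    · exact hΦ _
    · exact hpay _

variable (S P₂ y z u b) in
/-- The state of the reduction for a valid instance of PR₃, given the random element of the instance,
the hidden salts and the state of the experiment. -/
def hideState (st : PSIState S) (t : ZMod S.q) (κ : List Bool → Option (List Bool)) : HideState S :=
  (⟨b, u, t, scale (y * z * t⁻¹) P₂, st.chosen.isSome⟩, st.table, κ, st.queried,
    {m | st.chosen = some m})

theorem mean_mean_add_const {α β γ : Type*} (g : PMF γ) (p : PMF α) (h : PMF β) (F : γ → α → β → ℝ≥0∞)
    (e : ℝ≥0∞) : (mean g fun c => (mean p fun a => mean h (F c a)) + e) =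
      (mean p fun a => mean h fun b => mean g fun c => F c a b) + e := by
  rw [mean_add, mean_const, mean_comm]
  congr 2
  funext a
  exact mean_comm _ _ _

theorem le_mean_mean_of_eq {α β : Type*} {p : PMF α} {h : PMF β} {F : α → β → ℝ≥0∞} {e : ℝ≥0∞}
    (hF : ∀ a b, F a b = e) : e ≤ mean p fun a => mean h (F a) := by
  have : (fun a => mean h (F a)) = fun _ => e := funext fun a => by
    rw [show F a = fun _ => e from funext (hF a), mean_const]
  rw [this, mean_const]

/-- The two systems differ only when a signing or verification query meets the hidden salt of its
message. This salt is uniform given the view, so each query contributes at most `2^-n`, and `ε` is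
the error reserved for the remaining queries. Where the reduction stops because of a forbidden
message, the experiment is worth at most as much by `psiValue_le_of_mem`. -/
theorem psiValue_le_hideValue (hy : y ≠ 0) (hpay : ∀ g, pay g ≤ 1)
    (hC : ∀ c, bound c → c .challenge ≤ 1) (hq : ∀ c, bound c → psiQueries c ≤ q)
    (i : ℕ) (l : A.L) (μ : Mem S A.R) :
    psiValue S n P₂ y z u b A bound pay i l μ (⟨fun _ _ => none, ∅, none⟩, fun _ => 0) ≤
      (mean (uniformNonzero (ZMod S.q)) fun t => hideValue S n P₂ y z A pay i l μ
        (hideState S P₂ y z u b ⟨fun _ _ => none, ∅, none⟩ t fun _ => none)) +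
      q * ((2 : ℝ≥0∞) ^ n)⁻¹ := by
  have := A.resultValue_le_average S
    (H := (psiHandler S n P₂ (fun i => if i = b then y else u) z b).boundedTransformer bound)
    (J := fun w s => mean (psiJudge S w s.1) fun g => pay (decide (g = b)))
    (H' := Wrapper.exitTransformer (hideAnswer S n P₂ y z) pay fun _ => 0)
    (J' := fun w s => mean (hideFinal S w s) pay)
    (fun α s K ε => α = 1 ∧ ε = ((q - psiQueries s.2 : ℕ) : ℝ≥0∞) * ((2 : ℝ≥0∞) ^ n)⁻¹ ∧
      ∃ (κ : List Bool → Option (List Bool)) (D : List (List Bool)) (p : PMF (ZMod S.q)),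
        HideHidden s.1.chosen κ D ∧ (∀ m, s.1.chosen = some m → m ∉ s.1.queried) ∧
        -- The random scalar `t` of the instance is uniform until the challenge uses it. Afterwards
        -- it may be fixed, and nothing about its distribution is needed.
        (s.1.chosen = none ∧ p = uniformNonzero (ZMod S.q) ∨ 1 ≤ s.2 .challenge) ∧
        K = fun F => mean p fun t => mean (hiddenFun (uniformBits n) κ D) fun κ' =>
          F (hideState S P₂ y z u b s.1 t κ')) ?_ ?_ ?_
    (s := (⟨fun _ _ => none, ∅, none⟩, fun _ => 0)) ⟨rfl, rfl, fun _ => none, [], _,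
      ⟨by simp, by simp, by simp⟩, by simp, Or.inl ⟨rfl, rfl⟩, rfl⟩ i l μ
  · simp only [mean_hidden_nil, one_mul] at this
    exact this
  · rintro _ s _ _ ⟨rfl, rfl, κ, D, p, -, -, -, rfl⟩ γ p' F
    rw [mean_comm]
    exact congrArg (mean p) (funext fun t => mean_comm _ _ _)
  · rintro _ ⟨st, cnt⟩ _ _ ⟨rfl, rfl, κ, D, p, hκ, hfresh, -, rfl⟩ ⟨(w : Bool), ⟨⟩⟩
    simp only at hfresh
    rw [one_mul]
    refine le_add_right (le_of_eq ?_)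
    classical
    have he : decide (∃ m, st.chosen = some m ∧ m ∉ st.queried) = st.chosen.isSome := by
      cases ho : st.chosen with
      | none => simp
      | some m => simpa using hfresh m ho
    have hfin : ∀ t κ', mean (hideFinal S (w, ()) (hideState S P₂ y z u b st t κ')) pay =
        pay (decide ((w && st.chosen.isSome) = b)) := fun t κ' => mean_pure _ _
    simp only [hfin, mean_const, psiJudge, mean_pure]
    rw [← he]
  · rintro _ ⟨st, cnt⟩ _ _ ⟨rfl, rfl, κ, D, p, hκ, hfresh, hst, rfl⟩ c a i l μ ih
    simp only at hfresh hst hκ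
    have ih : ∀ (st : PSIState S) (cnt : PSICall → ℕ) κ D p, HideHidden st.chosen κ D →
        (∀ m, st.chosen = some m → m ∉ st.queried) →
        (st.chosen = none ∧ p = uniformNonzero (ZMod S.q) ∨ 1 ≤ cnt .challenge) → ∀ v,
        psiValue S n P₂ y z u b A bound pay i l (μ v) (st, cnt) ≤
          (mean p fun t => mean (hiddenFun (uniformBits n) κ D) fun κ' =>
            hideValue S n P₂ y z A pay i l (μ v) (hideState S P₂ y z u b st t κ')) +
          ((q - psiQueries cnt : ℕ) : ℝ≥0∞) * ((2 : ℝ≥0∞) ^ n)⁻¹ := by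
      intro st cnt κ D p h₁ h₂ h₃ v
      have := ih 1 (st, cnt) _ _ ⟨rfl, rfl, κ, D, p, h₁, h₂, h₃, rfl⟩ v
      rw [one_mul] at this
      exact this
    by_cases hb : bound (countCall cnt c)
    swap
    · refine le_trans (le_of_eq ?_) zero_le
      exact (congrArg _ (if_neg hb)).trans (mul_zero _)
    refine (congrArg _ (if_pos hb)).trans_le ?_
    rw [one_mul]
    have hcnt : ∀ d : PSICall, cnt .challenge ≤ countCall (O := psiSig) cnt d .challenge := by
      intro d
      by_cases hd : d = .challenge
      · subst hd
        exact (Nat.le_succ _).trans_eq (countCall_same (O := psiSig) cnt .challenge).symm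
      · exact (countCall_of_ne (O := psiSig) cnt (Ne.symm hd)).ge
    simp only [Wrapper.exitTransformer, zero_add]
    cases c with
    | hash =>
      obtain ⟨(m : List Bool), (salt : List Bool), ⟨⟩⟩ := a
      refine (congrArg (· ≤ _) (mean_map _ _ _)).mpr ?_
      simp only [hideAnswer, hideState, mean_bind, mean_map, Sum.elim_inl]
      obtain ⟨D', hD', he⟩ := hκ.exists_mean_reveal (n := n) m
      refine (mean_mono fun g : S.G₁ × HashTable S => ih ⟨g.2, st.queried, st.chosen⟩ (countCall
          (O := psiSig) cnt .hash) κ D' p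
        hD' hfresh (hst.imp_right fun h => h.trans (hcnt _)) (g.1, ())).trans (le_of_eq ?_)
      rw [mean_mean_add_const]
      refine congrArg₂ (· + ·) (congrArg (mean p) (funext fun t => ?_))
        (congrArg (fun N : ℕ => ((q - N : ℕ) : ℝ≥0∞) * _) (psiQueries_hash cnt))
      exact (he fun κ'' => mean (hashQuery S m salt st.table) fun g => hideValue S n P₂ y z A pay i l
        (μ (g.1, ())) (hideState S P₂ y z u b ⟨g.2, st.queried, st.chosen⟩ t κ'')).symm
    | sign j =>
      obtain ⟨(m : List Bool), ⟨⟩⟩ := a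
      refine (congrArg (· ≤ _) (mean_map _ _ _)).mpr ?_
      by_cases hm : st.chosen = some m
      · refine le_add_right (le_trans (mean_le_const fun g => ?_) (le_mean_mean_of_eq (e := pay
            !b) fun t κ' =>
          (congrArg (mean · _) (if_pos hm)).trans (mean_pure _ _)))
        exact psiValue_le_of_mem A hC i l (μ _) (st := ⟨g.2, insert m st.queried, st.chosen⟩)
          (cnt := countCall (O := psiSig) cnt (.sign j)) (m := m) hm (Or.inl rfl)
          ((hst.resolve_left fun h => by simp [h.1] at hm).trans (hcnt _))
      · have hR : ∀ t κ', mean (hideAnswer S n P₂ y z (.sign j) (m, ()) (hideState S P₂ y z u b st t κ'))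
            (Sum.elim (fun v => hideValue S n P₂ y z A pay i l (μ v.1) v.2) pay) =
              mean (reveal (uniformBits n) m κ') fun c => mean (uniformBits n) fun r =>
                if r = c.1 then pay !b else
                mean (hashQuery S m r st.table) fun g => hideValue S n P₂ y z A pay i l
                  (μ (r, (scale (if j = b then y else u) g.1 : S.G₁), ()))
                  (hideState S P₂ y z u b ⟨g.2, insert m st.queried, st.chosen⟩ t c.2) := by
          intro t κ'
          refine (congrArg (mean · _) (if_neg hm)).trans ((mean_bind _ _ _).trans
            (congrArg (mean _) (funext fun c => (mean_bind _ _ _).trans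
              (congrArg (mean _) (funext fun r => ?_)))))
          by_cases hr : r = c.1
          · rw [if_pos hr, if_pos hr]
            exact mean_pure _ _
          · rw [if_neg hr, if_neg hr]
            exact mean_map _ _ _
        refine le_trans ?_ (add_le_add (mean_mono fun t => mean_mono fun κ' => (hR t κ').ge) le_rfl)
        have hq' := hq _ hb
        have hcount := psiQueries_sign cnt j
        have hN : q - psiQueries cnt = q - psiQueries (countCall (O := psiSig) cnt (.sign j)) + 1 := by
          omega
        rw [hN, Nat.cast_add, Nat.cast_one, add_mul, one_mul, add_comm (_ * _)]
        simp only [sign, mean_bind, mean_map]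
        -- The salt of the signature may be fixed: the hidden salt is the one whose randomness makes
        -- a collision unlikely.
        have hstep : ∀ r : List Bool, (mean (hashQuery S m r st.table) fun g =>
            psiValue S n P₂ y z u b A bound pay i l (μ (r, (scale (if j = b then y else u) g.1 : S.G₁), ()))
              (⟨g.2, insert m st.queried, st.chosen⟩, countCall cnt (.sign j))) ≤
            (mean p fun t => mean (hiddenFun (uniformBits n) κ D) fun κ' =>
              mean (reveal (uniformBits n) m κ') fun c => if r = c.1 then pay !b else
                mean (hashQuery S m r st.table) fun g => hideValue S n P₂ y z A pay i l
                  (μ (r, (scale (if j = b then y else u) g.1 : S.G₁), ()))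
                  (hideState S P₂ y z u b ⟨g.2, insert m st.queried, st.chosen⟩ t c.2)) +
            (((2 : ℝ≥0∞) ^ n)⁻¹ + ((q - psiQueries (countCall (O := psiSig) cnt (.sign j)) : ℕ) : ℝ≥0∞) *
              ((2 : ℝ≥0∞) ^ n)⁻¹) := by
          intro r
          refine (mean_mono fun g : S.G₁ × HashTable S => ih ⟨g.2, insert m st.queried, st.chosen⟩
            (countCall (O := psiSig) cnt (.sign j)) κ (m :: D) p (hκ.cons hm) (fun m' hm' => ?_)
            (hst.imp_right fun h => h.trans (hcnt _)) _).trans ?_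
          · rintro (rfl | h)
            · exact hm hm'
            · exact hfresh _ hm' h
          · rw [mean_mean_add_const, ← add_assoc]
            refine add_le_add (mean_le_mean_add_const fun t _ => ?_) le_rfl
            exact hκ.mean_cons_le hm fun κ' => mean_le_const fun g => hideValue_le_one A hpay _ _ _ _
        refine (mean_mono hstep).trans (le_of_eq ?_)
        rw [mean_mean_add_const]
        refine congrArg (· + _) (congrArg (mean p) (funext fun t => congrArg (mean _) (funext fun
            κ' => ?_)))
        exact mean_comm _ _ _
    | verify j =>
      obtain ⟨(m : List Bool), (salt : List Bool), (Q₁ : S.G₁), (Q₂ : S.G₂), ⟨⟩⟩ := a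
      refine (congrArg (· ≤ _) (mean_map _ _ _)).mpr ?_
      by_cases hm : st.chosen = some m
      · refine le_add_right (le_trans (mean_le_const fun g => ?_) (le_mean_mean_of_eq (e := pay
            !b) fun t κ' =>
          (congrArg (mean · _) (if_pos hm)).trans (mean_pure _ _)))
        exact psiValue_le_of_mem A hC i l (μ _) (st := ⟨g.2, insert m st.queried, st.chosen⟩)
          (cnt := countCall (O := psiSig) cnt (.verify j)) (m := m) hm (Or.inl rfl)
          ((hst.resolve_left fun h => by simp [h.1] at hm).trans (hcnt _))
      · have hR : ∀ t κ', mean (hideAnswer S n P₂ y z (.verify j) (m, salt, Q₁, Q₂, ())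
              (hideState S P₂ y z u b st t κ'))
            (Sum.elim (fun v => hideValue S n P₂ y z A pay i l (μ v.1) v.2) pay) =
              mean (reveal (uniformBits n) m κ') fun c => if salt = c.1 then pay !b else
                mean (dverify S m salt Q₁ Q₂ (scale (if j = b then y else u) P₂) z st.table) fun g =>
                  hideValue S n P₂ y z A pay i l (μ (g.1, ()))
                    (hideState S P₂ y z u b ⟨g.2, insert m st.queried, st.chosen⟩ t c.2) := by
          intro t κ'
          refine (congrArg (mean · _) (if_neg hm)).trans ((mean_bind _ _ _).trans
            (congrArg (mean _) (funext fun c => ?_)))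
          by_cases hr : salt = c.1
          · rw [if_pos hr, if_pos hr]
            exact mean_pure _ _
          · rw [if_neg hr, if_neg hr]
            exact mean_map _ _ _
        refine le_trans ?_ (add_le_add (mean_mono fun t => mean_mono fun κ' => (hR t κ').ge) le_rfl)
        have hq' := hq _ hb
        have hcount := psiQueries_verify cnt j
        have hN : q - psiQueries cnt = q - psiQueries (countCall (O := psiSig) cnt (.verify j)) + 1 := by
          omega
        rw [hN, Nat.cast_add, Nat.cast_one, add_mul, one_mul, add_comm (_ * _)]
        refine (mean_mono fun g : Bool × HashTable S => ih ⟨g.2, insert m st.queried, st.chosen⟩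
            (countCall (O := psiSig) cnt (.verify j)) κ (m :: D) p (hκ.cons hm) (fun m' hm' => ?_)
            (hst.imp_right fun h => h.trans (hcnt _)) (g.1, ())).trans ?_
        · rintro (rfl | h)
          · exact hm hm'
          · exact hfresh _ hm' h
        · rw [mean_mean_add_const, ← add_assoc]
          refine add_le_add (mean_le_mean_add_const fun t _ => ?_) le_rfl
          exact hκ.mean_cons_le hm fun κ' => mean_le_const fun g => hideValue_le_one A hpay _ _ _ _
    | challenge =>
      obtain ⟨(m : List Bool), ⟨⟩⟩ := a
      have h₁ := hC _ hb
      have h₂ : countCall (O := psiSig) cnt .challenge .challenge = cnt .challenge + 1 :=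
        countCall_same (O := psiSig) cnt .challenge
      have h₃ : 1 ≤ countCall (O := psiSig) cnt .challenge .challenge := h₂ ▸ Nat.le_add_left _ _
      -- An earlier challenge would violate the bound on the calls, so `t` is still uniform and no
      -- message has been chosen.
      obtain ⟨ho, rfl⟩ := hst.resolve_right fun h => absurd (h₂ ▸ h₁ : cnt .challenge + 1 ≤ 1) (by omega)
      rw [ho] at hκ
      refine (congrArg (· ≤ _) (mean_bind _ _ _)).mpr ?_
      by_cases hm : m ∈ st.queried
      · refine le_add_right (le_trans (mean_le_const fun g => ?_) (le_mean_mean_of_eq (e := pay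
            !b) fun t κ' =>
          (congrArg (mean · _) (if_pos hm)).trans (mean_pure _ _)))
        refine (mean_map _ _ _).trans_le (mean_le_const fun d => ?_)
        exact psiValue_le_of_mem A hC i l (μ _) (st := ⟨g.2, st.queried, some m⟩)
          (cnt := countCall (O := psiSig) cnt .challenge) (m := m) rfl hm h₃
      · have hR : ∀ t κ', mean (hideAnswer S n P₂ y z .challenge (m, ()) (hideState S P₂ y z u b st t κ'))
            (Sum.elim (fun v => hideValue S n P₂ y z A pay i l (μ v.1) v.2) pay) =
              mean (reveal (uniformBits n) m κ') fun c => mean (hashQuery S m c.1 st.table) fun g =>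
                hideValue S n P₂ y z A pay i l
                  (μ (c.1, (scale t g.1 : S.G₁), (scale (y * z * t⁻¹) P₂ : S.G₂), ()))
                  (hideState S P₂ y z u b ⟨g.2, st.queried, some m⟩ t c.2) := by
          intro t κ'
          refine (congrArg (mean · _) (if_neg hm)).trans ((mean_bind _ _ _).trans
            (congrArg (mean _) (funext fun c => (mean_map _ _ _).trans
              (congrArg (mean _) (funext fun g => ?_)))))
          have hset : insert m {m | st.chosen = some m} = {m' | some m = some m'} := by
            ext m'
            simp [ho, eq_comm]
          rw [hideState, ← hset]
          rfl
        refine le_trans ?_ (add_le_add (mean_mono fun t => mean_mono fun κ' => (hR t κ').ge) le_rfl)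
        have hstep : ∀ (r : List Bool) (g : S.G₁ × HashTable S), (mean (uniformNonzero (ZMod S.q)) fun t =>
            psiValue S n P₂ y z u b A bound pay i l
              (μ (r, (scale t (scale y g.1) : S.G₁), (scale t⁻¹ (scale z P₂) : S.G₂), ()))
              (⟨g.2, st.queried, some m⟩, countCall cnt .challenge)) ≤
            (mean (uniformNonzero (ZMod S.q)) fun t => mean (hiddenFun (uniformBits n)
              (Function.update κ m (some r)) (D.filter (· ≠ m))) fun κ' => hideValue S n P₂ y z A pay i l
                (μ (r, (scale t g.1 : S.G₁), (scale (y * z * t⁻¹) P₂ : S.G₂), ()))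
                (hideState S P₂ y z u b ⟨g.2, st.queried, some m⟩ t κ')) +
            ((q - psiQueries cnt : ℕ) : ℝ≥0∞) * ((2 : ℝ≥0∞) ^ n)⁻¹ := by
          intro r g
          -- Substitution of `ty` for the scalar of the instance: the designated signature `(t·yH,
          -- t⁻¹·zP₂)` of the experiment is `(t'H, (yz/t')P₂)` with `t' = ty`.
          refine le_of_le_of_eq ?_ (congrArg (· + _) (mean_uniformNonzero_bijective
            (g := fun t : ZMod S.q => t * y) (mulRight_bijective₀ y hy) (zero_mul y) _))
          refine mean_le_mean_add_const fun t ht => ?_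
          have := ih ⟨g.2, st.queried, some m⟩ (countCall (O := psiSig) cnt .challenge) _ _
            (PMF.pure (t * y)) (hκ.challenge m r) (fun m' hm' => by cases hm'; exact hm) (Or.inr h₃)
            (r, (scale t (scale y g.1) : S.G₁), (scale t⁻¹ (scale z P₂) : S.G₂), ())
          rw [mean_pure] at this
          refine this.trans (le_of_eq ?_)
          have e₁ : scale t (scale y g.1) = scale (t * y) g.1 := (scale_mul S.card₁ t y g.1).symm
          have e₂ : scale t⁻¹ (scale z P₂) = scale (y * z * (t * y)⁻¹) P₂ := by
            rw [← scale_mul S.card₂]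
            congr 1
            rw [mem_support_uniformNonzero] at ht
            field_simp
          rw [e₁, e₂]
          exact congrArg (fun N : ℕ => _ + ((q - N : ℕ) : ℝ≥0∞) * _) (psiQueries_challenge cnt)
        simp only [mean_challenge hκ]
        simp only [sign, designate, mean_bind, mean_map]
        refine (mean_mono fun r => mean_mono fun g => hstep r g).trans (le_of_eq ?_)
        simp only [mean_mean_add_const]
        rw [mean_add, mean_const, mean_comm]

end Hide

/-! ### Complementary results and almost sure termination. -/

section Halting

variable {O : Sig} {inp out : List Srt} (P : Program O inp out) (S : BilinearStructure) {σ : Type}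

/-- Nothing is paid for instructions or calls, so the value is additive in the final payoff. -/
theorem Program.resultValue_add {h : Handler O S σ} {J J' : Args S out → σ → ℝ≥0∞} (n : ℕ) (l : P.L)
    (μ : Mem S P.R) (s : σ) :
    P.resultValue S (h.transformer fun _ => 0) J n l μ s +
        P.resultValue S (h.transformer fun _ => 0) J' n l μ s =
      P.resultValue S (h.transformer fun _ => 0) (fun w s => J w s + J' w s) n l μ s := by
  induction n generalizing l μ s with
  | zero => exact add_zero _
  | succ n ih =>
    simp only [Program.resultValue, Program.value, zero_add] at ih ⊢
    cases hl : P.code l with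
    | prim p x y next =>
      simp only [← ih, mean_add]
    | branch x l₁ l₀ => exact ih _ _ _
    | store i t a b x next => exact ih _ _ _
    | load i t a b x found missing =>
      cases hv : μ.tab i t (μ.reg .bits a) (μ.reg .bits b) <;> simp only [hv] <;> exact ih _ _ _
    | call c x y next => simp only [Handler.transformer, zero_add, ← ih, mean_add]
    | halt x => rfl

theorem Handler.transformer_mono (h : Handler O S σ) (cc : O.Call → ℝ≥0∞) (c : O.Call)
    (a : Args S (O.args c)) (s : σ) (Φ Φ' : Args S (O.rets c) × σ → ℝ≥0∞) (hΦ : ∀ v, Φ v ≤ Φ' v) :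
    h.transformer cc c a s Φ ≤ h.transformer cc c a s Φ' :=
  add_le_add le_rfl (mean_mono hΦ)

/-- Complementary judgements together accept whenever the run stops. -/
theorem Program.accept_add_accept (T : Costs) (k : ℕ) {callCost : O.Call → ℕ} {h : Handler O S σ}
    {v : Args S inp} {s : σ} {judge judge' : Args S out → σ → PMF Bool}
    (hJ : ∀ w s, judge w s true + judge' w s true = 1) :
    P.accept T k callCost S h v s judge + P.accept T k callCost S h v s judge' =
      ⨆ n, P.resultValue S (h.transformer fun _ => 0) (fun _ _ => 1) n P.start
        (Program.startMem S v) s := by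
  rw [P.accept_eq_iSup, P.accept_eq_iSup, ENNReal.iSup_add_iSup_of_monotone
    (P.value_mono S (h.transformer_mono S _) _ _ _) (P.value_mono S (h.transformer_mono S _) _ _ _)]
  refine iSup_congr fun n => (P.resultValue_add S n _ _ _).trans ?_
  simp only [hJ]

end Halting

/-- The payoff for the result `o`. -/
def targetPayoff (o g : Bool) : ℝ≥0∞ := if g = o then 1 else 0

theorem targetPayoff_le_one (o g : Bool) : targetPayoff o g ≤ 1 := by
  rw [targetPayoff]
  split_ifs <;> simp

theorem targetPayoff_add (o g : Bool) : targetPayoff o g + targetPayoff (!o) g = 1 := by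
  cases o <;> cases g <;> simp [targetPayoff]

theorem map_beq_apply (p : PMF Bool) (e : Bool) : (p.map (· == e)) true = mean p (targetPayoff e) := by
  rw [map_apply_eq_mean]
  congr 1
  funext g
  cases g <;> cases e <;> simp [targetPayoff]

/-! ### Experiment and reduction for fixed keys. -/

section Psi

variable {S : BilinearStructure} {n : ℕ} {P₂ : S.G₂} {x y z : ZMod S.q}

theorem exists_psiFormat (S : BilinearStructure) (n : ℕ) (c : PSICall) : ∃ w, psiFormat S n c w := by
  cases c with
  | hash =>
    obtain ⟨g, hg⟩ := exists_ne (0 : S.G₁)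
    exact ⟨(g, ()), hg⟩
  | sign => exact ⟨((List.replicate n false : List Bool), (0 : S.G₁), ()), List.length_replicate⟩
  | verify => exact ⟨(false, ()), trivial⟩
  | challenge =>
    exact ⟨((List.replicate n false : List Bool), (0 : S.G₁), (0 : S.G₂), ()), List.length_replicate⟩

theorem psiHandler_invariant {u : Bool → ZMod S.q} {b : Bool} (c : PSICall)
    (a : Args S (psiSig.args c)) (s : PSIState S) (hs : s.table.NeZero) :
    ∀ w ∈ (psiHandler S n P₂ u z b c a s).support, psiFormat S n c w.1 ∧ w.2.table.NeZero := by
  intro w hw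
  cases c with
  | hash =>
    obtain ⟨g, hg, rfl⟩ := (PMF.mem_support_map_iff _ _ _).1 hw
    exact hs.of_mem_support hg
  | sign =>
    obtain ⟨g, hg, rfl⟩ := (PMF.mem_support_map_iff _ _ _).1 hw
    exact hs.sign hg
  | verify =>
    obtain ⟨g, hg, rfl⟩ := (PMF.mem_support_map_iff _ _ _).1 hw
    exact ⟨trivial, hs.dverify hg⟩
  | challenge =>
    obtain ⟨g, hg, hw⟩ := (PMF.mem_support_bind_iff _ _ _).1 hw
    obtain ⟨d, hd, rfl⟩ := (PMF.mem_support_map_iff _ _ _).1 hw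
    obtain ⟨t, -, rfl⟩ := (PMF.mem_support_map_iff _ _ _).1 hd
    exact hs.sign hg

variable (A : PSIAdversary) (T : Costs) (k : ℕ)

variable (n P₂ z) in
/-- The probability that the experiment with the challenge bit `b` returns `e`. -/
def psiEvent (u : Bool → ZMod S.q) (b e : Bool) : ℝ≥0∞ :=
  A.accept T k (psiCallCost T k) S (psiHandler S n P₂ u z b) (psiInput S n P₂ (u false) (u true) z)
    ⟨fun _ _ => none, ∅, none⟩ fun w s => (psiJudge S w s).map (· == e)

theorem psiEvent_eq_iSup (u : Bool → ZMod S.q) (b e : Bool) :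
    psiEvent n P₂ z A T k u b e = ⨆ i, A.resultValue S
      ((psiHandler S n P₂ u z b).transformer fun _ => 0)
      (fun w s => mean (psiJudge S w s) (targetPayoff e)) i A.start
      (Program.startMem S (psiInput S n P₂ (u false) (u true) z)) ⟨fun _ _ => none, ∅, none⟩ := by
  refine (A.accept_eq_iSup S T k (psiCallCost T k) _ _ _ _).trans ?_
  simp only [map_beq_apply]

/-- A run without end belongs to neither event. Finite worst-case time excludes this, up to
probability zero. -/
theorem one_le_psiEvent_add {u : Bool → ZMod S.q} (b e : Bool)
    (ht : A.worstTime T k (psiCallCost T k) S (psiFormat S n)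
      (psiInput S n P₂ (u false) (u true) z) < ⊤) :
    1 ≤ psiEvent n P₂ z A T k u b e + psiEvent n P₂ z A T k u b !e := by
  refine (?_ : (1 : ℝ≥0∞) ≤ _).trans_eq
    (A.accept_add_accept S T k (callCost := psiCallCost T k) fun w s => ?_).symm
  · refine A.one_le_iSup_resultValue T k (h := psiHandler S n P₂ u z b) (Inv := fun s =>
        s.table.NeZero) (exists_psiFormat S n)
      (fun c => ?_) psiHandler_invariant ht HashTable.neZero_empty
    cases c <;> simp only [psiCallCost] <;> omega
  · rw [map_beq_apply, map_beq_apply, ← mean_add]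
    simp only [targetPayoff_add, mean_const]

variable (n P₂ y z) in
/-- The probability of the result `o` of the reduction after its choices. -/
def hideEvent (o : Bool) (s : HideCore S) : ℝ≥0∞ :=
  ⨆ i, hideValue S n P₂ y z A (targetPayoff o) i A.start
    (Program.startMem S (hideInput S n P₂ y z s)) (s, fun _ _ => none, fun _ => none, ∅, ∅)

theorem hideValue_monotone (pay : Bool → ℝ≥0∞) (l : A.L) (μ : Mem S A.R) (s : HideState S) :
    Monotone fun i => hideValue S n P₂ y z A pay i l μ s := by
  refine A.value_mono S (fun c a s Φ Φ' hΦ => ?_) l μ s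
  refine add_le_add le_rfl (mean_mono fun v => ?_)
  cases v
  · exact hΦ _
  · exact le_rfl

/-- The judge for the result `o`. -/
def targetJudge (S : BilinearStructure) (o : Bool) (w : Args S [.bool]) (_ : Unit) : PMF Bool :=
  PMF.pure ((show Bool from w.1) == o)

theorem targetJudge_apply {o b : Bool} {w : Args S [.bool]} (hw : HideRes S w b) :
    targetJudge S o w () true = targetPayoff o b := by
  subst hw
  obtain ⟨(w : Bool), ⟨⟩⟩ := w
  cases w <;> cases o <;> simp [targetPayoff, targetJudge]

/-- The results of the code are known exactly, so the upper and lower bounds for the compiled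
program coincide. An equality is needed for the symmetry argument on random instances. The factor
`2⁻¹` comes from the coin `bit`. -/
theorem accept_hideProgram (hP : P₂ ≠ 0) (hx : x ≠ 0) (aux : ℕ × ℕ) (t : ZMod S.q) (Q : S.G₂)
    (o : Bool) :
    (hideWrapper.program A).accept T k Empty.elim S (noHandler S)
        (pr3Input S (n, aux) P₂ x y z (scale t (scale x (S.ψ P₂)), Q)) () (targetJudge S o) =
      mean (uniformNonzero (ZMod S.q)) fun u => 2⁻¹ * (hideEvent n P₂ y z A o ⟨false, u, t, Q, false⟩ +
        hideEvent n P₂ y z A o ⟨true, u, t, Q, false⟩) := by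
  have hmono : ∀ s : HideCore S, Monotone fun i => hideValue S n P₂ y z A (targetPayoff o) i A.start
      (Program.startMem S (hideInput S n P₂ y z s)) (s, fun _ _ => none, fun _ => none, ∅, ∅) :=
    fun s => hideValue_monotone A _ _ _ _
  have hval : ∀ i, (mean (hideInit S n P₂ y z t Q) fun x => A.resultValue S
      (Wrapper.exitTransformer (hideAnswer S n P₂ y z) (targetPayoff o) fun _ => 0)
      (fun w s => mean (hideFinal S w s) (targetPayoff o)) i A.start (Program.startMem S x.1) x.2) =
      mean (uniformNonzero (ZMod S.q)) fun u => 2⁻¹ *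
        (hideValue S n P₂ y z A (targetPayoff o) i A.start
          (Program.startMem S (hideInput S n P₂ y z ⟨false, u, t, Q, false⟩))
          (⟨false, u, t, Q, false⟩, fun _ _ => none, fun _ => none, ∅, ∅) +
        hideValue S n P₂ y z A (targetPayoff o) i A.start
          (Program.startMem S (hideInput S n P₂ y z ⟨true, u, t, Q, false⟩))
          (⟨true, u, t, Q, false⟩, fun _ _ => none, fun _ => none, ∅, ∅)) := by
    intro i
    rw [hideInit, mean_bind]
    congr 1
    funext u
    rw [mean_map, mean_uniformUpTo, Finset.sum_range_succ, Finset.sum_range_one]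
    norm_num
    rfl
  have hW := hideWrapper_implements (n := n) (y := y) (z := z) hP hx aux t Q
  have hsup : (hideWrapper.program A).accept T k Empty.elim S (noHandler S)
        (pr3Input S (n, aux) P₂ x y z (scale t (scale x (S.ψ P₂)), Q)) () (targetJudge S o) =
      ⨆ i, mean (hideInit S n P₂ y z t Q) fun x => A.resultValue S
        (Wrapper.exitTransformer (hideAnswer S n P₂ y z) (targetPayoff o) fun _ => 0)
        (fun w s => mean (hideFinal S w s) (targetPayoff o)) i A.start (Program.startMem S x.1) x.2 :=
    le_antisymm
      (hideWrapper.accept_program_le A hW T k _ fun w b hw => (targetJudge_apply hw).le)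
      (iSup_le fun i => hideWrapper.le_accept_program A hW T k _
        (fun w b hw => (targetJudge_apply hw).ge) i)
  rw [hsup]
  simp only [hval]
  rw [← mean_iSup]
  · congr 1
    funext u
    rw [← ENNReal.mul_iSup, hideEvent, hideEvent, ENNReal.iSup_add_iSup_of_monotone (hmono _) (hmono _)]
  · exact fun u i j hij => mul_le_mul_right (add_le_add (hmono _ hij) (hmono _ hij)) _

/-- The comparison of a guess with `b` has the result `o` exactly if the guess is `b == o`. Both
values of `o` are needed later, since the simulation is estimated from one side only. -/
theorem psiEvent_le_hideEvent (hy : y ≠ 0) {u : ZMod S.q} {b o : Bool} {q : ℕ}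
    {bound : (PSICall → ℕ) → Prop}
    (hb : A.CallsBounded T k (psiCallCost T k) S (psiFormat S n)
      (hideInput S n P₂ y z ⟨b, u, 0, 0, false⟩) bound)
    (hC : ∀ c, bound c → c .challenge ≤ 1) (hq : ∀ c, bound c → psiQueries c ≤ q) :
    psiEvent n P₂ z A T k (fun i => if i = b then y else u) b (b == o) ≤
      (mean (uniformNonzero (ZMod S.q)) fun t =>
        hideEvent n P₂ y z A o ⟨b, u, t, scale (y * z * t⁻¹) P₂, false⟩) +
      q * ((2 : ℝ≥0∞) ^ n)⁻¹ := by
  rw [psiEvent_eq_iSup]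
  refine iSup_le fun i => ?_
  have hpay : ∀ g, targetPayoff (b == o) g = targetPayoff o (decide (g = b)) := by
    intro g
    cases b <;> cases o <;> cases g <;> simp [targetPayoff]
  have h₁ := A.resultValue_le_bounded_of_invariant T k
    (h := psiHandler S n P₂ (fun i => if i = b then y else u) z b)
    (Inv := fun s => s.table.NeZero) (exists_psiFormat S n) psiHandler_invariant hb
    (s := ⟨fun _ _ => none, ∅, none⟩)
    HashTable.neZero_empty (fun w s => mean (psiJudge S w s) (targetPayoff (b == o))) i
  refine h₁.trans ?_
  simp only [show targetPayoff (b == o) = fun g => targetPayoff o (decide (g = b)) from funext hpay]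
  refine (psiValue_le_hideValue A hy (targetPayoff_le_one o) hC hq i _ _).trans ?_
  gcongr
  refine mean_mono fun t => le_trans (le_of_eq ?_) (le_iSup _ i)
  have : {m : List Bool | (none : Option (List Bool)) = some m} = ∅ := by
    ext m
    simp
  simp only [hideState, this]
  rfl

/-- Exchanging the two signers. -/
theorem hideEvent_swap_le (o b : Bool) (u t : ZMod S.q) (Q : S.G₂) :
    hideEvent n P₂ y z A o ⟨b, u, t, Q, false⟩ ≤ hideEvent n P₂ u z A (!o) ⟨!b, y, t, Q, false⟩ := by
  have hpay : ∀ g, targetPayoff o g = targetPayoff (!o) !g := by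
    intro g
    cases g <;> cases o <;> simp [targetPayoff]
  refine iSup_mono fun i => ?_
  have hin : hideInput S n P₂ y z ⟨b, u, t, Q, false⟩ = hideInput S n P₂ u z ⟨!b, y, t, Q, false⟩ := by
    cases b <;> rfl
  rw [hin]
  -- In related states each signer has the same key, so the answers agree. Only the guess that
  -- counts as right is the opposite one.
  refine A.value_le_value S (fun s s' => s.2 = s'.2 ∧ s'.1.bit = !s.1.bit ∧ s.1.u = u ∧ s'.1.u = y ∧
    s'.1.t = s.1.t ∧ s'.1.Q = s.1.Q ∧ s'.1.started = s.1.started) ?_ ?_ ?_ i _ _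
  · rintro ⟨⟨b, u, t, Q, st⟩, s⟩ ⟨⟨b', u', t', Q', st'⟩, s'⟩ ⟨h₁, h₂, rfl, rfl, h₃, h₄, h₅⟩ c a Φ Φ' hΦ
    simp only at h₁ h₂ h₃ h₄ h₅
    subst h₁ h₂ h₃ h₄ h₅
    have hkey : ∀ i, HideCore.key ⟨b, u, t', Q', st'⟩ u' i =
        HideCore.key ⟨!b, u', t', Q', st'⟩ u i := by
      intro i
      cases b <;> cases i <;> rfl
    have hle : ∀ v st s, Φ (v, ⟨b, u, t', Q', st⟩, s) ≤ Φ' (v, ⟨!b, u', t', Q', st⟩, s) :=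
      fun v st s => hΦ v _ _ ⟨rfl, rfl, rfl, rfl, rfl, rfl, rfl⟩
    refine add_le_add le_rfl ?_
    obtain ⟨H, κ, D, C⟩ := s
    cases c with
    | hash =>
      obtain ⟨(m : List Bool), (r : List Bool), ⟨⟩⟩ := a
      simp only [hideAnswer, mean_bind, mean_map, Sum.elim_inl]
      exact mean_mono fun c => mean_mono fun g => hle _ _ _
    | sign i =>
      obtain ⟨(m : List Bool), ⟨⟩⟩ := a
      simp only [hideAnswer, hkey]
      split_ifs with hm
      · simp only [mean_pure]
        exact (hpay _).le
      · simp only [mean_bind]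
        refine mean_mono fun c => mean_mono fun r => ?_
        split_ifs with hc
        · simp only [mean_pure]
          exact (hpay _).le
        · simp only [mean_map]
          exact mean_mono fun g => hle _ _ _
    | verify i =>
      obtain ⟨(m : List Bool), (r : List Bool), (Q₁ : S.G₁), (Q₂ : S.G₂), ⟨⟩⟩ := a
      simp only [hideAnswer, hkey]
      split_ifs with hm
      · simp only [mean_pure]
        exact (hpay _).le
      · simp only [mean_bind]
        refine mean_mono fun c => ?_
        split_ifs with hc
        · simp only [mean_pure]
          exact (hpay _).le
        · simp only [mean_map]
          exact mean_mono fun g => hle _ _ _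
    | challenge =>
      obtain ⟨(m : List Bool), ⟨⟩⟩ := a
      simp only [hideAnswer]
      split_ifs with hm
      · simp only [mean_pure]
        exact (hpay _).le
      · simp only [mean_bind, mean_map]
        exact mean_mono fun c => mean_mono fun g => hle _ _ _
  · rintro ⟨⟨b, u, t, Q, st⟩, s⟩ ⟨⟨b', u', t', Q', st'⟩, s'⟩ ⟨h₁, h₂, rfl, rfl, h₃, h₄, h₅⟩ ⟨(w : Bool), ⟨⟩⟩
    simp only at h₁ h₂ h₃ h₄ h₅
    subst h₁ h₂ h₃ h₄ h₅
    simp only [hideFinal, mean_pure]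
    rw [hpay]
    cases b <;> cases w <;> cases st' <;> exact le_rfl
  · exact ⟨rfl, rfl, rfl, rfl, rfl, rfl, rfl⟩

end Psi

/-! ### Means over instances of PR₃. -/

section Pr3Mean

variable {Gen : BDHGenerator} {aux : ℕ → ℕ × ℕ × ℕ} {k : ℕ} {d : Bool}

theorem pr3Mean_add (F G : (S : BilinearStructure) →
    Args S [.bits, .g₂, .g₁, .g₂, .g₂, .g₁, .g₂, .nat, .nat, .nat] → ℝ≥0∞) :
    pr3Mean Gen aux k d F + pr3Mean Gen aux k d G = pr3Mean Gen aux k d fun S v => F S v + G S v := by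
  simp only [pr3Mean, mean_add]

theorem pr3Mean_eq_one_of_lt_top {M F : (S : BilinearStructure) →
    Args S [.bits, .g₂, .g₁, .g₂, .g₂, .g₁, .g₂, .nat, .nat, .nat] → ℝ≥0∞}
    (hM : pr3Mean Gen aux k d M < ⊤) (hF : ∀ S v, M S v < ⊤ → F S v = 1) :
    pr3Mean Gen aux k d F = 1 := by
  have h {α : Type _} {p : PMF α} {M F : α → ℝ≥0∞} (hM : mean p M < ⊤)
      (hF : ∀ a ∈ p.support, M a < ⊤ → F a = 1) : mean p F = 1 := by
    rw [mean_congr_support fun a ha => hF a ha (lt_top_of_mean_lt_top hM ha), mean_const]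
  have h' {α : Type} {p : PMF α} {M F : α → ℝ≥0∞} (hM : mean p M < ⊤)
      (hF : ∀ a ∈ p.support, M a < ⊤ → F a = 1) : mean p F = 1 := by
    rw [mean_congr_support fun a ha => hF a ha (lt_top_of_mean_lt_top hM ha), mean_const]
  exact h hM fun S _ h₁ => h' h₁ fun P₂ _ h₂ => h' h₂ fun x _ h₃ => h' h₃ fun y _ h₄ =>
    h' h₄ fun z _ h₅ => h' h₅ fun RQ _ h₆ => hF S _ h₆

end Pr3Mean

/-! ### Means over the keys. -/

section Local

variable {S : BilinearStructure} {n : ℕ} {P₂ : S.G₂} {x : ZMod S.q} (A : PSIAdversary) (T : Costs)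
  (k : ℕ)

variable (n P₂) in
/-- The probability that the experiment with the challenge bit `b` returns `e`. -/
def psiMean (b e : Bool) : ℝ≥0∞ :=
  mean (uniformNonzero (ZMod S.q)) fun u₀ => mean (uniformNonzero (ZMod S.q)) fun u₁ =>
    mean (uniformNonzero (ZMod S.q)) fun z =>
      psiEvent n P₂ z A T k (fun i => if i = true then u₁ else u₀) b e

/-- The keys are renamed by their roles: `y` belongs to the signer of the challenge and `u` to the
other one. -/
theorem psiMean_eq (b e : Bool) : psiMean n P₂ A T k b e =
    mean (uniformNonzero (ZMod S.q)) fun y => mean (uniformNonzero (ZMod S.q)) fun u =>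
      mean (uniformNonzero (ZMod S.q)) fun z =>
        psiEvent n P₂ z A T k (fun i => if i = b then y else u) b e := by
  cases b with
  | false =>
    have h : ∀ y u : ZMod S.q, (fun i : Bool => if i = false then y else u) =
        fun i => if i = true then u else y := by
      intro y u
      funext i
      cases i <;> rfl
    simp only [h]
    rfl
  | true => exact mean_comm _ _ _

theorem one_le_psiMean_add (b e : Bool)
    (ht : (mean (uniformNonzero (ZMod S.q)) fun u₀ => mean (uniformNonzero (ZMod S.q)) fun u₁ =>
      mean (uniformNonzero (ZMod S.q)) fun z => A.worstTime T k (psiCallCost T k) S (psiFormat S n)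
        (psiInput S n P₂ u₀ u₁ z)) < ⊤) :
    1 ≤ psiMean n P₂ A T k b e + psiMean n P₂ A T k b !e := by
  have h {p : PMF (ZMod S.q)} {M F : ZMod S.q → ℝ≥0∞} (hM : mean p M < ⊤)
      (hF : ∀ a, M a < ⊤ → 1 ≤ F a) : 1 ≤ mean p F :=
    (mean_const p 1).ge.trans (mean_mono_support fun a ha => hF a (lt_top_of_mean_lt_top hM ha))
  simp only [psiMean, ← mean_add]
  exact h ht fun u₀ h₀ => h h₀ fun u₁ h₁ => h h₁ fun z h₂ => one_le_psiEvent_add A T k b e h₂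

variable (n P₂) in
/-- The probability of the result `o` of the reduction, given its secret key and the instance. -/
def hideChoice (o : Bool) (y u z t : ZMod S.q) (Q : S.G₂) : ℝ≥0∞ :=
  2⁻¹ * (hideEvent n P₂ y z A o ⟨false, u, t, Q, false⟩ +
    hideEvent n P₂ y z A o ⟨true, u, t, Q, false⟩)

/-- When the signers are exchanged, the two values of `bit` change places and a right guess becomes
a wrong one. -/
theorem hideChoice_swap (o : Bool) (y u z t : ZMod S.q) (Q : S.G₂) :
    hideChoice n P₂ A o y u z t Q = hideChoice n P₂ A (!o) u y z t Q := by
  have h : ∀ o b (y u : ZMod S.q), hideEvent n P₂ y z A o ⟨b, u, t, Q, false⟩ =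
      hideEvent n P₂ u z A (!o) ⟨!b, y, t, Q, false⟩ := fun o b y u =>
    (hideEvent_swap_le A o b u t Q).antisymm
      ((hideEvent_swap_le A (!o) (!b) y t Q).trans_eq (by rw [Bool.not_not, Bool.not_not]))
  rw [hideChoice, hideChoice, h o false, h o true, add_comm]
  rfl

variable (n P₂ x) in
/-- The probability of the result `o` of the reduction. -/
def hideMean (aux : ℕ × ℕ) (d o : Bool) : ℝ≥0∞ :=
  mean (uniformNonzero (ZMod S.q)) fun y => mean (uniformNonzero (ZMod S.q)) fun z =>
    mean (pr3Pair S P₂ x y z d) fun RQ => (hideWrapper.program A).accept T k Empty.elim S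
      (noHandler S) (pr3Input S (n, aux) P₂ x y z RQ) () (targetJudge S o)

theorem hideMean_real (hP : P₂ ≠ 0) (hx : x ≠ 0) (aux : ℕ × ℕ) (o : Bool) :
    hideMean n P₂ x A T k aux false o =
      mean (uniformNonzero (ZMod S.q)) fun y => mean (uniformNonzero (ZMod S.q)) fun u =>
        mean (uniformNonzero (ZMod S.q)) fun z => mean (uniformNonzero (ZMod S.q)) fun t =>
          hideChoice n P₂ A o y u z t (scale (y * z * t⁻¹) P₂) := by
  refine congrArg (mean _) (funext fun y => ?_)
  rw [mean_comm]
  refine congrArg (mean _) (funext fun z => ?_)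
  rw [mean_comm, pr3Pair, mean_map]
  refine congrArg (mean _) (funext fun t => ?_)
  rw [mul_comm x t, scale_mul S.card₁]
  exact accept_hideProgram A T k hP hx aux t _ o

/-- The distribution of a random pair does not depend on `y`, so `y` and `u` are interchangeable,
and by `hideChoice_swap` their exchange reverses the result. -/
theorem hideMean_random (hP : P₂ ≠ 0) (hx : x ≠ 0) (aux : ℕ × ℕ) (o : Bool) :
    hideMean n P₂ x A T k aux true o = hideMean n P₂ x A T k aux true !o := by
  have hb := scale_bijective S.card₁ (scale_ne_zero S.card₁ hx (S.psi_ne_zero hP))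
  -- A random `R` may be `0`, and then `t = 0`; the analysis of the code does not exclude this
  -- value.
  choose t ht using hb.2
  have h : ∀ o, hideMean n P₂ x A T k aux true o =
      mean (uniformNonzero (ZMod S.q)) fun y => mean (uniformNonzero (ZMod S.q)) fun u =>
        mean (uniformNonzero (ZMod S.q)) fun z => mean (PMF.uniformOfFintype (S.G₁ × S.G₂)) fun RQ =>
          hideChoice n P₂ A o y u z (t RQ.1) RQ.2 := by
    intro o
    refine congrArg (mean _) (funext fun y => ?_)
    rw [mean_comm]
    refine congrArg (mean _) (funext fun z => ?_)
    rw [mean_comm, pr3Pair]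
    refine congrArg (mean _) (funext fun RQ => ?_)
    have := accept_hideProgram A T k (n := n) (y := y) (z := z) hP hx aux (t RQ.1) RQ.2 o
    simp only [ht] at this
    exact this
  rw [h, h, mean_comm]
  simp only [fun y u z t Q => hideChoice_swap (n := n) (P₂ := P₂) A o y u z t Q]

/-- The coin `bit` averages the two experiments. The error occurs in both of them with weight `1/2`,
hence once in total. -/
theorem psiMean_le_hideMean (hP : P₂ ≠ 0) (hx : x ≠ 0) (aux : ℕ × ℕ) (o : Bool) {q : ℕ}
    {bound : (PSICall → ℕ) → Prop}
    (hb : ∀ u₀ u₁ z : ZMod S.q, u₀ ≠ 0 → u₁ ≠ 0 → z ≠ 0 →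
      A.CallsBounded T k (psiCallCost T k) S (psiFormat S n) (psiInput S n P₂ u₀ u₁ z) bound)
    (hC : ∀ c, bound c → c .challenge ≤ 1) (hq : ∀ c, bound c → psiQueries c ≤ q) :
    2⁻¹ * (psiMean n P₂ A T k false (false == o) + psiMean n P₂ A T k true (true == o)) ≤
      hideMean n P₂ x A T k aux false o + q * ((2 : ℝ≥0∞) ^ n)⁻¹ := by
  rw [psiMean_eq, psiMean_eq, hideMean_real A T k hP hx]
  simp only [← mean_add, ← mean_mul_left]
  refine mean_le_mean_add_const fun y hy => mean_le_mean_add_const fun u hu =>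
    mean_le_mean_add_const fun z hz => ?_
  rw [mem_support_uniformNonzero] at hy hu hz
  have h : ∀ b, psiEvent n P₂ z A T k (fun i => if i = b then y else u) b (b == o) ≤
      (mean (uniformNonzero (ZMod S.q)) fun t =>
        hideEvent n P₂ y z A o ⟨b, u, t, scale (y * z * t⁻¹) P₂, false⟩) +
      q * ((2 : ℝ≥0∞) ^ n)⁻¹ := by
    intro b
    refine psiEvent_le_hideEvent A T k hy ?_ hC hq
    cases b
    · exact hb _ _ _ hy hu hz
    · exact hb _ _ _ hu hy hz
  simp only [hideChoice, mean_mul_left, mean_add]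
  refine (mul_le_mul_right (add_le_add (h false) (h true)) _).trans_eq ?_
  rw [add_add_add_comm, mul_add, ← two_mul, ← mul_assoc, ENNReal.inv_mul_cancel (by simp) (by simp),
    one_mul]

end Local

/-- Here `a` and `a'` are the probabilities of the two outputs for valid instances, `c = c' = 1/2`
those for random ones, and `p`, `r` the probabilities that an experiment returns `1` and `0`. The
hypotheses give `a - 1/2 ≥ (p₁ - p₀)/2 - ε` and `a' - 1/2 ≥ (p₀ - p₁)/2 - ε`, and one of the two is
the claim, according to the sign of `p₀ - p₁`. -/
theorem half_sub_le_abs {a a' c c' p₀ p₁ r₀ r₁ ε : ℝ≥0∞} (hε : ε ≠ ⊤) (ha : a + a' = 1)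
    (hc : c + c' = 1) (hcc : c = c') (h₀ : 1 ≤ p₀ + r₀) (h₁ : 1 ≤ p₁ + r₁)
    (h : 2⁻¹ * (r₀ + p₁) ≤ a + ε) (h' : 2⁻¹ * (p₀ + r₁) ≤ a' + ε) :
    |p₀.toReal - p₁.toReal| / 2 - ε.toReal ≤ |a.toReal - c.toReal| := by
  have hle : ∀ {b b' : ℝ≥0∞}, b + b' = 1 → b ≠ ⊤ ∧ b' ≠ ⊤ := by
    intro b b' h
    constructor <;> rintro rfl <;> simp at h
  have hhalf : ∀ {b b' : ℝ≥0∞}, 2⁻¹ * (b + b') ≠ ⊤ → b ≠ ⊤ ∧ b' ≠ ⊤ := by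
    intro b b' h
    constructor <;> rintro rfl <;> simp [ENNReal.mul_top] at h
  obtain ⟨ha₁, ha₂⟩ := hle ha
  obtain ⟨hc₁, hc₂⟩ := hle hc
  have hr : a + ε ≠ ⊤ := ENNReal.add_ne_top.2 ⟨ha₁, hε⟩
  have hr' : a' + ε ≠ ⊤ := ENNReal.add_ne_top.2 ⟨ha₂, hε⟩
  obtain ⟨f₁, f₂⟩ := hhalf (h.trans_lt hr.lt_top).ne
  obtain ⟨f₃, f₄⟩ := hhalf (h'.trans_lt hr'.lt_top).ne
  have e₁ := ENNReal.toReal_mono hr h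
  have e₂ := ENNReal.toReal_mono hr' h'
  have e₃ := ENNReal.toReal_mono (ENNReal.add_ne_top.2 ⟨f₃, f₁⟩) h₀
  have e₄ := ENNReal.toReal_mono (ENNReal.add_ne_top.2 ⟨f₂, f₄⟩) h₁
  have e₅ := congrArg ENNReal.toReal ha
  have e₆ := congrArg ENNReal.toReal hc
  subst hcc
  rw [ENNReal.toReal_mul, ENNReal.toReal_add f₁ f₂, ENNReal.toReal_add ha₁ hε] at e₁
  rw [ENNReal.toReal_mul, ENNReal.toReal_add f₃ f₄, ENNReal.toReal_add ha₂ hε] at e₂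
  rw [ENNReal.toReal_add f₃ f₁] at e₃
  rw [ENNReal.toReal_add f₂ f₄] at e₄
  rw [ENNReal.toReal_add ha₁ ha₂] at e₅
  rw [ENNReal.toReal_add hc₁ hc₁] at e₆
  simp only [ENNReal.toReal_inv, ENNReal.toReal_ofNat, ENNReal.toReal_one] at *
  have k₁ := le_abs_self (a.toReal - c.toReal)
  have k₂ := neg_abs_le (a.toReal - c.toReal)
  rcases abs_cases (p₀.toReal - p₁.toReal) with ⟨hab, -⟩ | ⟨hab, -⟩ <;> rw [hab] <;> linarith

/-- By `ht` the reduction stops almost surely on both kinds of instances, so its two outputs have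
total probability `1`. In particular, each has probability `1/2` on random pairs. -/
theorem le_pr3Adv {T : Costs} {Gen : BDHGenerator} {f τ qS qV qH : ℕ → ℕ} {A : PSIAdversary}
    (hA : IsPSIAdversary T Gen f τ qS qV qH A) (k : ℕ)
    (ht : ∀ d, (pr3Mean Gen (fun k => (f k, qS k, qV k)) k d fun S v =>
      (hideWrapper.program A).meanTime T k Empty.elim S (noHandler S) v ()) < ⊤) :
    psiAdv T Gen f A k / 2 - ((qS k : ℝ) + (qV k : ℝ)) / 2 ^ f k ≤
      pr3Adv T Gen (fun k => (f k, qS k, qV k)) (hideWrapper.program A) k := by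
  obtain ⟨htime, hbound⟩ := hA k
  set aux : ℕ → ℕ × ℕ × ℕ := fun k => (f k, qS k, qV k) with haux
  set a : Bool → Bool → ℝ≥0∞ := fun d o => pr3Mean Gen aux k d fun S v =>
    (hideWrapper.program A).accept T k Empty.elim S (noHandler S) v () (targetJudge S o) with ha
  set p : Bool → Bool → ℝ≥0∞ := fun b e => mean (Gen.gen k) fun S =>
    mean (uniformNonzero S.G₂) fun P₂ => psiMean (f k) P₂ A T k b e with hp
  have ha_sum : ∀ d, a d true + a d false = 1 := by
    intro d
    refine (pr3Mean_add _ _).trans (pr3Mean_eq_one_of_lt_top (ht d) fun S v hM => ?_)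
    refine ((hideWrapper.program A).accept_add_accept S T k ?_).trans
      ((hideWrapper.program A).iSup_resultValue_one S T k Empty.elim _ (fun c => c.elim) v () hM)
    rintro ⟨(w : Bool), ⟨⟩⟩ s
    cases w <;> simp [targetJudge]
  have ha_eq : ∀ d o, a d o = mean (Gen.gen k) fun S => mean (uniformNonzero S.G₂) fun P₂ =>
      mean (uniformNonzero (ZMod S.q)) fun x => hideMean (f k) P₂ x A T k (qS k, qV k) d o :=
    fun d o => rfl
  have hrand : a true true = a true false := by
    rw [ha_eq, ha_eq]
    refine mean_congr_support fun S _ => mean_congr_support fun P₂ hP =>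
      mean_congr_support fun x hx => ?_
    rw [mem_support_uniformNonzero] at hP hx
    exact hideMean_random A T k hP hx _ true
  have hpsum : ∀ b, 1 ≤ p b true + p b false := by
    intro b
    have hlt : (mean (Gen.gen k) fun S => mean (uniformNonzero S.G₂) fun P₂ =>
          mean (uniformNonzero (ZMod S.q)) fun u₀ => mean (uniformNonzero (ZMod S.q)) fun u₁ =>
          mean (uniformNonzero (ZMod S.q)) fun ub =>
            A.worstTime T k (psiCallCost T k) S (psiFormat S (f k))
              (psiInput S (f k) P₂ u₀ u₁ ub)) < ⊤ :=
      (le_add_self.trans_lt htime).trans (ENNReal.natCast_lt_top _)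
    simp only [hp, ← mean_add]
    refine (mean_const (Gen.gen k) 1).ge.trans (mean_mono_support fun S hS => ?_)
    refine (mean_const (uniformNonzero S.G₂) 1).ge.trans (mean_mono_support fun P₂ hP => ?_)
    exact one_le_psiMean_add A T k b true
      (lt_top_of_mean_lt_top (lt_top_of_mean_lt_top hlt hS) hP)
  have hreal : ∀ o, 2⁻¹ * (p false (false == o) + p true (true == o)) ≤
      a false o + ((qS k + qV k : ℕ) : ℝ≥0∞) * ((2 : ℝ≥0∞) ^ f k)⁻¹ := by
    intro o
    rw [ha_eq]
    simp only [hp, ← mean_add, ← mean_mul_left]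
    refine mean_le_mean_add_const fun S hS => mean_le_mean_add_const fun P₂ hP => ?_
    rw [← mean_const (uniformNonzero (ZMod S.q)) (2⁻¹ * _)]
    refine mean_le_mean_add_const fun x hx => ?_
    rw [mem_support_uniformNonzero] at hP hx
    exact psiMean_le_hideMean A T k hP hx _ o (hbound S hS P₂ hP) (fun c h => h.2.2.2)
      fun c h => add_le_add h.2.1 h.2.2.1
  have hprob : ∀ b, psiProb T Gen f A k b = p b true := by
    intro b
    have hid : ∀ q : PMF Bool, q.map (· == true) = q := by
      intro q
      simp only [beq_true]
      exact q.map_id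
    simp only [hp, psiMean, psiEvent, hid]
    rfl
  have hprob' : ∀ d, pr3Prob T Gen aux (hideWrapper.program A) k d = a d true := by
    intro d
    have hj : ∀ S, (fun (w : Args S [.bool]) (_ : Unit) => PMF.pure (show Bool from w.1)) =
        targetJudge S true := by
      intro S
      funext w _
      exact congrArg PMF.pure (beq_true _).symm
    simp only [ha, ← hj]
    rfl
  have := half_sub_le_abs (ENNReal.mul_ne_top (ENNReal.natCast_ne_top _) (by simp)) (ha_sum false)
    (ha_sum true) hrand (hpsum false) (hpsum true) (hreal true) (hreal false)
  rw [psiAdv, pr3Adv, hprob, hprob, hprob', hprob']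
  refine le_trans (le_of_eq ?_) this
  rw [ENNReal.toReal_mul, ENNReal.toReal_natCast]
  simp [div_eq_mul_inv]

/-! ### The time of the distinguisher for PR₃. -/

section HideTime

variable {S : BilinearStructure} {n : ℕ} {P₂ : S.G₂} {x y z : ZMod S.q}

/-- The lengths of the hidden salts belong to the invariant, because the challenge hands one of them
to the distinguisher. -/
theorem hideAnswer_invariant (c : PSICall) (a : Args S (psiSig.args c)) (s : HideState S)
    (hs : s.2.1.NeZero ∧ ∀ m c, s.2.2.1 m = some c → c.length = n) :
    ∀ w, Sum.inl w ∈ (hideAnswer S n P₂ y z c a s).support →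
      psiFormat S n c w.1 ∧ w.2.2.1.NeZero ∧ ∀ m c, w.2.2.2.1 m = some c → c.length = n := by
  intro w hw
  obtain ⟨s, H, κ, D, C⟩ := s
  obtain ⟨hH, hκ⟩ := hs
  have hrev : ∀ m, ∀ c ∈ (reveal (uniformBits n) m κ).support,
      c.1.length = n ∧ ∀ m' c', c.2 m' = some c' → c'.length = n := by
    intro m c hc
    obtain ⟨d, hd, rfl⟩ := (PMF.mem_support_map_iff _ _ _).1 hc
    have hl : d.length = n := by
      cases hm : κ m with
      | some e =>
        rw [hm] at hd
        cases (PMF.mem_support_pure_iff _ _).1 hd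
        exact hκ _ _ hm
      | none =>
        rw [hm] at hd
        exact length_of_mem_support_uniformBits hd
    refine ⟨hl, fun m' c' h => ?_⟩
    simp only at h
    by_cases hmm : m' = m
    · subst hmm
      simp only [Function.update_self, Option.some.injEq] at h
      exact h ▸ hl
    · rw [Function.update_of_ne hmm] at h
      exact hκ _ _ h
  cases c with
  | hash =>
    obtain ⟨c, hc, hw⟩ := (PMF.mem_support_bind_iff _ _ _).1 hw
    obtain ⟨g, hg, hw⟩ := (PMF.mem_support_map_iff _ _ _).1 hw
    cases hw
    obtain ⟨h₁, h₂⟩ := hH.of_mem_support hg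
    exact ⟨h₁, h₂, (hrev _ _ hc).2⟩
  | sign i =>
    obtain ⟨(m : List Bool), ⟨⟩⟩ := a
    simp only [hideAnswer] at hw
    split_ifs at hw with hm
    · exact nomatch (PMF.mem_support_pure_iff _ _).1 hw
    obtain ⟨c, hc, hw⟩ := (PMF.mem_support_bind_iff _ _ _).1 hw
    obtain ⟨r, hr, hw⟩ := (PMF.mem_support_bind_iff _ _ _).1 hw
    split_ifs at hw with hrc
    · exact nomatch (PMF.mem_support_pure_iff _ _).1 hw
    obtain ⟨g, hg, hw⟩ := (PMF.mem_support_map_iff _ _ _).1 hw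
    cases hw
    exact ⟨length_of_mem_support_uniformBits hr, (hH.of_mem_support hg).2, (hrev _ _ hc).2⟩
  | verify i =>
    obtain ⟨(m : List Bool), (r : List Bool), (Q₁ : S.G₁), (Q₂ : S.G₂), ⟨⟩⟩ := a
    simp only [hideAnswer] at hw
    split_ifs at hw with hm
    · exact nomatch (PMF.mem_support_pure_iff _ _).1 hw
    obtain ⟨c, hc, hw⟩ := (PMF.mem_support_bind_iff _ _ _).1 hw
    split_ifs at hw with hrc
    · exact nomatch (PMF.mem_support_pure_iff _ _).1 hw
    obtain ⟨g, hg, hw⟩ := (PMF.mem_support_map_iff _ _ _).1 hw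
    cases hw
    exact ⟨trivial, hH.dverify hg, (hrev _ _ hc).2⟩
  | challenge =>
    obtain ⟨(m : List Bool), ⟨⟩⟩ := a
    simp only [hideAnswer] at hw
    split_ifs at hw with hm
    · exact nomatch (PMF.mem_support_pure_iff _ _).1 hw
    obtain ⟨c, hc, hw⟩ := (PMF.mem_support_bind_iff _ _ _).1 hw
    obtain ⟨g, hg, hw⟩ := (PMF.mem_support_map_iff _ _ _).1 hw
    cases hw
    exact ⟨(hrev _ _ hc).1, (hH.of_mem_support hg).2, (hrev _ _ hc).2⟩

/-- Bounds for the time that the code of the reduction takes in addition. -/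
def hideExtra (T : Costs) (k : ℕ) : PSICall → ℕ
  | .hash => T.exp₁ k + 40
  | .sign _ => 40
  | .verify _ => 40
  | .challenge => T.exp₁ k + 40

theorem hideWrapper_cost (T : Costs) (k : ℕ) (c : PSICall) :
    1 + (((psiSig.args c).length : ℝ≥0∞) + ((hideWrapper.body c).cost (fun p => Prim.cost T k p) 1 +
      (psiSig.rets c).length)) ≤ (psiCallCost T k c : ℝ≥0∞) + hideExtra T k c := by
  rw [CodeTree.cost_eq_natCost]
  norm_cast
  cases c <;>
  simp only [hideWrapper, CodeTree.natCost, CodeTree.lookup, Prim.cost, psiSig, psiCallCost,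
    hideExtra, List.length_cons, List.length_nil] <;>
  omega

/-- The coin `bit` decides in which order the keys `y` and `u` are presented, so both orders occur
with weight `1/2`. Every pair `(R, Q)` is covered, since `X` generates the group and thus `R = tX`
for some `t`. -/
theorem hideProgram_meanTime_le (A : PSIAdversary) (T : Costs) (k : ℕ) (hP : P₂ ≠ 0) (hx : x ≠ 0)
    (hy : y ≠ 0) (hz : z ≠ 0) {qH qS qV : ℕ}
    (hb : ∀ u₀ u₁ z : ZMod S.q, u₀ ≠ 0 → u₁ ≠ 0 → z ≠ 0 →
      A.CallsBounded T k (psiCallCost T k) S (psiFormat S n) (psiInput S n P₂ u₀ u₁ z)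
        fun calls => calls .hash ≤ qH ∧ calls (.sign false) + calls (.sign true) ≤ qS ∧
          calls (.verify false) + calls (.verify true) ≤ qV ∧ calls .challenge ≤ 1)
    (aux : ℕ × ℕ) (R : S.G₁) (Q : S.G₂) :
    (hideWrapper.program A).meanTime T k Empty.elim S (noHandler S)
        (pr3Input S (n, aux) P₂ x y z (R, Q)) () ≤
      (mean (uniformNonzero (ZMod S.q)) fun u => 2⁻¹ *
        (A.worstTime T k (psiCallCost T k) S (psiFormat S n) (psiInput S n P₂ y u z) +
         A.worstTime T k (psiCallCost T k) S (psiFormat S n) (psiInput S n P₂ u y z))) +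
        ((T.exp₂ k + (qH * (T.exp₁ k + 40) + qS * 40 + qV * 40 + (T.exp₁ k + 100)) : ℕ) : ℝ≥0∞) := by
  obtain ⟨t, ht⟩ := (scale_bijective S.card₁ (scale_ne_zero S.card₁ hx (S.psi_ne_zero hP))).2 R
  simp only at ht
  subst ht
  refine (hideWrapper.meanTime_program_le A (hideWrapper_implements (n := n) (y := y)
    (z := z) hP hx aux t Q) T k Empty.elim (hideWrapper_cost T k) (fc := (20 : ℕ)) ?_).trans ?_
  · rw [CodeTree.cost_eq_natCost]
    norm_cast
    simp only [hideWrapper, CodeTree.natCost, CodeTree.lookup, Prim.cost, List.length_cons,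
      List.length_nil]
    omega
  -- The multiplication in `G₂` is for the public key of the signer whose secret key the reduction
  -- chooses.
  · have hinit : 1 + (hideWrapper.init.cost (fun p => (Prim.cost T k p : ℝ≥0∞)) 1 +
        ([.bits, .g₂, .nat, .g₂, .g₂, .g₂] : List Srt).length) ≤ ((T.exp₂ k + 40 : ℕ) : ℝ≥0∞) := by
      rw [CodeTree.cost_eq_natCost]
      norm_cast
      simp only [hideWrapper, CodeTree.natCost, Prim.cost, List.length_cons, List.length_nil]
      omega
    set E : ℕ := qH * (T.exp₁ k + 40) + qS * 40 + qV * 40 + (T.exp₁ k + 40) with hE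
    calc _ ≤ ((T.exp₂ k + 40 : ℕ) : ℝ≥0∞) + ((mean (uniformNonzero (ZMod S.q)) fun u => 2⁻¹ *
          (A.worstTime T k (psiCallCost T k) S (psiFormat S n) (psiInput S n P₂ y u z) +
          A.worstTime T k (psiCallCost T k) S (psiFormat S n) (psiInput S n P₂ u y z))) +
            ((E + 20 : ℕ) : ℝ≥0∞)) := ?_
      _ = _ := by
        rw [add_left_comm, ← Nat.cast_add]
        congr 2
        omega
    refine add_le_add hinit (iSup_le fun i => ?_)
    rw [hideInit, mean_bind]
    refine mean_le_mean_add_const fun u hu => ?_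
    rw [mem_support_uniformNonzero] at hu
    have hval : ∀ j, A.value S (fun p => (Prim.cost T k p : ℝ≥0∞)) 1
        (Wrapper.exitTransformer (hideAnswer S n P₂ y z) (fun _ => 0)
          fun c => (psiCallCost T k c : ℝ≥0∞) + hideExtra T k c) (fun _ _ => ((20 : ℕ) : ℝ≥0∞)) i
        A.start (Program.startMem S (hideInput S n P₂ y z (hideStart S t Q u j)))
        (hideStart S t Q u j, fun _ _ => none, fun _ => none, ∅, ∅) ≤
        A.worstTime T k (psiCallCost T k) S (psiFormat S n)
          (hideInput S n P₂ y z (hideStart S t Q u j)) + (E + 20 : ℕ) := by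
      intro j
      refine (A.value_exitTransformer_le T k (n := i) (callCost := psiCallCost T k) (s :=
          (hideStart S t Q u j, fun _ _ => none, fun _ => none, ∅, ∅))
        (Inv := fun s : HideState S => s.2.1.NeZero ∧ ∀ m c, s.2.2.1 m = some c → c.length = n)
        (exists_psiFormat S n) hideAnswer_invariant (w := fun c => (hideExtra T k c : ℝ≥0∞))
        (e := fun calls => ((calls .hash * (T.exp₁ k + 40) +
          (calls (.sign false) + calls (.sign true)) * 40 +
          (calls (.verify false) + calls (.verify true)) * 40 +
          calls .challenge * (T.exp₁ k + 40) : ℕ) : ℝ≥0∞)) (b := (E : ℝ≥0∞)) ?_ (by simp) ?_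
        (fun _ => le_rfl) _ ⟨HashTable.neZero_empty, nofun⟩).trans_eq ?_
      · intro c i
        have hsame : countCall (O := psiSig) c i i = c i + 1 := countCall_same c i
        have hne : ∀ d, d ≠ i → countCall (O := psiSig) c i d = c d := fun d => countCall_of_ne c
        refine (congrArg Nat.cast (?_ : countCall (O := psiSig) c i PSICall.hash * (T.exp₁ k + 40) +
          (countCall (O := psiSig) c i (PSICall.sign false) +
            countCall (O := psiSig) c i (PSICall.sign true)) * 40 +
          (countCall (O := psiSig) c i (PSICall.verify false) +
            countCall (O := psiSig) c i (PSICall.verify true)) * 40 +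
          countCall (O := psiSig) c i PSICall.challenge * (T.exp₁ k + 40) =
          _ + hideExtra T k i)).trans (Nat.cast_add _ _)
        cases i with
        | hash =>
          rw [hsame, hne (.sign false) nofun, hne (.sign true) nofun, hne (.verify false) nofun,
            hne (.verify true) nofun, hne .challenge nofun, hideExtra]
          ring
        | challenge =>
          rw [hsame, hne (.sign false) nofun, hne (.sign true) nofun, hne (.verify false) nofun,
            hne (.verify true) nofun, hne .hash nofun, hideExtra]
          ring
        | sign a =>
          cases a
          · rw [hsame, hne (.sign true) nofun, hne (.verify false) nofun,
              hne (.verify true) nofun, hne .hash nofun, hne .challenge nofun, hideExtra]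
            ring
          · rw [hsame, hne (.sign false) nofun, hne (.verify false) nofun,
              hne (.verify true) nofun, hne .hash nofun, hne .challenge nofun, hideExtra]
            ring
        | verify a =>
          cases a
          · rw [hsame, hne (.sign true) nofun, hne (.verify true) nofun,
              hne (.sign false) nofun, hne .hash nofun, hne .challenge nofun, hideExtra]
            ring
          · rw [hsame, hne (.sign false) nofun, hne (.verify false) nofun,
              hne (.sign true) nofun, hne .hash nofun, hne .challenge nofun, hideExtra]
            ring
      · intro σ h hr s i st hst
        have hj : ∀ i, (hideStart S t Q u j).key y i ≠ 0 := by
          intro i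
          rw [HideCore.key]
          split_ifs
          · exact hy
          · exact hu
        obtain ⟨h₁, h₂, h₃, h₄⟩ := hb _ _ z (hj false) (hj true) hz σ h hr s i st hst
        have : st.calls .challenge * (T.exp₁ k + 40) ≤ T.exp₁ k + 40 := by
          simpa using Nat.mul_le_mul_right (T.exp₁ k + 40) h₄
        norm_cast
        rw [hE]
        gcongr
      · rw [add_assoc, ← Nat.cast_add]
    rw [mean_map, mean_uniformUpTo, Finset.sum_range_succ, Finset.sum_range_one]
    have h2 : (((1 : ℕ) : ℝ≥0∞) + 1)⁻¹ = 2⁻¹ := by norm_num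
    rw [h2]
    refine (mul_le_mul_right (add_le_add (hval 0) (hval 1)) _).trans_eq ?_
    rw [add_add_add_comm, mul_add, ← two_mul, ← mul_assoc _ _ ((_ : ℕ) : ℝ≥0∞),
        ENNReal.inv_mul_cancel (by simp) (by simp),
      one_mul]
    rfl

end HideTime

theorem exists_pr3Distinguisher {T : Costs} {Gen : BDHGenerator} {f τ qS qV qH : ℕ → ℕ} {C : ℕ}
    (hC : 102 ≤ C) {A : PSIAdversary} (hA : IsPSIAdversary T Gen f τ qS qV qH A) :
    ∃ τ' : ℕ → ℕ,
      (∀ k, τ' k ≤ τ k + (qH k + qS k + 2 * qV k + 1) * (T.exp₁ k + C)) ∧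
      ∃ B : PR3Distinguisher,
        IsPR3Distinguisher T Gen (fun k => (f k, qS k, qV k)) τ' B ∧
        ∀ k, pr3Adv T Gen (fun k => (f k, qS k, qV k)) B k ≥
          psiAdv T Gen f A k / 2 - ((qS k : ℝ) + (qV k : ℝ)) / 2 ^ f k := by
  have htime : IsPR3Distinguisher T Gen (fun k => (f k, qS k, qV k))
      (fun k => τ k + (qH k + qS k + 2 * qV k + 1) * (T.exp₁ k + C)) (hideWrapper.program A) := by
    intro k d
    obtain ⟨ht, hb⟩ := hA k
    set W : (S : BilinearStructure) → S.G₂ → ZMod S.q → ZMod S.q → ZMod S.q → ℝ≥0∞ :=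
      fun S P₂ u₀ u₁ z => A.worstTime T k (psiCallCost T k) S (psiFormat S (f k))
        (psiInput S (f k) P₂ u₀ u₁ z) with hW
    set c : ℕ := qH k * (T.exp₁ k + 40) + qS k * 40 + qV k * 40 + (T.exp₁ k + 100) with hc
    -- The single `T.exp₁ k` outside the queries belongs to the challenge. The constant has to cover
    -- `100 = 40 + 40 + 20` for initialisation, challenge and result, and the surplus `2` from
    -- `hov`.
    have hle : 2 + c ≤ (qH k + qS k + 2 * qV k + 1) * (T.exp₁ k + C) := by
      have h₁ : qH k * (T.exp₁ k + 40) ≤ qH k * (T.exp₁ k + C) := by gcongr; omega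
      have h₂ : qS k * 40 ≤ qS k * (T.exp₁ k + C) := by gcongr; omega
      have h₃ : qV k * 40 ≤ 2 * qV k * (T.exp₁ k + C) := by gcongr <;> omega
      simp only [add_mul] at *
      omega
    -- The experiment of the adversary makes at least one multiplication in `G₂` more than that of
    -- PR₃, and this pays for the key made by the reduction.
    have hov : pr3Overhead T k d + T.exp₂ k ≤ psiOverhead T k + 2 := by
      cases d <;> simp only [pr3Overhead, psiOverhead] <;> omega
    have hmean : (pr3Mean Gen (fun k => (f k, qS k, qV k)) k d fun S v =>
        (hideWrapper.program A).meanTime T k Empty.elim S (noHandler S) v ()) ≤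
        (mean (Gen.gen k) fun S => mean (uniformNonzero S.G₂) fun P₂ =>
          mean (uniformNonzero (ZMod S.q)) fun u₀ => mean (uniformNonzero (ZMod S.q)) fun u₁ =>
          mean (uniformNonzero (ZMod S.q)) fun z => W S P₂ u₀ u₁ z) + ((T.exp₂ k + c : ℕ) : ℝ≥0∞) := by
      refine mean_le_mean_add_const fun S hS => mean_le_mean_add_const fun P₂ hP => ?_
      rw [← mean_const (uniformNonzero (ZMod S.q)) (_ + ((T.exp₂ k + c : ℕ) : ℝ≥0∞))]
      refine mean_mono_support fun x hx => ?_
      rw [mem_support_uniformNonzero] at hP hx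
      -- The keys of the signers are independent and uniform, so both orders have the same mean.
      have hsym : (mean (uniformNonzero (ZMod S.q)) fun u₀ => mean (uniformNonzero (ZMod S.q)) fun u₁ =>
          mean (uniformNonzero (ZMod S.q)) fun z => W S P₂ u₀ u₁ z) =
          mean (uniformNonzero (ZMod S.q)) fun y => mean (uniformNonzero (ZMod S.q)) fun z =>
          mean (uniformNonzero (ZMod S.q)) fun u => 2⁻¹ * (W S P₂ y u z + W S P₂ u y z) := by
        have h : ∀ y, (mean (uniformNonzero (ZMod S.q)) fun z =>
            mean (uniformNonzero (ZMod S.q)) fun u => 2⁻¹ * (W S P₂ y u z + W S P₂ u y z)) =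
            mean (uniformNonzero (ZMod S.q)) fun u => mean (uniformNonzero (ZMod S.q)) fun z =>
              2⁻¹ * (W S P₂ y u z + W S P₂ u y z) := fun y => mean_comm _ _ _
        rw [congrArg (mean _) (funext h)]
        simp only [mean_mul_left, mean_add]
        rw [mean_comm (uniformNonzero (ZMod S.q)) (uniformNonzero (ZMod S.q)) fun y u =>
          mean (uniformNonzero (ZMod S.q)) fun z => W S P₂ u y z, ← two_mul, ← mul_assoc,
          ENNReal.inv_mul_cancel (by simp) (by simp), one_mul]
      rw [hsym]
      refine mean_le_mean_add_const fun y hy => mean_le_mean_add_const fun z hz => ?_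
      rw [mem_support_uniformNonzero] at hy hz
      exact mean_le_const fun RQ => hideProgram_meanTime_le A T k hP hx hy hz (hb S hS P₂ hP)
        (qS k, qV k) RQ.1 RQ.2
    calc _ ≤ (pr3Overhead T k d : ℝ≥0∞) + (_ + ((T.exp₂ k + c : ℕ) : ℝ≥0∞)) :=
          add_le_add le_rfl hmean
      _ = ((pr3Overhead T k d + T.exp₂ k : ℕ) : ℝ≥0∞) + (_ + (c : ℝ≥0∞)) := by
        push_cast
        ring
      _ ≤ ((psiOverhead T k + 2 : ℕ) : ℝ≥0∞) + (_ + (c : ℝ≥0∞)) :=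
        add_le_add (Nat.cast_le.2 hov) le_rfl
      _ < _ := natCast_add_lt rfl le_rfl ht hle
  exact ⟨_, fun k => le_rfl, hideWrapper.program A, htime, fun k => le_pr3Adv hA k fun d =>
    (le_add_self.trans_lt (htime k d)).trans (ENNReal.natCast_lt_top _)⟩

end

theorem theorem2 :
    ∃ C : ℕ, ∀ (T : Costs) (Gen : BDHGenerator) (f qS qV qH τ : ℕ → ℕ),
      (∀ A : Forger, IsForger T Gen f τ qS qV qH A →
        ∃ τ' : ℕ → ℕ,
          (∀ k, τ' k ≤ τ k + (qH k + qS k + 2 * qV k + 2) * (T.exp₁ k + C)) ∧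
          ∃ B : PR2Solver,
            IsPR2Solver T Gen (fun k => (f k, qS k, qV k)) τ' B ∧
            ∀ k, pr2Succ T Gen (fun k => (f k, qS k, qV k)) B k ≥
              efSucc T Gen f A k /
                ((1 + 6 * (qS k : ℝ≥0∞) * 2 ^ f k) * ((qV k : ℝ≥0∞) + 1))) ∧
      (∀ A : PSIAdversary, IsPSIAdversary T Gen f τ qS qV qH A →
        ∃ τ' : ℕ → ℕ,
          (∀ k, τ' k ≤ τ k + (qH k + qS k + 2 * qV k + 1) * (T.exp₁ k + C)) ∧
          ∃ B : PR3Distinguisher,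
            IsPR3Distinguisher T Gen (fun k => (f k, qS k, qV k)) τ' B ∧
            ∀ k, pr3Adv T Gen (fun k => (f k, qS k, qV k)) B k ≥
              psiAdv T Gen f A k / 2 - ((qS k : ℝ) + (qV k : ℝ)) / 2 ^ f k) := by
  -- The constant is dictated by the second part; for the first one `40` would do.
  exact ⟨102, fun _ _ _ _ _ _ _ => ⟨fun _ => exists_pr2Solver (by norm_num),
    fun _ => exists_pr3Distinguisher le_rfl⟩⟩
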